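/- **Setting.** Let $\Omega^{+}=(0,1)\times\mathbb T^2$, $\Omega^{-}=(-1,0)\times\mathbb T^2$, $\Omega=(-1,1)\times\mathbb T^2$ with points $x=(x_1,x')$, $x'=(x_2,x_3)$, and for $T>0$ let $Q_T^\pm=(-\infty,T]\times\Omega^\pm$, $Q_T=(-\infty,T]\times\Omega$, $\omega_T=(-\infty,T]\times\{x_1=0\}\times\mathbb T^2$. Write $\partial_0=\partial_t$. Let $\sigma\in C^\infty(0,1)$ be positive with $\sigma(x_1)=x_1$ near $0$ and $\sigma(x_1)=1-x_1$ near $1$, and put $Z_0=\partial_t$, $Z_1=\sigma(|x_1|)\partial_1$, $Z_2=\partial_2$, $Z_3=\partial_3$. For $\gamma\ge 1$ let $$\|u\|_{H^m_\gamma}^2=\sum_{|\alpha|\le m}\gamma^{2(m-|\alpha|)}\|\partial^\alpha u\|_{L^2}^2,\qquad \|u\|_{H^m_{*,\gamma}}^2=\sum_{|\alpha|+2k\le m}\gamma^{2(m-|\alpha|-2k)}\|Z^\alpha\partial_1^k u\|_{L^2}^2,$$ $$\|u\|_{W^{1,\infty}_*}=\|u\|_{L^\infty}+\sum_{i=0}^3\|Z_iu\|_{L^\infty},\qquad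 \|u\|_{W^{2,\infty}_*}=\|u\|_{W^{1,\infty}_*}+\sum_{i=0}^3\|\partial_iu\|_{W^{1,\infty}_*}.$$ The unknowns are $U=(q,v,H,S)\in\mathbb R\times\mathbb R^3\times\mathbb R^3\times\mathbb R$ on $Q_T^+$, $\mathcal H\in\mathbb R^3$ on $Q_T^-$, $\Psi$ on $Q_T$, $\varphi$ on $\omega_T$. The equation of state $\rho=\rho(p,S)$ is smooth with $\rho>0$ and $\rho_p=\partial\rho/\partial p>0$ on an open set of values $(p,S)$ that contains $(0,0)$, and $\rho,\rho_p$ are evaluated at $p=q-\frac12|H|^2$. With $\partial_1\Phi_1=1+\partial_1\Psi$ the operators are $$\mathbb P(U,\Psi)=A_0(U)\partial_tU+\frac1{\partial_1\Phi_1}\Big(A_1(U)-A_0(U)\partial_t\Psi-\sum_{k=2}^3A_k(U)\partial_k\Psi\Big)\partial_1U+A_2(U)\partial_2U+A_3(U)\partial_3U,$$ where $A_0(U)\partial_t U+\sum_{j=1}^3 A_j(U)\partial_jU$ is the symmetric form of ideal compressible MHD with the rows $$\tfrac{\rho_p}{\rho}\big(\tfrac{dq}{dt}-H\cdot\tfrac{dH}{dt}\big)+\operatorname{div}v,\quad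 \rho\tfrac{dv}{dt}-(H\cdot\nabla)H+\nabla q,\quad \tfrac{dH}{dt}-(H\cdot\nabla)v-\tfrac{\rho_p}{\rho}H\big(\tfrac{dq}{dt}-H\cdot\tfrac{dH}{dt}\big),\quad \tfrac{dS}{dt},\qquad \tfrac{d}{dt}=\partial_t+v\cdot\nabla;$$ $$\mathbb V(\mathcal H,\Psi)=\begin{pmatrix}\nabla\times(\mathcal H_1\partial_1\Phi_1,\ \mathcal H_1\partial_2\Psi+\mathcal H_2,\ \mathcal H_1\partial_3\Psi+\mathcal H_3)\\ \operatorname{div}(\mathcal H_1-\mathcal H_2\partial_2\Psi-\mathcal H_3\partial_3\Psi,\ \mathcal H_2\partial_1\Phi_1,\ \mathcal H_3\partial_1\Phi_1)\end{pmatrix};$$ and the first three components of the boundary operator are, with traces on $\omega_T$, $$\mathbb B(U,\mathcal H,\varphi)_{1,2,3}=\big(\partial_t\varphi-v_1+v_2\partial_2\varphi+v_3\partial_3\varphi,\ \ q-\tfrac12|\mathcal H|^2,\ \ \mathcal H_1-\mathcal H_2\partial_2\varphi-\mathcal H_3\partial_3\varphi\big).$$ The second derivatives $\mathbb P'',\mathbb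 V'',\mathbb B''$ are the mixed derivatives $\partial_\varepsilon\partial_\delta|_{\varepsilon=\delta=0}$ of the operators at base state $+\,\varepsilon(\cdot)'+\delta(\cdot)''$. **Proposition 23.** Let $\tilde\alpha\in\mathbb N$. There exist constants $\tilde K_0>0$ and $C>0$ (depending on the equation of state, $\sigma$ and $\tilde\alpha$, but not on $T$, $\gamma$, $m$ or the functions below) such that the following holds for all integers $m\in[6,\tilde\alpha-2]$, all $T>0$ and all $\gamma\ge1$. Let $\hat U\in W^{2,\infty}_*(Q_T^+)\cap H^{\tilde\alpha}_{*,\gamma}(Q_T^+)$, $\hat{\mathcal H}\in W^{1,\infty}(Q_T^-)\cap H^{\tilde\alpha}_\gamma(Q_T^-)$, $\hat\Psi\in W^{2,\infty}(Q_T)\cap H^{\tilde\alpha}_\gamma(Q_T)$ satisfy $$\|\hat U\|_{W^{2,\infty}_*(Q_T^+)}+\|\hat{\mathcal H}\|_{W^{1,\infty}(Q_T^-)}+\|\hat\Psi\|_{W^{2,\infty}_*(Q_T)}\le\tilde K\quad\text{with }\tilde K\le\tilde K_0,$$ and let $\hat\varphi$ be any function on $\omega_T$. (i) If $(V',\Psi'),(V'',\Psi'')\in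 H^{m+2}_{*,\gamma}(Q_T^+)$, then $$\begin{aligned}\|\mathbb P''(\hat U,\hat\Psi)((V',\Psi'),(V'',\Psi''))\|_{H^m_{*,\gamma}(Q_T^+)}\le C\big\{&\|(\hat U,\hat\Psi)\|_{H^{m+2}_{*,\gamma}(Q_T^+)}\|(V',\Psi')\|_{W^{2,\infty}_*(Q_T^+)}\|(V'',\Psi'')\|_{W^{2,\infty}_*(Q_T^+)}\\&+\|(V',\Psi')\|_{H^{m+2}_{*,\gamma}(Q_T^+)}\|(V'',\Psi'')\|_{W^{2,\infty}_*(Q_T^+)}\\&+\|(V'',\Psi'')\|_{H^{m+2}_{*,\gamma}(Q_T^+)}\|(V',\Psi')\|_{W^{2,\infty}_*(Q_T^+)}\big\}.\end{aligned}$$ (ii) If $(\mathcal K',\nabla\Psi'),(\mathcal K'',\nabla\Psi'')\in H^{m+1}_\gamma(Q_T^-)$ ($\nabla$ the spatial gradient), then $$\begin{aligned}\|\mathbb V''(\hat{\mathcal H},\hat\Psi)((\mathcal K',\Psi'),(\mathcal K'',\Psi''))\|_{H^m_\gamma(Q_T^-)}\le C\big\{&\|(\hat{\mathcal H},\nabla\hat\Psi)\|_{H^{m+1}_\gamma(Q_T^-)}\|(\mathcal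 K',\nabla\Psi')\|_{W^{1,\infty}(Q_T^-)}\|(\mathcal K'',\nabla\Psi'')\|_{W^{1,\infty}(Q_T^-)}\\&+\|(\mathcal K',\nabla\Psi')\|_{H^{m+1}_\gamma(Q_T^-)}\|(\mathcal K'',\nabla\Psi'')\|_{W^{1,\infty}(Q_T^-)}\\&+\|(\mathcal K'',\nabla\Psi'')\|_{H^{m+1}_\gamma(Q_T^-)}\|(\mathcal K',\nabla\Psi')\|_{W^{1,\infty}(Q_T^-)}\big\}.\end{aligned}$$ (iii) If $(V',\mathcal K',\psi'),(V'',\mathcal K'',\psi'')\in H^{m+1}_{*,\gamma}(Q_T^+)\times H^{m+1}_\gamma(Q_T^-)\times H^{m+1}_\gamma(\omega_T)$, then, $\mathbb B''$ being taken at $(\hat U,\hat{\mathcal H},\hat\varphi)$ (on which it does not depend), $$\begin{aligned}\|\mathbb B''((V',\mathcal K',\psi'),(V'',\mathcal K'',\psi''))_{1,2,3}\|_{H^m_\gamma(\omega_T)}\le C\big\{&\|V'\|_{H^{m+1}_{*,\gamma}(Q_T^+)}\|\psi''\|_{W^{1,\infty}(\omega_T)}+\|V'\|_{L^\infty(Q_T^+)}\|\psi''\|_{H^{m+1}_\gamma(\omega_T)}\\&+\|V''\|_{H^{m+1}_{*,\gamma}(Q_T^+)}\|\psi'\|_{W^{1,\infty}(\omega_T)}+\|V''\|_{L^\infty(Q_T^+)}\|\psi'\|_{H^{m+1}_\gamma(\omega_T)}\\&+\|\mathcal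 K'\|_{H^3_\gamma(Q_T^-)}\|\mathcal K''\|_{H^{m+1}_\gamma(Q_T^-)}+\|\mathcal K'\|_{H^{m+1}_\gamma(Q_T^-)}\|\mathcal K''\|_{H^3_\gamma(Q_T^-)}\\&+\|\mathcal K'\|_{H^3_\gamma(Q_T^-)}\|\psi''\|_{H^{m+1}_\gamma(\omega_T)}+\|\mathcal K'\|_{H^{m+1}_\gamma(Q_T^-)}\|\psi''\|_{W^{1,\infty}(\omega_T)}\\&+\|\mathcal K''\|_{H^3_\gamma(Q_T^-)}\|\psi'\|_{H^{m+1}_\gamma(\omega_T)}+\|\mathcal K''\|_{H^{m+1}_\gamma(Q_T^-)}\|\psi'\|_{W^{1,\infty}(\omega_T)}\big\}.\end{aligned}$$ -/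

import Mathlib

open MeasureTheory Filter Topology
open scoped ENNReal ContDiff Matrix

noncomputable section

namespace PlasmaVacuum

/-! ### Domains

A function on `(-∞, T) × (a, b) × 𝕋²` is represented by its lift to the cover
`(-∞, T) × (a, b) × ℝ² ⊆ ℝ⁴`, which is 1-periodic in the last two variables. Weak derivatives are
taken on the cover; integrals and suprema are taken over one unit cell. The coordinates of a
point `z : Fin 4 → ℝ` are `(t, x₁, x₂, x₃) = (z 0, z 1, z 2, z 3)`, those of a point
`y : Fin 3 → ℝ` of the space-time boundary are `(t, x₂, x₃) = (y 0, y 1, y 2)`. -/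

/-- An open subset of `ℝ^d` together with the directions in which everything is 1-periodic. -/
structure PeriodicDomain (d : ℕ) where
  /-- the domain, lifted to `ℝ^d` -/
  cover : Set (Fin d → ℝ)
  /-- the indices of the periodic coordinates -/
  torus : Finset (Fin d)

/-- One period of the domain. -/
def PeriodicDomain.cell {d : ℕ} (D : PeriodicDomain d) : Set (Fin d → ℝ) :=
  D.cover ∩ {z | ∀ i ∈ D.torus, z i ∈ Set.Ico (0 : ℝ) 1}

/-- 1-periodicity in the periodic coordinates of `D`. -/
def IsPeriodic {d : ℕ} {E : Type} (D : PeriodicDomain d) (u : (Fin d → ℝ) → E) : Prop :=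
  ∀ i ∈ D.torus, ∀ z, u (z + Pi.single i 1) = u z

/-- `Q_T⁺ = (-∞, T) × (0, 1) × 𝕋²`. -/
def plasmaDomain (T : ℝ) : PeriodicDomain 4 where
  cover := {z | z 0 < T ∧ 0 < z 1 ∧ z 1 < 1}
  torus := {2, 3}

/-- `Q_T⁻ = (-∞, T) × (-1, 0) × 𝕋²`. -/
def vacuumDomain (T : ℝ) : PeriodicDomain 4 where
  cover := {z | z 0 < T ∧ -1 < z 1 ∧ z 1 < 0}
  torus := {2, 3}

/-- `Q_T = (-∞, T) × (-1, 1) × 𝕋²`. -/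
def fullDomain (T : ℝ) : PeriodicDomain 4 where
  cover := {z | z 0 < T ∧ -1 < z 1 ∧ z 1 < 1}
  torus := {2, 3}

/-- `ω_T = (-∞, T) × 𝕋²`. -/
def interfaceDomain (T : ℝ) : PeriodicDomain 3 where
  cover := {y | y 0 < T}
  torus := {1, 2}

/-! ### Weak derivatives -/

/-- Test functions `C_c^∞(A)`. -/
def IsTest {d : ℕ} (A : Set (Fin d → ℝ)) (φ : (Fin d → ℝ) → ℝ) : Prop :=
  ContDiff ℝ ∞ φ ∧ HasCompactSupport φ ∧ tsupport φ ⊆ A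

/-- The classical partial derivative `∂ᵢ φ`. -/
def pd {d : ℕ} (i : Fin d) (φ : (Fin d → ℝ) → ℝ) : (Fin d → ℝ) → ℝ :=
  fun z => fderiv ℝ φ z (Pi.single i 1)

/-- The classical derivative `∂^α φ = ∂₀^{α₀} ⋯ ∂_{d-1}^{α_{d-1}} φ`. -/
def pdMulti {d : ℕ} (α : Fin d → ℕ) (φ : (Fin d → ℝ) → ℝ) : (Fin d → ℝ) → ℝ :=
  (List.finRange d).foldr (fun i f => (pd i)^[α i] f) φ

/-- The locally integrable function `g` is the weak derivative `∂^α u` on `D`. -/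
def IsWeakDeriv {d : ℕ} (D : PeriodicDomain d) (α : Fin d → ℕ) (u g : (Fin d → ℝ) → ℝ) : Prop :=
  LocallyIntegrableOn u D.cover ∧ LocallyIntegrableOn g D.cover ∧
    ∀ φ, IsTest D.cover φ →
      ∫ z in D.cover, u z * pdMulti α φ z = (-1) ^ (∑ i, α i) * ∫ z in D.cover, g z * φ z

/-- The locally integrable function `g` is the first weak derivative `∂ᵢ u` on `D`. -/
def IsWeakPartial {d : ℕ} (D : PeriodicDomain d) (i : Fin d) (u g : (Fin d → ℝ) → ℝ) : Prop :=
  LocallyIntegrableOn u D.cover ∧ LocallyIntegrableOn g D.cover ∧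
    ∀ φ, IsTest D.cover φ →
      ∫ z in D.cover, u z * pd i φ z = - ∫ z in D.cover, g z * φ z

open Classical in
/-- A representative of the first weak derivative `∂ᵢ u` on `D` (which is unique up to equality
almost everywhere in `D`), if that exists. -/
def weakPartial {d : ℕ} (D : PeriodicDomain d) (i : Fin d) (u : (Fin d → ℝ) → ℝ) :
    (Fin d → ℝ) → ℝ :=
  if h : ∃ g, IsWeakPartial D i u g then h.choose else 0

/-! ### Weighted Sobolev spaces and `W^{k,∞}`

All norms take values in `[0, ∞]`; a function belongs to the space if and only if its norm is
finite. Pairs of functions and vector-valued functions are normed by the sum of the norms of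
their components. -/

/-- The multi-indices `α ∈ ℕ^d` with `|α| ≤ m`. -/
def multiIndices (d m : ℕ) : Finset (Fin d → ℕ) :=
  (Fintype.piFinset fun _ => Finset.range (m + 1)).filter fun α => ∑ i, α i ≤ m

/-- The `L^p` norm over one period. -/
def lpNorm {d : ℕ} (D : PeriodicDomain d) (p : ℝ≥0∞) (g : (Fin d → ℝ) → ℝ) : ℝ≥0∞ :=
  eLpNorm g p (volume.restrict D.cell)

/-- `‖∂^α u‖_{L^p}`; this is `∞` if `∂^α u` is not in `L^p`, as the infimum is then over the
empty set or over infinite values. -/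
def weakDerivNorm {d : ℕ} (D : PeriodicDomain d) (p : ℝ≥0∞) (α : Fin d → ℕ)
    (u : (Fin d → ℝ) → ℝ) : ℝ≥0∞ :=
  ⨅ (g : (Fin d → ℝ) → ℝ) (_ : IsWeakDeriv D α u g), lpNorm D p g

/-- The norm of `H^m_γ(D)`:
`‖u‖² = ∑_{|α| ≤ m} γ^{2(m-|α|)} ‖∂^α u‖²_{L²}`. -/
def hNorm {d : ℕ} (D : PeriodicDomain d) (γ : ℝ) (m : ℕ) (u : (Fin d → ℝ) → ℝ) : ℝ≥0∞ :=
  (∑ α ∈ multiIndices d m,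
    (ENNReal.ofReal γ ^ (m - ∑ i, α i) * weakDerivNorm D 2 α u) ^ 2) ^ (1 / 2 : ℝ)

/-- The norm of `W^{k,∞}(D)`: the sum over `|α| ≤ k` of `‖∂^α u‖_{L^∞}`. -/
def wInfNorm {d : ℕ} (D : PeriodicDomain d) (k : ℕ) (u : (Fin d → ℝ) → ℝ) : ℝ≥0∞ :=
  ∑ α ∈ multiIndices d k, weakDerivNorm D ⊤ α u

/-- The norm of a vector-valued function, obtained from the norm `N` for scalar functions. -/
def vecNorm {d n : ℕ} (N : ((Fin d → ℝ) → ℝ) → ℝ≥0∞) (u : (Fin d → ℝ) → Fin n → ℝ) : ℝ≥0∞ :=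
  ∑ j, N fun z => u z j

/-- The norm `N` of the spatial gradient `∇u = (∂₁u, ∂₂u, ∂₃u)` of a function of `(t, x)`;
`∞` if a weak derivative does not exist. -/
def gradNorm (D : PeriodicDomain 4) (N : ((Fin 4 → ℝ) → ℝ) → ℝ≥0∞) (u : (Fin 4 → ℝ) → ℝ) :
    ℝ≥0∞ :=
  ∑ i ∈ ({1, 2, 3} : Finset (Fin 4)), ⨅ (g : (Fin 4 → ℝ) → ℝ) (_ : IsWeakPartial D i u g), N g

/-! ### Conormal derivatives and anisotropic spaces -/

/-- The weight `σ` of the conormal derivative `Z₁ = σ(x₁) ∂₁`: smooth and positive on `(0, 1)`,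
equal to `x₁` near `0` and to `1 - x₁` near `1`. -/
def IsConormalWeight (σ : ℝ → ℝ) : Prop :=
  ContDiffOn ℝ ∞ σ (Set.Ioo 0 1) ∧ (∀ s ∈ Set.Ioo (0 : ℝ) 1, 0 < σ s) ∧
    (∀ᶠ s in 𝓝[>] (0 : ℝ), σ s = s) ∧ ∀ᶠ s in 𝓝[<] (1 : ℝ), σ s = 1 - s

/-- The coefficient `aᵢ` of `Zᵢ = aᵢ ∂ᵢ`, that is `Z₀ = ∂ₜ`, `Z₁ = σ(|x₁|) ∂₁`, `Z₂ = ∂₂`,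
`Z₃ = ∂₃`. -/
def zCoef (σ : ℝ → ℝ) (i : Fin 4) (z : Fin 4 → ℝ) : ℝ :=
  if i = 1 then σ |z 1| else 1

/-- The formal adjoint of `Zᵢ`, acting on test functions: `φ ↦ -∂ᵢ(aᵢ φ)`. -/
def zAdj (σ : ℝ → ℝ) (i : Fin 4) (φ : (Fin 4 → ℝ) → ℝ) : (Fin 4 → ℝ) → ℝ :=
  fun z => - pd i (fun w => zCoef σ i w * φ w) z

/-- The formal adjoint of `Z^α ∂₁^k = Z₀^{α₀} Z₁^{α₁} Z₂^{α₂} Z₃^{α₃} ∂₁^k`. -/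
def conormalAdj (σ : ℝ → ℝ) (α : Fin 4 → ℕ) (k : ℕ) (φ : (Fin 4 → ℝ) → ℝ) : (Fin 4 → ℝ) → ℝ :=
  (fun f z => - pd 1 f z)^[k]
    ((zAdj σ 3)^[α 3] ((zAdj σ 2)^[α 2] ((zAdj σ 1)^[α 1] ((zAdj σ 0)^[α 0] φ))))

/-- The locally integrable function `g` is `Z^α ∂₁^k u` in the sense of distributions on `D`. -/
def IsConormalDeriv (σ : ℝ → ℝ) (D : PeriodicDomain 4) (α : Fin 4 → ℕ) (k : ℕ)
    (u g : (Fin 4 → ℝ) → ℝ) : Prop :=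
  LocallyIntegrableOn u D.cover ∧ LocallyIntegrableOn g D.cover ∧
    ∀ φ, IsTest D.cover φ →
      ∫ z in D.cover, u z * conormalAdj σ α k φ z = ∫ z in D.cover, g z * φ z

/-- `‖Z^α ∂₁^k u‖_{L²}`. -/
def conormalDerivNorm (σ : ℝ → ℝ) (D : PeriodicDomain 4) (α : Fin 4 → ℕ) (k : ℕ)
    (u : (Fin 4 → ℝ) → ℝ) : ℝ≥0∞ :=
  ⨅ (g : (Fin 4 → ℝ) → ℝ) (_ : IsConormalDeriv σ D α k u g), lpNorm D 2 g

/-- The norm of `H^m_{*,γ}(D)`: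
`‖u‖² = ∑_{|α| + 2k ≤ m} γ^{2(m-|α|-2k)} ‖Z^α ∂₁^k u‖²_{L²}`. -/
def hStarNorm (σ : ℝ → ℝ) (D : PeriodicDomain 4) (γ : ℝ) (m : ℕ) (u : (Fin 4 → ℝ) → ℝ) : ℝ≥0∞ :=
  (∑ q ∈ (multiIndices 4 m ×ˢ Finset.range (m + 1)).filter
      (fun q => (∑ i, q.1 i) + 2 * q.2 ≤ m),
    (ENNReal.ofReal γ ^ (m - ((∑ i, q.1 i) + 2 * q.2)) *
      conormalDerivNorm σ D q.1 q.2 u) ^ 2) ^ (1 / 2 : ℝ)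

/-- The norm of `W^{1,∞}_*(D)`: `‖u‖_{L^∞} + ∑_{i=0}^3 ‖Zᵢ u‖_{L^∞}`. -/
def wStarOneNorm (σ : ℝ → ℝ) (D : PeriodicDomain 4) (u : (Fin 4 → ℝ) → ℝ) : ℝ≥0∞ :=
  lpNorm D ⊤ u + ∑ i, ⨅ (g : (Fin 4 → ℝ) → ℝ) (_ : IsWeakPartial D i u g),
    lpNorm D ⊤ fun z => zCoef σ i z * g z

/-- The norm of `W^{2,∞}_*(D)`: `‖u‖_{W^{1,∞}_*} + ∑_{i=0}^3 ‖∂ᵢ u‖_{W^{1,∞}_*}`, where the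
gradient is with respect to all the variables `(t, x)` of `D`. -/
def wStarTwoNorm (σ : ℝ → ℝ) (D : PeriodicDomain 4) (u : (Fin 4 → ℝ) → ℝ) : ℝ≥0∞ :=
  wStarOneNorm σ D u + ∑ i, ⨅ (g : (Fin 4 → ℝ) → ℝ) (_ : IsWeakPartial D i u g),
    wStarOneNorm σ D g

/-! ### Second derivatives of nonlinear operators -/

/-- `∂²F/∂ε∂δ` at `ε = δ = 0`. -/
def mixedDeriv {n : ℕ} (F : ℝ → ℝ → Fin n → ℝ) : Fin n → ℝ :=
  deriv (fun ε => deriv (fun δ => F ε δ) 0) 0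

/-! ### The plasma operator

The unknown is `U = (q, v, H, S)`, with `q = U 0`, `v = (U 1, U 2, U 3)`, `H = (U 4, U 5, U 6)`
and `S = U 7`. -/

/-- The pressure `p = q - |H|²/2`. -/
def pressure (U : Fin 8 → ℝ) : ℝ := U 0 - (U 4 ^ 2 + U 5 ^ 2 + U 6 ^ 2) / 2

/-- The density `ρ(p, S)` in the state `U`. -/
def density (ρ : ℝ → ℝ → ℝ) (U : Fin 8 → ℝ) : ℝ := ρ (pressure U) (U 7)

/-- The quotient `ρ_p / ρ` in the state `U`, where `ρ_p = ∂ρ/∂p`. -/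
def rhoRatio (ρ : ℝ → ℝ → ℝ) (U : Fin 8 → ℝ) : ℝ :=
  deriv (fun p => ρ p (U 7)) (pressure U) / density ρ U

/-- An equation of state `ρ = ρ(p, S)` which is smooth and satisfies the hyperbolicity condition
`ρ > 0`, `ρ_p > 0` on the open set `O` of values of `(p, S)`; the state `U = 0`, for which
`(p, S) = (0, 0)`, is one of the admissible states. -/
def IsEquationOfState (ρ : ℝ → ℝ → ℝ) (O : Set (ℝ × ℝ)) : Prop :=
  IsOpen O ∧ (0, 0) ∈ O ∧ ContDiffOn ℝ ∞ (fun x : ℝ × ℝ => ρ x.1 x.2) O ∧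
    ∀ x ∈ O, 0 < ρ x.1 x.2 ∧ 0 < deriv (fun p => ρ p x.2) x.1

/-- The matrix `A₀(U)`. -/
def matA0 (ρ : ℝ → ℝ → ℝ) (U : Fin 8 → ℝ) : Matrix (Fin 8) (Fin 8) ℝ :=
  let r := rhoRatio ρ U
  let d := density ρ U
  let a := U 4
  let b := U 5
  let c := U 6
  !![     r, 0, 0, 0,       -r * a,        -r * b,        -r * c, 0;
          0, d, 0, 0,            0,             0,             0, 0;
          0, 0, d, 0,            0,             0,             0, 0;
          0, 0, 0, d,            0,             0,             0, 0;
     -r * a, 0, 0, 0, 1 + r * a * a,     r * a * b,     r * a * c, 0;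
     -r * b, 0, 0, 0,     r * b * a, 1 + r * b * b,     r * b * c, 0;
     -r * c, 0, 0, 0,     r * c * a,     r * c * b, 1 + r * c * c, 0;
          0, 0, 0, 0,             0,             0,             0, 1]

/-- The matrix `Aⱼ(U)`, where `j = 0, 1, 2` stands for the spatial direction `x₁, x₂, x₃`;
`v` and `h` are the components of velocity and magnetic field in that direction, and
`e` is the corresponding unit vector. -/
def matA (ρ : ℝ → ℝ → ℝ) (U : Fin 8 → ℝ) (j : Fin 3) : Matrix (Fin 8) (Fin 8) ℝ :=
  let r := rhoRatio ρ U
  let d := density ρ U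
  let a := U 4
  let b := U 5
  let c := U 6
  let v := ![U 1, U 2, U 3] j
  let h := ![U 4, U 5, U 6] j
  let e : Fin 3 → ℝ := Pi.single j 1
  !![      r * v,   e 0,   e 1,   e 2,          -r * a * v,          -r * b * v,          -r * c * v, 0;
             e 0, d * v,     0,     0,                  -h,                   0,                   0, 0;
             e 1,     0, d * v,     0,                   0,                  -h,                   0, 0;
             e 2,     0,     0, d * v,                   0,                   0,                  -h, 0;
      -r * a * v,    -h,     0,     0, (1 + r * a * a) * v,       r * a * b * v,       r * a * c * v, 0;
      -r * b * v,     0,    -h,     0,       r * b * a * v, (1 + r * b * b) * v,       r * b * c * v, 0;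
      -r * c * v,     0,     0,    -h,       r * c * a * v,       r * c * b * v, (1 + r * c * c) * v, 0;
               0,     0,     0,     0,                   0,                   0,                   0, v]

/-- The nonlinear expression of the first-order operator `ℙ`: if `DU i` and `DΨ i` are the values
of `∂ᵢ U` and `∂ᵢ Ψ`, `i = 0, …, 3`, this is the value of
`ℙ(U, Ψ) = A₀(U) ∂ₜU + Ã₁(U, Ψ) ∂₁U + A₂(U) ∂₂U + A₃(U) ∂₃U`, where
`Ã₁(U, Ψ) = (∂₁Φ₁)⁻¹ (A₁(U) - A₀(U) ∂ₜΨ - A₂(U) ∂₂Ψ - A₃(U) ∂₃Ψ)` and `∂₁Φ₁ = 1 + ∂₁Ψ`. -/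
def plasmaSymbol (ρ : ℝ → ℝ → ℝ) (U : Fin 8 → ℝ) (DU : Fin 4 → Fin 8 → ℝ) (DΨ : Fin 4 → ℝ) :
    Fin 8 → ℝ :=
  matA0 ρ U *ᵥ DU 0 +
    ((1 + DΨ 1)⁻¹ •
      (matA ρ U 0 - DΨ 0 • matA0 ρ U - DΨ 2 • matA ρ U 1 - DΨ 3 • matA ρ U 2)) *ᵥ DU 1 +
    matA ρ U 1 *ᵥ DU 2 + matA ρ U 2 *ᵥ DU 3

/-- The first weak derivatives of a scalar function. -/
def weakGrad {d : ℕ} (D : PeriodicDomain d) (u : (Fin d → ℝ) → ℝ) (z : Fin d → ℝ) : Fin d → ℝ :=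
  fun i => weakPartial D i u z

/-- The first weak derivatives of a vector-valued function. -/
def weakJac {d n : ℕ} (D : PeriodicDomain d) (u : (Fin d → ℝ) → Fin n → ℝ) (z : Fin d → ℝ) :
    Fin d → Fin n → ℝ :=
  fun i j => weakPartial D i (fun w => u w j) z

/-- The operator `ℙ(U, Ψ)` on `D`. -/
def plasmaOp (ρ : ℝ → ℝ → ℝ) (D : PeriodicDomain 4)
    (U : (Fin 4 → ℝ) → Fin 8 → ℝ) (Ψ : (Fin 4 → ℝ) → ℝ) : (Fin 4 → ℝ) → Fin 8 → ℝ :=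
  fun z => plasmaSymbol ρ (U z) (weakJac D U z) (weakGrad D Ψ z)

/-- The second derivative `ℙ''(U, Ψ)((V₁, Ψ₁), (V₂, Ψ₂))` on `D`, that is
`∂²/∂ε∂δ ℙ(U + ε V₁ + δ V₂, Ψ + ε Ψ₁ + δ Ψ₂)` at `ε = δ = 0`, computed
pointwise, with the weak derivatives of `U + ε V₁ + δ V₂` and `Ψ + ε Ψ₁ + δ Ψ₂` written as
linear combinations (so that the representatives depend smoothly on `ε` and `δ`). -/
def plasmaSecond (ρ : ℝ → ℝ → ℝ) (D : PeriodicDomain 4)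
    (U : (Fin 4 → ℝ) → Fin 8 → ℝ) (Ψ : (Fin 4 → ℝ) → ℝ)
    (V₁ : (Fin 4 → ℝ) → Fin 8 → ℝ) (Ψ₁ : (Fin 4 → ℝ) → ℝ)
    (V₂ : (Fin 4 → ℝ) → Fin 8 → ℝ) (Ψ₂ : (Fin 4 → ℝ) → ℝ) : (Fin 4 → ℝ) → Fin 8 → ℝ :=
  fun z => mixedDeriv fun ε δ =>
    plasmaSymbol ρ (U z + ε • V₁ z + δ • V₂ z)
      (weakJac D U z + ε • weakJac D V₁ z + δ • weakJac D V₂ z)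
      (weakGrad D Ψ z + ε • weakGrad D Ψ₁ z + δ • weakGrad D Ψ₂ z)

/-! ### The vacuum operator -/

/-- The field `𝕳 = (H₁ ∂₁Φ₁, H₁ ∂₂Ψ + H₂, H₁ ∂₃Ψ + H₃)` as a function of the values of `H` and
of the derivatives of `Ψ`, where `∂₁Φ₁ = 1 + ∂₁Ψ`. -/
def curlFlux (H : Fin 3 → ℝ) (DΨ : Fin 4 → ℝ) : Fin 3 → ℝ :=
  ![H 0 * (1 + DΨ 1), H 0 * DΨ 2 + H 1, H 0 * DΨ 3 + H 2]

/-- The field `𝖍 = (H₁ - H₂ ∂₂Ψ - H₃ ∂₃Ψ, H₂ ∂₁Φ₁, H₃ ∂₁Φ₁)`. -/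
def divFlux (H : Fin 3 → ℝ) (DΨ : Fin 4 → ℝ) : Fin 3 → ℝ :=
  ![H 0 - H 1 * DΨ 2 - H 2 * DΨ 3, H 1 * (1 + DΨ 1), H 2 * (1 + DΨ 1)]

/-- For vector fields `F`, `G` of `(t, x)`, the function `(∇ × F, div G)` with values in `ℝ⁴`,
with weak spatial derivatives. -/
def curlDiv (D : PeriodicDomain 4) (F G : (Fin 4 → ℝ) → Fin 3 → ℝ) : (Fin 4 → ℝ) → Fin 4 → ℝ :=
  fun z =>
    ![weakJac D F z 2 2 - weakJac D F z 3 1,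
      weakJac D F z 3 0 - weakJac D F z 1 2,
      weakJac D F z 1 1 - weakJac D F z 2 0,
      weakJac D G z 1 0 + weakJac D G z 2 1 + weakJac D G z 3 2]

/-- The operator `𝕍(H, Ψ) = (∇ × 𝕳, div 𝖍)` on `D`. -/
def vacuumOp (D : PeriodicDomain 4) (H : (Fin 4 → ℝ) → Fin 3 → ℝ) (Ψ : (Fin 4 → ℝ) → ℝ) :
    (Fin 4 → ℝ) → Fin 4 → ℝ :=
  curlDiv D (fun z => curlFlux (H z) (weakGrad D Ψ z)) (fun z => divFlux (H z) (weakGrad D Ψ z))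

/-- The second derivative `𝕍''(H, Ψ)((K₁, Ψ₁), (K₂, Ψ₂))` on `D`. The curl and the divergence
are linear with constant coefficients, hence they commute with `∂²/∂ε∂δ`, which is applied to
the fields `𝕳` and `𝖍` at `(H + ε K₁ + δ K₂, Ψ + ε Ψ₁ + δ Ψ₂)`. -/
def vacuumSecond (D : PeriodicDomain 4)
    (H : (Fin 4 → ℝ) → Fin 3 → ℝ) (Ψ : (Fin 4 → ℝ) → ℝ)
    (K₁ : (Fin 4 → ℝ) → Fin 3 → ℝ) (Ψ₁ : (Fin 4 → ℝ) → ℝ)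
    (K₂ : (Fin 4 → ℝ) → Fin 3 → ℝ) (Ψ₂ : (Fin 4 → ℝ) → ℝ) : (Fin 4 → ℝ) → Fin 4 → ℝ :=
  curlDiv D
    (fun z => mixedDeriv fun ε δ =>
      curlFlux (H z + ε • K₁ z + δ • K₂ z)
        (weakGrad D Ψ z + ε • weakGrad D Ψ₁ z + δ • weakGrad D Ψ₂ z))
    (fun z => mixedDeriv fun ε δ =>
      divFlux (H z + ε • K₁ z + δ • K₂ z)
        (weakGrad D Ψ z + ε • weakGrad D Ψ₁ z + δ • weakGrad D Ψ₂ z))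

/-! ### The boundary operator on the interface -/

/-- The trace at `x₁ = 0`, from the side `x₁ > 0` if `s = 1` and from the side `x₁ < 0` if
`s = -1`: the limit, at almost every `(t, x')`, of the averages over `0 < s x₁ < r` as `r → 0⁺`. -/
def trace (s : ℝ) (u : (Fin 4 → ℝ) → ℝ) (y : Fin 3 → ℝ) : ℝ :=
  limUnder (𝓝[>] (0 : ℝ)) fun r => r⁻¹ * ∫ a in (0 : ℝ)..r, u ![y 0, s * a, y 1, y 2]

/-- The trace of a vector-valued function. -/
def vecTrace {n : ℕ} (s : ℝ) (u : (Fin 4 → ℝ) → Fin n → ℝ) (y : Fin 3 → ℝ) : Fin n → ℝ :=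
  fun j => trace s (fun z => u z j) y

/-- The first three components of the boundary operator `𝔹`, those on the interface:
`(∂ₜφ - v_N, q - |H|²/2, H_N)` as a function of the boundary values of the plasma unknown `U`
and of the vacuum magnetic field `H`, and of `Dφ = (∂ₜφ, ∂₂φ, ∂₃φ)`, where
`v_N = v₁ - v₂ ∂₂φ - v₃ ∂₃φ` and `H_N = H₁ - H₂ ∂₂φ - H₃ ∂₃φ`. -/
def interfaceSymbol (U : Fin 8 → ℝ) (H : Fin 3 → ℝ) (Dφ : Fin 3 → ℝ) : Fin 3 → ℝ :=
  ![Dφ 0 - (U 1 - U 2 * Dφ 1 - U 3 * Dφ 2),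
    U 0 - (H 0 ^ 2 + H 1 ^ 2 + H 2 ^ 2) / 2,
    H 0 - H 1 * Dφ 1 - H 2 * Dφ 2]

/-- The first three components of `𝔹(U, H, φ)` on `ω_T`; here `D` is `ω_T`. -/
def interfaceOp (D : PeriodicDomain 3)
    (U : (Fin 4 → ℝ) → Fin 8 → ℝ) (H : (Fin 4 → ℝ) → Fin 3 → ℝ) (φ : (Fin 3 → ℝ) → ℝ) :
    (Fin 3 → ℝ) → Fin 3 → ℝ :=
  fun y => interfaceSymbol (vecTrace 1 U y) (vecTrace (-1) H y) (weakGrad D φ y)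

/-- The first three components of the second derivative
`𝔹''(U, H, φ)((V₁, K₁, ψ₁), (V₂, K₂, ψ₂))` on `ω_T`; here `D` is `ω_T`. -/
def interfaceSecond (D : PeriodicDomain 3)
    (U : (Fin 4 → ℝ) → Fin 8 → ℝ) (H : (Fin 4 → ℝ) → Fin 3 → ℝ) (φ : (Fin 3 → ℝ) → ℝ)
    (V₁ : (Fin 4 → ℝ) → Fin 8 → ℝ) (K₁ : (Fin 4 → ℝ) → Fin 3 → ℝ) (ψ₁ : (Fin 3 → ℝ) → ℝ)
    (V₂ : (Fin 4 → ℝ) → Fin 8 → ℝ) (K₂ : (Fin 4 → ℝ) → Fin 3 → ℝ) (ψ₂ : (Fin 3 → ℝ) → ℝ) :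
    (Fin 3 → ℝ) → Fin 3 → ℝ :=
  fun y => mixedDeriv fun ε δ =>
    interfaceSymbol (vecTrace 1 U y + ε • vecTrace 1 V₁ y + δ • vecTrace 1 V₂ y)
      (vecTrace (-1) H y + ε • vecTrace (-1) K₁ y + δ • vecTrace (-1) K₂ y)
      (weakGrad D φ y + ε • weakGrad D ψ₁ y + δ • weakGrad D ψ₂ y)

/-! ### Norms of pairs -/

/-- `‖(V, Ψ)‖_{H^s_{*,γ}(Q_T⁺)}`. -/
def plasmaHNorm (σ : ℝ → ℝ) (T γ : ℝ) (s : ℕ)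
    (V : (Fin 4 → ℝ) → Fin 8 → ℝ) (Ψ : (Fin 4 → ℝ) → ℝ) : ℝ≥0∞ :=
  vecNorm (hStarNorm σ (plasmaDomain T) γ s) V + hStarNorm σ (plasmaDomain T) γ s Ψ

/-- `‖(V, Ψ)‖_{W^{2,∞}_*(Q_T⁺)}`. -/
def plasmaWNorm (σ : ℝ → ℝ) (T : ℝ)
    (V : (Fin 4 → ℝ) → Fin 8 → ℝ) (Ψ : (Fin 4 → ℝ) → ℝ) : ℝ≥0∞ :=
  vecNorm (wStarTwoNorm σ (plasmaDomain T)) V + wStarTwoNorm σ (plasmaDomain T) Ψ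

/-- `‖(K, ∇Ψ)‖_{H^s_γ(Q_T⁻)}`. -/
def vacuumHNorm (T γ : ℝ) (s : ℕ)
    (K : (Fin 4 → ℝ) → Fin 3 → ℝ) (Ψ : (Fin 4 → ℝ) → ℝ) : ℝ≥0∞ :=
  vecNorm (hNorm (vacuumDomain T) γ s) K +
    gradNorm (vacuumDomain T) (hNorm (vacuumDomain T) γ s) Ψ

/-- `‖(K, ∇Ψ)‖_{W^{1,∞}(Q_T⁻)}`. -/
def vacuumWNorm (T : ℝ) (K : (Fin 4 → ℝ) → Fin 3 → ℝ) (Ψ : (Fin 4 → ℝ) → ℝ) : ℝ≥0∞ :=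
  vecNorm (wInfNorm (vacuumDomain T) 1) K +
    gradNorm (vacuumDomain T) (wInfNorm (vacuumDomain T) 1) Ψ

end PlasmaVacuum

end

/-!
All three bounds are Moser (tame product) estimates, with constants independent of `T` and `γ`.
The second derivative of the operator is a sum of products `Φ(Y) · ∂'W' · ∂''W''`, with `Φ` a smooth
function of the jet `Y` of the base state (`exists_second_coeff`). Each order `j ≤ m` of the weighted
norms is treated separately and the powers of `γ` are restored at the end (`moser_h1`, `moser_hs1`).

*Interpolation.* For smooth functions, a Gagliardo-Nirenberg inequality is needed which is uniform
up to the boundary and admits the degenerate field `σ ∂₁`. Every side of the unit cell is partitioned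
into intervals, of length comparable to `σ` in the direction `x₁` (Whitney intervals). On an interval,
the derivative of order `k` is bounded by averages of the function and of a derivative of higher
order. The averages are controlled by a dyadic maximal function along the coordinate line, which is
bounded on `L²`; so no extension operator is used. A derivative along `σ ∂₁` has weight one, and a
bare derivative `∂₁` has weight two. Chains of such inequalities, together with the Faà di Bruno
expansion (`DerivBound`), give `moser_smooth`: the derivatives of `Φ(Y)` of weight at most `n` are
bounded in `L²` by those of `Y`, linearly, when `Y` is bounded.

*From smooth to weak derivatives.* `moll` is a convolution composed with an affine contraction into
the domain, so that it is smooth up to the boundary and its derivatives are mollified weak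
derivatives. It preserves periodicity, uniform bounds and weighted `L²` bounds, up to constants. As
bounds on weak derivatives are weakly closed (`exists_weak_of_tendsto`), `moser_weak` follows. The
conormal derivatives `Z^α ∂₁^k` and the weighted derivatives `σ^{α₁} ∂^α ∂₁^k` are combinations of
each other with smooth coefficients (`Expands`), which carries the estimate over to the conormal norm.

*Products.* A product `f g` is a value of the Moser estimate after dividing `f` and `g` by their sup
norms, which gives `‖f g‖ ≤ C (‖f‖_∞ ‖g‖_m + ‖f‖_m ‖g‖_∞)`; in the degenerate case of a vanishing
norm the function itself vanishes. The estimates in the plasma and in the vacuum then follow from the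
explicit form of the second derivatives (`plasma_estimate`, `vacuum_estimate`).

*Traces.* For smooth functions, the derivatives on the slice `x₁ = const` are bounded by those in the
domain, where `∂₁` counts for two orders in the anisotropic norm: in the derivative of `∫ |∂ₜ f|²`
with respect to `x₁`, the mixed derivative is integrated by parts along the slice, so that only `∂ₜ f`,
`∂ₜ² f` and `∂₁ f` occur (`trace_rectangle`). The slices of mollifications converge to the trace, and
the bounds pass to the limit as before (`trace_estimate`). The Sobolev embedding on the interface
bounds the trace of the vacuum field uniformly by its third order norm, and `interface_estimate` is
again a sum of products.
-/

noncomputable section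

namespace PlasmaVacuum

/-- Real functions of `d` real variables. -/
abbrev Fn (d : ℕ) : Type := (Fin d → ℝ) → ℝ

open ENNReal (ofReal ofReal_mul mul_top rpow_natCast coe_mul ofReal_le_ofReal ofReal_add rpow_mul
  ofReal_pow mul_ne_top mul_lt_top ofReal_toReal ofReal_ne_top ofReal_one coe_le_coe coe_toNNReal)
open Pi (single)
open Function (update iterate_succ_apply')
open Set (univ Ico Ioo Icc Iio indicator_of_mem)
open Finset (range single_le_sum sum_le_sum mem_univ sum_congr mul_sum sum_add_distrib sum_mul
  sum_const mem_range sum_nonneg sum_le_card_nsmul)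
open Eventually (of_forall)
open Metric (closedBall)
open Fin (forall_fin_succ)
open intervalIntegral (integral_mono_on integral_of_le integral_eq_sub_of_hasDerivAt)
open Real (norm_eq_abs enorm_of_nonneg)
open Fintype (card)

local notation "Smooth" => ContDiff ℝ ∞
local notation "vol" D:max => Measure.restrict volume (PeriodicDomain.cover D)
local notation "Q⁺" => plasmaDomain
local notation "Γ" => interfaceDomain

set_option autoImplicit true
variable {d : ℕ} {D : PeriodicDomain d} {f g u φ : Fn d}

section

/-! ### Maximal functions of nested partitions -/

section Maximal

variable {X β : Type*} [MeasurableSpace X] {μ : Measure X}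

/-- The average of `f` over the piece containing `x` of the partition of `X` into the fibres
of `π`. -/
def fiberAvg (μ : Measure X) (π : X → β) (f : X → ℝ≥0∞) (x : X) : ℝ≥0∞ :=
  (∫⁻ y in π ⁻¹' {π x}, f y ∂μ) / μ (π ⁻¹' {π x})

theorem fiberAvg_congr (π : X → β) (f : X → ℝ≥0∞) {x y : X} (h : π x = π y) :
    fiberAvg μ π f x = fiberAvg μ π f y := by
  simp only [fiberAvg, h]

theorem lintegral_tsum_fiber [Countable β] [MeasurableSpace β]
    [MeasurableSingletonClass β] {π : X → β} (hπ : Measurable π) (F : X → ℝ≥0∞) :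
    ∫⁻ x, F x ∂μ = ∑' b, ∫⁻ x in π ⁻¹' {b}, F x ∂μ := by
  rw [← lintegral_iUnion (fun b => hπ (measurableSet_singleton b))]
  · rw [← Set.preimage_iUnion, Set.iUnion_of_singleton, Set.preimage_univ, Measure.restrict_univ]
  · intro a b hab
    grind

theorem lintegral_fiberAvg_mul [Countable β] [MeasurableSpace β]
    [MeasurableSingletonClass β] {π : X → β} (hπ : Measurable π) (hfin : ∀ b, μ (π ⁻¹' {b}) ≠ ⊤)
    {f : X → ℝ≥0∞} (hf : Measurable f) (g : β → ℝ≥0∞) :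
    ∫⁻ x, fiberAvg μ π f x * g (π x) ∂μ = ∫⁻ x, f x * g (π x) ∂μ := by
  rw [lintegral_tsum_fiber hπ, lintegral_tsum_fiber hπ (fun x => f x * g (π x))]
  refine tsum_congr fun b => ?_
  have hm := hπ (measurableSet_singleton b)
  have e1 : ∫⁻ x in π ⁻¹' {b}, f x * g (π x) ∂μ = (∫⁻ x in π ⁻¹' {b}, f x ∂μ) * g b := by
    rw [← lintegral_mul_const _ hf]
    refine setLIntegral_congr_fun hm (fun x hx => ?_)
    grind
  have e2 : ∫⁻ x in π ⁻¹' {b}, fiberAvg μ π f x * g (π x) ∂μ =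
      ((∫⁻ y in π ⁻¹' {b}, f y ∂μ) / μ (π ⁻¹' {b})) * g b * μ (π ⁻¹' {b}) := by
    rw [← setLIntegral_const]
    refine setLIntegral_congr_fun hm (fun x hx => ?_)
    have : π x = b := hx
    simp only [fiberAvg, this]
  rw [e1, e2, mul_right_comm]
  by_cases h0 : μ (π ⁻¹' {b}) = 0
  · have : ∫⁻ y in π ⁻¹' {b}, f y ∂μ = 0 := by
      rw [Measure.restrict_eq_zero.mpr h0]; simp
    grind
  · rw [ENNReal.div_mul_cancel h0 (hfin b)]

theorem lintegral_fiberAvg_sq_le [Countable β] [MeasurableSpace β]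
    [MeasurableSingletonClass β] {π : X → β} (hπ : Measurable π)
    (hfin : ∀ b, μ (π ⁻¹' {b}) ≠ ⊤) {f : X → ℝ≥0∞} (hf : Measurable f) :
    ∫⁻ x, fiberAvg μ π f x ^ 2 ∂μ ≤ ∫⁻ x, f x ^ 2 ∂μ := by
  rw [lintegral_tsum_fiber hπ, lintegral_tsum_fiber hπ (fun x => f x ^ 2)]
  refine ENNReal.tsum_le_tsum fun b => ?_
  rw [setLIntegral_congr_fun
      (g := fun _ => ((∫⁻ y in π ⁻¹' {b}, f y ∂μ) / μ (π ⁻¹' {b})) ^ 2)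
          (hπ (measurableSet_singleton b)) (fun x hx => by
      have : π x = b := hx
      simp only [fiberAvg, this]), setLIntegral_const]
  have key : (∫⁻ y in π ⁻¹' {b}, f y ∂μ) ^ 2 ≤
      (∫⁻ y in π ⁻¹' {b}, f y ^ 2 ∂μ) * μ (π ⁻¹' {b}) := by
    have h := ENNReal.lintegral_mul_le_Lp_mul_Lq (μ.restrict (π ⁻¹' {b}))
      Real.HolderConjugate.two_two (g := fun _ => 1) hf.aemeasurable
      aemeasurable_const
    simp only [Pi.mul_apply, mul_one, ENNReal.one_rpow, lintegral_const, one_mul,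
      Measure.restrict_apply MeasurableSet.univ, Set.univ_inter] at h
    calc _ ≤ ((∫⁻ y in π ⁻¹' {b}, f y ^ (2 : ℝ) ∂μ) ^ (1 / (2 : ℝ)) *
            μ (π ⁻¹' {b}) ^ (1 / (2 : ℝ))) ^ 2 := by gcongr
      _ = _ := by
        rw [mul_pow, ← rpow_natCast, ← rpow_natCast, ← rpow_mul,
          ← rpow_mul]
        norm_num
  by_cases h0 : μ (π ⁻¹' {b}) = 0
  · rw [h0]; simp
  · rw [div_eq_mul_inv, mul_pow]
    calc _ ≤ (∫⁻ y in π ⁻¹' {b}, f y ^ 2 ∂μ) * μ (π ⁻¹' {b}) * (μ (π ⁻¹' {b}))⁻¹ ^ 2 *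
            μ (π ⁻¹' {b}) := by gcongr
      _ = (∫⁻ y in π ⁻¹' {b}, f y ^ 2 ∂μ) * (μ (π ⁻¹' {b}) * (μ (π ⁻¹' {b}))⁻¹) *
            (μ (π ⁻¹' {b}) * (μ (π ⁻¹' {b}))⁻¹) := by ring
      _ = _ := by rw [ENNReal.mul_inv_cancel h0 (hfin b)]; simp

/-- The maximum of the averages of `f` over the pieces containing `x` of the first `N + 1`
partitions. -/
def maxAvg (μ : Measure X) (π : ℕ → X → β) (f : X → ℝ≥0∞) : ℕ → X → ℝ≥0∞
  | 0 => fiberAvg μ (π 0) f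
  | N + 1 => fun x => max (maxAvg μ π f N x) (fiberAvg μ (π (N + 1)) f x)

theorem measurable_fiberAvg [Countable β] [MeasurableSpace β]
    [MeasurableSingletonClass β] {π : X → β} (hπ : Measurable π) (f : X → ℝ≥0∞) :
    Measurable (fiberAvg μ π f) :=
  (measurable_of_countable
    (fun b => (∫⁻ y in π ⁻¹' {b}, f y ∂μ) / μ (π ⁻¹' {b}))).comp hπ

theorem measurable_maxAvg [Countable β] [MeasurableSpace β]
    [MeasurableSingletonClass β] {π : ℕ → X → β} (hπ : ∀ k, Measurable (π k)) (f : X → ℝ≥0∞) (N) :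
    Measurable (maxAvg μ π f N) := by
  induction N with
  | zero => exact measurable_fiberAvg (hπ 0) f
  | succ N ih => exact ih.max (measurable_fiberAvg (hπ _) f)

theorem maxAvg_congr_fiber {π : ℕ → X → β}
    (hnest : ∀ k x y, π (k + 1) x = π (k + 1) y → π k x = π k y) (f : X → ℝ≥0∞) (N : ℕ) :
    ∀ x y, π N x = π N y → maxAvg μ π f N x = maxAvg μ π f N y := by
  induction N with
  | zero => exact fun x y h => fiberAvg_congr _ _ h
  | succ N ih =>
    intro x y h
    simp only [maxAvg]
    rw [ih x y (hnest N x y h), fiberAvg_congr _ _ h]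

/-- The telescoping form of Doob's inequality: in each step the square of the maximum increases
by at most `2 A d`, where `A` is the new average and `d` the increment of the maximum, and `A` may
be replaced by `f` under the integral. -/
theorem lintegral_maxAvg_sq_le [Countable β] [MeasurableSpace β]
    [MeasurableSingletonClass β] {π : ℕ → X → β} (hπ : ∀ k, Measurable (π k))
    (hnest : ∀ k x y, π (k + 1) x = π (k + 1) y → π k x = π k y)
    (hfin : ∀ k b, μ (π k ⁻¹' {b}) ≠ ⊤) {f : X → ℝ≥0∞} (hf : Measurable f) (N : ℕ) :
    ∫⁻ x, maxAvg μ π f N x ^ 2 ∂μ ≤ 2 * ∫⁻ x, f x * maxAvg μ π f N x ∂μ := by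
  have fact : ∀ k (G : X → ℝ≥0∞), (∀ x y, π k x = π k y → G x = G y) →
      ∫⁻ x, fiberAvg μ (π k) f x * G x ∂μ = ∫⁻ x, f x * G x ∂μ := by
    intro k G hG
    have h := lintegral_fiberAvg_mul (hπ k) (hfin k) hf (Function.extend (π k) G 0)
    have hx x : Function.extend (π k) G 0 (π k x) = G x :=
      Function.FactorsThrough.extend_apply (fun a b hab => hG a b hab) _ x
    grind
  induction N with
  | zero =>
    simp only [maxAvg, pow_two]
    rw [fact 0 (fiberAvg μ (π 0) f) (fun x y h => fiberAvg_congr _ _ h), two_mul]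
    simp
  | succ N ih =>
    set M := maxAvg μ π f N
    set A := fiberAvg μ (π (N + 1)) f
    have hM : Measurable M := measurable_maxAvg hπ f N
    have hA : Measurable A := measurable_fiberAvg (hπ _) f
    have hmax x : max (M x) (A x) = M x + (A x - M x) := by
      rw [add_tsub_eq_max]
    have hstep x : max (M x) (A x) ^ 2 ≤ M x ^ 2 + 2 * (A x * (A x - M x)) := by
      rcases le_total (A x) (M x) with h | h
      · rw [max_eq_left h]; simp
      · have h1 := add_tsub_cancel_of_le h
        rw [max_eq_right h]
        calc _ = M x * A x + A x * (A x - M x) := by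
              conv_lhs => rw [pow_two]
              nth_rewrite 1 [← h1]
              ring
          _ = M x * (M x + (A x - M x)) + A x * (A x - M x) := by rw [h1]
          _ = M x ^ 2 + (M x * (A x - M x) + A x * (A x - M x)) := by ring
          _ ≤ M x ^ 2 + (A x * (A x - M x) + A x * (A x - M x)) := by gcongr
          _ = _ := by ring
    have hd := fact (N + 1) (fun x => A x - M x) (fun x y h => by
      simp only [A, M]
      rw [fiberAvg_congr _ _ h, maxAvg_congr_fiber hnest f N x y (hnest N x y h)])
    calc _ ≤ ∫⁻ x, M x ^ 2 + 2 * (A x * (A x - M x)) ∂μ := lintegral_mono hstep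
      _ = _ := by
          rw [lintegral_add_left (hM.pow_const 2), lintegral_const_mul _ (show Measurable fun x => A x * (A x - M x) from
            hA.mul (hA.sub hM)), hd]
      _ ≤ 2 * ∫⁻ x, f x * M x ∂μ + 2 * ∫⁻ x, f x * (A x - M x) ∂μ := by gcongr
      _ = _ := by
          rw [← mul_add, ← lintegral_add_left (show Measurable fun x => f x * M x from hf.mul hM)]
          congr 1
          refine lintegral_congr fun x => ?_
          rw [← mul_add, ← hmax]
          rfl

/-- The maximal function of the sequence of partitions into the fibres of `π k`. -/
def maxFun (μ : Measure X) (π : ℕ → X → β) (f : X → ℝ≥0∞) (x : X) : ℝ≥0∞ :=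
  ⨆ k, fiberAvg μ (π k) f x

theorem maxFun_eq_iSup_maxAvg (π : ℕ → X → β) (f : X → ℝ≥0∞) (x : X) :
    maxFun μ π f x = ⨆ N, maxAvg μ π f N x := by
  apply le_antisymm
  · refine iSup_le fun k => le_iSup_of_le k ?_
    cases k with
    | zero => exact le_rfl
    | succ k => exact le_max_right _ _
  · refine iSup_le fun N => ?_
    induction N with
    | zero => exact le_iSup (fun k => fiberAvg μ (π k) f x) 0
    | succ N ih => exact max_le ih (le_iSup (fun k => fiberAvg μ (π k) f x) (N + 1))

/-- The `L²` bound for the maximal function of a nested sequence of partitions. -/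
theorem lintegral_maxFun_sq_le [Countable β] [MeasurableSpace β]
    [MeasurableSingletonClass β] {π : ℕ → X → β} (hπ : ∀ k, Measurable (π k))
    (hnest : ∀ k x y, π (k + 1) x = π (k + 1) y → π k x = π k y)
    (hfin : ∀ k b, μ (π k ⁻¹' {b}) ≠ ⊤) {f : X → ℝ≥0∞} (hf : Measurable f) :
    ∫⁻ x, maxFun μ π f x ^ 2 ∂μ ≤ 4 * ∫⁻ x, f x ^ 2 ∂μ := by
  have hmono x : Monotone fun N => maxAvg μ π f N x :=
    monotone_nat_of_le_succ fun N => le_max_left _ _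
  have h1 x : maxFun μ π f x ^ 2 = ⨆ N, maxAvg μ π f N x ^ 2 := by
    rw [maxFun_eq_iSup_maxAvg]
    exact Monotone.map_iSup_of_continuousAt
      (ENNReal.continuous_pow 2).continuousAt (fun a b h => by dsimp only; gcongr) (by simp)
  simp_rw [h1]
  rw [lintegral_iSup (fun N => (measurable_maxAvg hπ f N).pow_const 2)
    (fun a b hab x => by dsimp only; gcongr; exact hmono x hab)]
  refine iSup_le fun N => ?_
  by_cases hI : ∫⁻ x, f x ^ 2 ∂μ = ⊤
  · rw [hI]; simp
  have hMfin : ∫⁻ x, maxAvg μ π f N x ^ 2 ∂μ ≠ ⊤ := by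
    induction N with
    | zero => exact ne_top_of_le_ne_top hI (lintegral_fiberAvg_sq_le (hπ 0) (hfin 0) hf)
    | succ N ih =>
      refine ne_top_of_le_ne_top (ENNReal.add_ne_top.mpr ⟨ih, ne_top_of_le_ne_top hI
        (lintegral_fiberAvg_sq_le (hπ (N + 1)) (hfin (N + 1)) hf)⟩) ?_
      rw [← lintegral_add_left ((measurable_maxAvg hπ f N).pow_const 2)]
      refine lintegral_mono fun x => ?_
      simp only [maxAvg]
      rcases le_total (maxAvg μ π f N x) (fiberAvg μ (π (N + 1)) f x) with h | h
      · rw [max_eq_right h]; simp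
      · rw [max_eq_left h]; simp
  have h2 := lintegral_maxAvg_sq_le hπ hnest hfin hf N
  have h3 (a b : ℝ≥0∞) : 4 * (a * b) ≤ 4 * a ^ 2 + b ^ 2 := by
    rcases eq_or_ne a ⊤ with rfl | ha
    · simp
    rcases eq_or_ne b ⊤ with rfl | hb
    · simp
    lift a to NNReal using ha
    lift b to NNReal using hb
    norm_cast
    rw [← NNReal.coe_le_coe]
    push_cast
    nlinarith [sq_nonneg (2 * (a : ℝ) - b)]
  have h4 : 2 * ∫⁻ x, maxAvg μ π f N x ^ 2 ∂μ ≤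
      4 * ∫⁻ x, f x ^ 2 ∂μ + ∫⁻ x, maxAvg μ π f N x ^ 2 ∂μ := by
    calc _ ≤ 2 * (2 * ∫⁻ x, f x * maxAvg μ π f N x ∂μ) := by gcongr
      _ = ∫⁻ x, 4 * (f x * maxAvg μ π f N x) ∂μ := by
          rw [lintegral_const_mul _ (show Measurable fun x => f x * maxAvg μ π f N x from
            hf.mul (measurable_maxAvg hπ f N)), ← mul_assoc]
          norm_num
      _ ≤ _ := lintegral_mono fun x => h3 _ _
      _ = _ := by
          rw [lintegral_add_left ((hf.pow_const 2).const_mul 4),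
            lintegral_const_mul _ (hf.pow_const 2)]
  rw [two_mul] at h4
  exact (ENNReal.add_le_add_iff_right hMfin).mp h4

end Maximal

end

section

/-! ### Interpolation of derivatives on an interval -/

/-- `v k` is the `k`-th derivative of `v 0`, for every `k`. -/
def IsJet (v : ℕ → ℝ → ℝ) : Prop := ∀ k τ, HasDerivAt (v k) (v (k + 1) τ) τ

theorem IsJet.continuous (hv : IsJet v) (k) : Continuous (v k) :=
  continuous_iff_continuousAt.mpr fun τ => (hv k τ).continuousAt

theorem IsJet.abs_sub_le (hv : IsJet v) (k)
    (hx : x ∈ Icc (0 : ℝ) 1) (hy : y ∈ Icc (0 : ℝ) 1) :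
    |v k x - v k y| ≤ ∫ τ in (0 : ℝ)..1, |v (k + 1) τ| := by
  rw [← integral_eq_sub_of_hasDerivAt (a := y) (b := x) (fun τ _ => hv k τ) ((hv.continuous (k + 1)).intervalIntegrable _ _), ← norm_eq_abs]
  refine (intervalIntegral.norm_integral_le_integral_norm_uIoc).trans ?_
  rw [integral_of_le zero_le_one]
  refine setIntegral_mono_set ?_ (ae_of_all _ fun τ => norm_nonneg _) ?_
  · exact ((hv.continuous (k + 1)).abs.integrableOn_Icc).mono_set
      Set.Ioc_subset_Icc_self
  · refine LE.le.eventuallyLE (show _ ≤ _ from fun τ hτ => ?_)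
    rcases hτ with ⟨h1, h2⟩
    exact ⟨lt_of_le_of_lt (le_min hy.1 hx.1) h1, h2.trans (max_le hy.2 hx.2)⟩

/-- Integrating `v k` against a fixed bump function moves all the derivatives to the bump
function; hence `v k` is controlled by `v 0` and `v (k + 1)`. -/
theorem interp_unit_top (k : ℕ) : ∃ C, 0 < C ∧ ∀ v, IsJet v →
    ∀ x ∈ Icc (0 : ℝ) 1, |v k x| ≤
      C * ((∫ τ in (0 : ℝ)..1, |v 0 τ|) + ∫ τ in (0 : ℝ)..1, |v (k + 1) τ|) := by
  let f : ContDiffBump (1 / 2 : ℝ) := ⟨1 / 8, 1 / 4, by norm_num, by norm_num⟩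
  set η := f.normed volume
  have hηs : Smooth η := f.contDiff_normed
  have hjet : IsJet fun j => iteratedDeriv j η := by
    intro j τ
    change HasDerivAt (iteratedDeriv j η) (iteratedDeriv (j + 1) η τ) τ
    rw [iteratedDeriv_succ]
    exact ((hηs.differentiable_iteratedDeriv j (by exact_mod_cast ENat.natCast_lt_top j)) τ).hasDerivAt
  have htsupp : tsupport η = closedBall (1 / 2) (1 / 4) := f.tsupport_normed_eq
  have hzero j : ∀ x, x ∉ closedBall (1 / 2) (1 / 4) → iteratedDeriv j η x = 0 := by
    intro x hx
    rw [← htsupp] at hx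
    rw [(notMem_tsupport_iff_eventuallyEq.mp hx).iteratedDeriv_eq]
    cases j <;> simp
  have h0 := fun j => hzero j 0 (by
    rw [Real.closedBall_eq_Icc]; norm_num)
  have h1 := fun j => hzero j 1 (by
    rw [Real.closedBall_eq_Icc]; norm_num)
  have hint : ∫ τ in 0..1, η τ = 1 := by
    rw [integral_of_le zero_le_one, setIntegral_eq_integral_of_forall_compl_eq_zero,
      f.integral_normed]
    intro x hx
    have := hzero 0 x (by
      rw [Real.closedBall_eq_Icc]
      intro h
      exact hx ⟨by linarith [h.1], by linarith [h.2]⟩)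
    simpa using this
  obtain ⟨B, hB⟩ : ∃ B, ∀ x ∈ Icc 0 1, |iteratedDeriv k η x| ≤ B := by
    obtain ⟨B, hB⟩ := (isCompact_Icc).exists_bound_of_continuousOn
      (hjet.continuous k).continuousOn
    exact ⟨B, hB⟩
  have hB0 := (abs_nonneg _).trans (hB 0 (by simp))
  refine ⟨B + 1, by positivity, fun v hv x hx => ?_⟩
  have hII (g : ℝ → ℝ) : Continuous g → IntervalIntegrable g volume 0 1 := fun hg => hg.intervalIntegrable _ _
  have hparts : ∀ i j, ∫ τ in 0..1, iteratedDeriv j η τ * v i τ =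
      (-1) ^ i * ∫ τ in 0..1, iteratedDeriv (j + i) η τ * v 0 τ := by
    intro i
    induction i with
    | zero => intro j; simp
    | succ i ih =>
      intro j
      rw [intervalIntegral.integral_mul_deriv_eq_deriv_mul (u := iteratedDeriv j η) (u' := iteratedDeriv (j + 1) η) (v' := v (i + 1)) (fun τ _ => hjet j τ) (fun τ _ => hv i τ) (hII _ (hjet.continuous (j + 1))) (hII _ (hv.continuous (i + 1))), h0, h1, ih (j + 1), pow_succ, show j + 1 + i = j + (i + 1) by ring]
      ring
  set V := ∫ τ in 0..1, |v (k + 1) τ|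
  set W := ∫ τ in 0..1, |v 0 τ|
  have hV0 : 0 ≤ V := intervalIntegral.integral_nonneg zero_le_one fun _ _ => abs_nonneg _
  have hW0 : 0 ≤ W := intervalIntegral.integral_nonneg zero_le_one fun _ _ => abs_nonneg _
  have hmean : |∫ τ in 0..1, η τ * v k τ| ≤ B * W := by
    have := hparts k 0
    simp only [iteratedDeriv_zero, zero_add] at this
    rw [this, abs_mul, abs_pow, abs_neg, abs_one, one_pow, one_mul, ← norm_eq_abs,
      ← intervalIntegral.integral_const_mul]
    refine intervalIntegral.norm_integral_le_of_norm_le zero_le_one ?_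
      (hII _ ((hv.continuous 0).abs.const_mul B))
    refine ae_of_all _ fun τ hτ => ?_
    rw [norm_mul, norm_eq_abs, norm_eq_abs]
    gcongr
    exact hB τ ⟨hτ.1.le, hτ.2⟩
  have hosc : |v k x - ∫ τ in 0..1, η τ * v k τ| ≤ V := by
    have e : v k x - ∫ τ in 0..1, η τ * v k τ =
        ∫ τ in 0..1, η τ * (v k x - v k τ) := by
      simp_rw [mul_sub]
      rw [intervalIntegral.integral_sub (f := fun τ => η τ * v k x) (g := fun τ => η τ * v k τ)
        (hII _ (hηs.continuous.mul continuous_const))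
        (hII _ (hηs.continuous.mul (hv.continuous k))), intervalIntegral.integral_mul_const, hint,
        one_mul]
    rw [e, ← norm_eq_abs]
    have h : V = ∫ τ in 0..1, η τ * V := by
      rw [intervalIntegral.integral_mul_const, hint, one_mul]
    rw [h]
    refine intervalIntegral.norm_integral_le_of_norm_le zero_le_one ?_
      (hII _ (hηs.continuous.mul continuous_const))
    refine ae_of_all _ fun τ hτ => ?_
    rw [norm_mul, norm_eq_abs, norm_eq_abs, abs_of_nonneg (f.nonneg_normed τ)]
    exact mul_le_mul_of_nonneg_left (hv.abs_sub_le k hx ⟨hτ.1.le, hτ.2⟩) (f.nonneg_normed τ)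
  calc _ ≤ |v k x - ∫ τ in 0..1, η τ * v k τ| +
        |∫ τ in 0..1, η τ * v k τ| := by
          simpa using abs_add_le (v k x - ∫ τ in 0..1, η τ * v k τ) (∫ τ in 0..1, η τ * v k τ)
    _ ≤ _ := add_le_add hosc hmean
    _ ≤ _ := by nlinarith

theorem interp_unit {k n : ℕ} (hkn : k < n) : ∃ C, 0 < C ∧ ∀ v, IsJet v →
    ∀ x ∈ Icc (0 : ℝ) 1, |v k x| ≤
      C * ((∫ τ in (0 : ℝ)..1, |v 0 τ|) + ∫ τ in (0 : ℝ)..1, |v n τ|) := by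
  induction n, hkn using Nat.le_induction with
  | base => exact interp_unit_top k
  | succ n hn ih =>
    obtain ⟨C₁, hC₁, h₁⟩ := ih
    obtain ⟨C₂, hC₂, h₂⟩ := interp_unit_top n
    refine ⟨C₁ * (1 + C₂), by positivity, fun v hv x hx => ?_⟩
    have hW0 : 0 ≤ ∫ τ in 0..1, |v 0 τ| :=
      intervalIntegral.integral_nonneg zero_le_one fun _ _ => abs_nonneg _
    have hV0 : 0 ≤ ∫ τ in 0..1, |v (n + 1) τ| :=
      intervalIntegral.integral_nonneg zero_le_one fun _ _ => abs_nonneg _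
    have h3 : ∫ τ in 0..1, |v n τ| ≤
        C₂ * ((∫ τ in 0..1, |v 0 τ|) + ∫ τ in 0..1, |v (n + 1) τ|) := by
      simpa using integral_mono_on zero_le_one (μ := volume) ((hv.continuous n).abs.intervalIntegrable _ _) (continuous_const.intervalIntegrable _ _) (fun τ hτ => h₂ v hv τ hτ)
    refine (h₁ v hv x hx).trans ?_
    rw [mul_assoc]
    refine mul_le_mul_of_nonneg_left ?_ hC₁.le
    nlinarith

/-- Interpolation on an interval of length `L`, with averages in place of integrals. -/
theorem interp_interval {k n : ℕ} (hkn : k < n) : ∃ C, 0 < C ∧ ∀ v, IsJet v →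
    ∀ (l L : ℝ), 0 < L → ∀ x ∈ Icc l (l + L), L ^ k * |v k x| ≤
      C * (L⁻¹ * (∫ τ in l..(l + L), |v 0 τ|) + L ^ n * (L⁻¹ * ∫ τ in l..(l + L), |v n τ|)) := by
  obtain ⟨C, hC, h⟩ := interp_unit hkn
  refine ⟨C, hC, fun v hv l L hL x hx => ?_⟩
  have hw : IsJet fun j τ => L ^ j * v j (L * τ + l) := by
    intro j τ
    have h1 : HasDerivAt (fun τ => L * τ + l) L τ := by
      simpa using ((hasDerivAt_id τ).const_mul L).add_const l
    refine (((hv j (L * τ + l)).comp τ h1).const_mul (L ^ j)).congr_deriv ?_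
    dsimp only
    rw [pow_succ]; ring
  have hx' : (x - l) / L ∈ Icc 0 1 := by
    constructor
    · exact div_nonneg (by linarith [hx.1]) hL.le
    · rw [div_le_one hL]; linarith [hx.2]
  have hres := h _ hw _ hx'
  have e1 : L * ((x - l) / L) + l = x := by field_simp; ring
  have e2 j : ∫ τ in 0..1, |L ^ j * v j (L * τ + l)| =
      L ^ j * (L⁻¹ * ∫ τ in l..(l + L), |v j τ|) := by
    simp_rw [abs_mul, abs_of_pos (pow_pos hL j)]
    rw [intervalIntegral.integral_const_mul]
    rw [intervalIntegral.integral_comp_mul_add (a := 0) (b := 1) (fun τ => |v j τ|) hL.ne' l]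
    simp [add_comm]
  rw [e1, e2 0, e2 n, abs_mul, abs_of_pos (pow_pos hL k), pow_zero, one_mul] at hres
  exact hres

end

section

/-! ### Dyadic partitions of a line and the one-directional interpolation inequality -/

/-- A dyadic partition of the set `J ⊆ ℝ`: the points of `J` lie in dyadic intervals of length
`2^{-q}` relative to the origin `base`, where the generation `q` is constant on each of these
intervals. With `q = 0` these are the unit intervals; a variable `q` describes Whitney intervals,
whose length is comparable with the distance to the ends of `J`. -/
structure LinePart (J : Set ℝ) where
  /-- the origin of the dyadic intervals -/
  base : ℝ
  /-- the generation of the interval that contains a given point -/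
  q : ℝ → ℕ
  meas_q : Measurable q
  piece : ∀ τ ∈ J, ∀ τ' ∈ Ioo (base + ⌊(2 : ℝ) ^ q τ * (τ - base)⌋ / 2 ^ q τ)
    (base + (⌊(2 : ℝ) ^ q τ * (τ - base)⌋ + 1) / 2 ^ q τ), τ' ∈ J ∧ q τ' = q τ

namespace LinePart

variable {J : Set ℝ} (P : LinePart J)

/-- The label of the interval of the `k`-th subdivision that contains `τ`. -/
def proj (k : ℕ) (τ : ℝ) : ℕ × ℤ := (P.q τ, ⌊(2 : ℝ) ^ (k + P.q τ) * (τ - P.base)⌋)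

/-- The left end of the interval of the `k`-th subdivision that contains `τ`. -/
def left (k : ℕ) (τ : ℝ) : ℝ :=
  P.base + ⌊(2 : ℝ) ^ (k + P.q τ) * (τ - P.base)⌋ / 2 ^ (k + P.q τ)

/-- The length of the interval of the `k`-th subdivision that contains `τ`. -/
def len (k : ℕ) (τ : ℝ) : ℝ := ((2 : ℝ) ^ (k + P.q τ))⁻¹

theorem len_pos (k) (τ) : 0 < P.len k τ := by unfold len; positivity

theorem measurable_proj (k : ℕ) : Measurable (P.proj k) := by
  exact P.meas_q.prodMk (Int.measurable_floor.comp (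
      ((measurable_of_countable fun j : ℕ => (2 : ℝ) ^ (k + j)).comp P.meas_q).mul (measurable_id.sub_const _)))

theorem proj_nested (k) (x y) (h : P.proj (k + 1) x = P.proj (k + 1) y) :
    P.proj k x = P.proj k y := by
  simp only [proj, Prod.mk.injEq] at h ⊢
  obtain ⟨hq, hf⟩ := h
  refine ⟨hq, ?_⟩
  rw [hq] at hf ⊢
  have key : ∀ (a : ℝ) (m : ℤ), m ≤ ⌊(2 : ℝ) ^ (k + P.q y) * a⌋ ↔
      2 * m ≤ ⌊(2 : ℝ) ^ (k + 1 + P.q y) * a⌋ := by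
    intro a m
    rw [Int.le_floor, Int.le_floor]
    push_cast
    rw [show (2 : ℝ) ^ (k + 1 + P.q y) * a = 2 * ((2 : ℝ) ^ (k + P.q y) * a) by ring]
    constructor <;> intro h <;> linarith
  apply le_antisymm
  · rw [key, ← hf, ← key]
  · rw [key, hf, ← key]

theorem mem_Ico (k) (τ) : τ ∈ Ico (P.left k τ) (P.left k τ + P.len k τ) := by
  have hp : (0 : ℝ) < 2 ^ (k + P.q τ) := by positivity
  have h1 := Int.floor_le ((2 : ℝ) ^ (k + P.q τ) * (τ - P.base))
  have h2 := Int.lt_floor_add_one ((2 : ℝ) ^ (k + P.q τ) * (τ - P.base))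
  unfold left len
  constructor
  · have : (⌊(2 : ℝ) ^ (k + P.q τ) * (τ - P.base)⌋ : ℝ) / 2 ^ (k + P.q τ) ≤ τ - P.base := by
      rw [div_le_iff₀ hp]; linarith
    linarith
  · have : τ - P.base <
        ((⌊(2 : ℝ) ^ (k + P.q τ) * (τ - P.base)⌋ : ℝ) + 1) / 2 ^ (k + P.q τ) := by
      rw [lt_div_iff₀ hp]; linarith
    rw [add_div, one_div] at this
    linarith

theorem proj_fiber_subset (k) (τ) :
    P.proj k ⁻¹' {P.proj k τ} ⊆ Ico (P.left k τ) (P.left k τ + P.len k τ) := by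
  intro τ' h
  simp only [proj, Set.mem_preimage, Set.mem_singleton_iff, Prod.mk.injEq] at h
  have := P.mem_Ico k τ'
  unfold left len at this ⊢
  rw [h.2, h.1] at this
  exact this

theorem Ioo_subset (k) (hτ : τ ∈ J) :
    Ioo (P.left k τ) (P.left k τ + P.len k τ) ⊆ P.proj k ⁻¹' {P.proj k τ} ∩ J := by
  intro τ' h
  have hq0 : (0 : ℝ) < 2 ^ P.q τ := by positivity
  have hk0 : (0 : ℝ) < 2 ^ k := by positivity
  have hp : (0 : ℝ) < 2 ^ (k + P.q τ) := by positivity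
  set x := τ - P.base
  have hfl := Int.floor_le ((2 : ℝ) ^ P.q τ * x)
  have hfl' := Int.lt_floor_add_one ((2 : ℝ) ^ P.q τ * x)
  have e : (2 : ℝ) ^ (k + P.q τ) * x = 2 ^ k * ((2 : ℝ) ^ P.q τ * x) := by ring
  have h1 : (2 : ℤ) ^ k * ⌊(2 : ℝ) ^ P.q τ * x⌋ ≤ ⌊(2 : ℝ) ^ (k + P.q τ) * x⌋ := by
    rw [Int.le_floor, e]; push_cast; gcongr
  have h2 : ⌊(2 : ℝ) ^ (k + P.q τ) * x⌋ + 1 ≤ (2 : ℤ) ^ k * (⌊(2 : ℝ) ^ P.q τ * x⌋ + 1) := by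
    rw [Int.add_one_le_iff, Int.floor_lt, e]; push_cast; gcongr
  have h1' : (2 : ℝ) ^ k * ⌊(2 : ℝ) ^ P.q τ * x⌋ ≤ ⌊(2 : ℝ) ^ (k + P.q τ) * x⌋ := by
    exact_mod_cast h1
  have h2' : (⌊(2 : ℝ) ^ (k + P.q τ) * x⌋ : ℝ) + 1 ≤ 2 ^ k * (⌊(2 : ℝ) ^ P.q τ * x⌋ + 1) := by
    exact_mod_cast h2
  unfold left len at h
  have hl : (⌊(2 : ℝ) ^ P.q τ * x⌋ : ℝ) / 2 ^ P.q τ ≤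
      ⌊(2 : ℝ) ^ (k + P.q τ) * x⌋ / 2 ^ (k + P.q τ) := by
    rw [div_le_div_iff₀ hq0 hp]
    calc _ = (2 ^ k * (⌊(2 : ℝ) ^ P.q τ * x⌋ : ℝ)) * 2 ^ P.q τ := by rw [pow_add]; ring
      _ ≤ _ := by gcongr
  have hr : ((⌊(2 : ℝ) ^ (k + P.q τ) * x⌋ : ℝ) + 1) / 2 ^ (k + P.q τ) ≤
      ((⌊(2 : ℝ) ^ P.q τ * x⌋ : ℝ) + 1) / 2 ^ P.q τ := by
    rw [div_le_div_iff₀ hp hq0]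
    calc _ ≤ (2 ^ k * ((⌊(2 : ℝ) ^ P.q τ * x⌋ : ℝ) + 1)) * 2 ^ P.q τ := by gcongr
      _ = _ := by rw [pow_add]; ring
  have hr' := hr
  rw [add_div (_ : ℝ) 1 (2 ^ (k + P.q τ)), one_div] at hr'
  obtain ⟨hJ, hq⟩ := P.piece τ hτ τ' ⟨by linarith [h.1], by linarith [h.2]⟩
  refine ⟨?_, hJ⟩
  simp only [proj, Set.mem_preimage, Set.mem_singleton_iff, Prod.mk.injEq]
  refine ⟨hq, ?_⟩
  rw [hq, Int.floor_eq_iff]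
  have ha : (⌊(2 : ℝ) ^ (k + P.q τ) * x⌋ : ℝ) / 2 ^ (k + P.q τ) < τ' - P.base := by
    linarith [h.1]
  have hb : τ' - P.base < ((⌊(2 : ℝ) ^ (k + P.q τ) * x⌋ : ℝ) + 1) / 2 ^ (k + P.q τ) := by
    rw [add_div, one_div]; linarith [h.2]
  rw [div_lt_iff₀ hp] at ha
  rw [lt_div_iff₀ hp] at hb
  constructor <;> linarith

theorem q_eq_of_mem_Ioo (k) (hτ : τ ∈ J)
    (h : τ' ∈ Ioo (P.left k τ) (P.left k τ + P.len k τ)) : τ' ∈ J ∧ P.q τ' = P.q τ := by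
  have := P.Ioo_subset k hτ h
  refine ⟨this.2, ?_⟩
  have h1 := this.1
  simp only [proj, Set.mem_preimage, Set.mem_singleton_iff, Prod.mk.injEq] at h1
  exact h1.1

theorem fiber_finite (k : ℕ) (b : ℕ × ℤ) :
    (volume.restrict J) (P.proj k ⁻¹' {b}) ≠ ⊤ := by
  by_cases h : (P.proj k ⁻¹' {b}).Nonempty
  · obtain ⟨τ, hτ⟩ := h
    rw [hτ.symm]
    refine ne_top_of_le_ne_top ?_ (Measure.restrict_apply_le _ _)
    refine ne_top_of_le_ne_top ?_ (measure_mono (P.proj_fiber_subset k τ))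
    simp
  · rw [Set.not_nonempty_iff_eq_empty.mp h]; simp

theorem fiberAvg_eq (k) (hτ : τ ∈ J) (f) :
    fiberAvg (volume.restrict J) (P.proj k) f τ =
      (ofReal (P.len k τ))⁻¹ *
        ∫⁻ x in Ioo (P.left k τ) (P.left k τ + P.len k τ), f x := by
  have hm : MeasurableSet (P.proj k ⁻¹' {P.proj k τ}) :=
    P.measurable_proj k (measurableSet_singleton _)
  have hae : (P.proj k ⁻¹' {P.proj k τ} ∩ J : Set ℝ) =ᵐ[volume]
      Ioo (P.left k τ) (P.left k τ + P.len k τ) := by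
    refine Filter.EventuallyLE.antisymm ?_ (LE.le.eventuallyLE (P.Ioo_subset k hτ))
    refine (LE.le.eventuallyLE (show P.proj k ⁻¹' {P.proj k τ} ∩ J ≤ _ from
      Set.inter_subset_left.trans (P.proj_fiber_subset k τ))).trans ?_
    exact Ioo_ae_eq_Ico.symm.le
  unfold fiberAvg
  rw [Measure.restrict_restrict hm, Measure.restrict_congr_set hae, Measure.restrict_apply hm,
    measure_congr hae, Real.volume_Ioo, div_eq_mul_inv, mul_comm]
  congr 3
  ring

end LinePart

/-- The maximal function in the coordinate `i`. -/
def lineMax (i : Fin d) (P : LinePart J) (F : (Fin d → ℝ) → ℝ≥0∞)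
    (z : Fin d → ℝ) : ℝ≥0∞ :=
  maxFun (volume.restrict J) P.proj (fun τ => F (update z i τ)) (z i)

theorem measurable_update_pair (i) :
    Measurable fun p : (Fin d → ℝ) × ℝ => update p.1 i p.2 := by
  refine measurable_pi_lambda _ fun j => ?_
  by_cases h : j = i
  · subst h; simpa using measurable_snd
  · simp only [Function.update_of_ne h]
    exact (measurable_pi_apply j).comp measurable_fst

theorem measurable_lineMax (i : Fin d) (P : LinePart J)
    (hF : Measurable F) : Measurable (lineMax i P F) := by
  refine Measurable.iSup fun k => ?_
  have hmeas (z : Fin d → ℝ) : MeasurableSet (P.proj k ⁻¹' {P.proj k (z i)}) :=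
    P.measurable_proj k (measurableSet_singleton _)
  refine Measurable.div ?_ ?_
  · simp_rw [← lintegral_indicator (hmeas _)]
    refine Measurable.lintegral_prod_right' (f := fun p : (Fin d → ℝ) × ℝ =>
      (P.proj k ⁻¹' {P.proj k (p.1 i)}).indicator (fun τ => F (update p.1 i τ)) p.2) ?_
    exact (hF.comp (measurable_update_pair i)).indicator
        (measurableSet_eq_fun ((P.measurable_proj k).comp measurable_snd) ((P.measurable_proj k).comp ((measurable_pi_apply i).comp measurable_fst)))
  · exact (measurable_of_countable fun b => (volume.restrict J) (P.proj k ⁻¹' {b})).comp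
      ((P.measurable_proj k).comp (measurable_pi_apply i))

theorem lintegral_lineMax_sq_le {S : Fin d → Set ℝ} (i) (P : LinePart (S i))
    (hF : Measurable F) :
    ∫⁻ z in univ.pi S, lineMax i P F z ^ 2 ≤ 4 * ∫⁻ z in univ.pi S, F z ^ 2 := by
  rw [volume_pi, Measure.restrict_pi_pi, ← lintegral_const_mul _ (hF.pow_const 2)]
  refine lintegral_le_of_lmarginal_le {i} ((measurable_lineMax i P hF).pow_const 2)
    ((hF.pow_const 2).const_mul 4) fun x => ?_
  rw [lmarginal_singleton, lmarginal_singleton]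
  dsimp only
  have hm : Measurable fun τ => F (update x i τ) :=
    hF.comp ((measurable_update_pair i).comp measurable_prodMk_left)
  rw [lintegral_const_mul _ (hm.pow_const 2)]
  simpa only [lineMax, Function.update_idem, Function.update_self] using
      lintegral_maxFun_sq_le (μ := volume.restrict (S i)) P.measurable_proj P.proj_nested P.fiber_finite hm

theorem fiberAvg_rpow_le (P : LinePart J) (k) (hτ : τ ∈ J)
    {f : ℝ → ℝ≥0∞} (hf : Measurable f) {θ : ℝ} (h0 : 0 ≤ θ) (h1 : θ ≤ 1) :
    fiberAvg (volume.restrict J) (P.proj k) (fun x => f x ^ θ) τ ≤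
      fiberAvg (volume.restrict J) (P.proj k) f τ ^ θ := by
  rw [P.fiberAvg_eq k hτ, P.fiberAvg_eq k hτ]
  have hL : ofReal (P.len k τ) ≠ 0 := by simpa using P.len_pos k τ
  have h := ENNReal.lintegral_mul_norm_pow_le
    (μ := volume.restrict (Ioo (P.left k τ) (P.left k τ + P.len k τ)))
    (f := f) (g := fun _ => 1) hf.aemeasurable aemeasurable_const h0 (sub_nonneg.mpr h1) (by ring)
  simp only [ENNReal.one_rpow, mul_one, lintegral_const, one_mul,
    Measure.restrict_apply MeasurableSet.univ, Set.univ_inter, Real.volume_Ioo] at h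
  rw [show P.left k τ + P.len k τ - P.left k τ = P.len k τ by ring] at h
  rw [ENNReal.mul_rpow_of_nonneg _ _ h0]
  calc _ ≤ _ := mul_le_mul_right h _
    _ = _ := by
      rw [ENNReal.rpow_sub _ _ hL ofReal_ne_top, ENNReal.rpow_one, ENNReal.inv_rpow,
        mul_comm (_ ^ θ) (_ / _), ← mul_assoc, div_eq_mul_inv, ← mul_assoc,
        ENNReal.inv_mul_cancel hL ofReal_ne_top, one_mul]

end

section

theorem exists_two_pow_near {t : ℝ≥0∞} (h1 : 1 ≤ t) (h2 : t ≠ ⊤) :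
    ∃ p, 2 ^ p ≤ t ∧ t ≤ 2 ^ (p + 1) := by
  lift t to NNReal using h2
  obtain ⟨p, hp1, hp2⟩ := exists_nat_pow_near (x := t) (y := 2)
    (by exact_mod_cast h1) (by norm_num)
  exact ⟨p, by exact_mod_cast hp1, by exact_mod_cast hp2.le⟩

/-- Optimisation over the dyadic scales `2^{-p}`: with `t = y^{1/n}` one takes `2^p ≈ t`, or
`p = 0` if `t ≤ 1`. -/
theorem optimize_dyadic (C₁ C : NNReal) {n b J k : ℕ} (hn : b + J = n) (hk : 1 ≤ k) (hkJ : k < J)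
    {Q y a B : ℝ≥0∞}
    (hQ : ∀ p, Q ≤ C₁ * (2 ^ (p * k) * a + (2 ^ (p * (J - k)))⁻¹ * B))
    (ha : a ≤ C * y ^ ((b : ℝ) / n)) (hay : a ≤ y) (hB : B ≤ y) :
    Q ≤ ((C₁ * (2 + C + 2 ^ J) + 1 : NNReal) : ℝ≥0∞) * y ^ (((b + k : ℕ) : ℝ) / n) := by
  have hn0 : (n : ℝ) ≠ 0 := by
    have : 0 < n := by omega
    positivity
  set t := y ^ ((1 : ℝ) / n)
  have hpow (c : ℕ) : y ^ ((c : ℝ) / n) = t ^ c := by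
    rw [← rpow_natCast, ← rpow_mul]
    congr 1
    field_simp
  have hy : y = t ^ n := by
    rw [← hpow, div_self hn0, ENNReal.rpow_one]
  rw [hpow] at ha ⊢
  rw [hy] at hay hB
  clear_value t
  subst hy
  rcases eq_or_ne t ⊤ with rfl | ht
  · rw [ENNReal.top_pow (by omega), mul_top]
    · exact le_top
    · simp
  rcases le_total t 1 with h1 | h1
  · have h := hQ 0
    simp only [zero_mul, pow_zero, inv_one, one_mul] at h
    calc Q ≤ C₁ * (t ^ n + t ^ n) := h.trans (by gcongr)
      _ = C₁ * 2 * t ^ n := by ring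
      _ ≤ C₁ * 2 * t ^ (b + k) := by
          gcongr 1
          exact pow_le_pow_right_of_le_one' h1 (by omega)
      _ ≤ _ := by
          gcongr
          push_cast
          calc (C₁ : ℝ≥0∞) * 2 ≤ C₁ * (2 + C + 2 ^ J) := by
                gcongr
                rw [add_assoc]
                exact le_self_add
            _ ≤ _ := le_self_add
  · obtain ⟨p, hp1, hp2⟩ := exists_two_pow_near h1 ht
    have e1 : 2 ^ (p * k) * a ≤ C * t ^ (b + k) := by
      calc _ ≤ (2 ^ p) ^ k * (C * t ^ b) := by
            rw [pow_mul]; gcongr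
        _ ≤ t ^ k * (C * t ^ b) := by gcongr
        _ = _ := by ring
    have e2 : (2 ^ (p * (J - k)))⁻¹ * B ≤ 2 ^ J * t ^ (b + k) := by
      calc _ ≤ (2 ^ (p * (J - k)))⁻¹ * (t ^ (J - k) * t ^ (b + k)) := by
            gcongr
            rw [← pow_add]
            refine hB.trans (le_of_eq ?_)
            congr 1
            omega
        _ ≤ (2 ^ (p * (J - k)))⁻¹ * ((2 ^ (p + 1)) ^ (J - k) * t ^ (b + k)) := by gcongr
        _ = ((2 ^ (p * (J - k)))⁻¹ * 2 ^ (p * (J - k))) * (2 ^ (J - k) * t ^ (b + k)) := by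
            rw [← pow_mul, add_mul, pow_add, one_mul]; ring
        _ = _ := by rw [ENNReal.inv_mul_cancel (by positivity) (by finiteness), one_mul]
        _ ≤ _ := by
            gcongr
            · norm_num
            · omega
    calc Q ≤ C₁ * (C * t ^ (b + k) + 2 ^ J * t ^ (b + k)) := (hQ p).trans (by gcongr)
      _ = C₁ * (C + 2 ^ J) * t ^ (b + k) := by ring
      _ ≤ _ := by
          gcongr
          push_cast
          calc (C₁ : ℝ≥0∞) * (C + 2 ^ J) ≤ C₁ * (2 + C + 2 ^ J) := by
                gcongr
                exact le_add_self
            _ ≤ _ := le_self_add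

theorem ofReal_intervalIntegral_abs {f : ℝ → ℝ} (hf : Continuous f) (hL : 0 < L) :
    ofReal (∫ τ in l..(l + L), |f τ|) = ∫⁻ τ in Ioo l (l + L), ‖f τ‖ₑ := by
  rw [integral_of_le (by linarith), integral_Ioc_eq_integral_Ioo,
    ofReal_integral_eq_lintegral_ofReal]
  · refine lintegral_congr fun τ => ?_
    rw [← norm_eq_abs, ofReal_norm]
  · exact (hf.abs.integrableOn_Icc).mono_set Set.Ioo_subset_Icc_self
  · exact ae_of_all _ fun τ => abs_nonneg _

/-- A positive function `s` on `J` is comparable with the length of the pieces of `P`. -/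
def LinePart.Comparable (P : LinePart J) (s : ℝ → ℝ) (κ : ℝ) : Prop :=
  ∀ τ ∈ J, 0 ≤ s τ ∧ s τ ≤ κ * ((2 : ℝ) ^ P.q τ)⁻¹ ∧ ((2 : ℝ) ^ P.q τ)⁻¹ ≤ κ * s τ

/-- The interpolation inequality on the pieces of the `p`-th subdivision, with derivatives scaled
by the comparable weight `s`. -/
theorem interp_piece {k n : ℕ} (hkn : k < n) (κ : ℝ) (hκ : 0 < κ) : ∃ C : NNReal,
    ∀ (J : Set ℝ) (P : LinePart J) (s : ℝ → ℝ), P.Comparable s κ →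
    ∀ v, IsJet v → ∀ τ ∈ J, ∀ p,
      ofReal (s τ) ^ k * ‖v k τ‖ₑ ≤ C * (2 ^ (p * k) *
        fiberAvg (volume.restrict J) (P.proj p) (fun x => ‖v 0 x‖ₑ) τ +
        (2 ^ (p * (n - k)))⁻¹ * fiberAvg (volume.restrict J) (P.proj p)
          (fun x => ofReal (s x) ^ n * ‖v n x‖ₑ) τ) := by
  obtain ⟨C, hC, h⟩ := interp_interval hkn
  refine ⟨Real.toNNReal (C * κ ^ k * (1 + κ ^ n)), fun J P s hs v hv τ hτ p => ?_⟩
  set L := P.len p τ with hL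
  set l := P.left p τ
  have hL0 := P.len_pos p τ
  have h1 := h v hv l L hL0 τ (Set.Ico_subset_Icc_self (P.mem_Ico p τ))
  have hq : 0 < 2 ^ P.q τ := by positivity
  have hLe : L = (2 ^ p)⁻¹ * (2 ^ P.q τ)⁻¹ := by rw [hL, LinePart.len, pow_add, mul_inv]
  have hI j : 0 ≤ ∫ x in l..(l + L), |v j x| :=
    intervalIntegral.integral_nonneg (by linarith) fun _ _ => abs_nonneg _
  -- multiply the interpolation inequality by `(s / L)^k ≤ κ^k 2^{pk}`
  have hsL : s τ ≤ κ * 2 ^ p * L := by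
    rw [hLe]
    calc _ ≤ _ := (hs τ hτ).2.1
      _ = _ := by field_simp
  have h2 : s τ ^ k * |v k τ| ≤ C * κ ^ k * ((2 ^ p) ^ k * (L⁻¹ * ∫ x in l..(l + L), |v 0 x|) +
      (2 ^ p) ^ k * L ^ n * (L⁻¹ * ∫ x in l..(l + L), |v n x|)) := by
    calc _ ≤ (κ * 2 ^ p * L) ^ k * |v k τ| := by
          gcongr
          exact (hs τ hτ).1
      _ = (κ * 2 ^ p) ^ k * (L ^ k * |v k τ|) := by ring
      _ ≤ (κ * 2 ^ p) ^ k * (C * (L⁻¹ * (∫ x in l..(l + L), |v 0 x|) +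
            L ^ n * (L⁻¹ * ∫ x in l..(l + L), |v n x|))) := by gcongr
      _ = _ := by ring
  have hLn : (2 ^ p) ^ k * L ^ n = (2 ^ (p * (n - k)))⁻¹ * ((2 ^ P.q τ)⁻¹) ^ n := by
    rw [hLe, mul_pow, ← mul_assoc]
    congr 1
    obtain ⟨m, rfl⟩ := Nat.exists_eq_add_of_lt hkn
    rw [show k + m + 1 - k = m + 1 by omega, add_assoc, pow_add, inv_pow, inv_pow, pow_mul]
    field_simp
  have hA0 : ofReal (L⁻¹ * ∫ x in l..(l + L), |v 0 x|) =
      fiberAvg (volume.restrict J) (P.proj p) (fun x => ‖v 0 x‖ₑ) τ := by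
    rw [P.fiberAvg_eq p hτ, ofReal_mul (by positivity), ENNReal.ofReal_inv_of_pos hL0,
      ofReal_intervalIntegral_abs (hv.continuous 0) hL0]
  have hAn : ofReal (((2 ^ P.q τ)⁻¹) ^ n * (L⁻¹ * ∫ x in l..(l + L), |v n x|)) ≤
      ofReal (κ ^ n) * fiberAvg (volume.restrict J) (P.proj p)
        (fun x => ofReal (s x) ^ n * ‖v n x‖ₑ) τ := by
    rw [P.fiberAvg_eq p hτ, ofReal_mul (by positivity),
      ofReal_mul (by positivity), ENNReal.ofReal_inv_of_pos hL0,
      ofReal_intervalIntegral_abs (hv.continuous n) hL0, mul_left_comm,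
      mul_left_comm (ofReal (κ ^ n))]
    refine mul_le_mul_right ?_ _
    rw [← lintegral_const_mul' _ _ ofReal_ne_top,
      ← lintegral_const_mul' _ _ ofReal_ne_top]
    refine setLIntegral_mono' measurableSet_Ioo fun x hx => ?_
    obtain ⟨hxJ, hxq⟩ := P.q_eq_of_mem_Ioo p hτ hx
    have := (hs x hxJ).2.2
    rw [hxq] at this
    rw [← mul_assoc, ← ofReal_pow (hs x hxJ).1, ← ofReal_mul (by positivity),
      ← mul_pow]
    gcongr
  have hC' : ((Real.toNNReal (C * κ ^ k * (1 + κ ^ n)) : NNReal) : ℝ≥0∞) =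
      ofReal (C * κ ^ k) * (1 + ofReal (κ ^ n)) := by
    change ofReal _ = _
    rw [ofReal_mul (by positivity), ofReal_add zero_le_one (by positivity),
      ofReal_one]
  calc _ = _ := by
        rw [ofReal_mul (pow_nonneg (hs τ hτ).1 k), ofReal_pow (hs τ hτ).1,
          ← norm_eq_abs, ofReal_norm]
    _ ≤ _ := ofReal_le_ofReal h2
    _ = ofReal (C * κ ^ k) * (2 ^ (p * k) *
          ofReal (L⁻¹ * ∫ x in l..(l + L), |v 0 x|) + (2 ^ (p * (n - k)))⁻¹ *
          ofReal (((2 ^ P.q τ)⁻¹) ^ n * (L⁻¹ * ∫ x in l..(l + L), |v n x|))) := by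
        have h01 := hI 0
        have h02 := hI n
        rw [hLn, ofReal_mul (by positivity), ofReal_add (by positivity)
          (by positivity), ofReal_mul (by positivity), mul_assoc ((2 ^ (p * (n - k)))⁻¹),
          ofReal_mul (p := (2 ^ (p * (n - k)))⁻¹) (by positivity),
          ENNReal.ofReal_inv_of_pos (by positivity), ← pow_mul,
          ofReal_pow (by positivity), ofReal_pow (by positivity)]
        norm_num
    _ ≤ ofReal (C * κ ^ k) * (2 ^ (p * k) *
          fiberAvg (volume.restrict J) (P.proj p) (fun x => ‖v 0 x‖ₑ) τ + (2 ^ (p * (n - k)))⁻¹ *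
          (ofReal (κ ^ n) * fiberAvg (volume.restrict J) (P.proj p)
            (fun x => ofReal (s x) ^ n * ‖v n x‖ₑ) τ)) := by
        rw [hA0]; gcongr
    _ ≤ _ := by
        rw [hC', mul_assoc]
        refine mul_le_mul_right ?_ _
        rw [mul_add]
        refine add_le_add (le_mul_of_one_le_left' le_self_add) ?_
        rw [mul_left_comm]
        exact mul_le_mul_left le_add_self _

end

section

theorem fiberAvg_mono_of_piece (P : LinePart J) (p) (hτ : τ ∈ J)
    {f g : ℝ → ℝ≥0∞} (h : ∀ x ∈ J, f x ≤ g x) :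
    fiberAvg (volume.restrict J) (P.proj p) f τ ≤
      fiberAvg (volume.restrict J) (P.proj p) g τ := by
  rw [P.fiberAvg_eq p hτ, P.fiberAvg_eq p hτ]
  refine mul_le_mul_right (setLIntegral_mono' measurableSet_Ioo fun x hx => ?_) _
  exact h x (P.q_eq_of_mem_Ioo p hτ hx).1

theorem fiberAvg_const_mul (P : LinePart J) (p) (hτ : τ ∈ J)
    {f : ℝ → ℝ≥0∞} (hf : Measurable f) (c) :
    fiberAvg (volume.restrict J) (P.proj p) (fun x => c * f x) τ =
      c * fiberAvg (volume.restrict J) (P.proj p) f τ := by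
  rw [P.fiberAvg_eq p hτ, P.fiberAvg_eq p hτ, lintegral_const_mul _ hf, mul_left_comm]

/-- The interpolation step in one coordinate direction. A function `V 0` which is bounded by
`F^{b/n}`, and whose scaled `J`-th derivative has the weight `b + J = n` and is bounded by `F`,
has intermediate derivatives bounded by powers of `F` plus its maximal function, with exponents
proportional to the weight. -/
theorem line_step {n b J k : ℕ} (hn : b + J = n) (hk : 1 ≤ k) (hkJ : k < J) (κ) (hκ : 0 < κ)
    (C : NNReal) : ∃ C' : NNReal, ∀ {d : ℕ} (S : Fin d → Set ℝ) (i : Fin d)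
    (P : LinePart (S i)) (s : ℝ → ℝ), Measurable s → P.Comparable s κ →
    ∀ (V : ℕ → Fn d), (∀ z, IsJet fun k τ => V k (update z i τ)) →
    ∀ (ρ : (Fin d → ℝ) → ℝ≥0∞), (∀ z τ, ρ (update z i τ) = ρ z) →
    ∀ (F : (Fin d → ℝ) → ℝ≥0∞), Measurable F →
    (∀ z ∈ univ.pi S, ρ z * ‖V 0 z‖ₑ ≤ C * F z ^ ((b : ℝ) / n)) →
    (∀ z ∈ univ.pi S, ρ z * ‖V 0 z‖ₑ ≤ F z) →
    (∀ z ∈ univ.pi S, ρ z * (ofReal (s (z i)) ^ J * ‖V J z‖ₑ) ≤ F z) →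
    ∀ z ∈ univ.pi S, ρ z * (ofReal (s (z i)) ^ k * ‖V k z‖ₑ) ≤
      C' * (F z + lineMax i P F z) ^ (((b + k : ℕ) : ℝ) / n) := by
  obtain ⟨C₁, h₁⟩ := interp_piece hkJ κ hκ
  refine ⟨C₁ * (2 + C + 2 ^ J) + 1, fun {d} S i P s hsm hs V hV ρ hρ F hF hbase hdom htop z hz => ?_⟩
  have hτ := hz i (Set.mem_univ i)
  have hup : ∀ x ∈ S i, update z i x ∈ univ.pi S := by
    intro x hx j _
    by_cases h : j = i
    · subst h; simpa using hx
    · simpa [Function.update_of_ne h] using hz j (Set.mem_univ j)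
  have hFz : Measurable fun x => F (update z i x) :=
    hF.comp ((measurable_update_pair i).comp measurable_prodMk_left)
  have hVm j : Measurable fun x => ‖V j (update z i x)‖ₑ :=
    ((hV z).continuous j).measurable.enorm
  set a := ⨆ p, fiberAvg (volume.restrict (S i)) (P.proj p)
    (fun x => ρ z * ‖V 0 (update z i x)‖ₑ) (z i)
  set B := ⨆ p, fiberAvg (volume.restrict (S i)) (P.proj p)
    (fun x => ρ z * (ofReal (s x) ^ J * ‖V J (update z i x)‖ₑ)) (z i)
  have hθ1 : (b : ℝ) / n ≤ 1 := by
    apply div_le_one_of_le₀ _ (by positivity)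
    exact_mod_cast (by omega)
  refine optimize_dyadic C₁ C hn hk hkJ (a := a) (B := B) (fun p => ?_) ?_ ?_ ?_
  · have h := h₁ (S i) P s hs _ (hV z) (z i) hτ p
    simp only [Function.update_eq_self] at h
    calc _ ≤ ρ z * _ := mul_le_mul_right h _
      _ = C₁ * (2 ^ (p * k) * fiberAvg (volume.restrict (S i)) (P.proj p)
            (fun x => ρ z * ‖V 0 (update z i x)‖ₑ) (z i) + (2 ^ (p * (J - k)))⁻¹ *
            fiberAvg (volume.restrict (S i)) (P.proj p)
            (fun x => ρ z * (ofReal (s x) ^ J * ‖V J (update z i x)‖ₑ))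
              (z i)) := by
          rw [fiberAvg_const_mul P p hτ (hVm 0), fiberAvg_const_mul P p hτ
            (f := fun x => ofReal (s x) ^ J * ‖V J (update z i x)‖ₑ)
            ((hsm.ennreal_ofReal.pow_const J).mul (hVm J))]
          ring
      _ ≤ _ := by
          gcongr
          · exact le_iSup (fun p => fiberAvg (volume.restrict (S i)) (P.proj p)
              (fun x => ρ z * ‖V 0 (update z i x)‖ₑ) (z i)) p
          · exact le_iSup (fun p => fiberAvg (volume.restrict (S i)) (P.proj p)
              (fun x => ρ z * (ofReal (s x) ^ J * ‖V J (update z i x)‖ₑ))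
                (z i)) p
  · refine iSup_le fun p => ?_
    calc _ ≤ fiberAvg (volume.restrict (S i)) (P.proj p)
          (fun x => C * F (update z i x) ^ ((b : ℝ) / n)) (z i) := by
          refine fiberAvg_mono_of_piece P p hτ fun x hx => ?_
          have := hbase _ (hup x hx)
          rwa [hρ] at this
      _ = C * fiberAvg (volume.restrict (S i)) (P.proj p)
          (fun x => F (update z i x) ^ ((b : ℝ) / n)) (z i) :=
          fiberAvg_const_mul P p hτ (hFz.pow_const _) _
      _ ≤ C * fiberAvg (volume.restrict (S i)) (P.proj p)
          (fun x => F (update z i x)) (z i) ^ ((b : ℝ) / n) := by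
          gcongr
          exact fiberAvg_rpow_le P p hτ hFz (by positivity) hθ1
      _ ≤ _ := by
          gcongr
          exact (le_iSup (fun p => fiberAvg (volume.restrict (S i)) (P.proj p)
            (fun x => F (update z i x)) (z i)) p).trans le_add_self
  · refine le_trans (iSup_mono fun p => ?_) le_add_self
    refine fiberAvg_mono_of_piece P p hτ fun x hx => ?_
    have := hdom _ (hup x hx)
    rwa [hρ] at this
  · refine le_trans (iSup_mono fun p => ?_) le_add_self
    refine fiberAvg_mono_of_piece P p hτ fun x hx => ?_
    have := htop _ (hup x hx)
    rwa [hρ, Function.update_self] at this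

/-! ### Classical partial derivatives of smooth functions -/

theorem smooth_pd (hf : Smooth f) (i) :
    Smooth (pd i f) :=
  (hf.fderiv_right (by simp)).clm_apply contDiff_const

theorem smooth_pd_iterate (hf : Smooth f) (i)
    (k) : Smooth ((pd i)^[k] f) := by
  induction k with
  | zero => exact hf
  | succ k ih => rw [iterate_succ_apply']; exact smooth_pd ih i

theorem pd_comm (hf : Smooth f) (i j) :
    pd i (pd j f) = pd j (pd i f) := by
  have key : ∀ (v w) z,
      fderiv ℝ (fun y => fderiv ℝ f y v) z w = fderiv ℝ (fderiv ℝ f) z w v := by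
    intro v w z
    rw [fderiv_clm_apply (((hf.fderiv_right (m := ∞) (by simp)).differentiable (by simp)) z) (differentiableAt_const v)]
    simp
  funext z
  change fderiv ℝ (fun y => fderiv ℝ f y (single j 1)) z (single i 1) =
    fderiv ℝ (fun y => fderiv ℝ f y (single i 1)) z (single j 1)
  rw [key, key]
  exact (hf.contDiffAt.isSymmSndFDerivAt (by
    simpa using (WithTop.coe_le_coe.mpr le_top : (2 : WithTop ℕ∞) ≤ ((⊤ : ℕ∞) : WithTop ℕ∞)))) _ _

theorem pd_iterate_comm (hf : Smooth f) (i j)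
    (k) : pd i ((pd j)^[k] f) = (pd j)^[k] (pd i f) := by
  induction k with
  | zero => rfl
  | succ k ih =>
    rw [iterate_succ_apply', iterate_succ_apply',
      pd_comm (smooth_pd_iterate hf j k), ih]

theorem smooth_pdFold (hf : Smooth f) (α : Fin d → ℕ)
    (l : List (Fin d)) : Smooth (l.foldr (fun i f => (pd i)^[α i] f) f) := by
  induction l with
  | nil => exact hf
  | cons i l ih => exact smooth_pd_iterate ih i _

theorem pd_pdFold_comm (hf : Smooth f) (α : Fin d → ℕ)
    (i) (l : List (Fin d)) :
    pd i (l.foldr (fun i f => (pd i)^[α i] f) f) =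
      l.foldr (fun i f => (pd i)^[α i] f) (pd i f) := by
  induction l with
  | nil => rfl
  | cons j l ih =>
    simp only [List.foldr_cons]
    rw [pd_iterate_comm (smooth_pdFold hf α l), ih]

theorem smooth_pdMulti (hf : Smooth f) (α : Fin d → ℕ) :
    Smooth (pdMulti α f) := smooth_pdFold hf α _

theorem pd_pdMulti_comm (hf : Smooth f) (α)
    (i) : pd i (pdMulti α f) = pdMulti α (pd i f) := pd_pdFold_comm hf α i _

theorem pdMulti_succ (hf : Smooth f) (α)
    (i) : pdMulti (α + single i 1) f = pd i (pdMulti α f) := by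
  have key (l : List (Fin d)) : l.Nodup →
      l.foldr (fun j f => (pd j)^[(α + single i 1 : Fin d → ℕ) j] f) f =
        if i ∈ l then pd i (l.foldr (fun j f => (pd j)^[α j] f) f)
        else l.foldr (fun j f => (pd j)^[α j] f) f := by
    intro hl
    induction l with
    | nil => simp
    | cons j l ih =>
      rw [List.nodup_cons] at hl
      rw [List.foldr_cons, ih hl.2, List.foldr_cons]
      by_cases hij : i = j
      · subst hij
        rw [if_neg hl.1, if_pos (by simp)]
        simp [iterate_succ_apply']
      · have h0 : (α + single i 1 : Fin d → ℕ) j = α j := by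
          simp [Pi.single_eq_of_ne (Ne.symm hij)]
        rw [h0]
        by_cases hi : i ∈ l
        · rw [if_pos hi, if_pos (by simp [hi]), pd_iterate_comm (smooth_pdFold hf α l)]
        · rw [if_neg hi, if_neg (by simp [hi, hij])]
  have := key (List.finRange d) (List.nodup_finRange d)
  rwa [if_pos (List.mem_finRange i)] at this

@[simp] theorem pdMulti_zero {d : ℕ} (f : Fn d) : pdMulti 0 f = f := by
  have : ∀ l : List (Fin d), l.foldr (fun i f => (pd i)^[(0 : Fin d → ℕ) i] f) f = f := by
    intro l
    induction l with
    | nil => rfl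
    | cons i l ih => rw [List.foldr_cons, ih]; rfl
  exact this _

theorem pdMulti_single (hf : Smooth f) (i) :
    pdMulti (single i 1) f = pd i f := by
  have := pdMulti_succ hf 0 i
  rwa [zero_add, pdMulti_zero] at this

theorem hasDerivAt_line (hf : Smooth f) (i)
    (z) (τ) :
    HasDerivAt (fun τ => f (update z i τ)) (pd i f (update z i τ)) τ := by
  exact ((hf.differentiable (by simp) (update z i τ)).hasFDerivAt).comp_hasDerivAt τ (hasDerivAt_update z i τ)

theorem isJet_line (hf : Smooth f) (α : Fin d → ℕ)
    (i) (z) :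
    IsJet fun k τ => pdMulti (α + single i k) f (update z i τ) := by
  intro k τ
  have := hasDerivAt_line (smooth_pdMulti hf (α + single i k)) i z τ
  rwa [← pdMulti_succ hf, add_assoc, ← Pi.single_add] at this

end

section

/-! ### Uniform and Whitney partitions -/

/-- The partition of `J` into the unit intervals with end points in `a + ℤ`. -/
def uniformPart (J : Set ℝ) (a : ℝ)
    (h : ∀ τ ∈ J, Ioo (a + ⌊τ - a⌋) (a + ⌊τ - a⌋ + 1) ⊆ J) : LinePart J where
  base := a
  q := fun _ => 0
  meas_q := measurable_const
  piece := by
    intro τ hτ τ' hτ'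
    refine ⟨h τ hτ ?_, rfl⟩
    simpa [add_assoc] using hτ'

theorem comparable_uniform (J : Set ℝ) (a : ℝ)
    (h : ∀ τ ∈ J, Ioo (a + ⌊τ - a⌋) (a + ⌊τ - a⌋ + 1) ⊆ J) :
    (uniformPart J a h).Comparable (fun _ => 1) 1 := by
  intro τ _
  simp [uniformPart]

/-- The generation of the Whitney interval of `(0, 1)` that contains `τ`: the Whitney intervals
are `[2^{-q}, 2^{1-q})` and `[1 - 2^{1-q}, 1 - 2^{-q})`, `q ≥ 2`. -/
def whitneyGen (τ : ℝ) : ℕ :=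
  if τ < 1 / 2 then Nat.clog 2 ⌈τ⁻¹⌉₊ else Nat.log 2 ⌊(1 - τ)⁻¹⌋₊ + 1

theorem measurable_whitneyGen : Measurable whitneyGen := by
  refine Measurable.ite (measurableSet_Iio) ?_ ?_
  · exact (measurable_of_countable (Nat.clog 2)).comp (Nat.measurable_ceil.comp measurable_inv)
  · exact (measurable_of_countable fun n => Nat.log 2 n + 1).comp
      (Nat.measurable_floor.comp ((measurable_const.sub measurable_id).inv))

theorem whitneyGen_left_iff (h0 : 0 < τ) (h1 : τ < 1 / 2) (p) :
    whitneyGen τ = p ↔ 1 ≤ 2 ^ p * τ ∧ (2 : ℝ) ^ p * τ < 2 := by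
  have hc x : whitneyGen τ ≤ x ↔ 1 ≤ 2 ^ x * τ := by
    rw [whitneyGen, if_pos h1, Nat.clog_le_iff_le_pow (by norm_num), Nat.ceil_le]
    push_cast
    rw [inv_le_iff_one_le_mul₀ h0]
  constructor
  · rintro rfl
    refine ⟨(hc _).mp le_rfl, ?_⟩
    by_contra! hcon
    rcases hq : whitneyGen τ with _ | r
    · rw [hq] at hcon; norm_num at hcon; linarith
    · rw [hq, pow_succ] at hcon
      have := (hc r).mpr (by linarith)
      omega
  · rintro ⟨ha, hb⟩
    refine le_antisymm ((hc p).mpr ha) ?_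
    by_contra! hcon
    have h3 := (hc (whitneyGen τ)).mp le_rfl
    obtain ⟨r, rfl⟩ : ∃ r, p = r + 1 := ⟨p - 1, by omega⟩
    have : (2 : ℝ) ^ whitneyGen τ ≤ 2 ^ r := pow_le_pow_right₀ (by norm_num) (by omega)
    rw [pow_succ] at hb
    have : 2 ^ whitneyGen τ * τ ≤ 2 ^ r * τ := by gcongr
    linarith

theorem whitneyGen_right_iff (h0 : 1 / 2 ≤ τ) (h1 : τ < 1) (p) :
    whitneyGen τ = p ↔ 1 < 2 ^ p * (1 - τ) ∧ (2 : ℝ) ^ p * (1 - τ) ≤ 2 := by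
  have ht : 0 < 1 - τ := by linarith
  have hne : ⌊(1 - τ)⁻¹⌋₊ ≠ 0 := by
    have : 1 ≤ ⌊(1 - τ)⁻¹⌋₊ := Nat.le_floor (by
      push_cast; exact (one_le_inv₀ ht).mpr (by linarith))
    omega
  have hc x : x + 1 ≤ whitneyGen τ ↔ 2 ^ x * (1 - τ) ≤ 1 := by
    rw [whitneyGen, if_neg (by linarith), Nat.add_le_add_iff_right,
      Nat.le_log_iff_pow_le (by norm_num) hne, Nat.le_floor_iff (by positivity)]
    push_cast
    rw [le_inv_comm₀ (by positivity) ht, ← one_div, le_div_iff₀ (by positivity), mul_comm]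
  have hpos : 1 ≤ whitneyGen τ := by rw [whitneyGen, if_neg (by linarith)]; omega
  constructor
  · rintro rfl
    constructor
    · by_contra! hcon
      have := (hc _).mpr hcon
      omega
    · obtain ⟨r, hr⟩ : ∃ r, whitneyGen τ = r + 1 := ⟨whitneyGen τ - 1, by omega⟩
      have := (hc r).mp hr.ge
      rw [hr, pow_succ]; linarith
  · rintro ⟨ha, hb⟩
    refine le_antisymm ?_ ?_
    · by_contra! hcon
      have := (hc p).mp hcon
      linarith
    · rcases p with _ | r
      · omega
      · refine (hc r).mpr ?_
        rw [pow_succ] at hb; linarith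

theorem two_le_whitneyGen {τ : ℝ} (h0 : 0 < τ) (h1 : τ < 1) : 4 ≤ (2 : ℝ) ^ whitneyGen τ := by
  have h2 : 2 ≤ whitneyGen τ := by
    by_contra! hcon
    have h3 : whitneyGen τ = 0 ∨ whitneyGen τ = 1 := by omega
    rcases lt_or_ge τ (1 / 2) with h | h
    · rcases h3 with h3 | h3 <;> have := (whitneyGen_left_iff h0 h _).mp h3 <;>
        norm_num at this <;> linarith
    · rcases h3 with h3 | h3 <;> have := (whitneyGen_right_iff h h1 _).mp h3 <;>
        norm_num at this <;> linarith
  calc (4 : ℝ) = 2 ^ 2 := by norm_num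
    _ ≤ _ := pow_le_pow_right₀ (by norm_num) h2

/-- The partition of `(0, 1)` into Whitney intervals. -/
def whitneyPart : LinePart (Ioo 0 1) where
  base := 0
  q := whitneyGen
  meas_q := measurable_whitneyGen
  piece := by
    rintro τ ⟨h0, h1⟩ τ' ⟨ha, hb⟩
    have h4 := two_le_whitneyGen h0 h1
    set Q := (2 : ℝ) ^ whitneyGen τ with hQ
    have hQ0 : 0 < Q := by positivity
    simp only [sub_zero, zero_add] at ha hb
    rcases lt_or_ge τ (1 / 2) with h | h
    · have hq := (whitneyGen_left_iff h0 h _).mp rfl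
      rw [← hQ] at hq
      have hfl : ⌊Q * τ⌋ = 1 := by
        rw [Int.floor_eq_iff]; push_cast; constructor <;> linarith
      rw [hfl] at ha hb
      push_cast at ha hb
      rw [div_lt_iff₀ hQ0] at ha
      rw [lt_div_iff₀ hQ0] at hb
      have p0 : 0 < τ' := by nlinarith
      have p1 : τ' < 1 / 2 := by nlinarith
      refine ⟨⟨p0, by linarith⟩, ?_⟩
      rw [whitneyGen_left_iff p0 p1, ← hQ]
      constructor <;> linarith
    · have hq := (whitneyGen_right_iff h h1 _).mp rfl
      rw [← hQ] at hq
      have hfl : (⌊Q * τ⌋ : ℝ) = Q - 2 := by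
        have : ⌊Q * τ⌋ = (2 : ℤ) ^ whitneyGen τ - 2 := by
          rw [Int.floor_eq_iff]; push_cast; rw [← hQ]; constructor <;> linarith
        rw [this]; push_cast; rw [hQ]
      rw [hfl] at ha hb
      rw [div_lt_iff₀ hQ0] at ha
      rw [lt_div_iff₀ hQ0] at hb
      have p1 : τ' < 1 := by nlinarith
      have p0 : 1 / 2 ≤ τ' := by nlinarith
      refine ⟨⟨by linarith, p1⟩, ?_⟩
      rw [whitneyGen_right_iff p0 p1, ← hQ]
      constructor <;> linarith

theorem comparable_whitney (hκ : 0 < κ)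
    (h : ∀ τ ∈ Ioo (0 : ℝ) 1, s τ ≤ κ * min τ (1 - τ) ∧ min τ (1 - τ) ≤ κ * s τ) :
    whitneyPart.Comparable s (2 * κ) := by
  rintro τ ⟨h0, h1⟩
  have h2 := h τ ⟨h0, h1⟩
  have hQ0 : (0 : ℝ) < 2 ^ whitneyGen τ := by positivity
  have hmin : 0 < min τ (1 - τ) := lt_min h0 (by linarith)
  have hq : (2 ^ whitneyGen τ)⁻¹ ≤ min τ (1 - τ) ∧
      min τ (1 - τ) ≤ 2 * (2 ^ whitneyGen τ)⁻¹ := by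
    rw [inv_le_iff_one_le_mul₀ hQ0, ← div_eq_mul_inv, le_div_iff₀ hQ0]
    rcases lt_or_ge τ (1 / 2) with h | h
    · have hq := (whitneyGen_left_iff h0 h _).mp rfl
      rw [min_eq_left (by linarith)]
      constructor <;> linarith
    · have hq := (whitneyGen_right_iff h h1 _).mp rfl
      rw [min_eq_right (by linarith)]
      constructor <;> linarith
  have hs : 0 < s τ := by
    by_contra! hcon
    have : κ * s τ ≤ 0 := mul_nonpos_of_nonneg_of_nonpos hκ.le hcon
    linarith
  refine ⟨hs.le, ?_, ?_⟩
  · change s τ ≤ 2 * κ * (2 ^ whitneyGen τ)⁻¹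
    calc s τ ≤ κ * min τ (1 - τ) := h2.1
      _ ≤ κ * (2 * (2 ^ whitneyGen τ)⁻¹) := by gcongr; exact hq.2
      _ = _ := by ring
  · change (2 ^ whitneyGen τ)⁻¹ ≤ 2 * κ * s τ
    have : 0 ≤ κ * s τ := by positivity
    linarith [hq.1, h2.2]

/-! ### Gagliardo–Nirenberg inequalities in pointwise form -/

/-- The majorant obtained from `F` by adding the maximal functions in the directions listed in
`L`, one after the other. -/
def chainMax {S : Fin d → Set ℝ} (P : ∀ i, LinePart (S i)) :
    List (Fin d) → ((Fin d → ℝ) → ℝ≥0∞) → (Fin d → ℝ) → ℝ≥0∞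
  | [], F => F
  | i :: L, F => chainMax P L fun z => F z + lineMax i (P i) F z

section

variable {S : Fin d → Set ℝ} (P : ∀ i, LinePart (S i))

theorem measurable_chainMax (L : List (Fin d)) {F : (Fin d → ℝ) → ℝ≥0∞} (hF : Measurable F) :
    Measurable (chainMax P L F) := by
  induction L generalizing F with
  | nil => exact hF
  | cons i L ih => exact ih (hF.add (measurable_lineMax i (P i) hF))

theorem lintegral_chainMax_sq_le (L : List (Fin d)) {F : (Fin d → ℝ) → ℝ≥0∞}
    (hF : Measurable F) :
    ∫⁻ z in univ.pi S, chainMax P L F z ^ 2 ≤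
      10 ^ L.length * ∫⁻ z in univ.pi S, F z ^ 2 := by
  induction L generalizing F with
  | nil => simp [chainMax]
  | cons i L ih =>
    have hm := measurable_lineMax i (P i) hF
    refine (ih (hF.add hm)).trans ?_
    have h1 : ∫⁻ z in univ.pi S, (F z + lineMax i (P i) F z) ^ 2 ≤
        10 * ∫⁻ z in univ.pi S, F z ^ 2 := by
      calc _ ≤ ∫⁻ z in univ.pi S, (2 * F z ^ 2 + 2 * lineMax i (P i) F z ^ 2) := by
            refine lintegral_mono fun z => ?_
            have := ENNReal.rpow_add_le_mul_rpow_add_rpow (F z) (lineMax i (P i) F z)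
              (p := (2 : ℕ)) (by norm_num)
            simp only [rpow_natCast] at this
            norm_num at this
            rwa [mul_add] at this
        _ = 2 * (∫⁻ z in univ.pi S, F z ^ 2) +
              2 * (∫⁻ z in univ.pi S, lineMax i (P i) F z ^ 2) := by
            rw [lintegral_add_left ((hF.pow_const 2).const_mul 2),
              lintegral_const_mul _ (hF.pow_const 2), lintegral_const_mul _ (hm.pow_const 2)]
        _ ≤ 2 * (∫⁻ z in univ.pi S, F z ^ 2) +
              2 * (4 * ∫⁻ z in univ.pi S, F z ^ 2) := by
            gcongr; exact lintegral_lineMax_sq_le i (P i) hF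
        _ = _ := by ring
    calc _ ≤ 10 ^ L.length * (10 * ∫⁻ z in univ.pi S, F z ^ 2) :=
          mul_le_mul_right h1 _
      _ = _ := by rw [List.length_cons]; ring

/-- `line_step` for the derivatives of a smooth function, including the end points of the range of
orders. -/
theorem line_step_le (n b k : ℕ) (κ) (hκ : 0 < κ) (C : NNReal) :
    ∃ C₁ : NNReal, b + k ≤ n → ∀ {S : Fin d → Set ℝ} (i : Fin d) (P : LinePart (S i))
    (s : ℝ → ℝ), Measurable s → P.Comparable s κ →
    ∀ w, Smooth w → ∀ α₀,
    ∀ ρ : (Fin d → ℝ) → ℝ≥0∞, (∀ z τ, ρ (update z i τ) = ρ z) →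
    ∀ F, Measurable F →
    (∀ z ∈ univ.pi S, ρ z * ‖pdMulti α₀ w z‖ₑ ≤ C * F z ^ ((b : ℝ) / n)) →
    (∀ k, b + k ≤ n → ∀ z ∈ univ.pi S,
      ρ z * (ofReal (s (z i)) ^ k * ‖pdMulti (α₀ + single i k) w z‖ₑ) ≤ F z) →
    ∀ z ∈ univ.pi S,
      ρ z * (ofReal (s (z i)) ^ k * ‖pdMulti (α₀ + single i k) w z‖ₑ) ≤
        C₁ * (F z + lineMax i P F z) ^ (((b + k : ℕ) : ℝ) / n) := by
  rcases Nat.eq_zero_or_pos k with rfl | hk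
  · refine ⟨C, fun _ {S} i P s hsm hs w hw α₀ ρ hρ F hF hbase hdom z hz => ?_⟩
    simp only [Pi.single_zero, add_zero, pow_zero, one_mul]
    refine (hbase z hz).trans ?_
    gcongr
    exact le_self_add
  rcases lt_or_ge (b + k) n with hkn | hkn
  · obtain ⟨C₁, h₁⟩ := line_step (n := n) (b := b) (J := n - b) (by omega) hk
      (by omega) κ hκ C
    refine ⟨C₁, fun _ {S} i P s hsm hs w hw α₀ ρ hρ F hF hbase hdom z hz => ?_⟩
    have h0 : α₀ + single i 0 = α₀ := by simp
    have key := h₁ S i P s hsm hs (fun k => pdMulti (α₀ + single i k) w)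
      (isJet_line hw α₀ i) ρ hρ F hF
    rw [h0] at key
    refine key hbase (fun z hz => ?_) (hdom (n - b) (by omega)) z hz
    have := hdom 0 (by omega) z hz
    rwa [h0, pow_zero, one_mul] at this
  · refine ⟨1, fun hkn' {S} i P s hsm hs w hw α₀ ρ hρ F hF hbase hdom z hz => ?_⟩
    have hn0 : (n : ℝ) ≠ 0 := by
      have : 0 < n := by omega
      positivity
    rw [le_antisymm hkn' hkn, div_self hn0, ENNReal.rpow_one, ENNReal.coe_one, one_mul]
    exact (hdom k hkn' z hz).trans le_self_add

/-- Interpolation in the directions listed in `L`. The derivative in direction `i` comes with the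
factor `s i`. -/
theorem chain_interpolation (n : ℕ) (L : List (Fin d)) (hL : L.Nodup) (s : Fin d → ℝ → ℝ)
    (κ : ℝ) (hκ : 0 < κ) (b : ℕ) (hb : b ≤ n) (C : NNReal) : ∃ C' : NNReal,
    ∀ {S : Fin d → Set ℝ} (P : ∀ i, LinePart (S i)), (∀ i, Measurable (s i)) →
    (∀ i, (P i).Comparable (s i) κ) →
    ∀ w, Smooth w → ∀ α₀,
    ∀ ρ : (Fin d → ℝ) → ℝ≥0∞, (∀ i ∈ L, ∀ z τ, ρ (update z i τ) = ρ z) →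
    ∀ F, Measurable F →
    (∀ z ∈ univ.pi S, ρ z * ‖pdMulti α₀ w z‖ₑ ≤ C * F z ^ ((b : ℝ) / n)) →
    (∀ α, (∀ i, i ∉ L → α i = 0) → b + ∑ i, α i ≤ n → ∀ z ∈ univ.pi S,
      ρ z * ((∏ i, ofReal (s i (z i)) ^ α i) * ‖pdMulti (α₀ + α) w z‖ₑ) ≤ F z) →
    ∀ α, (∀ i, i ∉ L → α i = 0) → b + ∑ i, α i ≤ n → ∀ z ∈ univ.pi S,
      ρ z * ((∏ i, ofReal (s i (z i)) ^ α i) * ‖pdMulti (α₀ + α) w z‖ₑ) ≤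
        C' * chainMax P L F z ^ (((b + ∑ i, α i : ℕ) : ℝ) / n) := by
  induction L generalizing b C with
  | nil =>
    refine ⟨C, fun {S} P hsm hs w hw α₀ ρ hρ F hF hbase hdom α hα hαn z hz => ?_⟩
    have h0 : α = 0 := funext fun i => hα i (by simp)
    subst h0
    simpa [chainMax] using hbase z hz
  | cons i L ih =>
    rw [List.nodup_cons] at hL
    choose C₁ h₁ using fun k => line_step_le n b k κ hκ C
    choose C₂ h₂ using fun k : {k : ℕ // b + k ≤ n} => ih hL.2 (b + k) k.2 (C₁ k)
    have hfin : Finite {k : ℕ // b + k ≤ n} :=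
      Set.Finite.to_subtype ((Set.finite_Iic n).subset fun k (hk : b + k ≤ n) => by
        simp only [Set.mem_Iic]; omega)
    have := Fintype.ofFinite {k : ℕ // b + k ≤ n}
    refine ⟨∑ k, C₂ k,
      fun {S} P hsm hs w hw α₀ ρ hρ F hF hbase hdom α hα hαn z hz => ?_⟩
    set β := update α i 0 with hβ
    have hαβ : α = single i (α i) + β := by
      funext j
      by_cases h : j = i
      · subst h; simp [hβ]
      · simp [hβ, h]
    have hsum : ∑ j, α j = α i + ∑ j, β j := by
      conv_lhs => rw [hαβ]
      simp [sum_add_distrib]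
    have hprod : ∀ (γ : Fin d → ℕ) k (z : Fin d → ℝ),
        ∏ j, ofReal (s j (z j)) ^ (single i k + γ : Fin d → ℕ) j =
        ofReal (s i (z i)) ^ k * ∏ j, ofReal (s j (z j)) ^ γ j := by
      intro γ k z
      simp only [Pi.add_apply, pow_add, Finset.prod_mul_distrib]
      congr 1
      rw [Finset.prod_eq_single i]
      · simp
      · intro j _ hj; simp [hj]
      · simp
    have hbn : b + α i ≤ n := by omega
    have := h₂ ⟨α i, hbn⟩ P hsm hs w hw (α₀ + single i (α i))
      (fun z => ρ z * ofReal (s i (z i)) ^ α i) ?_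
      (fun z => F z + lineMax i (P i) F z) (hF.add (measurable_lineMax i (P i) hF)) ?_ ?_
      β ?_ (show b + α i + ∑ j, β j ≤ n by omega) z hz
    · have he : b + α i + ∑ j, β j = b + ∑ j, α j := by omega
      rw [he, add_assoc α₀, ← hαβ] at this
      have hp : ∏ j, ofReal (s j (z j)) ^ α j =
          ofReal (s i (z i)) ^ α i * ∏ j, ofReal (s j (z j)) ^ β j := by
        rw [← hprod, ← hαβ]
      rw [hp, mul_assoc, ← mul_assoc (ρ z)]
      exact this.trans (mul_le_mul_left (coe_le_coe.mpr
          (single_le_sum (fun _ _ => zero_le) (mem_univ _))) _)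
    · intro j hj z τ
      have : j ≠ i := fun h => hL.1 (h ▸ hj)
      rw [hρ j (List.mem_cons_of_mem _ hj), Function.update_of_ne this.symm]
    · intro z hz
      rw [mul_assoc]
      refine h₁ (α i) hbn i (P i) (s i) (hsm i) (hs i) w hw α₀ ρ (hρ i List.mem_cons_self) F hF hbase
        (fun k hk z hz => ?_) z hz
      have := hdom (single i k) ?_ (by simpa using hk) z hz
      · have h3 := hprod 0 k z
        simp only [add_zero] at h3
        rw [h3] at this
        simpa using this
      · intro j hj
        have : j ≠ i := fun h => hj (h ▸ List.mem_cons_self)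
        simp [this]
    · intro γ hγ hγn z hz
      have := hdom (single i (α i) + γ) ?_ ?_ z hz
      · rw [hprod, ← add_assoc] at this
        refine le_trans (le_of_eq ?_) (this.trans le_self_add)
        ring
      · intro j hj
        have hji : j ≠ i := fun h => hj (h ▸ List.mem_cons_self)
        simp [hji, hγ j fun h => hj (List.mem_cons_of_mem _ h)]
      · simp only [Pi.add_apply, sum_add_distrib]
        simpa [← add_assoc] using hγn
    · intro j hj
      by_cases h : j = i
      · subst h; simp [hβ]
      · rw [hβ, Function.update_of_ne h]
        exact hα j (by simp [h, hj])

end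

end

section

/-! ### Conormal scales of derivatives

A pair `p = (α, κ)` stands for the operator `s^{α_e} ∂^α ∂_e^κ`, where `s` is a function of the
coordinate `z e`. Its weight is `|α| + 2κ`, as in the anisotropic Sobolev spaces. In the isotropic
case one takes `s = 1` and `κ = 0`. -/

section


/-- The pairs of a multi-index and a number of additional derivatives. -/
abbrev Ord (d) := (Fin d → ℕ) × ℕ

/-- The weight `|α| + 2κ` of `(α, κ)`. -/
def wt (p : Ord d) : ℕ := (∑ i, p.1 i) + 2 * p.2

/-- The pairs `(α, κ)` of weight at most `n`; if `bare = false`, only those with `κ = 0`. -/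
def ords (d : ℕ) (bare : Bool) (n : ℕ) : Finset (Ord d) :=
  (multiIndices d n ×ˢ range (n + 1)).filter
    fun p => wt p ≤ n ∧ (bare = false → p.2 = 0)

theorem mem_multiIndices : α ∈ multiIndices d m ↔ ∑ i, α i ≤ m := by
  simp only [multiIndices, Finset.mem_filter, Fintype.mem_piFinset, mem_range,
    and_iff_right_iff_imp]
  intro h i
  have := single_le_sum (f := α) (fun _ _ => Nat.zero_le _) (mem_univ i)
  omega

theorem mem_ords {p : Ord d} :
    p ∈ ords d bare n ↔ wt p ≤ n ∧ (bare = false → p.2 = 0) := by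
  simp only [ords, Finset.mem_filter, Finset.mem_product, mem_multiIndices, mem_range,
    and_iff_right_iff_imp]
  intro h
  have := h.1
  unfold wt at this
  omega

theorem ords_mono (h : m ≤ n) :
    ords d bare m ⊆ ords d bare n := fun p hp => by
  rw [mem_ords] at hp ⊢; exact ⟨hp.1.trans h, hp.2⟩

/-- The derivative `∂^α ∂_e^κ f`, multiplied by the `α_e`-th power of the number `s₀`. -/
def frozenD (e : Fin d) (s₀ : ℝ) (p : Ord d) (f : Fn d) :
    Fn d :=
  fun z => s₀ ^ p.1 e * pdMulti (p.1 + single e p.2) f z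

/-- The derivative `s^{α_e} ∂^α ∂_e^κ f`, where `s` is evaluated at the coordinate `z e`. -/
def conD (e : Fin d) (s : ℝ → ℝ) (p : Ord d) (f : Fn d) :
    Fn d :=
  fun z => frozenD e (s (z e)) p f z

/-- A common condition on the sides `S i` of a box: they are measurable and have partitions with
intervals of length comparable to `1`, and `S e` has one with intervals of length comparable
to `s`. -/
def HasPartitions (e : Fin d) (s : ℝ → ℝ) (κ : ℝ) (S : Fin d → Set ℝ) : Prop :=
  (∀ i, ∃ P : LinePart (S i), P.Comparable (fun _ => 1) κ) ∧
    (∃ P : LinePart (S e), P.Comparable s κ) ∧ ∀ i, MeasurableSet (S i)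

/-- The sum of the squares of the `L²` norms of the scaled derivatives of weight at most `n`. -/
def levSq (e : Fin d) (s : ℝ → ℝ) (bare : Bool) (S : Fin d → Set ℝ) (n : ℕ)
    (f : Fn d) : ℝ≥0∞ :=
  ∑ p ∈ ords d bare n, ∫⁻ z in univ.pi S, ‖conD e s p f z‖ₑ ^ 2

theorem levSq_mono
    (h : m ≤ n) (f : Fn d) : levSq e s bare S m f ≤ levSq e s bare S n f :=
  Finset.sum_le_sum_of_subset (ords_mono h)

theorem measurable_conD {s : ℝ → ℝ} (hs : Measurable s) (p : Ord d)
    (hf : Smooth f) : Measurable (conD e s p f) :=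
  ((hs.comp (measurable_pi_apply e)).pow_const _).mul (smooth_pdMulti hf _).continuous.measurable

theorem sum_pow_two_le (t) (f : ι → ℝ≥0∞) :
    (∑ i ∈ t, f i) ^ 2 ≤ t.card * ∑ i ∈ t, f i ^ 2 := by
  have h := ENNReal.inner_le_Lp_mul_Lq t f (fun _ => 1) (p := 2) (q := 2) ⟨by norm_num, by norm_num, by norm_num⟩
  simp only [mul_one, ENNReal.one_rpow, sum_const, nsmul_eq_mul] at h
  calc (∑ i ∈ t, f i) ^ 2 ≤ ((∑ i ∈ t, f i ^ (2 : ℝ)) ^ (1 / 2 : ℝ) *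
        t.card ^ (1 / 2 : ℝ)) ^ 2 := by gcongr
    _ = t.card * ∑ i ∈ t, f i ^ 2 := by
      rw [mul_pow, ← rpow_natCast, ← rpow_natCast, ← rpow_mul,
        ← rpow_mul]
      norm_num [mul_comm]

/-- The Gagliardo–Nirenberg inequality in pointwise form: the scaled derivatives of a bounded
function are controlled by powers, proportional to their weight, of one function `M` in `L²`.
In the anisotropic case the weight of `∂_e` is two, so that `n` has to be even. -/
theorem exists_majorant (e : Fin d) (s) (hs : Measurable s) (κ) (hκ : 0 < κ)
    (bare) (n) (hbn : bare = true → Even n) (R : NNReal) :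
    ∃ C : NNReal, ∀ S, HasPartitions e s κ S →
    ∀ w, Smooth w → (∀ z ∈ univ.pi S, ‖w z‖ₑ ≤ R) →
    ∃ M, Measurable M ∧
      ∫⁻ z in univ.pi S, M z ^ 2 ≤ C * levSq e s bare S n w ∧
      ∀ p ∈ ords d bare n, ∀ z ∈ univ.pi S,
        ‖conD e s p w z‖ₑ ≤ C * M z ^ ((wt p : ℝ) / n) := by
  classical
  -- the bare derivatives `∂_e^k w` come first
  choose C₁ h₁ using fun k => line_step_le (n / 2) 0 k κ hκ R
  let sf := fun i => if i = e then s else fun _ => 1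
  have hsf : ∀ i, Measurable (sf i) := by
    intro i; by_cases h : i = e <;> simp only [sf, h, if_true, if_false]
    · exact hs
    · exact measurable_const
  choose C₂ h₂ using fun k : Fin (n / 2 + 1) => chain_interpolation n (List.finRange d)
    (List.nodup_finRange d) sf κ hκ (2 * k) (by omega) (C₁ k + R)
  refine ⟨10 ^ d * 10 * (ords d bare n).card + ∑ k, C₂ k, fun S hS w hw hwR => ?_⟩
  obtain ⟨hP, ⟨Pe, hPe⟩, hSm⟩ := hS
  have hP2 i : ∃ P : LinePart (S i), P.Comparable (sf i) κ := by
    by_cases h : i = e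
    · subst h; simpa [sf] using ⟨Pe, hPe⟩
    · simpa [sf, h] using hP i
  choose P₁ hP₁ using hP
  choose P₂ hP₂ using hP2
  set B := univ.pi S
  have hBm := MeasurableSet.univ_pi hSm
  set F := fun z => ∑ p ∈ ords d bare n, ‖conD e s p w z‖ₑ
  have hFm : Measurable F :=
    Finset.measurable_fun_sum _ fun p _ => (measurable_conD hs p hw).enorm
  set F₁ := fun z => F z + lineMax e (P₁ e) F z
  have hF₁m := hFm.add (measurable_lineMax e (P₁ e) hFm)
  have hprod : ∀ (α : Fin d → ℕ) (z : Fin d → ℝ),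
      ∏ i, ofReal (sf i (z i)) ^ α i = ofReal (s (z e)) ^ α e := by
    intro α z
    rw [Finset.prod_eq_single e]
    · simp [sf]
    · intro i _ hi; simp [sf, hi]
    · simp
  have hcon : ∀ α k, ∀ z ∈ B, ‖conD e s (α, k) w z‖ₑ =
      (∏ i, ofReal (sf i (z i)) ^ α i) * ‖pdMulti (single e k + α) w z‖ₑ := by
    intro α k z hz
    rw [hprod, conD, frozenD, enorm_mul, enorm_pow, enorm_of_nonneg
        ((hPe (z e) (hz e (Set.mem_univ e))).1), add_comm]
  have hle : ∀ α k, (α, k) ∈ ords d bare n → ∀ z ∈ B,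
      (∏ i, ofReal (sf i (z i)) ^ α i) * ‖pdMulti (single e k + α) w z‖ₑ ≤ F z := by
    intro α k hp z hz
    rw [← hcon α k z hz]
    exact single_le_sum (f := fun p => ‖conD e s p w z‖ₑ) (fun _ _ => zero_le) hp
  refine ⟨chainMax P₂ (List.finRange d) F₁, measurable_chainMax P₂ _ hF₁m, ?_, ?_⟩
  · have hFsq : ∫⁻ z in B, F z ^ 2 ≤ (ords d bare n).card * levSq e s bare S n w := by
      calc _ ≤ ∫⁻ z in B, (ords d bare n).card *
            ∑ p ∈ ords d bare n, ‖conD e s p w z‖ₑ ^ 2 :=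
            lintegral_mono fun z => sum_pow_two_le _ _
        _ = _ := by
            rw [lintegral_const_mul, lintegral_finsetSum]
            · rfl
            · exact fun p _ => (measurable_conD hs p hw).enorm.pow_const 2
            · exact Finset.measurable_fun_sum _ fun p _ =>
                (measurable_conD hs p hw).enorm.pow_const 2
    have h1 := lintegral_chainMax_sq_le P₂ (List.finRange d) hF₁m
    have h2 : ∫⁻ z in B, F₁ z ^ 2 ≤ 10 * ∫⁻ z in B, F z ^ 2 := by
      simpa [chainMax] using lintegral_chainMax_sq_le P₁ [e] hFm
    rw [List.length_finRange] at h1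
    calc _ ≤ 10 ^ d * (10 * ((ords d bare n).card * levSq e s bare S n w)) := by
          refine h1.trans ?_
          gcongr
          exact h2.trans (by gcongr)
      _ = ((10 ^ d * 10 * (ords d bare n).card : NNReal) : ℝ≥0∞) * levSq e s bare S n w := by
          push_cast; ring
      _ ≤ _ := by gcongr; exact le_self_add
  · rintro ⟨α, k⟩ hp z hz
    have hp' := mem_ords.mp hp
    have hwt : (∑ i, α i) + 2 * k ≤ n := hp'.1
    rw [hcon α k z hz]
    have hbase : ∀ z ∈ B, ‖pdMulti (single e k) w z‖ₑ ≤
        ((C₁ k + R : NNReal) : ℝ≥0∞) * F₁ z ^ (((2 * k : ℕ) : ℝ) / n) := by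
      rcases Nat.eq_zero_or_pos k with rfl | hkpos
      · intro z hz
        simp only [Pi.single_zero, pdMulti_zero, mul_zero, Nat.cast_zero, zero_div,
          ENNReal.rpow_zero, mul_one]
        exact (hwR z hz).trans (by push_cast; exact le_add_self)
      · have hbt : bare = true := by
          by_contra hcon
          have := hp'.2 (by simpa using hcon)
          simp at this; omega
        obtain ⟨r, hr⟩ := hbn hbt
        have hn2 : n / 2 = r := by omega
        intro z hz
        have := h₁ k (by omega) e (P₁ e) (fun _ => 1) measurable_const (hP₁ e) w hw 0
          (fun _ => 1) (fun _ _ => rfl) F hFm ?_ ?_ z hz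
        · simp only [ofReal_one, one_pow, one_mul, zero_add] at this
          refine this.trans ?_
          have he : (k : ℝ) / ((n / 2 : ℕ) : ℝ) = ((2 * k : ℕ) : ℝ) / n := by
            rw [hn2, hr]; push_cast
            rw [← two_mul, mul_div_mul_left _ _ two_ne_zero]
          rw [he]
          gcongr
          exact le_self_add
        · intro z hz
          simp only [pdMulti_zero, one_mul, Nat.cast_zero, zero_div, ENNReal.rpow_zero, mul_one]
          exact hwR z hz
        · intro j hj z hz
          simpa using hle 0 j (mem_ords.mpr ⟨by simp [wt]; omega, by simp [hbt]⟩) z hz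
    have := h₂ ⟨k, by omega⟩ P₂ hsf hP₂ w hw (single e k) (fun _ => 1) (fun _ _ _ _ => rfl)
      F₁ hF₁m (by simpa only [one_mul] using hbase) ?_ α (by simp) (by simpa [add_comm] using hwt) z hz
    · simp only [one_mul] at this
      refine this.trans ?_
      have he : 2 * k + ∑ i, α i = wt (α, k) := by simp [wt, add_comm]
      rw [he]
      exact mul_le_mul_left (coe_le_coe.mpr (
          (single_le_sum (fun _ _ => zero_le) (mem_univ _)).trans le_add_self)) _
    · intro β _ hβ z hz
      rw [one_mul]
      refine (hle β k (mem_ords.mpr ⟨?_, hp'.2⟩) z hz).trans le_self_add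
      simp only [wt] at hβ ⊢; omega

/-! ### Products and compositions at a point -/

theorem pd_mul (hf : Smooth f) (hg : Smooth g) (i : Fin d) :
    pd i (fun z => f z * g z) = fun z => pd i f z * g z + f z * pd i g z := by
  funext z
  simp only [pd]
  rw [fderiv_fun_mul (hf.differentiable (by simp) z) (hg.differentiable (by simp) z)]
  simp [mul_comm, add_comm]

theorem pd_const_mul (hf : Smooth f) (c) (i) :
    pd i (fun z => c * f z) = fun z => c * pd i f z := by
  funext z
  simp only [pd]
  rw [fderiv_const_mul (hf.differentiable (by simp) z)]
  simp

theorem pd_add (hf : Smooth f) (hg : Smooth g) (i) :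
    pd i (fun z => f z + g z) = fun z => pd i f z + pd i g z := by
  funext z
  simp only [pd]
  rw [fderiv_fun_add (hf.differentiable (by simp) z) (hg.differentiable (by simp) z)]
  simp

theorem sub_add_single {α : Fin d → ℕ} (h : α i ≠ 0) : α - single i 1 + single i 1 = α := by
  funext j
  by_cases hj : j = i
  · subst hj; simp; omega
  · simp [hj]

/-- Induction on a multi-index, adding one derivative at a time. -/
theorem multiIndex_ind {P : (Fin d → ℕ) → Prop} (h0 : P 0)
    (h1 : ∀ α i, P α → P (α + single i 1)) (α) : P α := by
  induction hn : ∑ i, α i generalizing α with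
  | zero =>
    have : α = 0 := funext fun i => by
      have := single_le_sum (f := α) (fun _ _ => Nat.zero_le _) (mem_univ i)
      simp only [Pi.zero_apply]; omega
    rwa [this]
  | succ n ih =>
    obtain ⟨i, hi⟩ : ∃ i, α i ≠ 0 := by
      by_contra! hcon
      simp [hcon] at hn
    rw [← sub_add_single hi]
    refine h1 _ _ (ih _ ?_)
    have := congrArg (∑ j, · j) (sub_add_single hi)
    simp only [Pi.add_apply, sum_add_distrib, Finset.sum_pi_single', mem_univ, if_true] at this
    omega

theorem pdMulti_const_mul (hf : Smooth f) (c) (α : Fin d → ℕ) :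
    pdMulti α (fun z => c * f z) = fun z => c * pdMulti α f z := by
  induction α using multiIndex_ind with
  | h0 => simp
  | h1 α i ih =>
    rw [pdMulti_succ (contDiff_const.mul hf), ih, pd_const_mul (smooth_pdMulti hf α),
      pdMulti_succ hf]

theorem pdMulti_add' (hf : Smooth f) (hg : Smooth g)
    (α : Fin d → ℕ) :
    pdMulti α (fun z => f z + g z) = fun z => pdMulti α f z + pdMulti α g z := by
  induction α using multiIndex_ind with
  | h0 => simp
  | h1 α i ih =>
    rw [pdMulti_succ (hf.add hg), ih, pd_add (smooth_pdMulti hf α)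
      (smooth_pdMulti hg α), pdMulti_succ hf, pdMulti_succ hg]

theorem pdMulti_pdMulti (hf : Smooth f) (α β : Fin d → ℕ) :
    pdMulti α (pdMulti β f) = pdMulti (α + β) f := by
  induction α using multiIndex_ind with
  | h0 => simp
  | h1 α i ih =>
    rw [pdMulti_succ (smooth_pdMulti hf β), ih, ← pdMulti_succ hf]
    congr 1
    abel

theorem smooth_frozenD (hf : Smooth f) (e) (s₀ : ℝ)
    (p : Ord d) : Smooth (frozenD e s₀ p f) :=
  contDiff_const.mul (smooth_pdMulti hf _)

theorem frozenD_zero (e) (s₀) (f : Fn d) : frozenD e s₀ 0 f = f := by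
  funext z; simp [frozenD]

theorem frozenD_frozenD (hf : Smooth f) (e) (s₀ : ℝ)
    (p q : Ord d) : frozenD e s₀ p (frozenD e s₀ q f) = frozenD e s₀ (p + q) f := by
  funext z
  change s₀ ^ p.1 e * pdMulti (p.1 + single e p.2)
    (fun z => s₀ ^ q.1 e * pdMulti (q.1 + single e q.2) f z) z = _ * _
  rw [pdMulti_const_mul (smooth_pdMulti hf _), pdMulti_pdMulti hf]
  rw [show p.1 + single e p.2 + (q.1 + single e q.2) =
    (p + q).1 + single e (p + q).2 by simp only [Prod.fst_add, Prod.snd_add, Pi.single_add]; abel]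
  simp only [Prod.fst_add, Pi.add_apply, pow_add]
  ring

theorem frozenD_add (hf : Smooth f) (hg : Smooth g)
    (e) (s₀ : ℝ) (p : Ord d) :
    frozenD e s₀ p (fun z => f z + g z) = fun z => frozenD e s₀ p f z + frozenD e s₀ p g z := by
  funext z
  simp only [frozenD]
  rw [pdMulti_add' hf hg, mul_add]

/-- The pairs `(α, κ)` with `|α| + κ = 1`. -/
def IsLetter (p : Ord d) : Prop := (∃ i, p = (single i 1, 0)) ∨ p = (0, 1)

theorem IsLetter.weight_pos {p : Ord d} (h : IsLetter p) : 1 ≤ wt p := by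
  rcases h with ⟨i, rfl⟩ | rfl <;> simp [wt]

theorem wt_add (p q : Ord d) : wt (p + q) = wt p + wt q := by
  simp only [wt, Prod.fst_add, Prod.snd_add, Pi.add_apply, sum_add_distrib]; ring

theorem eq_zero_of_wt {p : Ord d} (h : wt p = 0) : p = 0 := by
  simp only [wt, Nat.add_eq_zero_iff, Finset.sum_eq_zero_iff, mem_univ, true_implies] at h
  ext i
  · exact h.1 i
  · simpa using h.2

theorem exists_letter {p : Ord d} (hp : p ∈ ords d bare n) (h : wt p ≠ 0) :
    ∃ q ℓ, IsLetter ℓ ∧ p = q + ℓ ∧ ℓ ∈ ords d bare n ∧ q ∈ ords d bare (n - wt ℓ) := by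
  suffices H : ∃ q ℓ, IsLetter ℓ ∧ p = q + ℓ by
    obtain ⟨q, ℓ, hℓ, rfl⟩ := H
    simp only [mem_ords, wt_add, Prod.snd_add] at hp ⊢
    exact ⟨q, ℓ, hℓ, rfl, by grind, by grind⟩
  obtain ⟨α, k⟩ := p
  rcases Nat.eq_zero_or_pos k with rfl | hk
  · obtain ⟨i, hi⟩ : ∃ i, α i ≠ 0 := by
      by_contra! hcon
      simp [wt, hcon] at h
    exact ⟨(α - single i 1, 0), _, Or.inl ⟨i, rfl⟩, by simp [sub_add_single hi]⟩
  · exact ⟨(α, k - 1), _, Or.inr rfl, by ext <;> simp; omega⟩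

theorem exists_frozenD_letter (e : Fin d) (s₀) (h : IsLetter ℓ) :
    ∃ (c : ℝ) (i : Fin d), ∀ f, Smooth f →
      frozenD e s₀ ℓ f = fun z => c * pd i f z := by
  rcases h with ⟨i, rfl⟩ | rfl
  · refine ⟨s₀ ^ (single i 1 : Fin d → ℕ) e, i, fun f hf => ?_⟩
    funext z
    simp [frozenD, pdMulti_single hf]
  · refine ⟨1, e, fun f hf => ?_⟩
    funext z
    simp [frozenD, pdMulti_single hf]

/-- The scaled derivatives of `f` at `z` of weight `k ≤ n` are bounded by `a λ^k`. -/
def DerivBound (e : Fin d) (s₀ : ℝ) (bare : Bool) (lam : ℝ≥0∞) (z : Fin d → ℝ) (n : ℕ)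
    (f : Fn d) (a : ℝ≥0∞) : Prop :=
  ∀ p ∈ ords d bare n, ‖frozenD e s₀ p f z‖ₑ ≤ a * lam ^ wt p

variable {ι : Type*} [Fintype ι] [DecidableEq ι] {e : Fin d} {s₀ : ℝ} {bare : Bool} {lam : ℝ≥0∞} {z : Fin d → ℝ}

theorem DerivBound.mono {m n : ℕ} (h : m ≤ n)
    (hf : DerivBound e s₀ bare lam z n f a) : DerivBound e s₀ bare lam z m f a :=
  fun p hp => hf p (ords_mono h hp)

theorem DerivBound.letter (hf : Smooth f) {a : ℝ≥0∞}
    (h : DerivBound e s₀ bare lam z n f a) (hℓ : ℓ ∈ ords d bare n) :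
    DerivBound e s₀ bare lam z (n - wt ℓ) (frozenD e s₀ ℓ f) (a * lam ^ wt ℓ) := by
  intro p hp
  rw [mem_ords] at hp hℓ
  rw [frozenD_frozenD hf]
  refine (h (p + ℓ) (mem_ords.mpr ⟨?_, fun hb => ?_⟩)).trans ?_
  · rw [wt_add]; omega
  · simp [hp.2 hb, hℓ.2 hb]
  · rw [wt_add, pow_add]
    apply le_of_eq; ring

theorem DerivBound.mul (hf : Smooth f) (hg : Smooth g) (hfa : DerivBound e s₀ bare lam z n f a)
    (hgb : DerivBound e s₀ bare lam z n g b) :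
    DerivBound e s₀ bare lam z n (fun z => f z * g z) (2 ^ n * (a * b)) := by
  induction n using Nat.strong_induction_on generalizing f g a b with
  | _ n ih =>
    intro p hp
    by_cases h0 : wt p = 0
    · have h1 := hfa p hp
      have h2 := hgb p hp
      obtain rfl := eq_zero_of_wt h0
      simp only [frozenD_zero, h0, pow_zero, mul_one, enorm_mul] at h1 h2 ⊢
      exact (mul_le_mul' h1 h2).trans (le_mul_of_one_le_left zero_le (one_le_pow₀ one_le_two))
    · obtain ⟨q, ℓ, hℓ, rfl, hℓm, hqm⟩ := exists_letter hp h0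
      have hℓ1 := hℓ.weight_pos
      have hn := (mem_ords.mp hℓm).1
      have hfl := smooth_frozenD hf e s₀ ℓ
      have hgl := smooth_frozenD hg e s₀ ℓ
      have hlei : frozenD e s₀ ℓ (fun z => f z * g z) =
          fun z => frozenD e s₀ ℓ f z * g z + f z * frozenD e s₀ ℓ g z := by
        obtain ⟨c, i, hc⟩ := exists_frozenD_letter e s₀ hℓ
        rw [hc _ (hf.mul hg), hc _ hf, hc _ hg, pd_mul hf hg]
        funext z; ring
      rw [← frozenD_frozenD (hf.mul hg), hlei, frozenD_add (hfl.mul hg) (hf.mul hgl)]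
      have hm := Nat.sub_le n (wt ℓ)
      refine (enorm_add_le _ _).trans ((add_le_add
        (ih _ (by omega) hfl hg (hfa.letter hf hℓm) (hgb.mono hm) q hqm)
        (ih _ (by omega) hf hgl (hfa.mono hm) (hgb.letter hg hℓm) q hqm)).trans ?_)
      calc _ = 2 ^ (n - wt ℓ + 1) * (a * b) * lam ^ wt (q + ℓ) := by
            rw [pow_succ, wt_add, pow_add]; ring
        _ ≤ _ := by gcongr; exacts [one_le_two, by omega]

theorem DerivBound.sum (t) {f : ι → Fn d}
    (hf : ∀ k, Smooth (f k)) {a : ι → ℝ≥0∞}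
    (h : ∀ k, DerivBound e s₀ bare lam z n (f k) (a k)) :
    DerivBound e s₀ bare lam z n (fun z => ∑ k ∈ t, f k z) (∑ k ∈ t, a k) := by
  classical
  intro p hp
  have hlin : frozenD e s₀ p (fun z => ∑ k ∈ t, f k z) z = ∑ k ∈ t, frozenD e s₀ p (f k) z := by
    induction t using Finset.induction_on with
    | empty =>
      have := pdMulti_const_mul (f := fun _ => 0) contDiff_const 0
        (p.1 + single e p.2)
      simp only [mul_zero, zero_mul] at this
      simp [frozenD, this]
    | insert k t hk ih =>
      simp only [Finset.sum_insert hk]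
      rw [← ih, frozenD_add (hf k) (ContDiff.sum fun j _ => hf j)]
  rw [hlin, sum_mul]
  exact (enorm_sum_le _ _).trans (sum_le_sum fun k _ => h k p hp)

theorem pd_comp (hG : Smooth G)
    {W : ι → Fn d} (hW : ∀ k, Smooth (W k)) (i) :
    pd i (fun z => G fun k => W k z) =
      fun z => ∑ k, fderiv ℝ G (fun k => W k z) (single k 1) * pd i (W k) z := by
  funext z
  have h3 : fderiv ℝ (fun z => G fun k => W k z) z = _ :=
      (((hG.differentiable (by simp) fun k => W k z).hasFDerivAt).comp z (hasFDerivAt_pi.mpr fun k => ((hW k).differentiable (by simp) z).hasFDerivAt)).fderiv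
  simp only [pd]
  rw [h3, ContinuousLinearMap.comp_apply]
  conv_lhs => rw [← Finset.univ_sum_single
    ((ContinuousLinearMap.pi fun k => fderiv ℝ (W k) z) (single i 1))]
  rw [map_sum]
  refine sum_congr rfl fun k _ => ?_
  rw [ContinuousLinearMap.pi_apply, mul_comm, ← smul_eq_mul, ← map_smul]
  congr 1
  rw [← Pi.single_smul, smul_eq_mul, mul_one]

/-- The pointwise bound for a composition; the constant depends on the function `G` only through
its derivatives on a compact set. -/
theorem DerivBound.comp (n) {G : (ι → ℝ) → ℝ} (hG : Smooth G) (A : NNReal) :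
    ∃ C : NNReal, ∀ {s₀ lam z} (W : ι → Fn d), (∀ k, Smooth (W k)) →
    (∀ k, DerivBound e s₀ bare lam z n (W k) A) →
    DerivBound e s₀ bare lam z n (fun z => G fun k => W k z) C := by
  induction n using Nat.strong_induction_on generalizing G with
  | _ n ih =>
    have hG' : ∀ k, Smooth fun y => fderiv ℝ G y (single k 1) := fun k =>
      (hG.fderiv_right (by simp)).clm_apply contDiff_const
    obtain ⟨C₀, hC₀⟩ := (isCompact_univ_pi fun _ => isCompact_Icc (a := -(A : ℝ))).exists_bound_of_continuousOn hG.continuous.continuousOn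
    choose C₁ h₁ using fun (m : Fin n) k => ih m m.2 (hG' k)
    refine ⟨Real.toNNReal C₀ + ∑ m, ∑ k, 2 ^ n * (C₁ m k * A), fun {s₀ lam z} W hW hb p hp => ?_⟩
    push_cast
    by_cases h0 : wt p = 0
    · obtain rfl := eq_zero_of_wt h0
      have := hC₀ (fun k => W k z) fun k _ => by
        have := hb k 0 hp
        rw [h0, frozenD_zero, pow_zero, mul_one, Real.enorm_eq_ofReal_abs,
          ENNReal.ofReal_le_iff_le_toReal (by simp)] at this
        exact abs_le.mp (by simpa using this)
      rw [h0, frozenD_zero, pow_zero, mul_one, Real.enorm_eq_ofReal_abs]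
      exact (ofReal_le_ofReal this).trans le_self_add
    · obtain ⟨q, ℓ, hℓ, rfl, hℓm, hqm⟩ := exists_letter hp h0
      have hℓ1 := hℓ.weight_pos
      have hn := (mem_ords.mp hℓm).1
      have hGW : Smooth fun z => G fun k => W k z := hG.comp (contDiff_pi.mpr hW)
      have hch : frozenD e s₀ ℓ (fun z => G fun k => W k z) = fun z => ∑ k,
          fderiv ℝ G (fun k => W k z) (single k 1) * frozenD e s₀ ℓ (W k) z := by
        obtain ⟨c, i, hc⟩ := exists_frozenD_letter e s₀ hℓ
        rw [hc _ hGW, pd_comp hG hW]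
        funext z
        rw [mul_sum]
        refine sum_congr rfl fun k _ => ?_
        rw [hc _ (hW k)]; ring
      rw [← frozenD_frozenD hGW, hch, wt_add]
      let m : Fin n := ⟨n - wt ℓ, by omega⟩
      have hs := fun k => (hG' k).comp (contDiff_pi.mpr hW)
      have hfr := fun k => smooth_frozenD (hW k) e s₀ ℓ
      refine (DerivBound.sum Finset.univ (fun k => (hs k).mul (hfr k)) (fun k => DerivBound.mul
        (hs k) (hfr k) (h₁ m k W hW fun k => (hb k).mono (Nat.sub_le _ _))
        ((hb k).letter (hW k) hℓm)) q hqm).trans ?_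
      calc _ = (∑ k, 2 ^ (n - wt ℓ) * ((C₁ m k : ℝ≥0∞) * A)) *
            lam ^ (wt q + wt ℓ) := by
            rw [pow_add, sum_mul, sum_mul]
            exact sum_congr rfl fun k _ => by ring
        _ ≤ _ := by
            gcongr
            refine le_trans ?_ (le_add_self.trans' (single_le_sum (f := fun m => ∑ k,
              2 ^ n * ((C₁ m k : ℝ≥0∞) * A)) (fun _ _ => zero_le) (mem_univ m)))
            gcongr
            exacts [one_le_two, Nat.sub_le _ _]

end

end

section

/-! ### Nonlinear estimates for smooth functions -/

section


@[simp] theorem conD_zero (e : Fin d) (s : ℝ → ℝ) (f : Fn d) : conD e s 0 f = f := by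
  funext z; simp [conD, frozenD]

variable {X ι : Type*} [MeasurableSpace X] [Fintype ι] [DecidableEq ι] {Φ : (ι → ℝ) → ℝ}
  {e : Fin d} {s : ℝ → ℝ} {bare : Bool} {S : Fin d → Set ℝ} {K : Set ℝ}

theorem lintegral_add_sq_le (μ : Measure X) {f g : X → ℝ≥0∞}
    (hf : Measurable f) (hg : Measurable g) :
    ∫⁻ z, (f z + g z) ^ 2 ∂μ ≤ 2 * (∫⁻ z, f z ^ 2 ∂μ) + 2 * ∫⁻ z, g z ^ 2 ∂μ := by
  rw [← lintegral_const_mul _ (hf.pow_const 2), ← lintegral_const_mul _ (hg.pow_const 2),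
    ← lintegral_add_left ((hf.pow_const 2).const_mul 2)]
  refine lintegral_mono fun z => ?_
  have := ENNReal.rpow_add_le_mul_rpow_add_rpow (f z) (g z) (p := (2 : ℕ)) (by norm_num)
  simp only [rpow_natCast] at this
  norm_num at this
  rwa [mul_add] at this

theorem lintegral_const_mul_sq (μ : Measure X) (c : ℝ≥0∞)
    {f : X → ℝ≥0∞} (hf : Measurable f) :
    ∫⁻ z, (c * f z) ^ 2 ∂μ = c ^ 2 * ∫⁻ z, f z ^ 2 ∂μ := by
  simp_rw [mul_pow]
  exact lintegral_const_mul _ (hf.pow_const 2)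

theorem lintegral_sum_sq_le {ι : Type*} (μ : Measure X) (t : Finset ι)
    {f : ι → X → ℝ≥0∞} (hf : ∀ i, Measurable (f i)) :
    ∫⁻ z, (∑ i ∈ t, f i z) ^ 2 ∂μ ≤ t.card * ∑ i ∈ t, ∫⁻ z, f i z ^ 2 ∂μ := by
  calc _ ≤ ∫⁻ z, t.card * ∑ i ∈ t, f i z ^ 2 ∂μ := lintegral_mono fun z => sum_pow_two_le _ _
    _ = _ := by
      rw [lintegral_const_mul _ (Finset.measurable_fun_sum _ fun i _ => (hf i).pow_const 2),
        lintegral_finsetSum _ fun i _ => (hf i).pow_const 2]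

/-- The `L²` norm of a scaled derivative is part of `levSq`. -/
theorem le_levSq (f : Fn d) {p : Ord d} (h : wt p ≤ n) (h' : bare = false → p.2 = 0) :
    ∫⁻ z in univ.pi S, ‖conD e s p f z‖ₑ ^ 2 ≤ levSq e s bare S n f :=
  single_le_sum (f := fun p => ∫⁻ z in univ.pi S, ‖conD e s p f z‖ₑ ^ 2) (fun _ _ => zero_le)
    (mem_ords.mpr ⟨h, h'⟩)

/-- The functions `Y k` are smooth, and bounded by `R` on the box with the sides `S i`. -/
def BoundedOn (e : Fin d) (s : ℝ → ℝ) (κ : ℝ) (R : NNReal) (S : Fin d → Set ℝ) (Y : ι → Fn d) :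
    Prop :=
  HasPartitions e s κ S ∧ (∀ k, Smooth (Y k)) ∧ ∀ k, ∀ z ∈ univ.pi S, ‖Y k z‖ₑ ≤ R

/-- The Moser estimate for the derivatives of top weight `n`. -/
theorem moser_top (e : Fin d) (s : ℝ → ℝ) (hs : Measurable s) (κ : ℝ) (hκ : 0 < κ) (bare : Bool)
    (n : ℕ) (hn : 1 ≤ n) (hbn : bare = true → Even n) (hΦ : Smooth Φ) (R : NNReal) :
    ∃ C : NNReal, ∀ S Y, BoundedOn e s κ R S Y → ∀ p ∈ ords d bare n, wt p = n →
      ∫⁻ z in univ.pi S, ‖conD e s p (fun z => Φ fun k => Y k z) z‖ₑ ^ 2 ≤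
        C * ∑ k, levSq e s bare S n (Y k) := by
  obtain ⟨C₁, h₁⟩ := exists_majorant e s hs κ hκ bare n hbn R
  obtain ⟨C₂, h₂⟩ := DerivBound.comp n hΦ C₁
  refine ⟨C₂ ^ 2 * card ι * C₁, fun S Y ⟨hS, hY, hYR⟩ p hp hpn => ?_⟩
  choose M hMm hM2 hM using fun k => h₁ S hS (Y k) (hY k) (hYR k)
  have hpt : ∀ z ∈ univ.pi S,
      ‖conD e s p (fun z => Φ fun k => Y k z) z‖ₑ ≤ C₂ * ∑ k, M k z := by
    intro z hz
    have := h₂ (s₀ := s (z e)) (z := z)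
      (lam := (∑ k, M k z) ^ ((1 : ℝ) / n)) Y hY (fun k q hq => ?_) p hp
    · rw [hpn, ← rpow_natCast, ← rpow_mul, one_div, inv_mul_cancel₀ (by positivity),
        ENNReal.rpow_one] at this
      exact this
    · refine (hM k q hq z hz).trans ?_
      rw [← rpow_natCast, ← rpow_mul, one_div_mul_eq_div]
      gcongr
      exact single_le_sum (f := fun k => M k z) (fun _ _ => zero_le) (mem_univ k)
  calc _ ≤ ∫⁻ z in univ.pi S, (C₂ * ∑ k, M k z) ^ 2 :=
        setLIntegral_mono' (MeasurableSet.univ_pi hS.2.2) fun z hz => by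
          gcongr; exact hpt z hz
    _ = C₂ ^ 2 * ∫⁻ z in univ.pi S, (∑ k, M k z) ^ 2 :=
        lintegral_const_mul_sq _ _ (Finset.measurable_fun_sum _ fun k _ => hMm k)
    _ ≤ C₂ ^ 2 * (card ι * ∑ k, C₁ * levSq e s bare S n (Y k)) := by
        gcongr
        refine (lintegral_sum_sq_le _ _ hMm).trans ?_
        rw [Finset.card_univ]
        gcongr with k
        exact hM2 k
    _ = _ := by rw [← mul_sum]; push_cast; ring

/-- A smooth function which vanishes at the origin is Lipschitz on bounded sets. -/
theorem exists_lipschitz_bound (hΦ : Smooth Φ)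
    (h0 : Φ 0 = 0) (R : NNReal) :
    ∃ C : NNReal, ∀ y : ι → ℝ, (∀ k, ‖y k‖ₑ ≤ R) → ‖Φ y‖ₑ ≤ C * ∑ k, ‖y k‖ₑ := by
  obtain ⟨C, hC⟩ := (isCompact_closedBall (0 : ι → ℝ) R).exists_bound_of_continuousOn
    (hΦ.continuous_fderiv (by simp)).continuousOn
  refine ⟨Real.toNNReal C, fun y hy => ?_⟩
  have hyR : y ∈ closedBall (0 : ι → ℝ) R := by
    rw [mem_closedBall_zero_iff, pi_norm_le_iff_of_nonneg R.coe_nonneg]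
    intro k
    have := hy k
    rw [← ofReal_norm, ENNReal.ofReal_le_iff_le_toReal (by simp)] at this
    simpa using this
  have h1 := (convex_closedBall (0 : ι → ℝ) R).norm_image_sub_le_of_norm_fderiv_le (𝕜 := ℝ)
    (f := Φ) (fun x _ => hΦ.differentiable (by simp) x) hC
    (Metric.mem_closedBall_self R.2) hyR
  rw [h0, sub_zero, sub_zero] at h1
  have h2 : ‖y‖ ≤ ∑ k, ‖y k‖ := by
    rw [pi_norm_le_iff_of_nonneg (sum_nonneg fun _ _ => norm_nonneg _)]
    exact fun k => single_le_sum (f := fun k => ‖y k‖) (fun _ _ => norm_nonneg _)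
      (mem_univ k)
  have hC0 : 0 ≤ C := (norm_nonneg _).trans (hC 0 (Metric.mem_closedBall_self R.2))
  calc ‖Φ y‖ₑ = ofReal ‖Φ y‖ := (ofReal_norm _).symm
    _ ≤ ofReal (C * ∑ k, ‖y k‖) :=
        ofReal_le_ofReal (h1.trans (mul_le_mul_of_nonneg_left h2 hC0))
    _ = _ := by
        rw [ofReal_mul hC0, ENNReal.ofReal_sum_of_nonneg fun _ _ => norm_nonneg _]
        simp only [ofReal_norm]
        rfl

theorem moser_zero (hΦ : Smooth Φ) (h0 : Φ 0 = 0) (R : NNReal) :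
    ∃ C : NNReal, ∀ e s κ bare S (Y : ι → Fn d), BoundedOn e s κ R S Y →
    levSq e s bare S 0 (fun z => Φ fun k => Y k z) ≤ C * ∑ k, levSq e s bare S 0 (Y k) := by
  obtain ⟨C, hC⟩ := exists_lipschitz_bound hΦ h0 R
  refine ⟨C ^ 2 * card ι, fun e s κ bare S Y ⟨hS, hY, hYR⟩ => ?_⟩
  have hlev (f : Fn d) : levSq e s bare S 0 f = ∫⁻ z in univ.pi S, ‖f z‖ₑ ^ 2 := by
    have : ords d bare 0 = {0} := by
      ext p
      rw [Finset.mem_singleton, mem_ords]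
      exact ⟨fun h => eq_zero_of_wt (by omega), by rintro rfl; simp [wt]⟩
    rw [levSq, this, Finset.sum_singleton, conD_zero]
  simp_rw [hlev]
  calc _ ≤ ∫⁻ z in univ.pi S, (C * ∑ k, ‖Y k z‖ₑ) ^ 2 :=
        setLIntegral_mono' (MeasurableSet.univ_pi hS.2.2) fun z hz => by
          gcongr; exact hC _ fun k => hYR k z hz
    _ = C ^ 2 * ∫⁻ z in univ.pi S, (∑ k, ‖Y k z‖ₑ) ^ 2 :=
        lintegral_const_mul_sq _ _ (Finset.measurable_fun_sum _ fun k _ =>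
          (hY k).continuous.measurable.enorm)
    _ ≤ C ^ 2 * (card ι * ∑ k, ∫⁻ z in univ.pi S, ‖Y k z‖ₑ ^ 2) := by
        gcongr
        exact lintegral_sum_sq_le _ _ fun k => (hY k).continuous.measurable.enorm
    _ = _ := by push_cast; ring

/-! ### Commutators with the weight -/

theorem pdMulti_succ' (hf : Smooth f) (α : Fin d → ℕ)
    (i : Fin d) : pdMulti (α + single i 1) f = pdMulti α (pd i f) := by
  rw [pdMulti_succ hf, pd_pdMulti_comm hf]

theorem smooth_coord {c : ℝ → ℝ} (hc : Smooth c) (e : Fin d) :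
    Smooth fun z : Fin d → ℝ => c (z e) :=
  hc.comp (contDiff_apply ℝ ℝ e)

theorem pd_coord {c : ℝ → ℝ} (hc : Smooth c) (e i : Fin d) (z : Fin d → ℝ) :
    pd i (fun z : Fin d → ℝ => c (z e)) z = if i = e then deriv c (z e) else 0 := by
  have h2 : HasFDerivAt (fun z : Fin d → ℝ => z e) (ContinuousLinearMap.proj (R := ℝ) (φ := fun _ : Fin d => ℝ) e) z :=
    (ContinuousLinearMap.proj (R := ℝ) (φ := fun _ : Fin d => ℝ) e).hasFDerivAt
  simp only [pd]
  change fderiv ℝ (c ∘ fun z : Fin d → ℝ => z e) z _ = _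
  rw [(((hc.differentiable (by simp) (z e)).hasDerivAt).hasFDerivAt.comp z h2).fderiv]
  by_cases h : i = e
  · subst h; simp
  · simp [h, Ne.symm h]

theorem commutator_bound (hK : IsCompact K) (e : Fin d) (γ : Fin d → ℕ) :
    ∀ {c : ℝ → ℝ}, Smooth c → ∃ C : ℝ, 0 ≤ C ∧ ∀ f : Fn d, Smooth f →
    ∀ z : Fin d → ℝ, z e ∈ K → ∀ M : ℝ, 0 ≤ M →
    (∀ j, 1 ≤ j → j ≤ γ e → |pdMulti (γ - single e j) f z| ≤ M) →
    |pdMulti γ (fun z => c (z e) * f z) z - c (z e) * pdMulti γ f z| ≤ C * M := by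
  induction γ using multiIndex_ind with
  | h0 => intro c hc; exact ⟨0, le_rfl, by simp⟩
  | h1 γ i ih =>
    intro c hc
    obtain ⟨C₁, hC₁, h₁⟩ := ih hc
    by_cases hi : i = e
    · subst hi
      have hc' : Smooth (deriv c) := ((contDiff_infty_iff_deriv (f := c)).mp hc).2
      obtain ⟨C₂, hC₂, h₂⟩ := ih hc'
      obtain ⟨B, hB⟩ := hK.exists_bound_of_continuousOn hc'.continuous.continuousOn
      refine ⟨max B 0 + C₂ + C₁, by positivity, fun f hf z hz M hM hj => ?_⟩
      have hcs := smooth_coord hc i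
      rw [pdMulti_succ' (hcs.mul hf), pd_mul hcs hf]
      simp only [pd_coord hc i i, if_true]
      rw [pdMulti_add' ((smooth_coord hc' i).mul hf) (hcs.mul (smooth_pd hf i)),
        pdMulti_succ' hf]
      have b0 : |pdMulti γ f z| ≤ M := by
        have := hj 1 le_rfl (by simp)
        rwa [add_tsub_cancel_right] at this
      have b1 := h₂ f hf z hz M hM fun j h1 h2 => by
        have := hj (j + 1) (by omega) (by simpa using h2)
        rwa [show γ + single i 1 - single i (j + 1) = γ - single i j by
          rw [add_comm j 1, Pi.single_add, ← tsub_tsub, add_tsub_cancel_right]] at this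
      have b2 := h₁ (pd i f) (smooth_pd hf i) z hz M hM fun j h1 h2 => by
        have := hj j h1 (by simp; omega)
        rw [← pdMulti_succ' hf]
        rwa [show γ - single i j + single i 1 = γ + single i 1 - single i j by
          funext k; by_cases hk : k = i <;> simp [hk]; omega]
      have b3 : |deriv c (z i) * pdMulti γ f z| ≤ max B 0 * M := by
        rw [abs_mul]
        gcongr
        exact (hB _ hz).trans (le_max_left _ _)
      rw [abs_le] at b1 b2 b3 ⊢
      constructor <;> nlinarith
    · refine ⟨C₁, hC₁, fun f hf z hz M hM hj => ?_⟩
      have hcs := smooth_coord hc e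
      rw [pdMulti_succ' (hcs.mul hf), pd_mul hcs hf, pdMulti_succ' hf]
      simp only [pd_coord hc e i, if_neg hi, zero_mul, zero_add]
      refine h₁ (pd i f) (smooth_pd hf i) z hz M hM fun j h1 h2 => ?_
      have := hj j h1 (by simpa [Ne.symm hi] using h2)
      rw [← pdMulti_succ' hf]
      rwa [show γ - single e j + single i 1 = γ + single i 1 - single e j by
        funext k; by_cases hk : k = e <;> simp [hk, Ne.symm hi]]

/-- The conormal derivative `Z_i`, that is `s ∂_e` for `i = e` and `∂_i` for `i ≠ e`. -/
def zD (e : Fin d) (s : ℝ → ℝ) (i : Fin d) (f : Fn d) : Fn d :=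
  fun z => (if i = e then s (z e) else 1) * pd i f z

theorem smooth_zD (hs : Smooth s) (i : Fin d)
    (hf : Smooth f) : Smooth (zD e s i f) := by
  unfold zD
  by_cases h : i = e
  · simp only [h, if_true]; exact (smooth_coord hs e).mul (smooth_pd hf e)
  · simp only [h, if_false]; exact contDiff_const.mul (smooth_pd hf i)

/-- Up to terms of lower weight, `Z_i` may be moved to the right of the scaled derivatives. -/
theorem conD_zD_sub_le (hK : IsCompact K) (e : Fin d)
    (hs : Smooth s) (p : Ord d) (i : Fin d) :
    ∃ C : NNReal, ∀ f : Fn d, Smooth f → ∀ z : Fin d → ℝ, z e ∈ K →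
      ‖conD e s p (zD e s i f) z - conD e s (p + (single i 1, 0)) f z‖ₑ ≤
        C * ∑ q ∈ ords d true (wt p), ‖conD e s q f z‖ₑ := by
  obtain ⟨α, k⟩ := p
  by_cases hi : i = e
  · subst hi
    obtain ⟨C, hC, h⟩ := commutator_bound hK i (α + single i k) hs
    obtain ⟨B, hB⟩ := hK.exists_bound_of_continuousOn hs.continuous.continuousOn
    refine ⟨Real.toNNReal (C * max B 1 ^ α i), fun f hf z hz => ?_⟩
    set a := s (z i) ^ α i with ha
    set M := ∑ q ∈ ords d true (wt (α, k)), |conD i s q f z| with hM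
    have hq : ∀ q, wt q ≤ wt (α, k) → |conD i s q f z| ≤ M := fun q hq =>
      single_le_sum (f := fun q => |conD i s q f z|) (fun _ _ => abs_nonneg _)
        (mem_ords.mpr ⟨hq, by simp⟩)
    have hB1 : 1 ≤ max B 1 := le_max_right _ _
    have hsB : |s (z i)| ≤ max B 1 := (hB _ hz).trans (le_max_left _ _)
    have hpf := smooth_pd hf i
    have key := h (fun w => a * pd i f w) (contDiff_const.mul hpf) z hz (max B 1 ^ α i * M)
      (by positivity) fun j h1 h2 => by
        rw [pdMulti_const_mul hpf, ← pdMulti_succ' hf]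
        set δ := α + single i k - single i j + single i 1 with hδ
        have hδi : δ i = α i + k - j + 1 := by simp [hδ]
        have hδk : ∀ l, l ≠ i → δ l = α l := fun l hl => by simp [hδ, hl]
        simp only [Pi.add_apply, Pi.single_eq_same] at h2
        rw [abs_mul]
        rcases le_or_gt (α i) (δ i) with hle | hlt
        · have e1 : δ = α + single i (δ i - α i) := by
            funext l; by_cases hl : l = i <;> simp [hl, hδk]; omega
          have := hq (α, δ i - α i) (by simp only [wt]; omega)
          simp only [conD, frozenD, abs_mul, ← e1] at this
          calc _ ≤ M := this
            _ ≤ _ := le_mul_of_one_le_left (sum_nonneg fun _ _ => abs_nonneg _) (one_le_pow₀ hB1)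
        · have := hq (δ, 0) (by
            simp only [wt, mul_zero, add_zero]
            refine le_trans (sum_le_sum fun l _ => ?_) (Nat.le_add_right _ _)
            by_cases hl : l = i
            · subst hl; exact hlt.le
            · exact (hδk l hl).le)
          simp only [conD, frozenD, abs_mul, Pi.single_zero, add_zero] at this
          have e2 : |a| ≤ max B 1 ^ α i * |s (z i) ^ δ i| := by
            rw [ha, abs_pow, abs_pow, show α i = (α i - δ i) + δ i by omega, pow_add]
            gcongr ?_ * _
            calc |s (z i)| ^ (α i - δ i) ≤ max B 1 ^ (α i - δ i) := by gcongr
              _ ≤ max B 1 ^ (α i - δ i + δ i) := pow_le_pow_right₀ hB1 (by omega)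
          calc _ ≤ max B 1 ^ α i * |s (z i) ^ δ i| * |pdMulti δ f z| := by gcongr
            _ = max B 1 ^ α i * (|s (z i) ^ δ i| * |pdMulti δ f z|) := by ring
            _ ≤ _ := by gcongr
    have e3 : conD i s (α, k) (zD i s i f) z - conD i s ((α, k) + (single i 1, 0)) f z =
        pdMulti (α + single i k) (fun z => s (z i) * (a * pd i f z)) z -
          s (z i) * pdMulti (α + single i k) (fun w => a * pd i f w) z := by
      have e4 : (fun z : Fin d → ℝ => s (z i) * (a * pd i f z)) =
          fun z => a * (s (z i) * pd i f z) := by funext w; ring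
      have e5 : zD i s i f = fun z => s (z i) * pd i f z := by funext w; simp [zD]
      rw [e4, pdMulti_const_mul ((smooth_coord hs i).mul hpf), pdMulti_const_mul hpf,
        ← pdMulti_succ' hf, e5]
      simp only [conD, frozenD, Prod.fst_add, Prod.snd_add, Pi.add_apply, Pi.single_eq_same,
        add_zero]
      rw [add_right_comm, ← ha, pow_succ]
      ring
    rw [e3]
    calc _ = ofReal |_| := Real.enorm_eq_ofReal_abs _
      _ ≤ ofReal (C * (max B 1 ^ α i * M)) := ofReal_le_ofReal key
      _ = _ := by
        rw [← mul_assoc, ofReal_mul (by positivity), hM,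
          ENNReal.ofReal_sum_of_nonneg fun _ _ => abs_nonneg _]
        simp only [Real.enorm_eq_ofReal_abs]
        rfl
  · refine ⟨0, fun f hf z hz => ?_⟩
    have e1 : conD e s (α, k) (zD e s i f) z = conD e s ((α, k) + (single i 1, 0)) f z := by
      have : zD e s i f = pd i f := by funext w; simp [zD, hi]
      rw [this]
      simp only [conD, frozenD, Prod.fst_add, Prod.snd_add, Pi.add_apply, add_zero]
      rw [← pdMulti_succ' hf, add_right_comm, Pi.single_eq_of_ne (Ne.symm hi), add_zero]
    rw [e1, sub_self]
    simp

theorem lintegral_conD_zD_le (hK : IsCompact K) (e : Fin d) (hs : Smooth s) (p : Ord d)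
    (i : Fin d) :
    ∃ C : NNReal, ∀ S : Fin d → Set ℝ, (∀ i, MeasurableSet (S i)) → S e ⊆ K →
    ∀ f : Fn d, Smooth f →
      (∫⁻ z in univ.pi S, ‖conD e s p (zD e s i f) z‖ₑ ^ 2 ≤
        C * levSq e s true S (wt p + 1) f) ∧
      ∫⁻ z in univ.pi S, ‖conD e s (p + (single i 1, 0)) f z‖ₑ ^ 2 ≤
        2 * (∫⁻ z in univ.pi S, ‖conD e s p (zD e s i f) z‖ₑ ^ 2) +
          C * levSq e s true S (wt p) f := by
  obtain ⟨C, hC⟩ := conD_zD_sub_le hK e hs p i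
  set N : NNReal := ((ords d true (wt p)).card : NNReal)
  refine ⟨2 + 2 * (C ^ 2 * N), fun S hS hSK f hf => ?_⟩
  have hm := fun p f (hf : Smooth f) =>
    measurable_conD (e := e) (f := f) hs.continuous.measurable p hf
  have hm3 : Measurable fun z => ∑ q ∈ ords d true (wt p), ‖conD e s q f z‖ₑ :=
    Finset.measurable_fun_sum _ fun q _ => (hm q f hf).enorm
  have H : ∀ A B : Fn d, Measurable B → (∀ z, z e ∈ K → ‖A z - B z‖ₑ ≤
      C * ∑ q ∈ ords d true (wt p), ‖conD e s q f z‖ₑ) →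
      ∫⁻ z in univ.pi S, ‖A z‖ₑ ^ 2 ≤ 2 * (∫⁻ z in univ.pi S, ‖B z‖ₑ ^ 2) +
        2 * (C ^ 2 * N * levSq e s true S (wt p) f) := fun A B hB hAB => by
    calc _ ≤ ∫⁻ z in univ.pi S, (‖B z‖ₑ +
          C * ∑ q ∈ ords d true (wt p), ‖conD e s q f z‖ₑ) ^ 2 := by
          refine setLIntegral_mono' (MeasurableSet.univ_pi hS) fun z hz => ?_
          gcongr
          refine le_trans ?_ (add_le_add_right (hAB z (hSK (hz e (Set.mem_univ e)))) _)
          simpa using enorm_add_le (B z) (A z - B z)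
      _ ≤ _ := by
          refine (lintegral_add_sq_le _ hB.enorm (hm3.const_mul _)).trans ?_
          rw [lintegral_const_mul_sq _ _ hm3, mul_assoc]
          gcongr
          exact lintegral_sum_sq_le _ _ fun q => (hm q f hf).enorm
  constructor
  · calc _ ≤ _ := H _ _ (hm _ f hf) fun z hz => hC f hf z hz
      _ ≤ 2 * levSq e s true S (wt p + 1) f +
          2 * (C ^ 2 * N * levSq e s true S (wt p + 1) f) := by
          gcongr
          · exact le_levSq _ (by rw [wt_add]; simp [wt]) (by simp)
          · exact levSq_mono (Nat.le_succ _) f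
      _ = _ := by push_cast; ring
  · calc _ ≤ _ := H _ _ (hm _ _ (smooth_zD hs i hf)) fun z hz => by
          rw [← enorm_neg, neg_sub]; exact hC f hf z hz
      _ ≤ _ := by
          rw [← mul_assoc]
          gcongr
          push_cast
          exact le_add_self

/-- The Moser estimate for smooth functions. In the anisotropic case, the conormal derivatives
`Z_i Y` have to be bounded: for odd `n` one of them is differentiated `n - 1` times. -/
theorem moser_smooth (e : Fin d) (hs : Smooth s) (κ : ℝ) (hκ : 0 < κ) (hK : IsCompact K)
    (bare : Bool) (n : ℕ) (hΦ : Smooth Φ) (h0 : Φ 0 = 0) (R : NNReal) :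
    ∃ C : NNReal, ∀ S Y, BoundedOn e s κ R S Y → S e ⊆ K →
    (bare = true → ∀ i k, ∀ z ∈ univ.pi S, ‖zD e s i (Y k) z‖ₑ ≤ R) →
      levSq e s bare S n (fun z => Φ fun k => Y k z) ≤ C * ∑ k, levSq e s bare S n (Y k) := by
  have hsm := hs.continuous.measurable
  induction n with
  | zero =>
    obtain ⟨C, hC⟩ := moser_zero hΦ h0 R
    exact ⟨C, fun S Y hY _ _ => hC e s κ bare S Y hY⟩
  | succ n ih =>
    obtain ⟨C₀, h₀⟩ := ih
    have hterm (p : Ord d) : ∃ C : NNReal, p ∈ ords d bare (n + 1) →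
        ∀ S Y, BoundedOn e s κ R S Y → S e ⊆ K →
        (bare = true → ∀ i k, ∀ z ∈ univ.pi S, ‖zD e s i (Y k) z‖ₑ ≤ R) →
        ∫⁻ z in univ.pi S, ‖conD e s p (fun z => Φ fun k => Y k z) z‖ₑ ^ 2 ≤
          C * ∑ k, levSq e s bare S (n + 1) (Y k) := by
      by_cases hp : p ∈ ords d bare (n + 1)
      swap
      · exact ⟨0, fun h => absurd h hp⟩
      have hp' := mem_ords.mp hp
      rcases Nat.lt_or_ge (wt p) (n + 1) with hlt | hge
      · refine ⟨C₀, fun _ S Y hY hSK hZ =>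
          (le_levSq _ (Nat.lt_succ_iff.mp hlt) hp'.2).trans ((h₀ S Y hY hSK hZ).trans ?_)⟩
        gcongr
        exact levSq_mono (Nat.le_succ _) _
      have hpn : wt p = n + 1 := le_antisymm hp'.1 hge
      by_cases hev : bare = true → Even (n + 1)
      · obtain ⟨C, hC⟩ := moser_top e s hsm κ hκ bare (n + 1) (by omega) hev hΦ R
        exact ⟨C, fun _ S Y hY _ _ => hC S Y hY p hp hpn⟩
      -- the anisotropic case with `n + 1` odd
      push Not at hev
      obtain ⟨hb, hodd⟩ := hev
      subst hb
      have hn : Even n := by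
        simpa [Nat.even_add_one] using hodd
      obtain ⟨α, k⟩ := p
      obtain ⟨i, hi⟩ : ∃ i, α i ≠ 0 := by
        by_contra! hcon
        simp only [wt, hcon, Finset.sum_const_zero, zero_add] at hpn
        obtain ⟨r, hr⟩ := hn
        omega
      set q : Ord d := (α - single i 1, k) with hq
      have hpq : ((α, k) : Ord d) = q + (single i 1, 0) := by
        simp [hq, sub_add_single hi]
      have hqn : wt q = n := by
        rw [hpq, wt_add] at hpn
        simp only [wt, Finset.sum_pi_single', mem_univ, if_true, mul_zero,
          add_zero] at hpn ⊢
        simpa using hpn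
      obtain ⟨C₁, h₁⟩ := lintegral_conD_zD_le hK e hs q i
      choose C₂ h₂ using fun q' => lintegral_conD_zD_le hK e hs q' i
      -- the function with `Z_i Φ(Y) = Φ'(Y, Z_i Y)`
      set Φ' : (ι ⊕ ι → ℝ) → ℝ := fun y =>
        ∑ k, fderiv ℝ Φ (fun k => y (Sum.inl k)) (single k 1) * y (Sum.inr k) with hΦ'
      have hΦ's : Smooth Φ' := by
        refine ContDiff.sum fun k _ => ContDiff.mul ?_ (contDiff_apply ℝ ℝ _)
        refine ContDiff.clm_apply ?_ contDiff_const
        exact (hΦ.fderiv_right (m := ∞) (by simp)).comp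
          (contDiff_pi.mpr fun k => contDiff_apply ℝ ℝ _)
      have hev : ∃ C : NNReal, ∀ S (Y : ι ⊕ ι → Fn d), BoundedOn e s κ R S Y →
          ∫⁻ z in univ.pi S, ‖conD e s q (fun z => Φ' fun k => Y k z) z‖ₑ ^ 2 ≤
            C * ∑ k, levSq e s true S n (Y k) := by
        rcases Nat.eq_zero_or_pos n with rfl | hn0
        · obtain ⟨C, hC⟩ := moser_zero hΦ's (by simp [hΦ']) R
          exact ⟨C, fun S Y hY => (le_levSq _ hqn.le (by simp)).trans (hC e s κ true S Y hY)⟩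
        · obtain ⟨C, hC⟩ := moser_top e s hsm κ hκ true n hn0 (fun _ => hn) hΦ's R
          exact ⟨C, fun S Y hY => hC S Y hY q (mem_ords.mpr ⟨hqn.le, by simp⟩) hqn⟩
      obtain ⟨C₃, h₃⟩ := hev
      refine ⟨2 * C₃ * (1 + ∑ q' ∈ ords d true n, C₂ q') + C₁ * C₀,
        fun _ S Y hY' hSK hZ => ?_⟩
      have ⟨hS, hY, hYR⟩ := hY'
      have hu : Smooth fun z => Φ fun k => Y k z := hΦ.comp (contDiff_pi.mpr hY)
      have hZu : zD e s i (fun z => Φ fun k => Y k z) = fun z => Φ' fun k =>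
          (Sum.elim Y (fun k => zD e s i (Y k)) k : Fn d) z := by
        funext z
        simp only [zD, hΦ', pd_comp hΦ hY, Sum.elim_inl, Sum.elim_inr]
        rw [mul_sum]
        exact sum_congr rfl fun k _ => by ring
      have hlevZ k : levSq e s true S n (zD e s i (Y k)) ≤
          (∑ q' ∈ ords d true n, C₂ q' : NNReal) * levSq e s true S (n + 1) (Y k) := by
        push_cast
        rw [levSq, sum_mul]
        refine sum_le_sum fun q' hq' => ?_
        refine (h₂ q' S hS.2.2 hSK (Y k) (hY k)).1.trans ?_
        gcongr
        exact levSq_mono (Nat.succ_le_succ (mem_ords.mp hq').1) _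
      rw [hpq]
      refine (h₁ S hS.2.2 hSK _ hu).2.trans ?_
      rw [hqn, hZu]
      have h4 := h₃ S (Sum.elim Y fun k => zD e s i (Y k)) ⟨hS, ?_, ?_⟩
      · rw [Fintype.sum_sum_type] at h4
        simp only [Sum.elim_inl, Sum.elim_inr] at h4
        calc _ ≤ 2 * (C₃ * ((∑ k, levSq e s true S (n + 1) (Y k)) +
              ∑ k, (∑ q' ∈ ords d true n, C₂ q' : NNReal) * levSq e s true S (n + 1) (Y k))) +
              C₁ * (C₀ * ∑ k, levSq e s true S (n + 1) (Y k)) := by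
              gcongr
              · refine h4.trans ?_
                gcongr with k _ k _
                · exact levSq_mono (Nat.le_succ _) _
                · exact hlevZ k
              · refine (h₀ S Y hY' hSK hZ).trans ?_
                gcongr with k _
                exact levSq_mono (Nat.le_succ _) _
          _ = _ := by
              rw [← mul_sum]
              push_cast
              ring
      · rintro (k | k)
        · exact hY k
        · exact smooth_zD hs i (hY k)
      · rintro (k | k)
        · exact hYR k
        · exact hZ rfl i k
    choose C hC using hterm
    refine ⟨∑ p ∈ ords d bare (n + 1), C p, fun S Y hY hSK hZ => ?_⟩
    push_cast
    rw [levSq, sum_mul]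
    exact sum_le_sum fun p hp => hC p hp S Y hY hSK hZ

end

end

section

/-! ### Calculus of weak derivatives -/

variable {A : Set (Fin d → ℝ)}

theorem IsTest.eq_zero (h : IsTest A φ) (hz : z ∉ A) :
    φ z = 0 := image_eq_zero_of_notMem_tsupport fun h' => hz (h.2.2 h')

theorem tsupport_pd_subset (φ : Fn d) (i) : tsupport (pd i φ) ⊆ tsupport φ :=
  tsupport_fderiv_apply_subset ℝ _

theorem IsTest.pd (h : IsTest A φ) (i : Fin d) : IsTest A (pd i φ) :=
  ⟨smooth_pd h.1 i, h.2.1.mono' (subset_closure.trans (tsupport_pd_subset φ i)),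
    (tsupport_pd_subset φ i).trans h.2.2⟩

theorem IsTest.pdMulti (h : IsTest A φ) (α) :
    IsTest A (pdMulti α φ) := by
  induction α using multiIndex_ind with
  | h0 => simpa using h
  | h1 α i ih => rw [pdMulti_succ h.1]; exact ih.pd i

/-- A test function times a function which is smooth on the domain is a test function. -/
theorem IsTest.mul (hA : IsOpen A) (h : IsTest A φ)
    (hc : ContDiffOn ℝ ∞ c A) : IsTest A fun z => c z * φ z := by
  have hsub : tsupport (fun z => c z * φ z) ⊆ tsupport φ := tsupport_mul_subset_right
  refine ⟨contDiff_iff_contDiffAt.mpr fun z => ?_, h.2.1.mono' (subset_closure.trans hsub),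
    hsub.trans h.2.2⟩
  by_cases hz : z ∈ A
  · exact (hc.contDiffAt (hA.mem_nhds hz)).mul h.1.contDiffAt
  · exact (contDiffAt_const).congr_of_eventuallyEq
      (notMem_tsupport_iff_eventuallyEq.mp (fun h' => hz (h.2.2 (hsub h'))))

theorem IsTest.integrableOn (h : IsTest A φ)
    (hu : LocallyIntegrableOn u A) : IntegrableOn (fun z => u z * φ z) A := by
  have h1 :=
    (hu.integrableOn_compact_subset h.2.2 h.2.1).mul_continuousOn h.1.continuous.continuousOn
      h.2.1
  rw [integrableOn_iff_integrable_of_support_subset] at h1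
  · exact h1.integrableOn
  · intro z hz
    exact subset_closure (fun h0 : φ z = 0 => hz (by simp [h0]))

theorem ae_eq_of_forall_test (hA : IsOpen A)
    (hf : LocallyIntegrableOn f A) (hg : LocallyIntegrableOn g A)
    (h : ∀ φ, IsTest A φ → ∫ z in A, f z * φ z = ∫ z in A, g z * φ z) :
    f =ᵐ[volume.restrict A] g := by
  have := hA.ae_eq_zero_of_integral_contDiff_smul_eq_zero (hf.sub hg) fun φ h1 h2 h3 => by
    have hφ : IsTest A φ := ⟨h1, h2, h3⟩
    have h4 : ∫ z in A, (f z * φ z - g z * φ z) = 0 := by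
      rw [integral_sub (hφ.integrableOn hf) (hφ.integrableOn hg), h φ hφ, sub_self]
    rw [← setIntegral_eq_integral_of_forall_compl_eq_zero]
    · rw [← h4]
      refine integral_congr_ae (of_forall fun z => ?_)
      simp only [smul_eq_mul, Pi.sub_apply]; ring
    · intro z hz; simp [hφ.eq_zero hz]
  rw [Filter.EventuallyEq, ae_restrict_iff' hA.measurableSet]
  filter_upwards [this] with z hz hzA
  exact sub_eq_zero.mp (hz hzA)

theorem integral_mul_congr (h : f =ᵐ[volume.restrict A] g) :
    ∫ z in A, f z * φ z = ∫ z in A, g z * φ z :=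
  integral_congr_ae (h.mono fun z hz => by grind)


theorem weakDeriv_single :
    IsWeakDeriv D (single i 1) u g ↔ IsWeakPartial D i u g := by
  refine and_congr_right fun _ => and_congr_right fun _ => forall₂_congr fun φ hφ => ?_
  rw [pdMulti_single hφ.1]
  simp

theorem IsWeakDeriv.unique (hD : IsOpen D.cover)
    (h : IsWeakDeriv D α u g) (h' : IsWeakDeriv D α u g') :
    g =ᵐ[vol D] g' :=
  ae_eq_of_forall_test hD h.2.1 h'.2.1 fun φ hφ => by
    have h1 := h.2.2 φ hφ
    rw [h'.2.2 φ hφ] at h1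
    exact (mul_left_cancel₀ (pow_ne_zero _ (by norm_num)) h1).symm

theorem IsWeakPartial.unique (hD : IsOpen D.cover)
    (h : IsWeakPartial D i u g) (h' : IsWeakPartial D i u g') :
    g =ᵐ[vol D] g' :=
  (weakDeriv_single.2 h).unique hD (weakDeriv_single.2 h')

theorem IsWeakDeriv.congr (h : IsWeakDeriv D α u g)
    (hu : u =ᵐ[vol D] u') (hg : g =ᵐ[vol D] g') :
    IsWeakDeriv D α u' g' :=
  ⟨h.1.congr hu, h.2.1.congr hg, fun φ hφ => by
    rw [← integral_mul_congr hu, ← integral_mul_congr hg, h.2.2 φ hφ]⟩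

theorem IsWeakPartial.congr (h : IsWeakPartial D i u g)
    (hu : u =ᵐ[vol D] u') (hg : g =ᵐ[vol D] g') :
    IsWeakPartial D i u' g' := weakDeriv_single.1 ((weakDeriv_single.2 h).congr hu hg)

theorem IsWeakDeriv.add (hu : IsWeakDeriv D α u g)
    (hv : IsWeakDeriv D α v h) :
    IsWeakDeriv D α (fun z => u z + v z) (fun z => g z + h z) := by
  refine ⟨hu.1.add hv.1, hu.2.1.add hv.2.1, fun φ hφ => ?_⟩
  simp_rw [add_mul]
  rw [integral_add ((hφ.pdMulti α).integrableOn hu.1) ((hφ.pdMulti α).integrableOn hv.1),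
    integral_add (hφ.integrableOn hu.2.1) (hφ.integrableOn hv.2.1), hu.2.2 φ hφ, hv.2.2 φ hφ]
  ring

theorem IsWeakDeriv.const_mul (h : IsWeakDeriv D α u g)
    (c) : IsWeakDeriv D α (fun z => c * u z) (fun z => c * g z) := by
  refine ⟨h.1.smul c, h.2.1.smul c, fun φ hφ => ?_⟩
  simp_rw [mul_assoc]
  rw [integral_const_mul, integral_const_mul, h.2.2 φ hφ]
  ring

theorem IsWeakPartial.const_mul (h : IsWeakPartial D i u g)
    (c) : IsWeakPartial D i (fun z => c * u z) (fun z => c * g z) :=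
  weakDeriv_single.1 ((weakDeriv_single.2 h).const_mul c)

theorem isWeakPartial_zero (i) : IsWeakPartial D i (fun _ => 0) (fun _ => 0) :=
  ⟨locallyIntegrableOn_zero, locallyIntegrableOn_zero, by simp⟩

theorem isWeakDeriv_zero_iff (hD : IsOpen D.cover) :
    IsWeakDeriv D 0 u g ↔ LocallyIntegrableOn u D.cover ∧ u =ᵐ[vol D] g := by
  constructor
  · intro h
    refine ⟨h.1, ae_eq_of_forall_test hD h.1 h.2.1 fun φ hφ => ?_⟩
    simpa using h.2.2 φ hφ
  · rintro ⟨h1, h2⟩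
    refine ⟨h1, h1.congr h2, fun φ hφ => ?_⟩
    simpa using integral_mul_congr h2

theorem sum_add_single (α : Fin d → ℕ) (i) :
    ∑ j, (α + single i 1 : Fin d → ℕ) j = (∑ j, α j) + 1 := by
  simp [sum_add_distrib]

theorem IsWeakDeriv.partial {α : Fin d → ℕ}
    (hg : IsWeakDeriv D α u g) (hh : IsWeakPartial D i g h) :
    IsWeakDeriv D (α + single i 1) u h := by
  refine ⟨hg.1, hh.2.1, fun φ hφ => ?_⟩
  rw [pdMulti_succ' hφ.1, hg.2.2 _ (hφ.pd i), hh.2.2 φ hφ, sum_add_single]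
  ring

theorem IsWeakDeriv.of_trans
    (hg : IsWeakDeriv D α u g) (hh : IsWeakDeriv D (α + β) u h) : IsWeakDeriv D β g h := by
  refine ⟨hg.2.1, hh.2.1, fun φ hφ => ?_⟩
  have h1 := hh.2.2 φ hφ
  rw [← pdMulti_pdMulti hφ.1, hg.2.2 _ (hφ.pdMulti β)] at h1
  simp only [Pi.add_apply, sum_add_distrib, pow_add, mul_assoc] at h1
  exact mul_left_cancel₀ (pow_ne_zero _ (by norm_num)) h1

theorem locInt_mul (hD : IsOpen D.cover)
    (hc : ContinuousOn c D.cover) (hu : LocallyIntegrableOn u D.cover) :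
    LocallyIntegrableOn (fun z => c z * u z) D.cover :=
  hu.continuousOn_mul hc hD.isLocallyClosed

/-- Classical derivatives are weak derivatives. -/
theorem isWeakPartial_of_contDiff (hu : Smooth u) (i) :
    IsWeakPartial D i u (pd i u) := by
  refine ⟨(hu.continuous.locallyIntegrable).locallyIntegrableOn _,
    ((smooth_pd hu i).continuous.locallyIntegrable).locallyIntegrableOn _, fun φ hφ => ?_⟩
  have hI : ∀ (f ψ), Continuous f → IsTest D.cover ψ →
      Integrable fun z => f z * ψ z := fun f ψ hf hψ =>
    (hf.mul hψ.1.continuous).integrable_of_hasCompactSupport hψ.2.1.mul_left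
  rw [setIntegral_eq_integral_of_forall_compl_eq_zero fun z hz => by simp [(hφ.pd i).eq_zero hz],
    setIntegral_eq_integral_of_forall_compl_eq_zero fun z hz => by simp [hφ.eq_zero hz]]
  exact integral_mul_fderiv_eq_neg_fderiv_mul_of_integrable
    (hI _ _ (smooth_pd hu i).continuous hφ) (hI _ _ hu.continuous (hφ.pd i))
    (hI _ _ hu.continuous hφ) (fun z _ => hu.differentiable (by simp) z)
    (fun z _ => hφ.1.differentiable (by simp) z)

theorem isWeakDeriv_of_contDiff (hD : IsOpen D.cover)
    (hu : Smooth u) (α) : IsWeakDeriv D α u (pdMulti α u) := by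
  induction α using multiIndex_ind with
  | h0 =>
    rw [pdMulti_zero, isWeakDeriv_zero_iff hD]
    exact ⟨(hu.continuous.locallyIntegrable).locallyIntegrableOn _, EventuallyEq.rfl⟩
  | h1 α i ih =>
    have := ih.partial (isWeakPartial_of_contDiff (smooth_pdMulti hu α) i)
    rwa [← pdMulti_succ hu] at this

theorem weakPartial_spec (h : IsWeakPartial D i u g) :
    IsWeakPartial D i u (weakPartial D i u) := by
  rw [weakPartial, dif_pos ⟨g, h⟩]
  grind

theorem weakPartial_ae_eq (hD : IsOpen D.cover)
    (h : IsWeakPartial D i u g) : weakPartial D i u =ᵐ[vol D] g :=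
  (weakPartial_spec h).unique hD h

/-! ### Periodicity almost everywhere -/

/-- The integer translations which leave the domain invariant. -/
def IsShift (D : PeriodicDomain d) (v : Fin d → ℤ) : Prop := ∀ i, i ∉ D.torus → v i = 0

/-- The integer vector `v` as an element of `ℝ^d`. -/
def shiftVec (v : Fin d → ℤ) : Fin d → ℝ := fun i => v i

/-- `f` is almost everywhere invariant under the periods of the domain. -/
def AEPeriodic (D : PeriodicDomain d) (f : Fn d) : Prop :=
  ∀ v, IsShift D v → (fun z => f (z + shiftVec v)) =ᵐ[vol D] f

/-- The domain is invariant under its periods. -/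
def IsInvariant (D : PeriodicDomain d) : Prop :=
  ∀ v, IsShift D v → ∀ z, z + shiftVec v ∈ D.cover ↔ z ∈ D.cover

theorem IsPeriodic.shift {u : (Fin d → ℝ) → E} (hu : IsPeriodic D u)
    (hv : IsShift D v) (z) : u (z + shiftVec v) = u z := by
  have h1 : ∀ i ∈ D.torus, ∀ (n : ℕ) z, u (z + single i n) = u z := by
    intro i hi n
    induction n with
    | zero => simp
    | succ n ih =>
      intro z
      have : z + single i ((n + 1 : ℕ) : ℝ) = (z + single i n) + single i 1 := by
        rw [add_assoc, ← Pi.single_add]; push_cast; rfl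
      rw [this, hu i hi, ih]
  have h2 : ∀ i ∈ D.torus, ∀ (n : ℤ) z, u (z + single i n) = u z := by
    intro i hi n z
    rcases n.eq_nat_or_neg with ⟨n, rfl | rfl⟩
    · exact_mod_cast h1 i hi n z
    · have := h1 i hi n (z + single i ((-n) : ℝ))
      rw [add_assoc, ← Pi.single_add] at this
      simpa using this.symm
  have h3 : ∀ t z, u (z + ∑ i ∈ t, single i (v i : ℝ)) = u z := by
    intro t
    induction t using Finset.induction_on with
    | empty => simp
    | insert i t hi ih =>
      intro z
      rw [Finset.sum_insert hi, add_comm (single i _), ← add_assoc]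
      by_cases hit : i ∈ D.torus
      · grind
      · rw [hv i hit]; simpa using ih z
  have h4 := h3 Finset.univ z
  rwa [show (∑ i, single i (v i : ℝ)) = shiftVec v from Finset.univ_sum_single _] at h4

theorem IsPeriodic.ae (hu : IsPeriodic D u) : AEPeriodic D u :=
  fun _ hv => of_forall fun z => hu.shift hv z

theorem isShift_neg {v : Fin d → ℤ} (h : IsShift D v) : IsShift D (-v) := fun i hi => by
  simp [h i hi]

theorem shiftVec_neg (v : Fin d → ℤ) : shiftVec (-v) = -shiftVec v := by
  funext i; simp [shiftVec]

theorem pd_comp_add (w) (i) :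
    pd i (fun z => φ (z + w)) = fun z => pd i φ (z + w) := by
  funext z
  simp only [pd, fderiv_comp_add_right]

theorem pdMulti_comp_add (hφ : Smooth φ) (w)
    (α) : pdMulti α (fun z => φ (z + w)) = fun z => pdMulti α φ (z + w) := by
  induction α using multiIndex_ind with
  | h0 => simp
  | h1 α i ih =>
    have hc : Smooth fun z => φ (z + w) := hφ.comp (contDiff_id.add contDiff_const)
    rw [pdMulti_succ hc, ih, pd_comp_add, pdMulti_succ hφ]

theorem measurePreserving_shift (hD : IsOpen D.cover) (hI : IsInvariant D)
    {v : Fin d → ℤ} (hv : IsShift D v) :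
    MeasurePreserving (fun z => z + shiftVec v) (vol D)
      (vol D) := by
  have h := (measurePreserving_add_right volume (shiftVec v)).restrict_preimage hD.measurableSet
  have : (fun z => z + shiftVec v) ⁻¹' D.cover = D.cover := by
    ext z; exact hI v hv z
  grind

theorem integral_shift (hD : IsOpen D.cover) (hI : IsInvariant D) {v : Fin d → ℤ}
    (hv : IsShift D v) (f : Fn d) :
    ∫ z in D.cover, f (z + shiftVec v) = ∫ z in D.cover, f z :=
  (measurePreserving_shift hD hI hv).integral_comp
    (measurableEmbedding_addRight (shiftVec v)) f

theorem locInt_shift (hI : IsInvariant D) {v : Fin d → ℤ} (hv : IsShift D v)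
    (hf : LocallyIntegrableOn f D.cover) :
    LocallyIntegrableOn (fun z => f (z + shiftVec v)) D.cover := by
  intro z hz
  obtain ⟨U, hU, hfU⟩ := hf (z + shiftVec v) ((hI v hv z).mpr hz)
  refine ⟨(fun z => z + shiftVec v) ⁻¹' U, ?_, ?_⟩
  · exact ((continuous_id.add continuous_const).continuousWithinAt.tendsto_nhdsWithin
      fun w => (hI v hv w).mpr) hU
  · exact ((measurePreserving_add_right volume (shiftVec v)).integrableOn_comp_preimage
      (measurableEmbedding_addRight (shiftVec v))).mpr hfU

theorem IsTest.shift (hI : IsInvariant D) {v : Fin d → ℤ} (hv : IsShift D v)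
    (hφ : IsTest D.cover φ) :
    IsTest D.cover fun z => φ (z + shiftVec v) := by
  have he : (fun z => φ (z + shiftVec v)) = φ ∘ Homeomorph.addRight (shiftVec v) := rfl
  refine ⟨hφ.1.comp (contDiff_id.add contDiff_const), ?_, ?_⟩
  · rw [he]; exact hφ.2.1.comp_homeomorph _
  · rw [he, tsupport_comp_eq_preimage φ (Homeomorph.addRight (shiftVec v))]
    intro z hz
    exact (hI v hv z).mp (hφ.2.2 hz)

theorem IsWeakDeriv.shift (hD : IsOpen D.cover) (hI : IsInvariant D) {v : Fin d → ℤ}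
    (hv : IsShift D v) {α : Fin d → ℕ} (h : IsWeakDeriv D α u g) :
    IsWeakDeriv D α (fun z => u (z + shiftVec v)) (fun z => g (z + shiftVec v)) := by
  refine ⟨locInt_shift hI hv h.1, locInt_shift hI hv h.2.1,
    fun φ hφ => ?_⟩
  have h1 := h.2.2 _ (hφ.shift hI (isShift_neg hv))
  rw [pdMulti_comp_add hφ.1, ← integral_shift hD hI hv,
    ← integral_shift hD hI hv (fun z => g z * _)] at h1
  simpa [shiftVec_neg] using h1

theorem IsWeakDeriv.aePeriodic (hD : IsOpen D.cover) (hI : IsInvariant D)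
    {α : Fin d → ℕ} (h : IsWeakDeriv D α u g) (hu : AEPeriodic D u) :
    AEPeriodic D g := fun v hv =>
  ((h.shift hD hI hv).congr (hu v hv) EventuallyEq.rfl).unique hD h

end

section

open scoped Convolution

/-! ### Mollification with a contraction into the domain -/

/-- The parameter `δ = 1 / (n + 2)` of the `n`-th mollification. -/
def mollR (n : ℕ) : ℝ := 1 / (n + 2)

theorem mollR_pos (n : ℕ) : 0 < mollR n := by unfold mollR; positivity

theorem mollR_le (n : ℕ) : mollR n ≤ 1 / 2 := by
  unfold mollR
  apply one_div_le_one_div_of_le (by norm_num)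
  have : 0 ≤ n := n.cast_nonneg
  linarith

theorem tendsto_mollR : Tendsto mollR atTop (𝓝[>] 0) := by
  refine tendsto_nhdsWithin_iff.mpr ⟨?_, of_forall mollR_pos⟩
  exact (tendsto_const_nhds).div_atTop
      (tendsto_atTop_add_const_right _ _ tendsto_natCast_atTop_atTop)

/-- The mollifying bump function, supported in the ball of radius `δ / 4`. -/
def mollBump (d n : ℕ) : ContDiffBump (0 : Fin d → ℝ) where
  rIn := mollR n / 8
  rOut := mollR n / 4
  rIn_pos := by have := mollR_pos n; positivity
  rIn_lt_rOut := by have := mollR_pos n; linarith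

/-- The mollifying kernel. -/
def mollKer (d n : ℕ) : Fn d := (mollBump d n).normed volume

theorem smooth_mollKer (n) : Smooth (mollKer d n) :=
  (mollBump d n).contDiff_normed

theorem compact_mollKer (n) : HasCompactSupport (mollKer d n) :=
  (mollBump d n).hasCompactSupport_normed

theorem mollKer_nonneg (n) (z) : 0 ≤ mollKer d n z :=
  (mollBump d n).nonneg_normed z

theorem tsupport_mollKer (n) :
    tsupport (mollKer d n) = closedBall 0 (mollR n / 4) :=
  (mollBump d n).tsupport_normed_eq

theorem mollKer_eq_zero (h : z ∉ closedBall 0 (mollR n / 4)) :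
    mollKer d n z = 0 := by
  rw [← tsupport_mollKer] at h
  exact image_eq_zero_of_notMem_tsupport h

theorem lintegral_mollKer (n) : ∫⁻ z, ofReal (mollKer d n z) = 1 := by
  have hint : Integrable (mollKer d n) := (mollBump d n).integrable_normed
  rw [← ofReal_integral_eq_lintegral_ofReal hint (of_forall (mollKer_nonneg n))]
  change ofReal (∫ z, (mollBump d n).normed volume z) = 1
  rw [(mollBump d n).integral_normed]; simp

theorem lintegral_mollKer_sub (n) (y) :
    ∫⁻ w, ofReal (mollKer d n (y - w)) = 1 := by
  rw [lintegral_sub_left_eq_self (fun w => ofReal (mollKer d n w)) y, lintegral_mollKer]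

/-- The convolution of `f` with `ρ`. -/
def conv (f ρ : Fn d) : Fn d := f ⋆[ContinuousLinearMap.mul ℝ ℝ, volume] ρ

theorem conv_apply (f ρ : Fn d) (z) :
    conv f ρ z = ∫ w, f w * ρ (z - w) := rfl

theorem smooth_conv (hf : LocallyIntegrable f) (hρ : Smooth ρ)
    (hρc : HasCompactSupport ρ) : Smooth (conv f ρ) :=
  hρc.contDiff_convolution_right _ hf hρ

theorem pd_conv (hf : LocallyIntegrable f) (hρ : Smooth ρ)
    (hρc : HasCompactSupport ρ) (i) : pd i (conv f ρ) = conv f (pd i ρ) := by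
  funext z
  simp only [pd, conv]
  rw [(hρc.hasFDerivAt_convolution_right (ContinuousLinearMap.mul ℝ ℝ) hf (hρ.of_le (by simp)) z).fderiv, convolution_precompR_apply _ hf (hρc.fderiv ℝ)
    (hρ.continuous_fderiv (by simp))]
  rfl

theorem hasCompactSupport_pdMulti (hρ : Smooth ρ)
    (hρc : HasCompactSupport ρ) (α) : HasCompactSupport (pdMulti α ρ) :=
  (IsTest.pdMulti ⟨hρ, hρc, Set.subset_univ _⟩ α).2.1

theorem pdMulti_conv (hf : LocallyIntegrable f) (hρ : Smooth ρ)
    (hρc : HasCompactSupport ρ) (α) :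
    pdMulti α (conv f ρ) = conv f (pdMulti α ρ) := by
  induction α using multiIndex_ind with
  | h0 => simp
  | h1 α i ih =>
    rw [pdMulti_succ (smooth_conv hf hρ hρc), ih, pd_conv hf (smooth_pdMulti hρ α)
      (hasCompactSupport_pdMulti hρ hρc α), pdMulti_succ hρ]

/-- The affine map `z ↦ ((1 - δ aᵢ) zᵢ + δ bᵢ)ᵢ`. -/
def affMap (a b : Fin d → ℝ) (δ : ℝ) (z : Fin d → ℝ) : Fin d → ℝ :=
  fun i => (1 - δ * a i) * z i + δ * b i

theorem smooth_affMap (a b : Fin d → ℝ) (δ : ℝ) : Smooth (affMap a b δ) :=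
  contDiff_pi.mpr fun i => (contDiff_const.mul (contDiff_apply ℝ ℝ i)).add contDiff_const

theorem pd_comp_affMap (hG : Smooth G) (a b : Fin d → ℝ) (δ)
    (i) : pd i (fun z => G (affMap a b δ z)) =
      fun z => (1 - δ * a i) * pd i G (affMap a b δ z) := by
  rw [pd_comp hG
    (fun k => contDiff_pi.mp (smooth_affMap a b δ) k)]
  funext z
  have h k : pd i (fun z => affMap a b δ z k) z = if i = k then 1 - δ * a i else 0 := by
    simp only [affMap]
    rw [pd_coord (c := fun t => (1 - δ * a k) * t + δ * b k) (by fun_prop) k i z]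
    split_ifs with hik <;> simp [hik]
  simp only [h, mul_ite, mul_zero, Finset.sum_ite_eq, mem_univ, if_true]
  rw [mul_comm]; rfl

theorem pdMulti_comp_affMap (hG : Smooth G) (a b : Fin d → ℝ) (δ)
    (α) : pdMulti α (fun z => G (affMap a b δ z)) =
      fun z => (∏ i, (1 - δ * a i) ^ α i) * pdMulti α G (affMap a b δ z) := by
  have hcomp : ∀ {H : Fn d}, Smooth H →
      Smooth fun z => H (affMap a b δ z) := fun h => h.comp (smooth_affMap a b δ)
  induction α using multiIndex_ind with
  | h0 => simp
  | h1 α i ih =>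
    rw [pdMulti_succ (hcomp hG), ih, pd_const_mul (hcomp (smooth_pdMulti hG α)),
      pd_comp_affMap (smooth_pdMulti hG α), pdMulti_succ hG]
    funext z
    rw [← mul_assoc]
    congr 1
    simp only [Pi.add_apply, pow_add, Finset.prod_mul_distrib]
    congr 1
    rw [Finset.prod_eq_single i]
    · simp
    · simp +contextual
    · simp

/-- The shape of the domains considered here: a product of open sets `I i`, which for the periodic
coordinates are the whole line, such that for small `δ` the map `affMap a b δ` moves the domain
into itself, with distance at least `δ / 4` from the boundary. -/
structure IsBox (D : PeriodicDomain d) (I : Fin d → Set ℝ) (a b : Fin d → ℝ) : Prop where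
  cover_eq : D.cover = univ.pi I
  isOpen_side : ∀ i, IsOpen (I i)
  torus_eq : ∀ i ∈ D.torus, I i = univ
  torus_a : ∀ i ∈ D.torus, a i = 0
  torus_b : ∀ i ∈ D.torus, b i = 0
  a_nonneg : ∀ i, 0 ≤ a i
  a_le : ∀ i, a i ≤ 1
  dist_le : ∀ i, ∀ τ ∈ I i, |b i - a i * τ| ≤ 2
  inside : ∀ i, ∀ τ ∈ I i, ∀ δ, 0 < δ → δ ≤ 1 / 2 → ∀ u, |u| ≤ δ / 4 →
    (1 - δ * a i) * τ + δ * b i - u ∈ I i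

/-- The `n`-th mollification of `f`. -/
def moll (D : PeriodicDomain d) (a b : Fin d → ℝ) (n : ℕ) (f : Fn d) :
    Fn d :=
  fun z => conv (D.cover.indicator f) (mollKer d n) (affMap a b (mollR n) z)

variable {I : Fin d → Set ℝ} {a b : Fin d → ℝ}

theorem IsBox.isOpen (h : IsBox D I a b) : IsOpen D.cover := by
  rw [h.cover_eq]
  exact isOpen_set_pi Set.finite_univ fun i _ => h.isOpen_side i

theorem IsBox.invariant (h : IsBox D I a b) : IsInvariant D := by
  intro v hv z
  rw [h.cover_eq]
  simp only [Set.mem_pi, Set.mem_univ, true_implies]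
  refine forall_congr' fun i => ?_
  by_cases hi : i ∈ D.torus
  · simp [h.torus_eq i hi]
  · simp [shiftVec, hv i hi]

theorem IsBox.affMap_sub_mem (h : IsBox D I a b) {z : Fin d → ℝ} (hz : z ∈ D.cover) (n : ℕ)
    {u : Fin d → ℝ} (hu : u ∈ closedBall (0 : Fin d → ℝ) (mollR n / 4)) :
    affMap a b (mollR n) z - u ∈ D.cover := by
  rw [h.cover_eq] at hz ⊢
  intro i hi
  refine h.inside i _ (hz i hi) _ (mollR_pos n) (mollR_le n) _ ?_
  rw [mem_closedBall_zero_iff] at hu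
  exact (norm_le_pi_norm u i).trans hu

theorem smooth_moll (hf : LocallyIntegrable (D.cover.indicator f))
    (n : ℕ) : Smooth (moll D a b n f) :=
  (smooth_conv hf (smooth_mollKer n) (compact_mollKer n)).comp
    (smooth_affMap a b _)

theorem pdMulti_comp_sub (hρ : Smooth ρ) (y : Fin d → ℝ)
    (α : Fin d → ℕ) :
    pdMulti α (fun w => ρ (y - w)) = fun w => (-1) ^ (∑ i, α i) * pdMulti α ρ (y - w) := by
  have h := pdMulti_comp_affMap hρ (fun _ => 2) y 1 α
  have h1 : ∀ w, affMap (fun _ => 2) y 1 w = y - w := by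
    intro w; funext i; simp only [affMap, Pi.sub_apply]; ring
  simp only [h1] at h
  rw [h]
  funext w
  congr 1
  rw [Finset.prod_pow_eq_pow_sum]
  norm_num

/-- Inside the domain, the derivatives of the mollification are mollified weak derivatives. -/
theorem pdMulti_moll (h : IsBox D I a b) {α : Fin d → ℕ}
    (hf : LocallyIntegrable (D.cover.indicator f)) (hg : IsWeakDeriv D α f g) (n : ℕ)
    {z : Fin d → ℝ} (hz : z ∈ D.cover) :
    pdMulti α (moll D a b n f) z = (∏ i, (1 - mollR n * a i) ^ α i) *
      ∫ w in D.cover, g w * mollKer d n (affMap a b (mollR n) z - w) := by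
  set y := affMap a b (mollR n) z with hy
  have hk := smooth_mollKer (d := d) n
  have hkc := compact_mollKer (d := d) n
  unfold moll
  rw [pdMulti_comp_affMap (smooth_conv hf hk hkc), pdMulti_conv hf hk hkc]
  dsimp only
  congr 1
  have htest : IsTest D.cover fun w => mollKer d n (y - w) := by
    have he : (fun w => mollKer d n (y - w)) = mollKer d n ∘ Homeomorph.subLeft y := rfl
    refine ⟨hk.comp (contDiff_const.sub contDiff_id), ?_, ?_⟩
    · rw [he]; exact hkc.comp_homeomorph _
    · rw [he, tsupport_comp_eq_preimage _ (Homeomorph.subLeft y), tsupport_mollKer]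
      intro w hw
      simpa [← hy] using h.affMap_sub_mem hz n hw
  have h1 := hg.2.2 _ htest
  rw [pdMulti_comp_sub hk] at h1
  rw [conv_apply, ← hy]
  have h2 : ∫ w in D.cover, f w * ((-1) ^ (∑ i, α i) * pdMulti α (mollKer d n) (y - w)) =
      (-1) ^ (∑ i, α i) * ∫ w, D.cover.indicator f w * pdMulti α (mollKer d n) (y - w) := by
    rw [← integral_const_mul, ← integral_indicator h.isOpen.measurableSet]
    refine integral_congr_ae (of_forall fun w => ?_)
    by_cases hw : w ∈ D.cover
    · simp only [indicator_of_mem hw]; ring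
    · simp [Set.indicator_of_notMem hw]
  rw [h2] at h1
  exact mul_left_cancel₀ (pow_ne_zero _ (by norm_num)) h1

theorem contraction_prod_le (h : IsBox D I a b) (n : ℕ) (α : Fin d → ℕ) :
    |∏ i, (1 - mollR n * a i) ^ α i| ≤ 1 := by
  rw [Finset.abs_prod]
  refine Finset.prod_le_one (fun _ _ => abs_nonneg _) fun i _ => ?_
  rw [abs_pow]
  refine pow_le_one₀ (abs_nonneg _) ?_
  have h1 := mollR_pos n
  have h2 := mollR_le n
  have h3 := h.a_nonneg i
  have h4 := h.a_le i
  rw [abs_le]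
  constructor <;> nlinarith

/-- A weight `s` which does not increase much when the argument is moved by the mollification. -/
def MollWeight (D : PeriodicDomain d) (a b : Fin d → ℝ) (Λ : NNReal) (s : Fn d) : Prop :=
  Measurable s ∧ (∀ v, IsShift D v → ∀ z, s (z + shiftVec v) = s z) ∧
    ∀ n, ∀ z ∈ D.cover, ∀ w ∈ D.cover, affMap a b (mollR n) z - w ∈
      closedBall (0 : Fin d → ℝ) (mollR n / 4) → ‖s z‖ₑ ≤ Λ * ‖s w‖ₑ

variable {s : Fn d} {Λ : NNReal} {α : Fin d → ℕ} {z : Fin d → ℝ}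

theorem enorm_moll_le_lintegral (h : IsBox D I a b) (hs : MollWeight D a b Λ s)
    (hf : LocallyIntegrable (D.cover.indicator f)) (hg : IsWeakDeriv D α f g) (n)
    (hz : z ∈ D.cover) : ‖s z * pdMulti α (moll D a b n f) z‖ₑ ≤ Λ *
      ∫⁻ w in D.cover, ofReal (mollKer d n (affMap a b (mollR n) z - w)) * ‖s w * g w‖ₑ := by
  rw [pdMulti_moll h hf hg n hz, mul_left_comm, enorm_mul, ← integral_const_mul,
    ← lintegral_const_mul' _ _ ENNReal.coe_ne_top]
  refine (mul_le_of_le_one_left zero_le ?_).trans ((enorm_integral_le_lintegral_enorm _).trans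
    (setLIntegral_mono' h.isOpen.measurableSet fun w hw => ?_))
  · rw [Real.enorm_eq_ofReal_abs]
    exact ENNReal.ofReal_le_one.2 (contraction_prod_le h n α)
  simp only [enorm_mul]
  rw [enorm_of_nonneg (mollKer_nonneg n _)]
  by_cases hb : affMap a b (mollR n) z - w ∈ closedBall 0 (mollR n / 4)
  · exact (mul_le_mul_left (hs.2.2 n z hz w hw hb) _).trans_eq (by ring)
  · simp [mollKer_eq_zero hb]

theorem measurable_mollKer_sub (n) (y : Fin d → ℝ) :
    Measurable fun w => ofReal (mollKer d n (y - w)) :=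
  ((smooth_mollKer n).continuous.comp
    (continuous_const.sub continuous_id)).measurable.ennreal_ofReal

/-- Jensen's inequality for the averages with the mollifying kernel. -/
theorem sq_lintegral_mollKer_le {G : (Fin d → ℝ) → ℝ≥0∞} (y : Fin d → ℝ)
    (hG : AEMeasurable G (vol D)) :
    (∫⁻ w in D.cover, ofReal (mollKer d n (y - w)) * G w) ^ 2 ≤
      ∫⁻ w in D.cover, ofReal (mollKer d n (y - w)) * G w ^ 2 := by
  have hkm := measurable_mollKer_sub n y
  refine (pow_le_pow_left' (((ENNReal.lintegral_mul_norm_pow_le (hkm.aemeasurable.mul (hG.pow_const 2)) hkm.aemeasurable (p := 1 / 2) (q := 1 / 2) (by norm_num) (by norm_num) (by norm_num)).trans (mul_le_of_le_one_right' (ENNReal.rpow_le_one ((setLIntegral_le_lintegral _ _).trans (lintegral_mollKer_sub n y).le) (by norm_num)))).trans' (lintegral_congr fun w => ?_).le) 2).trans_eq ?_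
  · rw [Pi.mul_apply, ENNReal.mul_rpow_of_nonneg _ _ (by norm_num), mul_right_comm, ← ENNReal.rpow_add_of_nonneg
      _ _ (by norm_num) (by norm_num), ← rpow_natCast, ← rpow_mul]
    norm_num
  · rw [← rpow_natCast, ← rpow_mul]
    norm_num

/-! ### Integration over periods -/

/-- The index of the period that contains a point. -/
def perIdx (D : PeriodicDomain d) (z : Fin d → ℝ) : Fin d → ℤ :=
  fun i => if i ∈ D.torus then ⌊z i⌋ else 0

theorem measurable_perIdx (D : PeriodicDomain d) : Measurable (perIdx D) := by
  refine measurable_pi_lambda _ fun i => ?_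
  unfold perIdx
  split_ifs
  exacts [Int.measurable_floor.comp (measurable_pi_apply i), measurable_const]

theorem isShift_perIdx (D : PeriodicDomain d) (z : Fin d → ℝ) :
    IsShift D (perIdx D z) := fun i hi => by simp [perIdx, hi]

theorem perIdx_add (hv : IsShift D v) (z) :
    perIdx D (z + shiftVec v) = perIdx D z + v := by
  funext i
  by_cases h : i ∈ D.torus
  · simp [perIdx, h, shiftVec]
  · simp [perIdx, h, hv i h]

theorem cell_eq (D : PeriodicDomain d) : D.cell = D.cover ∩ perIdx D ⁻¹' {0} := by
  ext z
  simp only [PeriodicDomain.cell, Set.mem_inter_iff, Set.mem_ofPred_eq, Set.mem_preimage,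
    Set.mem_singleton_iff]
  refine and_congr_right fun _ => ?_
  simp only [funext_iff, perIdx, ite_eq_right_iff, Int.floor_eq_zero_iff, Pi.zero_apply]

theorem measurableSet_cell (hD : IsOpen D.cover) : MeasurableSet D.cell := by
  rw [cell_eq]
  exact hD.measurableSet.inter (measurable_perIdx D (measurableSet_singleton _))

theorem setLIntegral_period (hD : IsOpen D.cover) (hI : IsInvariant D) {v : Fin d → ℤ}
    (hv : IsShift D v) (F : (Fin d → ℝ) → ℝ≥0∞) :
    ∫⁻ z in D.cover ∩ perIdx D ⁻¹' {v}, F z = ∫⁻ z in D.cell, F (z + shiftVec v) := by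
  have h := ((measurePreserving_add_right volume (shiftVec v)).restrict_preimage
    (hD.measurableSet.inter (measurable_perIdx D (measurableSet_singleton v))))
  have he : (fun z => z + shiftVec v) ⁻¹' (D.cover ∩ perIdx D ⁻¹' {v}) = D.cell := by
    ext z
    rw [cell_eq]
    simp only [Set.mem_preimage, Set.mem_inter_iff, hI v hv z, Set.mem_singleton_iff,
      perIdx_add hv, add_eq_right]
  rw [he] at h
  exact (h.lintegral_comp_emb (measurableEmbedding_addRight (shiftVec v)) F).symm

theorem lintegral_period_le (hD : IsOpen D.cover) (hI : IsInvariant D) (v)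
    (hF : ∀ v, IsShift D v →
      (fun z => F (z + shiftVec v)) =ᵐ[vol D] F) :
    ∫⁻ z in D.cover ∩ perIdx D ⁻¹' {v}, F z ≤ ∫⁻ z in D.cell, F z := by
  by_cases hv : IsShift D v
  · rw [setLIntegral_period hD hI hv]
    refine (lintegral_congr_ae ?_).le
    exact ae_mono (Measure.restrict_mono (by rw [cell_eq]; exact Set.inter_subset_left) le_rfl)
      (hF v hv)
  · have : D.cover ∩ perIdx D ⁻¹' {v} = ∅ := by
      ext z
      simp only [Set.mem_inter_iff, Set.mem_preimage, Set.mem_singleton_iff,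
        Set.mem_empty_iff_false, iff_false, not_and]
      rintro - rfl
      exact hv (isShift_perIdx D z)
    rw [this]; simp

theorem lintegral_cover_tsum (F : (Fin d → ℝ) → ℝ≥0∞) :
    ∫⁻ z in D.cover, F z = ∑' v, ∫⁻ z in D.cover ∩ perIdx D ⁻¹' {v}, F z := by
  rw [lintegral_tsum_fiber (measurable_perIdx D)]
  refine tsum_congr fun v => ?_
  rw [Measure.restrict_restrict (measurable_perIdx D (measurableSet_singleton v)),
    Set.inter_comm]

/-- The integral of a periodic function over the part of the domain where the periodic
coordinates lie in `[-1, 2)` is at most `3^d` times its integral over one period. -/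
theorem lintegral_big_le (hD : IsOpen D.cover) (hI : IsInvariant D)
    {F : (Fin d → ℝ) → ℝ≥0∞} (hF : ∀ v, IsShift D v →
      (fun z => F (z + shiftVec v)) =ᵐ[vol D] F) :
    ∫⁻ z in D.cover, {z : Fin d → ℝ | ∀ i ∈ D.torus, z i ∈ Ico (-1 : ℝ) 2}.indicator F z ≤
      3 ^ d * ∫⁻ z in D.cell, F z := by
  classical
  rw [lintegral_cover_tsum]
  set V : Finset (Fin d → ℤ) := Fintype.piFinset fun _ => Finset.Icc (-1) 1 with hV
  rw [tsum_eq_sum]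
  · calc _ ≤ ∑ v ∈ V, ∫⁻ z in D.cell, F z := by
          refine sum_le_sum fun v _ => ?_
          refine le_trans (lintegral_mono fun z => ?_) (lintegral_period_le hD hI v hF)
          exact Set.indicator_le_self _ _ _
      _ = _ := by
          rw [sum_const, hV, Fintype.card_piFinset]
          simp
  · intro v hv
    rw [setLIntegral_congr_fun (hD.measurableSet.inter (measurable_perIdx D (measurableSet_singleton v))), lintegral_zero]
    intro z hz
    refine Set.indicator_of_notMem (fun hz' => hv ?_) _
    rw [hV, Fintype.mem_piFinset]
    intro i
    rw [← hz.2, Finset.mem_Icc]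
    by_cases hi : i ∈ D.torus
    · have := hz' i hi
      simp only [perIdx, hi, if_true]
      constructor
      · rw [Int.le_floor]; push_cast; exact this.1
      · rw [← Int.lt_add_one_iff, Int.floor_lt]; push_cast; linarith [this.2]
    · simp [perIdx, hi]

theorem lintegral_comp_affMap_sub_le (h : IsBox D I a b) (n)
    (hF : Measurable F) (w) :
    ∫⁻ z, F (affMap a b (mollR n) z - w) ≤ 2 ^ d * ∫⁻ z, F z := by
  set δ := mollR n
  have h1 := mollR_pos n
  have h2 := mollR_le n
  have hfac : ∀ i, (1 / 2) ≤ 1 - δ * a i := fun i => by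
    have h3 := h.a_nonneg i
    have h4 := h.a_le i
    nlinarith
  have hdet : Matrix.det (Matrix.diagonal fun i => 1 - δ * a i) = ∏ i, (1 - δ * a i) :=
    Matrix.det_diagonal
  have hdet0 : (1 / 2) ^ d ≤ ∏ i, (1 - δ * a i) := by
    simpa using Finset.prod_le_prod (s := .univ) (fun _ _ => by norm_num) fun i _ => hfac i
  have hpos := lt_of_lt_of_le (by positivity) hdet0
  have hmap := Real.smul_map_diagonal_volume_pi
    (by rw [hdet]; exact hpos.ne')
  rw [hdet, abs_of_pos hpos] at hmap
  set c := fun i => δ * b i - w i with hc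
  have haff : ∀ z, affMap a b δ z - w =
      Matrix.toLin' (Matrix.diagonal fun i => 1 - δ * a i) z + c := by
    intro z; funext i
    simp only [affMap, Pi.sub_apply, Pi.add_apply, Matrix.toLin'_apply, Matrix.mulVec_diagonal, hc]
    ring
  have hmeas : Measurable fun z => F (z + c) := hF.comp (measurable_id.add_const c)
  have key : ∫⁻ z, F z = ofReal (∏ i, (1 - δ * a i)) *
      ∫⁻ z, F (affMap a b δ z - w) := by
    rw [← lintegral_add_right_eq_self F c]
    conv_lhs => rw [← hmap]
    rw [lintegral_smul_measure, lintegral_map hmeas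
      (LinearMap.continuous_of_finiteDimensional _).measurable, smul_eq_mul]
    simp only [haff]
  rw [key, ← mul_assoc]
  refine le_mul_of_one_le_left zero_le ?_
  calc 1 = 2 ^ d * ofReal ((1 / 2) ^ d) := by
        rw [ofReal_pow (by norm_num), ← mul_pow, ← ENNReal.ofReal_ofNat 2,
          ← ofReal_mul (by norm_num)]
        norm_num
    _ ≤ _ := by gcongr

theorem lintegral_moll_sq_le (h : IsBox D I a b) (hs : MollWeight D a b Λ s)
    (hf : LocallyIntegrable (D.cover.indicator f)) (hg : IsWeakDeriv D α f g)
    (hper : AEPeriodic D g) (n : ℕ) :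
    ∫⁻ z in D.cell, ‖s z * pdMulti α (moll D a b n f) z‖ₑ ^ 2 ≤
      6 ^ d * Λ ^ 2 * ∫⁻ z in D.cell, ‖s z * g z‖ₑ ^ 2 := by
  have hDo := h.isOpen
  have hgm :=
    (hg.2.1.aestronglyMeasurable).aemeasurable
  set G := fun w => ‖s w * g w‖ₑ ^ 2 with hG
  have hGper v : IsShift D v → (fun z => G (z + shiftVec v)) =ᵐ[vol D] G := fun hv =>
      (hper v hv).mono fun z hz => by simp only [hG, hs.2.1 v hv, hz]
  have hkm : Measurable fun z => ofReal (mollKer d n z) :=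
    (smooth_mollKer n).continuous.measurable.ennreal_ofReal
  set A := affMap a b (mollR n) with hA
  have hAm : Measurable A := (smooth_affMap a b _).continuous.measurable
  have hcell : D.cell ⊆ D.cover := by rw [cell_eq]; exact Set.inter_subset_left
  have hcm := measurableSet_cell hDo
  have h1 : ∀ z ∈ D.cell, ‖s z * pdMulti α (moll D a b n f) z‖ₑ ^ 2 ≤
      Λ ^ 2 * ∫⁻ w in D.cover, ofReal (mollKer d n (A z - w)) * G w := by
    intro z hz
    refine (pow_le_pow_left' (enorm_moll_le_lintegral h hs hf hg n (hcell hz)) 2).trans ?_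
    rw [mul_pow]
    gcongr
    exact sq_lintegral_mollKer_le _ (hs.1.aemeasurable.mul hgm).enorm
  have hjm : AEMeasurable (Function.uncurry fun (z w) =>
      ofReal (mollKer d n (A z - w)) * G w)
      ((volume.restrict D.cell).prod (vol D)) := by
    exact (hkm.comp ((hAm.comp measurable_fst).sub measurable_snd)).aemeasurable.mul
      (((hs.1.aemeasurable.mul hgm).enorm.pow_const 2).comp_quasiMeasurePreserving Measure.quasiMeasurePreserving_snd)
  calc _ ≤ ∫⁻ z in D.cell, Λ ^ 2 *
        ∫⁻ w in D.cover, ofReal (mollKer d n (A z - w)) * G w :=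
        setLIntegral_mono' hcm h1
    _ = Λ ^ 2 * ∫⁻ z in D.cell,
        ∫⁻ w in D.cover, ofReal (mollKer d n (A z - w)) * G w :=
        lintegral_const_mul' _ _ (by simp)
    _ = Λ ^ 2 * ∫⁻ w in D.cover,
        ∫⁻ z in D.cell, ofReal (mollKer d n (A z - w)) * G w := by
        rw [lintegral_lintegral_swap hjm]
    _ ≤ Λ ^ 2 * ∫⁻ w in D.cover, 2 ^ d *
          {z : Fin d → ℝ | ∀ i ∈ D.torus, z i ∈ Ico (-1) 2}.indicator G w := by
        gcongr with w
        by_cases hw : w ∈ {z : Fin d → ℝ | ∀ i ∈ D.torus, z i ∈ Ico (-1) 2}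
        · rw [indicator_of_mem hw, lintegral_mul_const
            (f := fun z => ofReal (mollKer d n (A z - w))) _
            (hkm.comp (hAm.sub_const w))]
          gcongr
          refine (setLIntegral_le_lintegral _ _).trans
            ((lintegral_comp_affMap_sub_le h n hkm w).trans ?_)
          rw [lintegral_mollKer, mul_one]
        · rw [setLIntegral_congr_fun hcm, lintegral_zero]
          · exact zero_le
          intro z hz
          dsimp only
          rw [mollKer_eq_zero, ENNReal.ofReal_zero, zero_mul]
          intro hb
          apply hw
          intro i hi
          rw [mem_closedBall_zero_iff] at hb
          have h2 := (norm_le_pi_norm _ i).trans hb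
          have h3 := mollR_le n
          have h4 := hz.2 i hi
          simp only [hA, affMap, h.torus_a i hi, h.torus_b i hi, Pi.sub_apply, mul_zero, sub_zero,
            one_mul, add_zero, norm_eq_abs, abs_le] at h2
          constructor <;> linarith [h4.1, h4.2]
    _ ≤ Λ ^ 2 * (2 ^ d * (3 ^ d * ∫⁻ z in D.cell, G z)) := by
        rw [lintegral_const_mul' _ _ (by simp)]
        gcongr
        exact lintegral_big_le hDo h.invariant hGper
    _ = _ := by
        rw [show (6 : ℝ≥0∞) = 2 * 3 by norm_num, mul_pow]; ring

theorem enorm_moll_le (h : IsBox D I a b)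
    (hs : MollWeight D a b Λ s)
    (hf : LocallyIntegrable (D.cover.indicator f)) (hg : IsWeakDeriv D α f g)
    (hR : ∀ᵐ z ∂vol D, ‖s z * g z‖ₑ ≤ R) (n)
    (hz : z ∈ D.cover) : ‖s z * pdMulti α (moll D a b n f) z‖ₑ ≤ Λ * R := by
  refine (enorm_moll_le_lintegral h hs hf hg n hz).trans (mul_le_mul_right ?_ _)
  calc _ ≤ ∫⁻ w in D.cover, ofReal (mollKer d n (affMap a b (mollR n) z - w)) * R :=
        lintegral_mono_ae (hR.mono fun w hw => mul_le_mul_right hw _)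
    _ ≤ 1 * R := by
        rw [lintegral_mul_const _ (measurable_mollKer_sub n _)]
        gcongr
        exact (setLIntegral_le_lintegral _ _).trans (lintegral_mollKer_sub n _).le
    _ = _ := one_mul _

theorem moll_periodic (h : IsBox D I a b) (hf : AEPeriodic D f) (n) :
    IsPeriodic D (moll D a b n f) := by
  intro i hi z
  set v : Fin d → ℤ := single i 1 with hv
  have hvs : IsShift D v := fun j hj => by
    have : j ≠ i := fun e => hj (e ▸ hi)
    simp [hv, this]
  have hvec : (single i 1) = shiftVec v := by
    funext j
    by_cases hj : j = i <;> simp [hv, shiftVec, hj]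
  have haff : affMap a b (mollR n) (z + shiftVec v) =
      affMap a b (mollR n) z + shiftVec v := by
    funext j
    by_cases hj : j ∈ D.torus
    · simp [affMap, h.torus_a j hj, h.torus_b j hj]
    · simp [affMap, shiftVec, hvs j hj]
  unfold moll
  rw [hvec, haff, conv_apply, conv_apply,
    ← integral_add_right_eq_self _ (shiftVec v)]
  refine integral_congr_ae ?_
  have hper := hf v hvs
  rw [Filter.EventuallyEq, ae_restrict_iff' h.isOpen.measurableSet] at hper
  filter_upwards [hper] with w hw
  rw [add_sub_add_right_eq_sub]
  congr 1
  by_cases hwc : w ∈ D.cover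
  · rw [indicator_of_mem hwc, indicator_of_mem ((h.invariant v hvs w).mpr hwc), hw hwc]
  · rw [Set.indicator_of_notMem hwc,
      Set.indicator_of_notMem fun h' => hwc ((h.invariant v hvs w).mp h')]

theorem ae_tendsto_moll (h : IsBox D I a b)
    (hf : LocallyIntegrable (D.cover.indicator f)) :
    ∀ᵐ z ∂vol D, Tendsto (fun n => moll D a b n f z) atTop (𝓝 (f z)) := by
  rw [ae_restrict_iff' h.isOpen.measurableSet]
  filter_upwards [IsUnifLocDoublingMeasure.ae_tendsto_average_norm_sub volume hf 8] with z hz hzc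
  set F := D.cover.indicator f
  have hFz : F z = f z := indicator_of_mem hzc _
  set y := fun n => affMap a b (mollR n) z with hy
  set r := fun n => mollR n / 4 with hr
  have hr0 : ∀ n, 0 < r n := fun n => by have := mollR_pos n; simp only [hr]; positivity
  have hrlim : Tendsto r atTop (𝓝[>] 0) := by
    refine tendsto_nhdsWithin_iff.mpr ⟨?_, of_forall hr0⟩
    simpa [hr] using (tendsto_nhdsWithin_iff.mp tendsto_mollR).1.div_const 4
  have hmem : ∀ᶠ n in atTop, z ∈ closedBall (y n) (8 * r n) := by
    refine of_forall fun n => ?_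
    have hd := mollR_pos n
    rw [mem_closedBall_iff_norm, pi_norm_le_iff_of_nonneg (by have := hr0 n; positivity)]
    intro i
    have hzi : z i ∈ I i := by
      have := hzc; rw [h.cover_eq] at this; exact this i (Set.mem_univ i)
    have := h.dist_le i (z i) hzi
    simp only [Pi.sub_apply, hy, affMap, norm_eq_abs, hr]
    rw [show z i - ((1 - mollR n * a i) * z i + mollR n * b i) =
      -(mollR n * (b i - a i * z i)) by ring, abs_neg, abs_mul, abs_of_pos hd]
    nlinarith
  have hlim := (hz y r hrlim hmem).const_mul (2 ^ d)
  rw [mul_zero] at hlim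
  have hbound n : ‖moll D a b n f z - f z‖ ≤
      2 ^ d * ⨍ w in closedBall (y n) (r n), ‖F w - F z‖ := by
    set k := mollKer d n with hk
    have hkc : Continuous fun w => k (y n - w) :=
      (smooth_mollKer n).continuous.comp (continuous_const.sub continuous_id)
    have hone : ∫ w, k (y n - w) = 1 := by
      rw [integral_sub_left_eq_self (fun w => k w) volume (y n)]
      exact (mollBump d n).integral_normed
    have hsupp :=
      (compact_mollKer n).comp_homeomorph (Homeomorph.subLeft (y n))
    have hi1 : Integrable fun w => F w * k (y n - w) := by
      simpa [mul_comm] using hf.integrable_smul_right_of_hasCompactSupport hkc hsupp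
    have e1 : moll D a b n f z - f z = ∫ w, (F w - F z) * k (y n - w) := by
      have : ∫ w, F z * k (y n - w) = f z := by rw [integral_const_mul, hone, mul_one, hFz]
      rw [← this]
      unfold moll
      rw [conv_apply, ← integral_sub hi1 ((hkc.integrable_of_hasCompactSupport hsupp).const_mul _)]
      refine integral_congr_ae (of_forall fun w => ?_)
      simp only [hy]; ring
    have hball : volume.real (closedBall (0 : Fin d → ℝ) (r n)) =
        volume.real (closedBall (y n) (r n)) := by
      simp only [Measure.real, Measure.addHaar_closedBall_center volume (y n)]
    have hkle x : k x ≤ 2 ^ d / volume.real (closedBall (y n) (r n)) := by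
      have := (mollBump d n).normed_le_div_measure_closedBall_rOut (μ := volume) 2
        (by simp only [mollBump]; linarith) x
      rw [Module.finrank_fin_fun] at this
      rw [← hball]; exact this
    have hsub w : w ∉ closedBall (y n) (r n) → (F w - F z) * k (y n - w) = 0 := by
      intro hw
      rw [hk, mollKer_eq_zero, mul_zero]
      intro hb
      apply hw
      rw [mem_closedBall_zero_iff, norm_sub_rev] at hb
      rwa [mem_closedBall_iff_norm]
    rw [e1, ← setIntegral_eq_integral_of_forall_compl_eq_zero hsub, setAverage_eq, smul_eq_mul]
    calc _ ≤ ∫ w in closedBall (y n) (r n),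
          2 ^ d / volume.real (closedBall (y n) (r n)) * ‖F w - F z‖ := by
          refine norm_integral_le_of_norm_le (
              (((hf.integrableOn_isCompact (isCompact_closedBall _ _)).sub (integrableOn_const (measure_closedBall_lt_top.ne))).norm).const_mul _) (of_forall fun w => ?_)
          rw [norm_mul, mul_comm, Real.norm_of_nonneg (mollKer_nonneg n _)]
          gcongr
          exact hkle _
      _ = _ := by rw [integral_const_mul]; ring
  rw [tendsto_iff_norm_sub_tendsto_zero]
  exact squeeze_zero (fun _ => norm_nonneg _) hbound hlim

end

section

/-! ### Weak closedness of bounds on derivatives -/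

theorem eLpNorm_two_sq [MeasurableSpace X] (μ : Measure X) (f : X → ℝ) :
    eLpNorm f 2 μ ^ 2 = ∫⁻ x, ‖f x‖ₑ ^ 2 ∂μ := by
  simpa using eLpNorm_nnreal_pow_eq_lintegral (p := 2) (by norm_num)

/-- Bounded sequences of a Hilbert space have weak limits along an ultrafilter. -/
theorem exists_weak_limit [NormedAddCommGroup E] [InnerProductSpace ℝ E]
    [CompleteSpace E] (x : ℕ → E) (B) (hx : ∀ n, ‖x n‖ ≤ B) :
    ∃ y, ‖y‖ ≤ B ∧
      ∀ w, Tendsto (fun n => inner ℝ (x n) w) (hyperfilter ℕ : Filter ℕ) (𝓝 (inner ℝ y w)) := by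
  set F := fun n => StrongDual.toWeakDual (InnerProductSpace.toDual ℝ E (x n))
  have hF n : F n ∈ WeakDual.toStrongDual ⁻¹' closedBall 0 B := by
    simp [F, hx n]
  obtain ⟨f, hf, hlim⟩ := (WeakDual.isCompact_closedBall 0 B).ultrafilter_le_nhds' ((hyperfilter ℕ).map F)
    (Ultrafilter.mem_map.2 (Filter.univ_mem' hF))
  refine ⟨(InnerProductSpace.toDual ℝ E).symm (WeakDual.toStrongDual f), ?_, fun w => ?_⟩
  · simpa using hf
  · rw [InnerProductSpace.toDual_symm_apply]
    exact ((WeakDual.eval_continuous w).tendsto f).comp hlim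


theorem finite_image_perIdx (D : PeriodicDomain d) (hK : IsCompact K) :
    (perIdx D '' K).Finite := by
  obtain ⟨R, hR⟩ := hK.isBounded.exists_norm_le
  refine (Set.Finite.pi' fun _ => Set.finite_Icc (-(⌈R⌉ + 1)) (⌈R⌉ + 1)).subset ?_
  rintro _ ⟨z, hz, rfl⟩ i
  have h1 := abs_le.mp ((norm_le_pi_norm z i).trans (hR z hz))
  have h2 := Int.le_ceil R
  simp only [perIdx]
  split_ifs
  · constructor
    · exact Int.le_floor.2 (by push_cast; linarith [h1.1])
    · have : (⌊z i⌋) ≤ ((⌈R⌉ + 1) : ℝ) := by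
        push_cast; linarith [Int.floor_le (z i), h1.2]
      exact_mod_cast this
  · have : 0 ≤ ⌈R⌉ := by
      exact Int.ceil_nonneg ((norm_nonneg z).trans (hR z hz))
    constructor <;> omega

/-- If bounded smooth periodic functions converge almost everywhere, and if a weighted derivative of
them stays bounded in `L²`, then the limit has this weak derivative, with a comparable bound. The
derivatives converge weakly in a space `L²` over the cover, weighted so as to make the sum over all
periods finite. -/
theorem exists_weak_of_tendsto (d : ℕ) : ∃ C : NNReal, ∀ (D : PeriodicDomain d),
    IsOpen D.cover → IsInvariant D → ∀ (α : Fin d → ℕ) (s : Fn d),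
    Smooth s → (∀ z ∈ D.cover, s z ≠ 0) →
    (∀ v, IsShift D v → ∀ z, s (z + shiftVec v) = s z) →
    ∀ (u : ℕ → Fn d) (w : Fn d) (R : ℝ) (B : NNReal),
    (∀ n, Smooth (u n)) → (∀ n, IsPeriodic D (u n)) →
    (∀ n, ∀ z ∈ D.cover, ‖u n z‖ ≤ R) →
    (∀ᵐ z ∂vol D, Tendsto (fun n => u n z) atTop (𝓝 (w z))) →
    (∀ n, ∫⁻ z in D.cell, ‖s z * pdMulti α (u n) z‖ₑ ^ 2 ≤ B) →
    ∃ g, IsWeakDeriv D α w g ∧ ∫⁻ z in D.cell, ‖s z * g z‖ₑ ^ 2 ≤ C * B := by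
  obtain ⟨wt, hwt, hsum⟩ := ENNReal.exists_pos_sum_of_countable' (ε := 1) (by norm_num) (Fin d → ℤ)
  have hwt_top := fun v =>
    ((ENNReal.le_tsum v).trans_lt hsum).trans ENNReal.one_lt_top
  refine ⟨((wt 0)⁻¹).toNNReal, fun D hD hI α s hs hs0 hsp u w R B hu hper hR hlim hB => ?_⟩
  set μ := vol D with hμ
  set q := fun v => Real.sqrt (wt v).toReal
  have hqpos := fun v =>
    Real.sqrt_pos.2 (ENNReal.toReal_pos (hwt v).ne' (hwt_top v).ne)
  have hq2 v : ‖q v‖ₑ ^ 2 = wt v := by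
    rw [enorm_of_nonneg (hqpos v).le, ← ofReal_pow (hqpos v).le,
      Real.sq_sqrt ENNReal.toReal_nonneg, ofReal_toReal (hwt_top v).ne]
  set r := fun z => q (perIdx D z) with hr
  have hrm := (measurable_of_countable q).comp (measurable_perIdx D)
  have hrinv K : IsCompact K → ∃ M, ∀ z ∈ K, ‖(r z)⁻¹‖ ≤ M := by
    intro hK
    obtain ⟨M, hM⟩ := ((finite_image_perIdx D hK).image fun v => ‖(q v)⁻¹‖).bddAbove
    exact ⟨M, fun z hz => hM ⟨_, ⟨z, hz, rfl⟩, rfl⟩⟩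
  have hcell : D.cell ⊆ D.cover := by rw [cell_eq]; exact Set.inter_subset_left
  -- the weighted derivatives
  set h := fun n z => r z * (s z * pdMulti α (u n) z) with hh
  have hh2 n : ∫⁻ z, ‖h n z‖ₑ ^ 2 ∂μ ≤ B := by
    rw [hμ, lintegral_cover_tsum]
    calc _ ≤ ∑' v, wt v * B := by
          refine ENNReal.tsum_le_tsum fun v => ?_
          calc _ = ∫⁻ z in D.cover ∩ perIdx D ⁻¹' {v},
                wt v * ‖s z * pdMulti α (u n) z‖ₑ ^ 2 := by
                refine setLIntegral_congr_fun
                    (hD.measurableSet.inter (measurable_perIdx D (measurableSet_singleton v))) fun z hz => ?_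
                have : r z = q v := by rw [hr]; exact congrArg q hz.2
                simp only [hh, this, enorm_mul (q v), mul_pow, hq2]
            _ = wt v * ∫⁻ z in D.cover ∩ perIdx D ⁻¹' {v},
                ‖s z * pdMulti α (u n) z‖ₑ ^ 2 := lintegral_const_mul' _ _ (hwt_top v).ne
            _ ≤ _ := by
                refine mul_le_mul_right ((lintegral_period_le hD hI v ?_).trans (hB n)) _
                intro v' hv'
                refine of_forall fun z => ?_
                have : pdMulti α (u n) (z + shiftVec v') = pdMulti α (u n) z := by
                  rw [← congrFun (pdMulti_comp_add (hu n) (shiftVec v') α) z]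
                  congr 1
                  funext z
                  exact (hper n).shift hv' z
                simp only [this, hsp v' hv']
      _ ≤ 1 * B := by
          rw [ENNReal.tsum_mul_right]
          exact mul_le_mul_left hsum.le _
      _ = B := one_mul _
  have hhL n : MemLp (h n) 2 μ := by
    refine ⟨((fun n => hrm.mul ( (fun n => hs.continuous.mul (smooth_pdMulti (hu n) α).continuous) n).measurable) n).aestronglyMeasurable, ?_⟩
    exact (ENNReal.pow_lt_top_iff).1 (
        ((eLpNorm_two_sq μ (h n)).le.trans ((hh2 n))).trans_lt ENNReal.coe_lt_top)
      |>.resolve_right (by norm_num)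
  obtain ⟨H, hHB, hHlim⟩ := exists_weak_limit (fun n => (hhL n).toLp (h n)) (Real.sqrt B) (by
    intro n
    rw [Lp.norm_toLp]
    refine Real.le_sqrt_of_sq_le ?_
    rw [← ENNReal.toReal_pow, eLpNorm_two_sq]
    exact ENNReal.toReal_le_coe_of_le_coe (hh2 n))
  have hHloc : LocallyIntegrableOn (fun z => (r z)⁻¹ * H z) D.cover := by
    refine (locallyIntegrableOn_iff hD.isLocallyClosed).2 fun K hKD hK => ?_
    have : IsFiniteMeasure (volume.restrict K) := ⟨by simpa using hK.measure_lt_top⟩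
    obtain ⟨M, hM⟩ := hrinv K hK
    exact (((Lp.memLp H).mono_measure (Measure.restrict_mono hKD le_rfl)).integrable (by norm_num)).bdd_mul hrm.inv.aestronglyMeasurable
      ((ae_restrict_mem hK.measurableSet).mono fun z hz => hM z hz)
  have hsinv := hs.contDiffOn.inv hs0
  have hum : ∀ n, AEStronglyMeasurable (u n) μ := fun n =>
    (hu n).continuous.aestronglyMeasurable
  have hwR : ∀ᵐ z ∂μ, ‖w z‖ ≤ R := by
    filter_upwards [hlim, ae_restrict_mem hD.measurableSet] with z hz hzD
    exact le_of_tendsto' hz.norm fun n => hR n z hzD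
  have hwloc : LocallyIntegrableOn w D.cover := by
    refine (locallyIntegrableOn_iff hD.isLocallyClosed).2 fun K hKD hK => ?_
    have hle : volume.restrict K ≤ μ := Measure.restrict_mono hKD le_rfl
    exact IntegrableOn.of_bound hK.measure_lt_top (
        (aestronglyMeasurable_of_tendsto_ae atTop hum hlim).mono_measure hle) R (ae_mono hle hwR)
  refine ⟨fun z => (s z)⁻¹ * ((r z)⁻¹ * H z), ⟨hwloc,
      locInt_mul hD hsinv.continuousOn hHloc, fun φ hφ => ?_⟩, ?_⟩
  · have hθ : IsTest D.cover fun z => (s z)⁻¹ * φ z := hφ.mul hD hsinv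
    have hψ : MemLp (fun z => (r z)⁻¹ * ((s z)⁻¹ * φ z)) 2 μ := by
      obtain ⟨M, hM⟩ := hrinv _ hθ.2.1
      refine MemLp.of_le_mul (c := M) (hθ.1.continuous.memLp_of_hasCompactSupport hθ.2.1)
        (hrm.inv.mul hθ.1.continuous.measurable).aestronglyMeasurable
        (of_forall fun z => ?_)
      by_cases hz : z ∈ tsupport fun z => (s z)⁻¹ * φ z
      · rw [norm_mul]
        exact mul_le_mul_of_nonneg_right (hM z hz) (norm_nonneg _)
      · simp only [image_eq_zero_of_notMem_tsupport hz, mul_zero, norm_zero, le_refl]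
    have h1 := hHlim (hψ.toLp _)
    have h2 n : inner ℝ ((hhL n).toLp (h n)) (hψ.toLp _) =
        (-1) ^ (∑ i, α i) * ∫ z in D.cover, u n z * pdMulti α φ z := by
      rw [(isWeakDeriv_of_contDiff hD (hu n) α).2.2 φ hφ, ← mul_assoc, ← mul_pow, neg_one_mul,
        neg_neg, one_pow, one_mul, L2.inner_def]
      refine integral_congr_ae ?_
      filter_upwards [(hhL n).coeFn_toLp, hψ.coeFn_toLp, ae_restrict_mem hD.measurableSet]
        with z e1 e2 hz
      have e3 := hs0 z hz
      have e4 : r z ≠ 0 := (hqpos _).ne'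
      rw [e1, e2]
      simp only [hh, RCLike.inner_apply, conj_trivial]
      field_simp
    have h3 : inner ℝ H (hψ.toLp _) =
        ∫ z in D.cover, ((s z)⁻¹ * ((r z)⁻¹ * H z)) * φ z := by
      rw [L2.inner_def]
      refine integral_congr_ae ?_
      filter_upwards [hψ.coeFn_toLp] with z e2
      rw [e2]
      simp only [RCLike.inner_apply, conj_trivial]
      ring
    have h4 : Tendsto (fun n => ∫ z in D.cover, u n z * pdMulti α φ z) atTop
        (𝓝 (∫ z in D.cover, w z * pdMulti α φ z)) := by
      have hp := hφ.pdMulti α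
      refine tendsto_integral_of_dominated_convergence (fun z => R * ‖pdMulti α φ z‖)
        (fun n => (hum n).mul hp.1.continuous.aestronglyMeasurable) ?_ (fun n => ?_) ?_
      · exact (hp.1.continuous.integrable_of_hasCompactSupport hp.2.1).norm.const_mul R
          |>.integrableOn
      · filter_upwards [ae_restrict_mem hD.measurableSet] with z hz
        rw [norm_mul]
        exact mul_le_mul_of_nonneg_right (hR n z hz) (norm_nonneg _)
      · exact hlim.mono fun z hz =>
        hz.mul_const _
    simp only [h2] at h1
    rw [← h3, tendsto_nhds_unique h1 ((h4.mono_left Nat.hyperfilter_le_atTop).const_mul ((-1) ^ (∑ i, α i))), ← mul_assoc, ← mul_pow, neg_one_mul, neg_neg, one_pow, one_mul]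
  · have hH2 : ∫⁻ z, ‖H z‖ₑ ^ 2 ∂μ ≤ B := by
      rw [← eLpNorm_two_sq, ← ofReal_toReal (Lp.eLpNorm_ne_top H), ← Lp.norm_def,
        ← ofReal_pow (norm_nonneg _)]
      refine (ofReal_le_ofReal (pow_le_pow_left₀ (norm_nonneg _) hHB 2)).trans ?_
      rw [Real.sq_sqrt B.coe_nonneg, ENNReal.ofReal_coe_nnreal]
    calc _ = ∫⁻ z in D.cell, (wt 0)⁻¹ * ‖H z‖ₑ ^ 2 := by
          refine setLIntegral_congr_fun (measurableSet_cell hD) fun z hz => ?_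
          have e1 : r z = q 0 := by
            rw [cell_eq] at hz
            rw [hr]; exact congrArg q hz.2
          have e2 : s z * ((s z)⁻¹ * ((r z)⁻¹ * H z)) = (q 0)⁻¹ * H z := by
            rw [← mul_assoc, mul_inv_cancel₀ (hs0 z (hcell hz)), one_mul, e1]
          have e3 : ‖(q 0)⁻¹‖ₑ ^ 2 = (wt 0)⁻¹ := by
            rw [enorm_inv (hqpos 0).ne', ← ENNReal.inv_pow, hq2]
          simp only [e2, enorm_mul, mul_pow, e3]
      _ = (wt 0)⁻¹ * ∫⁻ z in D.cell, ‖H z‖ₑ ^ 2 :=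
          lintegral_const_mul' _ _ (ENNReal.inv_ne_top.2 (hwt 0).ne')
      _ ≤ (wt 0)⁻¹ * B := by
          gcongr
          exact (lintegral_mono_set hcell).trans hH2
      _ = _ := by rw [coe_toNNReal (ENNReal.inv_ne_top.2 (hwt 0).ne')]

end

section

/-! ### The Moser estimate for weakly differentiable functions -/


theorem AEPeriodic.ae_le (hD : IsOpen D.cover) (hI : IsInvariant D)
    (hp : AEPeriodic D f)
    (hf : AEMeasurable f (vol D))
    (h : ∀ᵐ z ∂volume.restrict D.cell, ‖f z‖ₑ ≤ R) :
    ∀ᵐ z ∂vol D, ‖f z‖ₑ ≤ R := by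
  set χ : ℝ≥0∞ → ℝ≥0∞ := Set.indicator (Set.Ioi R) (fun _ => 1) with hχ
  have h0 : ∫⁻ z in D.cover, χ ‖f z‖ₑ = 0 := by
    rw [lintegral_cover_tsum, ENNReal.tsum_eq_zero]
    intro v
    refine le_antisymm ((lintegral_period_le hD hI v ?_).trans ?_) zero_le
    · intro v hv
      filter_upwards [hp v hv] with z hz
      rw [hz]
    · rw [lintegral_congr_ae, lintegral_zero]
      filter_upwards [h] with z hz
      rw [hχ, Set.indicator_of_notMem]
      simpa using hz
  replace h0 := (lintegral_eq_zero_iff' (f := fun z => χ ‖f z‖ₑ)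
    ((measurable_const.indicator measurableSet_Ioi).comp_aemeasurable hf.enorm)).1 h0
  filter_upwards [h0] with z hz
  by_contra hc
  simp only [hχ, Pi.zero_apply, Set.indicator_apply_eq_zero, Set.mem_Ioi] at hz
  exact one_ne_zero (hz (not_le.1 hc))

/-- The square of the `L²` norm of the scaled weak derivative `s^{α_e} ∂^α ∂_e^κ u`, `p = (α, κ)`;
this is `∞` if the derivative does not exist. -/
def scaledSq (e : Fin d) (s : ℝ → ℝ) (D : PeriodicDomain d) (p : Ord d)
    (u : Fn d) : ℝ≥0∞ :=
  ⨅ (g : Fn d) (_ : IsWeakDeriv D (p.1 + single e p.2) u g),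
    ∫⁻ z in D.cell, ‖s (z e) ^ p.1 e * g z‖ₑ ^ 2

/-- The sum of the squares of the `L²` norms of the scaled weak derivatives of weight at most `n`. -/
def weakLev (e : Fin d) (s : ℝ → ℝ) (bare : Bool) (D : PeriodicDomain d) (n : ℕ)
    (u : Fn d) : ℝ≥0∞ := ∑ p ∈ ords d bare n, scaledSq e s D p u

theorem le_weakLev
    (hp : p ∈ ords d bare n) (u) :
    scaledSq e s D p u ≤ weakLev e s bare D n u :=
  single_le_sum (f := fun p => scaledSq e s D p u) (fun _ _ => zero_le) hp

theorem exists_of_scaledSq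
    (h : scaledSq e s D p u ≠ ⊤) :
    ∃ g, IsWeakDeriv D (p.1 + single e p.2) u g := by
  by_contra hne
  exact h (iInf₂_eq_top.2 fun g hg => absurd ⟨g, hg⟩ hne)

/-- The boxes on which the constants of the Moser estimate are uniform: the unit cell is a product
of sides with partitions adapted to `s`, and mollification respects the weight `s`. -/
structure IsMoserBox (e : Fin d) (s) (κ) (Λ) (K)
    (D) (I) (a b) (S) : Prop where
  box : IsBox D I a b
  cell_eq : D.cell = univ.pi S
  partitions : HasPartitions e s κ S
  subset : S e ⊆ K
  pos : ∀ z ∈ D.cover, 0 < s (z e)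
  weight : MollWeight D a b Λ fun z => s (z e)

theorem mollWeight_one (D) (a b : Fin d → ℝ) :
    MollWeight D a b 1 fun _ => 1 :=
  ⟨measurable_const, fun _ _ _ => rfl, fun _ _ _ _ _ _ => by simp⟩

theorem MollWeight.pow
    (h : MollWeight D a b Λ s) (j) : MollWeight D a b (Λ ^ j) fun z => s z ^ j := by
  refine ⟨h.1.pow_const j, fun v hv z => by simp only [h.2.1 v hv z], fun n z hz w hw hb => ?_⟩
  simp only [enorm_pow, ENNReal.coe_pow]
  rw [← mul_pow]
  exact pow_le_pow_left₀ zero_le (h.2.2 n z hz w hw hb) j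

theorem cell_subset (D : PeriodicDomain d) : D.cell ⊆ D.cover := Set.inter_subset_left

theorem IsWeakDeriv.scaledSq_eq (hD : IsOpen D.cover) (s)
   
    (h : IsWeakDeriv D (p.1 + single e p.2) u g) :
    scaledSq e s D p u = ∫⁻ z in D.cell, ‖s (z e) ^ p.1 e * g z‖ₑ ^ 2 := by
  refine le_antisymm (iInf₂_le g h) (le_iInf₂ fun g' h' => le_of_eq ?_)
  refine lintegral_congr_ae (ae_restrict_of_ae_restrict_of_subset (cell_subset D) ?_)
  filter_upwards [h.unique hD h'] with z hz
  rw [hz]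

theorem locInt_indicator_of_bound (hD : IsOpen D.cover)
    (hf : AEStronglyMeasurable f (vol D)) {R : NNReal}
    (h : ∀ᵐ z ∂vol D, ‖f z‖ₑ ≤ R) :
    LocallyIntegrable (D.cover.indicator f) := by
  have hb : ∀ᵐ z, ‖D.cover.indicator f z‖ ≤ R := by
    have := (ae_restrict_iff' hD.measurableSet).1 h
    filter_upwards [this] with z hz
    by_cases hzD : z ∈ D.cover
    · rw [indicator_of_mem hzD]
      have := hz hzD
      rwa [← ofReal_norm, ENNReal.ofReal_le_coe] at this
    · rw [Set.indicator_of_notMem hzD]; simp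
  have h1 : LocallyIntegrable fun _ : Fin d → ℝ => (R : ℝ) := locallyIntegrable_const _
  exact h1.mono ((aestronglyMeasurable_indicator_iff hD.measurableSet).2 hf) (by
    exact hb.mono fun z hz => by simpa using hz)

/-- The Moser estimate for bounded functions with finite scaled derivatives: the estimate for smooth
functions is applied to mollifications, which converge almost everywhere, and the bounds on the
derivatives pass to the limit. -/
theorem moser_weak [Fintype ι] [DecidableEq ι] (e)
    (hs : Smooth s) (κ) (hκ : 0 < κ) (Λ) (hK : IsCompact K)
    (bare : Bool) (n : ℕ) {Φ : (ι → ℝ) → ℝ} (hΦ : Smooth Φ) (h0 : Φ 0 = 0) (R : NNReal) :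
    ∃ C : NNReal, ∀ D I a b S, IsMoserBox e s κ Λ K D I a b S →
    ∀ Y : ι → Fn d, (∀ k, AEPeriodic D (Y k)) →
    (∀ k, ∀ᵐ z ∂vol D, ‖Y k z‖ₑ ≤ R) →
    (bare = true → ∀ i k, ∃ h, IsWeakPartial D i (Y k) h ∧
      ∀ᵐ z ∂vol D, ‖(if i = e then s (z e) else 1) * h z‖ₑ ≤ R) →
      weakLev e s bare D n (fun z => Φ fun k => Y k z) ≤ C * ∑ k, weakLev e s bare D n (Y k) := by
  set R' := max 1 Λ * R with hR'
  obtain ⟨C₁, hC₁⟩ := moser_smooth e hs κ hκ hK bare n hΦ h0 R'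
  obtain ⟨C₂, hC₂⟩ := exists_weak_of_tendsto d
  set Q := 6 ^ d * (max 1 Λ) ^ (2 * n) with hQ
  have hQ1 : ∀ j ≤ n, 6 ^ d * (((Λ ^ j) : ℝ≥0∞)) ^ 2 ≤ Q := by
    intro j hj
    have : 6 ^ d * (Λ ^ j) ^ 2 ≤ Q := by
      rw [hQ, ← pow_mul, mul_comm j 2]
      refine mul_le_mul_right ?_ _
      exact (pow_le_pow_left₀ zero_le (le_max_right 1 Λ) _).trans
        (pow_le_pow_right₀ (le_max_left 1 Λ) (by omega))
    exact_mod_cast this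
  refine ⟨max 1 ((ords d bare n).card * (C₂ * (C₁ * Q))), fun D I a b S hB Y hper hYR hZ => ?_⟩
  have hDo := hB.box.isOpen
  have hI := hB.box.invariant
  by_cases hfin : ∑ k, weakLev e s bare D n (Y k) = ⊤
  · rw [hfin, mul_top]
    · exact le_top
    · exact_mod_cast (zero_lt_one.trans_le (le_max_left _ _)).ne'
  have hterm k : ∀ p ∈ ords d bare n, ∃ g, IsWeakDeriv D (p.1 + single e p.2) (Y k) g := by
    intro p hp
    refine exists_of_scaledSq (s := s) fun htop => hfin ?_
    rw [ENNReal.sum_eq_top]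
    exact ⟨k, mem_univ _, top_le_iff.1 (htop.symm.le.trans (le_weakLev hp _))⟩
  choose! g hg using hterm
  have hloc := fun k => locInt_indicator_of_bound hDo (
      (fun k => (hg k 0 (by rw [mem_ords]; simp [wt])).1.aestronglyMeasurable) k) (hYR k)
  set u := fun j k => moll D a b j (Y k)
  have husm : ∀ j k, Smooth (u j k) := fun j k => smooth_moll (hloc k) j
  have huper : ∀ j k, IsPeriodic D (u j k) := fun j k => moll_periodic hB.box (hper k) j
  have huR j k : ∀ z ∈ D.cover, ‖u j k z‖ₑ ≤ R := by
    intro z hz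
    simpa [pdMulti_zero] using enorm_moll_le hB.box (mollWeight_one D a b) (hloc k) ((isWeakDeriv_zero_iff hDo).2 ⟨(hg k 0 (by rw [mem_ords]; simp [wt])).1, EventuallyEq.rfl⟩) (R := R) (by simpa using hYR k) j hz
  have hRR : (R : ℝ≥0∞) ≤ R' := by
    exact_mod_cast (le_mul_of_one_le_left zero_le (le_max_left _ _))
  have huZ : bare = true → ∀ j i k, ∀ z ∈ D.cover, ‖zD e s i (u j k) z‖ₑ ≤ R' := by
    intro hb j i k z hz
    obtain ⟨h, hh, hhR⟩ := hZ hb i k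
    have hc : MollWeight D a b (max 1 Λ) fun z => if i = e then s (z e) else 1 := by
      by_cases hie : i = e
      · simp only [hie, if_true]
        refine ⟨hB.weight.1, hB.weight.2.1, fun n z hz w hw hzw => ?_⟩
        exact (hB.weight.2.2 n z hz w hw hzw).trans (by gcongr; exact le_max_right _ _)
      · simp only [hie, if_false]
        exact ⟨measurable_const, fun _ _ _ => rfl, by simp⟩
    have := enorm_moll_le hB.box hc (hloc k) (weakDeriv_single.2 hh) hhR j hz
    rw [pdMulti_single (husm j k) i] at this
    simpa only [zD, hR', coe_mul] using this
  have hulev j k : levSq e s bare S n (u j k) ≤ Q * weakLev e s bare D n (Y k) := by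
    unfold levSq weakLev
    rw [mul_sum]
    refine sum_le_sum fun p hp => ?_
    rw [(hg k p hp).scaledSq_eq hDo s, ← hB.cell_eq]
    have hpe : p.1 e ≤ n := by
      have h1 := (mem_ords.1 hp).1
      have h2 := single_le_sum (f := p.1) (fun _ _ => Nat.zero_le _) (mem_univ e)
      unfold wt at h1
      omega
    refine (lintegral_moll_sq_le hB.box (hB.weight.pow (p.1 e)) (hloc k) (hg k p hp)
      ((hg k p hp).aePeriodic hDo hI (hper k)) j).trans ?_
    exact mul_le_mul_left (hQ1 _ hpe) _
  have hcellS : ∀ z ∈ univ.pi S, z ∈ D.cover := fun z hz =>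
    cell_subset D (by rw [hB.cell_eq]; exact hz)
  set B := C₁ * (Q * ∑ k, weakLev e s bare D n (Y k)) with hBdef
  have hBtop : B ≠ ⊤ := mul_ne_top ENNReal.coe_ne_top
    (mul_ne_top ENNReal.coe_ne_top hfin)
  have hmos j : levSq e s bare S n (fun z => Φ fun k => u j k z) ≤ B := by
    refine (hC₁ S (u j) ⟨hB.partitions, husm j, fun k z hz => (huR j k z (hcellS z hz)).trans hRR⟩ hB.subset
      (fun hb i k z hz => huZ hb j i k z (hcellS z hz))).trans ?_
    rw [hBdef]
    gcongr
    rw [mul_sum]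
    exact sum_le_sum fun k _ => hulev j k
  obtain ⟨M, hM⟩ := (isCompact_closedBall 0 R).exists_bound_of_continuousOn
    hΦ.continuous.continuousOn
  have hlim : ∀ᵐ z ∂vol D,
      Tendsto (fun j => Φ fun k => u j k z) atTop (𝓝 (Φ fun k => Y k z)) := by
    exact (ae_all_iff.2 fun k => ae_tendsto_moll hB.box (hloc k)).mono fun z hz =>
      (hΦ.continuous.tendsto _).comp (tendsto_pi_nhds.2 hz)
  have key : ∀ p ∈ ords d bare n,
      scaledSq e s D p (fun z => Φ fun k => Y k z) ≤ C₂ * B := by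
    intro p hp
    obtain ⟨g', hg', hle⟩ := hC₂ D hDo hI (p.1 + single e p.2) (fun z => s (z e) ^ p.1 e)
      ((hs.comp (contDiff_apply ℝ ℝ e)).pow _) (fun z hz => (pow_pos (hB.pos z hz) _).ne')
      (hB.weight.pow (p.1 e)).2.1 (fun j z => Φ fun k => u j k z) (fun z => Φ fun k => Y k z) M
      B.toNNReal (fun j => hΦ.comp (contDiff_pi.2 fun k => husm j k)) (fun j i hi z => by simp only [huper j _ i hi z])
      (fun j z hz => hM _ (by
        rw [mem_closedBall_zero_iff, pi_norm_le_iff_of_nonneg R.coe_nonneg]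
        intro k
        have := huR j k z hz
        rwa [← ofReal_norm, ENNReal.ofReal_le_coe] at this)) hlim (by
        intro j
        rw [coe_toNNReal hBtop, hB.cell_eq]
        exact (le_levSq _ (mem_ords.1 hp).1 (mem_ords.1 hp).2).trans (hmos j))
    rw [coe_toNNReal hBtop] at hle
    exact (iInf₂_le g' hg').trans hle
  calc _ ≤ ∑ _p ∈ ords d bare n, C₂ * B := sum_le_sum key
    _ = ((ords d bare n).card * (C₂ * (C₁ * Q)) : NNReal) * ∑ k, weakLev e s bare D n (Y k) := by
        rw [sum_const, nsmul_eq_mul, hBdef]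
        push_cast
        ring
    _ ≤ _ := by
        gcongr
        exact le_max_right _ _

end

section

/-! ### The domains as boxes -/

theorem LinePart.Comparable.mono {P : LinePart J}
    (h : P.Comparable s κ) (hκ : κ ≤ κ') : P.Comparable s κ' := fun τ hτ => by
  obtain ⟨h1, h2, h3⟩ := h τ hτ
  exact ⟨h1, h2.trans (by gcongr), h3.trans (by gcongr)⟩

theorem exists_part_Iio (T : ℝ) {κ : ℝ} (hκ : 1 ≤ κ) :
    ∃ P : LinePart (Iio T), P.Comparable (fun _ => 1) κ := by
  refine ⟨_, (comparable_uniform (Iio T) T fun τ hτ x hx => ?_).mono hκ⟩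
  have h1 : τ - T < 0 := sub_neg.2 hτ
  have h3 : (⌊τ - T⌋ : ℝ) + 1 ≤ 0 := by exact_mod_cast (Int.floor_lt.2 (by simpa using h1))
  have := hx.2
  rw [Set.mem_Iio]
  linarith

theorem exists_part_unit {J : Set ℝ} (a) (h1 : J ⊆ Ico a (a + 1))
    (h2 : Ioo a (a + 1) ⊆ J) (hκ : 1 ≤ κ) :
    ∃ P : LinePart J, P.Comparable (fun _ => 1) κ := by
  refine ⟨_, (comparable_uniform J a fun τ hτ x hx => h2 ?_).mono hκ⟩
  have h3 := h1 hτ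
  have h4 : ⌊τ - a⌋ = 0 := Int.floor_eq_zero_iff.2 ⟨by linarith [h3.1], by linarith [h3.2]⟩
  simpa [h4] using hx

theorem exists_part_Ico {κ : ℝ} (hκ : 1 ≤ κ) :
    ∃ P : LinePart (Ico 0 1), P.Comparable (fun _ => 1) κ :=
  exists_part_unit 0 (by simp) (by simpa using Set.Ioo_subset_Ico_self) hκ

/-- The weight `σ`, continued by `τ` to the left and by `1 - τ` to the right of `(0, 1)`; this makes
it smooth on the line. -/
def sigExt (σ : ℝ → ℝ) (τ : ℝ) : ℝ := if τ ≤ 0 then τ else if τ < 1 then σ τ else 1 - τ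

variable {σ : ℝ → ℝ}

theorem sigExt_of_mem {τ : ℝ} (h : τ ∈ Ioo (0 : ℝ) 1) : sigExt σ τ = σ τ := by
  simp [sigExt, not_le.2 h.1, h.2]

theorem sigExt_near_zero (hσ : IsConormalWeight σ) : ∃ η > 0, η < 1 / 2 ∧ ∀ τ < η,
    sigExt σ τ = τ := by
  obtain ⟨η, hη, h⟩ := mem_nhdsGT_iff_exists_Ioo_subset.1 hσ.2.2.1
  refine ⟨min η (1 / 4), lt_min hη (by norm_num), (min_le_right _ _).trans_lt (by norm_num),
    fun τ hτ => ?_⟩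
  by_cases h0 : τ ≤ 0
  · simp [sigExt, h0]
  · rw [not_le] at h0
    rw [sigExt_of_mem ⟨h0, by linarith [hτ.trans_le (min_le_right η (1 / 4))]⟩]
    exact h ⟨h0, hτ.trans_le (min_le_left _ _)⟩

theorem sigExt_near_one (hσ : IsConormalWeight σ) : ∃ η < 1, 1 / 2 < η ∧ ∀ τ > η,
    sigExt σ τ = 1 - τ := by
  obtain ⟨η, hη, h⟩ := mem_nhdsLT_iff_exists_Ioo_subset.1 hσ.2.2.2
  refine ⟨max η (3 / 4), max_lt hη (by norm_num), lt_of_lt_of_le (by norm_num) (le_max_right _ _),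
    fun τ hτ => ?_⟩
  have h2 := (le_max_right _ _).trans_lt hτ
  by_cases h0 : τ < 1
  · rw [sigExt_of_mem ⟨by linarith, h0⟩]
    exact h ⟨(le_max_left _ _).trans_lt hτ, h0⟩
  · simp [sigExt, h0, not_le.2 (show 0 < τ by linarith)]

theorem smooth_sigExt (hσ : IsConormalWeight σ) : Smooth (sigExt σ) := by
  rw [contDiff_iff_contDiffAt]
  intro τ
  obtain ⟨η, hη, -, h1⟩ := sigExt_near_zero hσ
  obtain ⟨η', hη', -, h2⟩ := sigExt_near_one hσ
  by_cases hτ : τ < η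
  · exact contDiffAt_id.congr_of_eventuallyEq (Filter.mem_of_superset (Iio_mem_nhds hτ) h1)
  by_cases hτ' : η' < τ
  · exact (contDiffAt_const.sub contDiffAt_id).congr_of_eventuallyEq
      (Filter.mem_of_superset (Ioi_mem_nhds hτ') h2)
  have hm : τ ∈ Ioo 0 1 := ⟨by linarith, by linarith⟩
  exact (hσ.1.contDiffAt (Ioo_mem_nhds hm.1 hm.2)).congr_of_eventuallyEq
    (Filter.mem_of_superset (Ioo_mem_nhds hm.1 hm.2) fun _ => sigExt_of_mem)

theorem sigExt_pos (hσ : IsConormalWeight σ) {τ : ℝ} (h : τ ∈ Ioo (0 : ℝ) 1) :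
    0 < sigExt σ τ := by
  rw [sigExt_of_mem h]; exact hσ.2.1 τ h

theorem sigExt_comparable (hσ : IsConormalWeight σ) : ∃ κ : ℝ, 1 ≤ κ ∧
    ∀ τ ∈ Ioo (0 : ℝ) 1,
      sigExt σ τ ≤ κ * min τ (1 - τ) ∧ min τ (1 - τ) ≤ κ * sigExt σ τ := by
  obtain ⟨η, hη, hη2, h1⟩ := sigExt_near_zero hσ
  obtain ⟨η', hη', hη2', h2⟩ := sigExt_near_one hσ
  have hsub : Icc η η' ⊆ Ioo 0 1 := fun τ h => ⟨by linarith [h.1], by linarith [h.2]⟩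
  have hc := (smooth_sigExt hσ).continuous
  have hm : Continuous fun τ : ℝ => min τ (1 - τ) := by fun_prop
  obtain ⟨M, hM⟩ := (isCompact_Icc).exists_bound_of_continuousOn
    (hc.continuousOn.div hm.continuousOn
        (fun τ h => (lt_min (hsub h).1 (by linarith [(hsub h).2])).ne'))
  obtain ⟨M', hM'⟩ := (isCompact_Icc).exists_bound_of_continuousOn
    (hm.continuousOn.div hc.continuousOn (fun τ h => (sigExt_pos hσ (hsub h)).ne'))
  refine ⟨max 1 (max M M'), le_max_left _ _, fun τ hτ => ?_⟩
  by_cases ha : τ < η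
  · rw [h1 τ ha, min_eq_left (by linarith)]
    constructor <;> exact le_mul_of_one_le_left hτ.1.le (le_max_left _ _)
  by_cases hb : η' < τ
  · rw [h2 τ hb, min_eq_right (by linarith)]
    constructor <;> exact le_mul_of_one_le_left (by linarith [hτ.2]) (le_max_left _ _)
  have hI : τ ∈ Icc η η' := ⟨not_lt.1 ha, not_lt.1 hb⟩
  constructor
  · rw [← div_le_iff₀ (lt_min hτ.1 (by linarith [hτ.2]))]
    exact ((le_abs_self _).trans (hM τ hI)).trans ((le_max_left _ _).trans (le_max_right _ _))
  · rw [← div_le_iff₀ (sigExt_pos hσ hτ)]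
    exact ((le_abs_self _).trans (hM' τ hI)).trans ((le_max_right _ _).trans (le_max_right _ _))

theorem isBox_slab {D : PeriodicDomain 4} (hr : r = l + 1) (hc : c = l + 1 / 2)
    (hD : D.cover = univ.pi ![Iio T, Ioo l r, univ, univ]) (ht : D.torus = {2, 3}) :
    IsBox D ![Iio T, Ioo l r, univ, univ] ![0, 1, 0, 0] ![-1, c, 0, 0] where
  cover_eq := hD
  isOpen_side := by simp [forall_fin_succ, isOpen_Iio, isOpen_Ioo]
  torus_eq := by simp [ht]
  torus_a := by simp [ht]
  torus_b := by simp [ht]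
  a_nonneg := by simp [forall_fin_succ]
  a_le := by simp [forall_fin_succ]
  dist_le := by
    simp only [forall_fin_succ, Matrix.cons_val_zero, Matrix.cons_val_succ, Set.mem_Ioo, abs_le]
    norm_num
    intro τ h1 h2
    constructor <;> linarith
  inside := by
    simp only [forall_fin_succ, Matrix.cons_val_zero, Matrix.cons_val_succ, Set.mem_Iio,
      Set.mem_Ioo, abs_le]
    refine ⟨fun τ h δ h1 h2 u h3 => by linarith [h3.1], fun τ h δ h1 h2 u h3 => ?_, by simp⟩
    constructor <;> nlinarith [h3.1, h3.2, mul_pos h1 (sub_pos.2 h.1), mul_pos h1 (sub_pos.2 h.2)]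

theorem isBox_plasma (T : ℝ) : IsBox (Q⁺ T)
    ![Iio T, Ioo 0 1, univ, univ] ![0, 1, 0, 0] ![-1, 1 / 2, 0, 0] :=
  isBox_slab (by simp) (by simp) (by ext; simp [plasmaDomain, forall_fin_succ]) rfl

theorem isBox_vacuum (T : ℝ) : IsBox (vacuumDomain T)
    ![Iio T, Ioo (-1) 0, univ, univ] ![0, 1, 0, 0] ![-1, -1 / 2, 0, 0] :=
  isBox_slab (by simp) (by norm_num) (by ext; simp [vacuumDomain, forall_fin_succ]) rfl

theorem isBox_interface (T) : IsBox (Γ T) ![Iio T, univ, univ] 0 ![-1, 0, 0] where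
  cover_eq := by ext; simp [interfaceDomain, forall_fin_succ]
  isOpen_side := by simp [forall_fin_succ, isOpen_Iio]
  torus_eq := by simp [interfaceDomain]
  torus_a := by simp
  torus_b := by simp [interfaceDomain]
  a_nonneg := by simp
  a_le := by simp
  dist_le := by norm_num [forall_fin_succ]
  inside := by
    simp only [forall_fin_succ, Matrix.cons_val_zero, Matrix.cons_val_succ, Set.mem_Iio, abs_le,
      Pi.zero_apply]
    refine ⟨fun τ h δ h1 h2 u h3 => by linarith [h3.1], by simp⟩

/-- The sides of the unit cell of the plasma domain. -/
def plasmaSides (T : ℝ) : Fin 4 → Set ℝ :=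
  ![Iio T, Ioo 0 1, Ico 0 1, Ico 0 1]

/-- The sides of the unit cell of the vacuum domain. -/
def vacuumSides (T : ℝ) : Fin 4 → Set ℝ :=
  ![Iio T, Ioo (-1) 0, Ico 0 1, Ico 0 1]

/-- The sides of the unit cell of the interface. -/
def interfaceSides (T : ℝ) : Fin 3 → Set ℝ := ![Iio T, Ico 0 1, Ico 0 1]

theorem exists_isMoserBox_plasma (hσ : IsConormalWeight σ) : ∃ κ : ℝ, 0 < κ ∧ ∃ Λ : NNReal,
    ∀ T, IsMoserBox 1 (sigExt σ) κ Λ (Icc 0 1) (Q⁺ T)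
      ![Iio T, Ioo 0 1, univ, univ] ![0, 1, 0, 0] ![-1, 1 / 2, 0, 0]
      (plasmaSides T) := by
  obtain ⟨κ, hκ, h⟩ := sigExt_comparable hσ
  refine ⟨2 * κ, by linarith, (2 * κ ^ 2).toNNReal, fun T => ⟨isBox_plasma T, ?_, ?_, ?_, ?_, ?_⟩⟩
  · ext z
    simp [PeriodicDomain.cell, plasmaDomain, plasmaSides, Set.mem_pi, forall_fin_succ, and_assoc]
  · refine ⟨?_, ⟨whitneyPart, comparable_whitney (by linarith) h⟩, ?_⟩
    · have h1 : 1 ≤ 2 * κ := by linarith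
      have h3 := exists_part_Ico h1
      simp only [plasmaSides, forall_fin_succ]
      exact ⟨exists_part_Iio T h1, exists_part_unit 0 (by simpa using Set.Ioo_subset_Ico_self) (by simp) h1, h3, h3, fun i => i.elim0⟩
    · simp [plasmaSides, forall_fin_succ]
  · simpa [plasmaSides] using Set.Ioo_subset_Icc_self
  · intro z hz
    exact sigExt_pos hσ hz.2
  · refine ⟨(smooth_sigExt hσ).continuous.measurable.comp (measurable_pi_apply 1), ?_, ?_⟩
    · intro v hv z
      simp [shiftVec, hv 1 (by simp [plasmaDomain])]
    · intro n z hz w hw hzw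
      have hδ := mollR_pos n
      have hδ' := mollR_le n
      rw [mem_closedBall_zero_iff] at hzw
      have h1 := abs_le.1 ((norm_le_pi_norm _ 1).trans hzw)
      simp only [affMap, Pi.sub_apply, Matrix.cons_val_one, Matrix.cons_val_zero] at h1
      have hz1 := hz.2
      have hw1 := hw.2
      have e1 : min (z 1) (1 - z 1) ≤ 2 * min (w 1) (1 - w 1) := by
        rw [mul_min_of_nonneg _ _ (by norm_num)]
        refine le_min ((min_le_left _ _).trans ?_) ((min_le_right _ _).trans ?_)
        · nlinarith [h1.2, hz1.1]
        · nlinarith [h1.1, hz1.2]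
      have e2 : sigExt σ (z 1) ≤ 2 * κ ^ 2 * sigExt σ (w 1) := by
        nlinarith [(h _ hz1).1, (h _ hw1).2]
      rw [enorm_of_nonneg (sigExt_pos hσ hz1).le, enorm_of_nonneg (sigExt_pos hσ hw1).le]
      refine (ofReal_le_ofReal e2).trans (le_of_eq ?_)
      rw [ofReal_mul (by positivity)]
      rfl

theorem isMoserBox_vacuum (T) : IsMoserBox 1 (fun _ => 1) 1 1 (Icc (-1) 0) (vacuumDomain T)
    ![Iio T, Ioo (-1) 0, univ, univ] ![0, 1, 0, 0] ![-1, -1 / 2, 0, 0]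
    (vacuumSides T) := by
  have h2 := exists_part_unit (J := Ioo (-1) 0) (-1)
    (by simpa using Set.Ioo_subset_Ico_self) (by simp) le_rfl
  have h3 := exists_part_Ico le_rfl
  refine ⟨isBox_vacuum T, ?_, ⟨?_, h2, ?_⟩, ?_, fun _ _ => one_pos, mollWeight_one _ _ _⟩
  · ext z
    simp [PeriodicDomain.cell, vacuumDomain, vacuumSides, Set.mem_pi, forall_fin_succ, and_assoc]
  · simp only [vacuumSides, forall_fin_succ]
    exact ⟨exists_part_Iio T le_rfl, h2, h3, h3, fun i => i.elim0⟩
  · simp [vacuumSides, forall_fin_succ]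
  · simpa [vacuumSides] using Set.Ioo_subset_Icc_self

theorem isMoserBox_interface (T) : IsMoserBox 1 (fun _ => 1) 1 1 (Icc 0 1)
    (Γ T) ![Iio T, univ, univ] 0 ![-1, 0, 0] (interfaceSides T) := by
  have h3 := exists_part_Ico le_rfl
  refine ⟨isBox_interface T, ?_, ⟨?_, h3, ?_⟩, ?_, fun _ _ => one_pos, mollWeight_one _ _ _⟩
  · ext z
    simp [PeriodicDomain.cell, interfaceDomain, interfaceSides, Set.mem_pi, forall_fin_succ]
  · simp only [interfaceSides, forall_fin_succ]
    exact ⟨exists_part_Iio T le_rfl, h3, h3, fun i => i.elim0⟩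
  · simp [interfaceSides, forall_fin_succ]
  · simpa [interfaceSides] using Set.Ico_subset_Icc_self

end

section

/-! ### Conormal derivatives in terms of scaled derivatives -/


/-- The formal adjoint `(-∂)^β` of `∂^β`. -/
def adjD (β : Fin d → ℕ) (φ : Fn d) : Fn d :=
  fun z => (-1) ^ (∑ i, β i) * pdMulti β φ z

theorem smooth_adjD (hφ : Smooth φ) (β) :
    Smooth (adjD β φ) := contDiff_const.mul (smooth_pdMulti hφ β)

theorem adjD_zero (φ : Fn d) : adjD 0 φ = φ := by
  funext z; simp [adjD, pdMulti_zero]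

theorem adjD_adjD (hφ : Smooth φ) (α β) :
    adjD α (adjD β φ) = adjD (α + β) φ := by
  funext z
  unfold adjD
  rw [pdMulti_const_mul (smooth_pdMulti hφ β), pdMulti_pdMulti hφ]
  simp only [Pi.add_apply, sum_add_distrib, pow_add]
  ring

theorem adjD_single (hφ : Smooth φ) (i) :
    adjD (single i 1) φ = fun z => -pd i φ z := by
  funext z
  simp [adjD, pdMulti_single hφ]

theorem adjD_add (hf : Smooth f) (hg : Smooth g)
    (β) : adjD β (fun z => f z + g z) = fun z => adjD β f z + adjD β g z := by
  funext z
  simp only [adjD]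
  rw [pdMulti_add' hf hg]
  ring

theorem adjD_coord_mul (hc : Smooth c)
    (hφ : Smooth φ) (hβ : β e = 0) :
    adjD β (fun z => c (z e) * φ z) = fun z => c (z e) * adjD β φ z := by
  have key β : β e = 0 →
      pdMulti β (fun z => c (z e) * φ z) = fun z => c (z e) * pdMulti β φ z := by
    induction β using multiIndex_ind with
    | h0 => simp [pdMulti_zero]
    | h1 β i ih =>
      intro h
      have hie : i ≠ e := by
        rintro rfl
        simp at h
      have h' : β e = 0 := by
        have : β e + (single i 1 : Fin d → ℕ) e = 0 := h
        omega
      rw [pdMulti_succ ((smooth_coord hc e).mul hφ), ih h',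
        pd_mul (smooth_coord hc e) (smooth_pdMulti hφ β), pdMulti_succ hφ]
      funext z
      rw [pd_coord hc, if_neg hie]
      ring
  funext z
  simp only [adjD, key β hβ]
  ring

/-- The formal adjoint `φ ↦ -∂_e (s φ)` of `s ∂_e`. -/
def zAdjoint (e : Fin d) (s : ℝ → ℝ) (φ : Fn d) : Fn d :=
  fun z => -pd e (fun w => s (w e) * φ w) z

variable {e : Fin d} {s : ℝ → ℝ}

theorem smooth_zAdjoint (hs : Smooth s) (hφ : Smooth φ) :
    Smooth (zAdjoint e s φ) :=
  (smooth_pd ((smooth_coord hs e).mul hφ) e).neg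

theorem smooth_zAdjoint_iter (hs : Smooth s)
    (hφ : Smooth φ) (k : ℕ) : Smooth ((zAdjoint e s)^[k] φ) := by
  induction k with
  | zero => exact hφ
  | succ k ih => rw [iterate_succ_apply']; exact smooth_zAdjoint hs ih

theorem zAdjoint_add (hs : Smooth s) (hf : Smooth f)
    (hg : Smooth g) :
    zAdjoint e s (fun z => f z + g z) = fun z => zAdjoint e s f z + zAdjoint e s g z := by
  funext z
  simp only [zAdjoint, mul_add]
  rw [pd_add ((smooth_coord hs e).mul hf) ((smooth_coord hs e).mul hg)]
  ring

theorem zAdjoint_iterate_add (hs : Smooth s) (hf : Smooth f)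
    (hg : Smooth g) (k : ℕ) : (zAdjoint e s)^[k] (fun z => f z + g z) =
      fun z => (zAdjoint e s)^[k] f z + (zAdjoint e s)^[k] g z := by
  induction k with
  | zero => rfl
  | succ k ih =>
    rw [iterate_succ_apply', ih, zAdjoint_add hs (smooth_zAdjoint_iter hs hf k)
      (smooth_zAdjoint_iter hs hg k), iterate_succ_apply',
      iterate_succ_apply']

/-- `c · (-∂_e (s φ)) = -∂_e (s (c φ)) + s c' φ`. -/
theorem coord_mul_zAdjoint (hs : Smooth s) (hc : Smooth c)
    (hφ : Smooth φ) (z : Fin d → ℝ) :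
    c (z e) * zAdjoint e s φ z = zAdjoint e s (fun w => c (w e) * φ w) z +
      s (z e) * deriv c (z e) * φ z := by
  have h1 : (fun w => s (w e) * (c (w e) * φ w)) =
      fun w => c (w e) * (s (w e) * φ w) := by funext w; ring
  simp only [zAdjoint]
  rw [h1, pd_mul (smooth_coord hc e) ((smooth_coord hs e).mul hφ)]
  dsimp only
  rw [pd_coord hc, if_pos rfl]
  ring

theorem smooth_deriv {c : ℝ → ℝ} (hc : Smooth c) : Smooth (deriv c) :=
  (contDiff_infty_iff_deriv.1 hc).2

theorem coord_pow_mul_zAdjoint (hs : Smooth s) (hc : Smooth c) (hφ : Smooth φ) (i : ℕ) :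
    (fun z => s (z e) ^ i * (c (z e) * zAdjoint e s φ z)) = fun z =>
      adjD (single e 1) (fun w => s (w e) ^ (i + 1) * (c (w e) * φ w)) z +
        s (z e) ^ i * ((i * deriv s (z e) * c (z e) + s (z e) * deriv c (z e)) * φ z) := by
  funext z
  have h1 := coord_mul_zAdjoint (e := e) hs ((hs.pow i).mul hc) hφ z
  have h2 : deriv (fun τ => s τ ^ i * c τ) (z e) =
      i * s (z e) ^ (i - 1) * deriv s (z e) * c (z e) + s (z e) ^ i * deriv c (z e) :=
    (((hs.differentiable (by simp) (z e)).hasDerivAt.pow i).mul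
      (hc.differentiable (by simp) (z e)).hasDerivAt).deriv
  have h3 : i * (s (z e) ^ (i - 1) * s (z e)) = i * s (z e) ^ i := by
    cases i <;> simp [pow_succ]
  have h4 : (fun w => s (w e) * (s (w e) ^ i * c (w e) * φ w)) =
      fun w => s (w e) ^ (i + 1) * (c (w e) * φ w) := by funext w; ring
  rw [adjD_single ((smooth_coord (hs.pow _) e).mul ((smooth_coord hc e).mul hφ))]
  simp only [zAdjoint, h2, h4] at h1 ⊢
  linear_combination h1 + (deriv s (z e) * c (z e) * φ z) * h3

/-- `L φ` is a sum of terms `B i (c φ)` with `i ≤ a` and smooth coefficients `c` that depend on the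
coordinate `e` only. -/
def Expands (e : Fin d) (B : ℕ → Fn d → Fn d) (a : ℕ) (L : Fn d → Fn d) : Prop :=
  ∃ (N : ℕ) (k : Fin N → ℕ) (c : Fin N → ℝ → ℝ), (∀ j, k j ≤ a ∧ Smooth (c j)) ∧
    ∀ φ, Smooth φ → ∀ z, L φ z = ∑ j, B (k j) (fun w => c j (w e) * φ w) z

theorem Expands.base (B : ℕ → Fn d → Fn d) {L : Fn d → Fn d} (h : B 0 = L) : Expands e B 0 L :=
  ⟨1, 0, 1, fun _ => ⟨le_rfl, contDiff_const⟩, by simp [← h]⟩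

theorem Expands.add {B : ℕ → Fn d → Fn d} {a : ℕ} {L L' M : Fn d → Fn d} (h : Expands e B a L)
    (h' : Expands e B a L') (hM : ∀ φ, Smooth φ → ∀ z, M φ z = L φ z + L' φ z) :
    Expands e B a M := by
  obtain ⟨N, k, c, hc, h⟩ := h
  obtain ⟨N', k', c', hc', h'⟩ := h'
  refine ⟨N + N', Fin.append k k', Fin.append c c', Fin.addCases (by simpa using hc)
    (by simpa using hc'), fun φ hφ z => ?_⟩
  simp [hM φ hφ, h φ hφ, h' φ hφ, Fin.sum_univ_add]

theorem Expands.coord_mul {B : ℕ → Fn d → Fn d} {L : Fn d → Fn d} (h : Expands e B a L)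
    {y : ℝ → ℝ} (hy : Smooth y) : Expands e B a fun φ => L fun w => y (w e) * φ w := by
  obtain ⟨N, k, c, hc, h⟩ := h
  refine ⟨N, k, fun j τ => c j τ * y τ, fun j => ⟨(hc j).1, (hc j).2.mul hy⟩, fun φ hφ z => ?_⟩
  simp only [h _ ((smooth_coord hy e).mul hφ), mul_assoc]

theorem Expands.comp {B : ℕ → Fn d → Fn d} {L X : Fn d → Fn d} (h : Expands e B a L)
    (hX : ∀ φ, Smooth φ → Smooth (X φ)) {r : ℕ → (ℝ → ℝ) → ℝ → ℝ}
    (hr : ∀ i c, Smooth c → Smooth (r i c)) (hB : ∀ i c, Smooth c → ∀ φ, Smooth φ → ∀ z,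
      B i (fun w => c (w e) * X φ w) z = B (i + 1) (fun w => c (w e) * φ w) z +
        B i (fun w => r i c (w e) * φ w) z) : Expands e B (a + 1) fun φ => L (X φ) := by
  obtain ⟨N, k, c, hc, h⟩ := h
  refine Expands.add
    (L' := fun φ z => ∑ j, B (k j) (fun w => r (k j) (c j) (w e) * φ w) z)
    ⟨N, fun j => k j + 1, c, fun j => ⟨Nat.succ_le_succ (hc j).1, (hc j).2⟩, fun _ _ _ => rfl⟩
    ⟨N, k, _, fun j => ⟨(hc j).1.trans (Nat.le_succ a), hr _ _ (hc j).2⟩, fun _ _ _ => rfl⟩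
    fun φ hφ z => ?_
  simp only [h _ (hX φ hφ), fun j => hB (k j) (c j) (hc j).2 φ hφ z, sum_add_distrib]

theorem Expands.mono {B : ℕ → Fn d → Fn d} {a b : ℕ} {L : Fn d → Fn d} (h : Expands e B a L)
    (hab : a ≤ b) : Expands e B b L := by
  obtain ⟨N, k, c, hc, h⟩ := h
  exact ⟨N, k, c, fun j => ⟨(hc j).1.trans hab, (hc j).2⟩, h⟩

theorem adjD_coord_pow_mul_zAdjoint (hs : Smooth s) (hc : Smooth c) (hφ : Smooth φ)
    (β) (i : ℕ) (z : Fin d → ℝ) :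
    adjD (β + single e i) (fun w => s (w e) ^ i * (c (w e) * zAdjoint e s φ w)) z =
      adjD (β + single e (i + 1)) (fun w => s (w e) ^ (i + 1) * (c (w e) * φ w)) z +
        adjD (β + single e i) (fun w =>
          s (w e) ^ i * ((i * deriv s (w e) * c (w e) + s (w e) * deriv c (w e)) * φ w)) z := by
  have h1 := (smooth_coord (hs.pow (i + 1)) e).mul ((smooth_coord hc e).mul hφ)
  rw [coord_pow_mul_zAdjoint hs hc hφ, adjD_add (smooth_adjD h1 _) ((smooth_coord (hs.pow i)
    e).mul ((smooth_coord ((((contDiff_const).mul (smooth_deriv hs)).mul hc).add (hs.mul (smooth_deriv hc))) e).mul hφ)), adjD_adjD h1,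
    add_assoc, ← Pi.single_add]

/-- The expansion of `(s ∂_e)^a` in the operators `s^i ∂_e^i`, in terms of adjoints. -/
theorem expands_zAdjoint (hs : Smooth s) (β : Fin d → ℕ) (a : ℕ) :
    Expands e (fun i φ => adjD (β + single e i) fun w => s (w e) ^ i * φ w) a
      fun φ => adjD β ((zAdjoint e s)^[a] φ) := by
  induction a with
  | zero => exact .base _ (by simp)
  | succ a ih =>
    exact ih.comp (fun φ hφ => smooth_zAdjoint hs hφ)
     
      (fun i c hc => ((contDiff_const.mul (smooth_deriv hs)).mul hc).add
        (hs.mul (smooth_deriv hc)))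
      fun i c hc φ hφ z => adjD_coord_pow_mul_zAdjoint hs hc hφ β i z

/-- The expansion of `s^a ∂_e^a` in the operators `(s ∂_e)^i`, in terms of adjoints. -/
theorem expands_adjD (hs : Smooth s) (β : Fin d → ℕ) (a : ℕ) :
    Expands e (fun i φ => adjD β ((zAdjoint e s)^[i] φ)) a
      fun φ => adjD (β + single e a) fun w => s (w e) ^ a * φ w := by
  induction a with
  | zero => exact .base _ (by simp)
  | succ a ih =>
    have hy : Smooth fun τ => -(a * deriv s τ) := (contDiff_const.mul (smooth_deriv hs)).neg
    refine (ih.comp (X := zAdjoint e s)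
      (fun φ hφ => smooth_zAdjoint hs hφ) (fun i c hc => hs.mul (smooth_deriv hc))
      fun i c hc φ hφ z => ?_).add ((ih.coord_mul hy).mono a.le_succ) fun φ hφ z => ?_
    · have h1 := (smooth_coord hc e).mul hφ
      have h2 := (smooth_coord (hs.mul (smooth_deriv hc)) e).mul hφ
      rw [Function.iterate_succ_apply, ← congrFun (adjD_add (smooth_zAdjoint_iter hs
        (smooth_zAdjoint hs h1) i) (smooth_zAdjoint_iter hs h2 i) β) z,
        ← zAdjoint_iterate_add hs (smooth_zAdjoint hs h1) h2]
      simp only [coord_mul_zAdjoint hs hc hφ]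
    · have h4 : adjD (single e 1) (fun w => s (w e) ^ (a + 1) * φ w) = fun w =>
          s (w e) ^ a * zAdjoint e s φ w + s (w e) ^ a * (-(a * deriv s (w e)) * φ w) := by
        funext w
        have := congrFun (coord_pow_mul_zAdjoint (e := e) hs (contDiff_const (c := 1)) hφ a) w
        simp only [one_mul, mul_one, deriv_const, mul_zero, add_zero] at this
        linear_combination -this
      rw [← congrFun (adjD_add ((smooth_coord (hs.pow a) e).mul (smooth_zAdjoint hs hφ))
          ((smooth_coord (hs.pow a) e).mul ((smooth_coord hy e).mul hφ)) _) z, ← h4, adjD_adjD ((smooth_coord (hs.pow _) e).mul hφ),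
        add_assoc, ← Pi.single_add]

end

section

theorem isWeakDeriv_iff_adjD
    : IsWeakDeriv D α u g ↔ LocallyIntegrableOn u D.cover ∧
      LocallyIntegrableOn g D.cover ∧ ∀ φ, IsTest D.cover φ →
        ∫ z in D.cover, u z * adjD α φ z = ∫ z in D.cover, g z * φ z := by
  have h φ : ∫ z in D.cover, u z * adjD α φ z =
      (-1) ^ (∑ i, α i) * ∫ z in D.cover, u z * pdMulti α φ z := by
    rw [← integral_const_mul]
    refine integral_congr_ae (of_forall fun z => ?_)
    simp only [adjD]
    ring
  have h2 : ((-1 : ℝ) ^ (∑ i, α i)) * (-1) ^ (∑ i, α i) = 1 := by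
    rw [← mul_pow]; norm_num
  unfold IsWeakDeriv
  refine and_congr_right fun _ => and_congr_right fun _ => forall₂_congr fun φ _ => ?_
  rw [h]
  constructor
  · intro h3
    rw [h3, ← mul_assoc, h2, one_mul]
  · intro h3
    rw [← h3, ← mul_assoc, h2, one_mul]

theorem locInt_sum (t)
    {f : ι → Fn d} (h : ∀ i ∈ t, LocallyIntegrableOn (f i) A) :
    LocallyIntegrableOn (fun z => ∑ i ∈ t, f i z) A := by
  classical
  induction t using Finset.induction_on with
  | empty => simpa using locallyIntegrableOn_zero
  | insert k t hk ih =>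
    simp only [Finset.sum_insert hk]
    exact (h k (Finset.mem_insert_self _ _)).add
      (ih fun i hi => h i (Finset.mem_insert_of_mem hi))

theorem isOpen_plasma (T) : IsOpen (Q⁺ T).cover := (isBox_plasma T).isOpen

variable {σ : ℝ → ℝ} {T : ℝ}

theorem IsTest.adjD (h : IsTest A φ)
    (α) : IsTest A (adjD α φ) := by
  have h1 := h.pdMulti α
  refine ⟨contDiff_const.mul h1.1, h1.2.1.mul_left, (tsupport_mul_subset_right).trans h1.2.2⟩

theorem IsTest.coord_mul (h : IsTest A φ)
    (hc : Smooth c) (e) : IsTest A fun z => c (z e) * φ z :=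
  ⟨(smooth_coord hc e).mul h.1, h.2.1.mul_left, (tsupport_mul_subset_right).trans h.2.2⟩

theorem IsTest.zAdjoint (h : IsTest A φ)
    (hs : Smooth s) (e) : IsTest A (zAdjoint e s φ) := by
  have h1 := (h.coord_mul hs e).adjD (single e 1)
  rwa [adjD_single (h.coord_mul hs e).1] at h1

theorem zAdj_of_ne (hi : i ≠ 1) {φ : Fn 4} (hφ : Smooth φ) :
    zAdj σ i φ = adjD (single i 1) φ := by
  rw [adjD_single hφ]
  funext z
  simp [zAdj, zCoef, hi]

theorem zAdj_iterate_of_ne (hi : i ≠ 1) {φ : Fn 4} (hφ : Smooth φ)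
    (k) : (zAdj σ i)^[k] φ = adjD (single i k) φ := by
  induction k with
  | zero => simp [adjD_zero]
  | succ k ih =>
    rw [iterate_succ_apply', ih, zAdj_of_ne hi (smooth_adjD hφ _), adjD_adjD hφ,
      ← Pi.single_add, add_comm]

theorem zCoef_one_eq (hz : z ∈ (Q⁺ T).cover) :
    zCoef σ 1 z = sigExt σ (z 1) := by
  simp [zCoef, abs_of_pos hz.2.1, sigExt_of_mem hz.2]

theorem zAdj_one {φ : Fn 4} (hφ : IsTest (Q⁺ T).cover φ) :
    zAdj σ 1 φ = zAdjoint 1 (sigExt σ) φ := by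
  have : (fun w => zCoef σ 1 w * φ w) = fun w => sigExt σ (w 1) * φ w := by
    funext w
    by_cases hw : w ∈ (Q⁺ T).cover
    · rw [zCoef_one_eq hw]
    · rw [hφ.eq_zero hw, mul_zero, mul_zero]
  unfold zAdj zAdjoint
  rw [this]

theorem zAdj_one_iterate (hσ : IsConormalWeight σ) {φ : Fn 4}
    (hφ : IsTest (Q⁺ T).cover φ) (k) :
    (zAdj σ 1)^[k] φ = (zAdjoint 1 (sigExt σ))^[k] φ := by
  have h k : IsTest (Q⁺ T).cover ((zAdjoint 1 (sigExt σ))^[k] φ) := by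
    induction k with
    | zero => exact hφ
    | succ k ih =>
      rw [iterate_succ_apply']
      exact ih.zAdjoint (smooth_sigExt hσ) 1
  induction k with
  | zero => rfl
  | succ k ih =>
    rw [iterate_succ_apply', ih, zAdj_one (h k), iterate_succ_apply']

theorem conormalAdj_eq (hσ : IsConormalWeight σ) {φ : Fn 4}
    (hφ : IsTest (Q⁺ T).cover φ) (α) (k) :
    conormalAdj σ α k φ =
      adjD (single 1 k + (single 3 (α 3) + single 2 (α 2)))
        ((zAdjoint 1 (sigExt σ))^[α 1] (adjD (single 0 (α 0)) φ)) := by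
  have hbare : ∀ k (ψ : Fn 4), Smooth ψ →
      (fun f z => -pd 1 f z)^[k] ψ = adjD (single 1 k) ψ := by
    intro k ψ hψ
    induction k with
    | zero => simp [adjD_zero]
    | succ k ih =>
      rw [iterate_succ_apply', ih, ← adjD_single (smooth_adjD hψ _), adjD_adjD hψ,
        ← Pi.single_add, add_comm]
  unfold conormalAdj
  have h0 := hφ.adjD (single 0 (α 0))
  have h1 := smooth_zAdjoint_iter (e := 1) (smooth_sigExt hσ) h0.1 (α 1)
  rw [zAdj_iterate_of_ne (by decide) hφ.1, zAdj_one_iterate hσ h0,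
    zAdj_iterate_of_ne (by decide) h1, zAdj_iterate_of_ne (by decide) (smooth_adjD h1 _),
    hbare _ _ (smooth_adjD (smooth_adjD h1 _) _), adjD_adjD h1,
    adjD_adjD h1]

theorem update_add_single (α : Fin 4 → ℕ) (i k) :
    single 1 k + (single 3 (α 3) + single 2 (α 2)) + single 1 i + single 0 (α 0) =
      update α 1 i + single 1 k := by
  funext j
  fin_cases j <;> simp
  omega

theorem IsTest.zAdjoint_iterate (h : IsTest A φ) (hs : Smooth s)
    (e) (n) : IsTest A ((PlasmaVacuum.zAdjoint e s)^[n] φ) := by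
  induction n with
  | zero => exact h
  | succ n ih => rw [iterate_succ_apply']; exact ih.zAdjoint hs e

theorem conormal_of_weak (hσ : IsConormalWeight σ) (α) (m : ℕ) :
    ∃ (N : ℕ) (k : Fin N → ℕ) (c : Fin N → ℝ → ℝ), (∀ j, k j ≤ α 1 ∧ Smooth (c j)) ∧
      ∀ (T : ℝ) (u : Fn 4) (G : ℕ → Fn 4),
      (∀ i ≤ α 1, IsWeakDeriv (Q⁺ T) (update α 1 i + single 1 m) u (G i)) →
      IsConormalDeriv σ (Q⁺ T) α m u fun z =>
        ∑ j, c j (z 1) * (sigExt σ (z 1) ^ k j * G (k j) z) := by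
  have hs := smooth_sigExt hσ
  obtain ⟨N, k, c, hc, h⟩ := expands_zAdjoint hs
    (single 1 m + (single 3 (α 3) + single 2 (α 2)) : Fin 4 → ℕ) (α 1)
  dsimp only at h
  refine ⟨N, k, c, hc, fun T u G hG => ?_⟩
  have hD := isOpen_plasma T
  have hu := (hG 0 (Nat.zero_le _)).1
  have hloc : ∀ j ∈ Finset.univ, LocallyIntegrableOn
      (fun z => c j (z 1) * (sigExt σ (z 1) ^ k j * G (k j) z)) (Q⁺ T).cover := fun j _ =>
    locInt_mul hD (smooth_coord (hc j).2 1).continuous.continuousOn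
      (locInt_mul hD (smooth_coord (hs.pow (k j)) 1).continuous.continuousOn
        (hG _ (hc j).1).2.1)
  refine ⟨hu, locInt_sum _ hloc, fun φ hφ => ?_⟩
  have ht := fun j => (hφ.coord_mul (hc j).2 1).coord_mul (hs.pow (k j)) 1
  have hA : ∀ z, conormalAdj σ α m φ z = ∑ j, adjD (update α 1 (k j) + single 1 m)
      (fun w => sigExt σ (w 1) ^ k j * (c j (w 1) * φ w)) z := fun z => by
    rw [conormalAdj_eq hσ hφ, h _ (smooth_adjD hφ.1 _)]
    refine sum_congr rfl fun j _ => ?_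
    have h1 := adjD_coord_mul (e := 1) (β := single 0 (α 0)) ((hs.pow (k j)).mul (hc j).2) hφ.1
      (by simp)
    simp only [mul_assoc] at h1
    rw [← h1, adjD_adjD (ht j).1, update_add_single]
  simp only [hA, mul_sum, sum_mul]
  rw [integral_finsetSum _ fun j _ => ((ht j).adjD _).integrableOn hu,
    integral_finsetSum _ fun j hj => hφ.integrableOn (hloc j hj)]
  refine sum_congr rfl fun j _ => ?_
  rw [(isWeakDeriv_iff_adjD.1 (hG _ (hc j).1)).2.2 _ (ht j)]
  exact integral_congr_ae (of_forall fun z => by dsimp only; ring)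

theorem weak_of_conormal (hσ : IsConormalWeight σ) (α : Fin 4 → ℕ) (m : ℕ) :
    ∃ (N : ℕ) (k : Fin N → ℕ) (c : Fin N → ℝ → ℝ), (∀ j, k j ≤ α 1 ∧ Smooth (c j)) ∧
      ∀ (T : ℝ) (u : Fn 4) (G : ℕ → Fn 4),
      (∀ i ≤ α 1, IsConormalDeriv σ (Q⁺ T) (update α 1 i) m u (G i)) →
      IsWeakDeriv (Q⁺ T) (α + single 1 m) u fun z =>
        (sigExt σ (z 1) ^ α 1)⁻¹ * ∑ j, c j (z 1) * G (k j) z := by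
  have hs := smooth_sigExt hσ
  obtain ⟨N, k, c, hc, h⟩ := expands_adjD hs
    (single 1 m + (single 3 (α 3) + single 2 (α 2)) : Fin 4 → ℕ) (α 1)
  dsimp only at h
  refine ⟨N, k, c, hc, fun T u G hG => isWeakDeriv_iff_adjD.2 ?_⟩
  have hD := isOpen_plasma T
  have hu := (hG 0 (Nat.zero_le _)).1
  have hpos : ∀ z ∈ (Q⁺ T).cover, sigExt σ (z 1) ^ α 1 ≠ 0 := fun z hz =>
    (pow_pos (sigExt_pos hσ hz.2) _).ne'
  have hinv : ContDiffOn ℝ ∞ (fun z => (sigExt σ (z 1) ^ α 1)⁻¹) (Q⁺ T).cover :=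
    (smooth_coord (hs.pow (α 1)) 1).contDiffOn.inv hpos
  have hloc : ∀ j ∈ Finset.univ, LocallyIntegrableOn
      (fun z => c j (z 1) * G (k j) z) (Q⁺ T).cover := fun j _ => locInt_mul hD
    (smooth_coord (hc j).2 1).continuous.continuousOn (hG _ (hc j).1).2.1
  refine ⟨hu, locInt_mul hD hinv.continuousOn
    (locInt_sum _ hloc), fun φ hφ => ?_⟩
  set χ := fun z => (sigExt σ (z 1) ^ α 1)⁻¹ * φ z with hχ
  have hχt : IsTest (Q⁺ T).cover χ := hφ.mul hD hinv
  have hφχ : φ = fun w => sigExt σ (w 1) ^ α 1 * χ w := by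
    funext w
    by_cases hw : w ∈ (Q⁺ T).cover
    · simp only [hχ, mul_inv_cancel_left₀ (hpos w hw)]
    · rw [hφ.eq_zero hw, hχt.eq_zero hw, mul_zero]
  have ht := fun j => hχt.coord_mul (hc j).2 1
  have hA : ∀ z, adjD (α + single 1 m) φ z =
      ∑ j, conormalAdj σ (update α 1 (k j)) m (fun w => c j (w 1) * χ w) z := fun z => by
    have hi : α + single 1 m = single 1 m + (single 3 (α 3) + single 2 (α 2)) +
      single 1 (α 1) + single 0 (α 0) := by rw [update_add_single, Function.update_eq_self]
    rw [hi, hφχ, ← adjD_adjD (hχt.coord_mul (hs.pow _) 1).1, adjD_coord_mul (hs.pow _) hχt.1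
      (by simp), h _ (smooth_adjD hχt.1 _)]
    refine sum_congr rfl fun j _ => ?_
    rw [conormalAdj_eq hσ (ht j), adjD_coord_mul (hc j).2 hχt.1 (by simp)]
    simp
  have hint : ∀ j, IntegrableOn (fun z => u z *
      conormalAdj σ (update α 1 (k j)) m (fun w => c j (w 1) * χ w) z) (Q⁺ T).cover := fun j => by
    rw [conormalAdj_eq hσ (ht j)]
    exact ((((ht j).adjD _).zAdjoint_iterate hs 1 _).adjD _).integrableOn hu
  simp only [hA, mul_sum, sum_mul]
  rw [integral_finsetSum _ fun j _ => hint j, integral_finsetSum _ fun j hj =>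
    hφ.integrableOn (locInt_mul hD hinv.continuousOn (hloc j hj))]
  refine sum_congr rfl fun j _ => ?_
  rw [(hG _ (hc j).1).2.2 _ (ht j)]
  exact integral_congr_ae (of_forall fun z => by simp only [hχ]; ring)

/-! ### Comparison of the norms -/

theorem lintegral_linear_comb_sq_le [MeasurableSpace X] [Fintype ι] (μ : Measure X)
    {M : NNReal} {c G : ι → X → ℝ} (hc : ∀ i, ∀ᵐ z ∂μ, ‖c i z‖ₑ ≤ M)
    (hG : ∀ i, AEMeasurable (G i) μ) : ∫⁻ z, ‖∑ i, c i z * G i z‖ₑ ^ 2 ∂μ ≤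
      (card ι * M ^ 2 : NNReal) * ∑ i, ∫⁻ z, ‖G i z‖ₑ ^ 2 ∂μ := by
  calc _ ≤ ∫⁻ z, card ι * ∑ i, M ^ 2 * ‖G i z‖ₑ ^ 2 ∂μ := by
        refine lintegral_mono_ae ?_
        filter_upwards [ae_all_iff.2 hc] with z hz
        refine (pow_le_pow_left₀ zero_le (enorm_sum_le _ _) 2).trans
          ((sum_pow_two_le _ _).trans ?_)
        rw [Finset.card_univ]
        gcongr with i hi
        rw [enorm_mul, mul_pow]
        gcongr
        exact hz i
    _ = _ := by
        rw [lintegral_const_mul' _ _ (by simp), lintegral_finsetSum' _ fun i _ =>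
          ((hG i).enorm.pow_const 2).const_mul _]
        simp only [lintegral_const_mul' _ _ (ENNReal.pow_ne_top (ENNReal.coe_ne_top))]
        rw [← mul_sum]
        push_cast
        ring

theorem IsConormalDeriv.unique {D : PeriodicDomain 4} (hD : IsOpen D.cover)
    {u g g' : Fn 4} (h : IsConormalDeriv σ D α k u g)
    (h' : IsConormalDeriv σ D α k u g') : g =ᵐ[vol D] g' :=
  ae_eq_of_forall_test hD h.2.1 h'.2.1 fun φ hφ => by rw [← h.2.2 φ hφ, h'.2.2 φ hφ]

theorem lpNorm_congr
    (h : f =ᵐ[vol D] g) : lpNorm D p f = lpNorm D p g :=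
  eLpNorm_congr_ae (ae_restrict_of_ae_restrict_of_subset (cell_subset D) h)

theorem lpNorm_two_sq (D) (g : Fn d) :
    lpNorm D 2 g ^ 2 = ∫⁻ z in D.cell, ‖g z‖ₑ ^ 2 := eLpNorm_two_sq _ _

theorem IsConormalDeriv.norm_eq {D : PeriodicDomain 4} (hD : IsOpen D.cover) {α : Fin 4 → ℕ}
    {u g : Fn 4} (h : IsConormalDeriv σ D α k u g) :
    conormalDerivNorm σ D α k u = lpNorm D 2 g :=
  le_antisymm (iInf₂_le g h) (le_iInf₂ fun _ h' => (lpNorm_congr (h.unique hD h')).le)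

theorem IsWeakDeriv.norm_eq (hD : IsOpen D.cover)
    (h : IsWeakDeriv D α u g) :
    weakDerivNorm D p α u = lpNorm D p g :=
  le_antisymm (iInf₂_le g h) (le_iInf₂ fun _ h' => (lpNorm_congr (h.unique hD h')).le)

theorem exists_conormalDeriv {D : PeriodicDomain 4} {α : Fin 4 → ℕ}
    {u : Fn 4} (h : conormalDerivNorm σ D α k u ≠ ⊤) :
    ∃ g, IsConormalDeriv σ D α k u g := by
  by_contra hne
  exact h (iInf₂_eq_top.2 fun g hg => absurd ⟨g, hg⟩ hne)

theorem exists_weakDeriv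
    (h : weakDerivNorm D p α u ≠ ⊤) : ∃ g, IsWeakDeriv D α u g := by
  by_contra hne
  exact h (iInf₂_eq_top.2 fun g hg => absurd ⟨g, hg⟩ hne)

/-- The sum of the squares of the norms of the conormal derivatives of weight at most `n`. -/
def conLev (σ : ℝ → ℝ) (D : PeriodicDomain 4) (n : ℕ) (u : Fn 4) : ℝ≥0∞ :=
  ∑ q ∈ ords 4 true n, conormalDerivNorm σ D q.1 q.2 u ^ 2

theorem exists_coord_bound {c : Fin N → ℝ → ℝ} (hc : ∀ i, Smooth (c i)) :
    ∃ M : NNReal, ∀ T i, ∀ᵐ z ∂volume.restrict (Q⁺ T).cell, ‖c i (z 1)‖ₑ ≤ M := by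
  choose M hM using fun i => (isCompact_Icc).exists_bound_of_continuousOn
    (hc i).continuous.continuousOn
  refine ⟨∑ i, (M i).toNNReal, fun T i => ?_⟩
  filter_upwards [ae_restrict_mem (measurableSet_cell (isOpen_plasma T))] with z hz
  rw [← ofReal_norm]
  exact (ofReal_le_ofReal (hM i _ ⟨hz.1.2.1.le, hz.1.2.2.le⟩)).trans (coe_le_coe.2
    (single_le_sum (f := fun i => (M i).toNNReal) (fun _ _ => zero_le) (mem_univ i)))

/-- Squared norms of combinations of `∂₁`-lower terms, with bounded coefficients, are controlled by
a common bound `R` of the squared norms of all terms of weight at most `n`. -/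
theorem exists_level_bound (n : ℕ) {N : (Fin 4 → ℕ) → ℕ → ℕ} {k : ∀ α m, Fin (N α m) → ℕ}
    {c : ∀ α m, Fin (N α m) → ℝ → ℝ} (h : ∀ α m j, k α m j ≤ α 1 ∧ Smooth (c α m j)) :
    ∃ C : NNReal, ∀ (T : ℝ) (V : (Fin 4 → ℕ) × ℕ → ℝ≥0∞) (G : (Fin 4 → ℕ) × ℕ → Fn 4) (R : ℝ≥0∞),
      (∀ q ∈ ords 4 true n, AEMeasurable (G q) (volume.restrict (Q⁺ T).cell) ∧
        ∫⁻ z in (Q⁺ T).cell, ‖G q z‖ₑ ^ 2 ≤ R) →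
      ((∀ α m i, i ≤ α 1 → (α, m) ∈ ords 4 true n → (update α 1 i, m) ∈ ords 4 true n) →
        ∀ α m, (α, m) ∈ ords 4 true n → V (α, m) ≤ ∫⁻ z in (Q⁺ T).cell,
          ‖∑ j, c α m j (z 1) * G (update α 1 (k α m j), m) z‖ₑ ^ 2) →
      ∑ p ∈ ords 4 true n, V p ≤ (C + 1 : NNReal) * R := by
  choose M hM using fun α m => exists_coord_bound fun j => (h α m j).2
  have hup : ∀ α m i, i ≤ α 1 → (α, m) ∈ ords 4 true n →
      (update α 1 i, m) ∈ ords 4 true n := fun α m i hi hp => by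
    rw [mem_ords] at hp ⊢
    refine ⟨le_trans ?_ hp.1, by simp⟩
    simpa [wt, Fin.sum_univ_succ] using hi
  refine ⟨∑ p ∈ ords 4 true n, N p.1 p.2 * M p.1 p.2 ^ 2 * N p.1 p.2,
    fun T V G R hG hV => ?_⟩
  refine (sum_le_sum (g := fun p => ((N p.1 p.2 * M p.1 p.2 ^ 2 * N p.1 p.2 : NNReal) : ℝ≥0∞) * R)
    fun p hp => ?_).trans ?_
  · refine (hV hup p.1 p.2 hp).trans ((lintegral_linear_comb_sq_le _ (hM _ _ T) fun j =>
      (hG _ (hup _ _ _ (h _ _ j).1 hp)).1).trans ?_)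
    refine (mul_le_mul_right (sum_le_card_nsmul _ _ R fun j _ =>
      (hG _ (hup _ _ _ (h _ _ j).1 hp)).2) _).trans ?_
    simp [mul_assoc]
  · rw [← sum_mul, ← ENNReal.ofNNReal_finsetSum]
    gcongr
    exact le_self_add

theorem weakLev_le_conLev (hσ : IsConormalWeight σ) (n : ℕ) : ∃ C : NNReal, ∀ T u,
    weakLev 1 (sigExt σ) true (Q⁺ T) n u ≤ C * conLev σ (Q⁺ T) n u := by
  choose N k c hc h using fun α m => weak_of_conormal hσ α m
  obtain ⟨C, hC⟩ := exists_level_bound n hc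
  refine ⟨C + 1, fun T u => ?_⟩
  have hD := isOpen_plasma T
  by_cases hfin : conLev σ (Q⁺ T) n u = ⊤
  · rw [hfin, mul_top (by simp)]
    exact le_top
  have hG := fun q hq =>
    exists_conormalDeriv fun htop => hfin
      (ENNReal.sum_eq_top.2 ⟨q, hq, by rw [htop]; simp⟩)
  choose! G hG using hG
  refine hC T _ G _ (fun q hq => ⟨((hG q hq).2.1.aestronglyMeasurable.mono_measure
    (Measure.restrict_mono (cell_subset _) le_rfl)).aemeasurable, ?_⟩) fun hup α m hp => ?_
  · rw [← lpNorm_two_sq, ← (hG q hq).norm_eq hD]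
    exact single_le_sum (f := fun q : (Fin 4 → ℕ) × ℕ =>
      conormalDerivNorm σ (Q⁺ T) q.1 q.2 u ^ 2) (fun _ _ => zero_le) hq
  · refine (iInf₂_le _ (h α m T u (fun i => G (update α 1 i, m)) fun i hi =>
      hG _ (hup _ _ _ hi hp))).trans
      (setLIntegral_congr_fun (measurableSet_cell hD) fun z hz => ?_).le
    simp only [mul_inv_cancel_left₀ (pow_pos (sigExt_pos hσ hz.1.2) _).ne']

theorem conLev_le_weakLev (hσ : IsConormalWeight σ) (n : ℕ) : ∃ C : NNReal, ∀ T u,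
    conLev σ (Q⁺ T) n u ≤ C * weakLev 1 (sigExt σ) true (Q⁺ T) n u := by
  choose N k c hc h using fun α m => conormal_of_weak hσ α m
  obtain ⟨C, hC⟩ := exists_level_bound n hc
  refine ⟨C + 1, fun T u => ?_⟩
  have hD := isOpen_plasma T
  by_cases hfin : weakLev 1 (sigExt σ) true (Q⁺ T) n u = ⊤
  · rw [hfin, mul_top (by simp)]
    exact le_top
  have hG : ∀ q ∈ ords 4 true n, ∃ g, IsWeakDeriv (Q⁺ T) (q.1 + single 1 q.2) u g :=
    fun q hq => exists_of_scaledSq fun htop => hfin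
      (top_le_iff.1 (htop.symm.le.trans (le_weakLev hq _)))
  choose! G hG using hG
  refine hC T _ (fun q z => sigExt σ (z 1) ^ q.1 1 * G q z) _ (fun q hq =>
    ⟨((locInt_mul hD (smooth_coord ((smooth_sigExt hσ).pow _)
      1).continuous.continuousOn (hG q hq).2.1).aestronglyMeasurable.mono_measure
      (Measure.restrict_mono (cell_subset _) le_rfl)).aemeasurable, ?_⟩) fun hup α m hp => ?_
  · rw [← (hG q hq).scaledSq_eq hD (sigExt σ)]
    exact le_weakLev hq u
  · dsimp only
    rw [(h α m T u (fun i => G (update α 1 i, m)) fun i hi => hG _ (hup _ _ _ hi hp)).norm_eq hD,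
      lpNorm_two_sq]
    simp

end

section

/-! ### Sums of weighted norms -/

/-- The sum of the numbers `N p`, `p` of weight at most `n`, with powers of `γ`. -/
def lev1 (d) (bare : Bool) (γ : ℝ) (n : ℕ) (N : (Fin d → ℕ) × ℕ → ℝ≥0∞) : ℝ≥0∞ :=
  ∑ p ∈ ords d bare n, ofReal γ ^ (n - wt p) * N p

variable {bare : Bool} {γ : ℝ} {n : ℕ}

theorem one_le_ofReal (hγ : 1 ≤ γ) : 1 ≤ ofReal γ := by
  rw [← ofReal_one]; exact ofReal_le_ofReal hγ

theorem lev1_le_of_le {N N' : (Fin d → ℕ) × ℕ → ℝ≥0∞} (h : ∀ p, N p ≤ N' p) :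
    lev1 d bare γ n N ≤ lev1 d bare γ n N' :=
  sum_le_sum fun p _ => mul_le_mul_right (h p) _

theorem lev1_add (N N' : (Fin d → ℕ) × ℕ → ℝ≥0∞) :
    lev1 d bare γ n (fun p => N p + N' p) = lev1 d bare γ n N + lev1 d bare γ n N' := by
  simp only [lev1, mul_add, sum_add_distrib]

theorem lev1_const_mul (c : ℝ≥0∞) (N : (Fin d → ℕ) × ℕ → ℝ≥0∞) :
    lev1 d bare γ n (fun p => c * N p) = c * lev1 d bare γ n N := by
  simp only [lev1, mul_sum]
  exact sum_congr rfl fun p _ => by ring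

theorem lev1_zero : lev1 d bare γ n (fun _ => 0) = 0 := by simp [lev1]

theorem le_lev1 (hγ : 1 ≤ γ) {N : (Fin d → ℕ) × ℕ → ℝ≥0∞} {p : (Fin d → ℕ) × ℕ}
    (hp : p ∈ ords d bare n) : N p ≤ lev1 d bare γ n N := by
  calc N p ≤ ofReal γ ^ (n - wt p) * N p :=
        le_mul_of_one_le_left zero_le (one_le_pow₀ (one_le_ofReal hγ))
    _ ≤ _ := single_le_sum (f := fun p => ofReal γ ^ (n - wt p) * N p)
        (fun _ _ => zero_le) hp

theorem sum_sq_le_sq_sum' (t) (f : ι → ℝ≥0∞) :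
    ∑ i ∈ t, f i ^ 2 ≤ (∑ i ∈ t, f i) ^ 2 :=
  Finset.sum_sq_le_sq_sum_of_nonneg fun _ _ => zero_le

theorem sqrt_sq (x : ℝ≥0∞) : (x ^ (1 / 2 : ℝ)) ^ 2 = x := by
  rw [← rpow_natCast, ← rpow_mul]
  norm_num

theorem sq_le_sq_iff {x y : ℝ≥0∞} : x ^ 2 ≤ y ^ 2 ↔ x ≤ y := ENNReal.pow_le_pow_left_iff (by norm_num)

theorem sqrt_sum_sq_le_sum (t) (f : ι → ℝ≥0∞) :
    (∑ i ∈ t, f i ^ 2) ^ (1 / 2 : ℝ) ≤ ∑ i ∈ t, f i := by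
  rw [← sq_le_sq_iff, sqrt_sq]
  exact sum_sq_le_sq_sum' t f

theorem sum_le_card_mul_sqrt (t) (f : ι → ℝ≥0∞) :
    ∑ i ∈ t, f i ≤ t.card * (∑ i ∈ t, f i ^ 2) ^ (1 / 2 : ℝ) := by
  rw [← nsmul_eq_mul]
  refine sum_le_card_nsmul _ _ _ fun i hi => ?_
  rw [← sq_le_sq_iff, sqrt_sq]
  exact single_le_sum (f := fun i => f i ^ 2) (fun _ _ => zero_le) hi

/-- Bounds between the unweighted norms of all orders imply a bound between the weighted norms. -/
theorem lev1_le_of_lev [Fintype ι] (n r : ℕ) (C : ℕ → NNReal) :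
    ∃ C' : NNReal, ∀ (γ : ℝ), 1 ≤ γ → ∀ (N : (Fin d → ℕ) × ℕ → ℝ≥0∞)
      (N' : ι → (Fin d → ℕ) × ℕ → ℝ≥0∞),
      (∀ j ≤ n, ∑ p ∈ ords d bare j, N p ^ 2 ≤
        C j * ∑ k, ∑ q ∈ ords d bare (j + r), N' k q ^ 2) →
      lev1 d bare γ n N ≤ C' * ∑ k, lev1 d bare γ (n + r) (N' k) := by
  refine ⟨(ords d bare n).card * ∑ j ∈ range (n + 1), (1 + C j), fun γ hγ N N' h => ?_⟩
  have key : ∀ p ∈ ords d bare n, ofReal γ ^ (n - wt p) * N p ≤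
      ((∑ j ∈ range (n + 1), (1 + C j) : NNReal) : ℝ≥0∞) *
        ∑ k, lev1 d bare γ (n + r) (N' k) := by
    intro p hp
    have hw := (mem_ords.1 hp).1
    have h1 : N p ≤ (1 + C (wt p)) *
        ∑ k, ∑ q ∈ ords d bare (wt p + r), N' k q := by
      rw [← sq_le_sq_iff, mul_pow]
      have hp' :=
        mem_ords.2 ⟨le_rfl, (mem_ords.1 hp).2⟩
      calc N p ^ 2 ≤ _ := single_le_sum (f := fun p => N p ^ 2) (fun _ _ => zero_le) hp'
        _ ≤ _ := h _ hw
        _ ≤ _ := by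
          refine mul_le_mul' ?_ ?_
          · exact_mod_cast (by nlinarith [sq_nonneg (C (wt p))])
          · refine le_trans (sum_le_sum fun k _ => sum_sq_le_sq_sum' _ _) ?_
            exact sum_sq_le_sq_sum' _ _
    have h2 : (1 + C (wt p) : ℝ≥0∞) ≤
        ((∑ j ∈ range (n + 1), (1 + C j) : NNReal) : ℝ≥0∞) := by
      exact_mod_cast (single_le_sum (f := fun j => 1 + C j) (fun _ _ => zero_le) (mem_range.2 (Nat.lt_succ_of_le hw)))
    calc _ ≤ ofReal γ ^ (n - wt p) * (((∑ j ∈ range (n + 1), (1 + C j) : NNReal)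
          : ℝ≥0∞) * ∑ k, ∑ q ∈ ords d bare (wt p + r), N' k q) := by
          gcongr
          exact h1.trans (mul_le_mul_left h2 _)
      _ = ((∑ j ∈ range (n + 1), (1 + C j) : NNReal) : ℝ≥0∞) *
          ∑ k, ∑ q ∈ ords d bare (wt p + r),
            ofReal γ ^ (n - wt p) * N' k q := by
          simp only [← mul_sum]; ring
      _ ≤ _ := by
          gcongr with k
          unfold lev1
          refine (sum_le_sum fun q hq => ?_).trans
            (Finset.sum_le_sum_of_subset (ords_mono (by omega)))
          have := (mem_ords.1 hq).1
          exact mul_le_mul_left (pow_le_pow_right₀ (one_le_ofReal hγ) (by omega)) _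
  refine (sum_le_card_nsmul _ _ _ key).trans (le_of_eq ?_)
  rw [nsmul_eq_mul]
  push_cast
  ring

theorem ords_true (m) : (multiIndices 4 m ×ˢ range (m + 1)).filter
    (fun q => (∑ i, q.1 i) + 2 * q.2 ≤ m) = ords 4 true m := by
  ext q
  simp [ords, wt]

theorem sum_ords_false (d m) (f : (Fin d → ℕ) × ℕ → ℝ≥0∞) :
    ∑ p ∈ ords d false m, f p = ∑ α ∈ multiIndices d m, f (α, 0) := by
  refine Finset.sum_bij' (fun p _ => p.1) (fun α _ => (α, 0)) ?_ ?_ ?_ ?_ ?_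
  · intro p hp
    have := (mem_ords.1 hp).1
    rw [mem_multiIndices]
    unfold wt at this
    omega
  · intro α hα
    rw [mem_multiIndices] at hα
    exact mem_ords.2 ⟨by simpa [wt] using hα, fun _ => rfl⟩
  · intro p hp
    exact Prod.ext rfl ((mem_ords.1 hp).2 rfl).symm
  · intro α _
    rfl
  · intro p hp
    exact congrArg f (Prod.ext rfl ((mem_ords.1 hp).2 rfl))

/-- The sum of the terms of the norm of `H^n_γ`. -/
def h1 (D : PeriodicDomain d) (γ : ℝ) (n : ℕ) (u : Fn d) : ℝ≥0∞ :=
  lev1 d false γ n fun p => weakDerivNorm D 2 p.1 u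

/-- The sum of the terms of the norm of `H^n_{*,γ}`. -/
def hs1 (σ : ℝ → ℝ) (D : PeriodicDomain 4) (γ : ℝ) (n : ℕ) (u : Fn 4) : ℝ≥0∞ :=
  lev1 4 true γ n fun p => conormalDerivNorm σ D p.1 p.2 u

theorem h1_eq (D : PeriodicDomain d) (γ) (n) (u) : h1 D γ n u =
    ∑ α ∈ multiIndices d n, ofReal γ ^ (n - ∑ i, α i) * weakDerivNorm D 2 α u := by
  simp [h1, lev1, sum_ords_false, wt]

theorem hNorm_le_h1 (D : PeriodicDomain d) (γ) (n) (u) :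
    hNorm D γ n u ≤ h1 D γ n u := by
  rw [h1_eq]; exact sqrt_sum_sq_le_sum _ _

theorem h1_le_hNorm (D : PeriodicDomain d) (γ) (n) (u) :
    h1 D γ n u ≤ (multiIndices d n).card * hNorm D γ n u := by
  rw [h1_eq]; exact sum_le_card_mul_sqrt _ _

theorem hStarNorm_le_hs1 (σ : ℝ → ℝ) (D) (γ) (n)
    (u) : hStarNorm σ D γ n u ≤ hs1 σ D γ n u := by
  unfold hStarNorm
  rw [ords_true]
  exact sqrt_sum_sq_le_sum _ _

theorem hs1_le_hStarNorm (σ : ℝ → ℝ) (D) (γ) (n)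
    (u) : hs1 σ D γ n u ≤ (ords 4 true n).card * hStarNorm σ D γ n u := by
  unfold hStarNorm
  rw [ords_true]
  exact sum_le_card_mul_sqrt _ _

/-! ### Elementary properties of the norms -/

variable {u v : Fn d} {p : ℝ≥0∞} {α : Fin d → ℕ}

theorem weakDerivNorm_congr (h : u =ᵐ[vol D] v) :
    weakDerivNorm D p α u = weakDerivNorm D p α v := by
  unfold weakDerivNorm
  refine iInf_congr fun g => ?_
  have : IsWeakDeriv D α u g ↔ IsWeakDeriv D α v g :=
    ⟨fun h' => h'.congr h EventuallyEq.rfl, fun h' => h'.congr h.symm EventuallyEq.rfl⟩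
  simp only [this]

theorem aesm_cell (h : LocallyIntegrableOn f D.cover) :
    AEStronglyMeasurable f (volume.restrict D.cell) :=
  h.aestronglyMeasurable.mono_measure (Measure.restrict_mono (cell_subset _) le_rfl)

theorem weakDerivNorm_add_le (hD : IsOpen D.cover) (hp : 1 ≤ p) :
    weakDerivNorm D p α (fun z => u z + v z) ≤ weakDerivNorm D p α u + weakDerivNorm D p α v := by
  by_cases hu : weakDerivNorm D p α u = ⊤
  · simp [hu]
  by_cases hv : weakDerivNorm D p α v = ⊤
  · simp [hv]
  obtain ⟨g, hg⟩ := exists_weakDeriv hu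
  obtain ⟨h, hh⟩ := exists_weakDeriv hv
  rw [(hg.add hh).norm_eq hD, hg.norm_eq hD, hh.norm_eq hD]
  exact eLpNorm_add_le (aesm_cell hg.2.1) (aesm_cell hh.2.1) hp

theorem weakDerivNorm_zero : weakDerivNorm D p α (fun _ => 0) = 0 := by
  refine le_antisymm ((iInf₂_le _ ⟨locallyIntegrableOn_zero, locallyIntegrableOn_zero, fun φ _ => by simp⟩).trans ?_) zero_le
  simp [lpNorm]

theorem weakDerivNorm_const_mul_le (hD : IsOpen D.cover) (c) :
    weakDerivNorm D p α (fun z => c * u z) ≤ ‖c‖ₑ * weakDerivNorm D p α u := by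
  by_cases hc : c = 0
  · simp [hc, weakDerivNorm_zero]
  by_cases hu : weakDerivNorm D p α u = ⊤
  · rw [hu, mul_top (by simpa using hc)]; exact le_top
  obtain ⟨g, hg⟩ := exists_weakDeriv hu
  rw [(hg.const_mul c).norm_eq hD, hg.norm_eq hD]
  exact (eLpNorm_const_smul c g p _).le

theorem weakDerivNorm_partial_le (h : IsWeakPartial D i u g) :
    weakDerivNorm D p α g ≤ weakDerivNorm D p (α + single i 1) u := by
  refine le_iInf₂ fun k hk => iInf₂_le _ ?_
  rw [add_comm] at hk
  exact (weakDeriv_single.2 h).of_trans hk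

theorem h1_congr (h : u =ᵐ[vol D] v) : h1 D γ n u = h1 D γ n v := by
  simp only [h1, weakDerivNorm_congr h]

theorem h1_add_le (hD : IsOpen D.cover) :
    h1 D γ n (fun z => u z + v z) ≤ h1 D γ n u + h1 D γ n v := by
  unfold h1
  rw [← lev1_add]
  exact lev1_le_of_le fun _ => weakDerivNorm_add_le hD (by norm_num)

theorem h1_const_mul_le (hD : IsOpen D.cover) (c : ℝ) :
    h1 D γ n (fun z => c * u z) ≤ ‖c‖ₑ * h1 D γ n u := by
  unfold h1
  rw [← lev1_const_mul]
  exact lev1_le_of_le fun _ => weakDerivNorm_const_mul_le hD c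

theorem h1_zero : h1 D γ n (fun _ => 0) = 0 := by
  simp only [h1, weakDerivNorm_zero, lev1_zero]

theorem weakDerivNorm_le_h1 (hγ : 1 ≤ γ) (hα : ∑ i, α i ≤ n) :
    weakDerivNorm D 2 α u ≤ h1 D γ n u :=
  le_lev1 (p := (α, 0)) hγ
    (mem_ords.2 ⟨by simpa [wt] using hα, fun _ => rfl⟩)

theorem h1_partial_le {i : Fin d} (h : IsWeakPartial D i u g) :
    h1 D γ n g ≤ h1 D γ (n + 1) u := by
  rw [h1_eq, h1_eq]
  calc _ ≤ ∑ α ∈ multiIndices d n, ofReal γ ^ (n + 1 - ∑ j, (α + single i 1 : Fin d → ℕ) j) *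
        weakDerivNorm D 2 (α + single i 1) u := by
        refine sum_le_sum fun α _ => ?_
        rw [sum_add_single, Nat.add_sub_add_right]
        gcongr
        exact weakDerivNorm_partial_le h
    _ = ∑ β ∈ (multiIndices d n).map (addRightEmbedding (single i 1)),
        ofReal γ ^ (n + 1 - ∑ j, β j) * weakDerivNorm D 2 β u := by
        rw [Finset.sum_map]; rfl
    _ ≤ _ := by
        refine Finset.sum_le_sum_of_subset fun β hβ => ?_
        obtain ⟨α, hα, rfl⟩ := Finset.mem_map.1 hβ
        rw [mem_multiIndices] at hα ⊢
        simp only [addRightEmbedding_apply]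
        rw [sum_add_single]
        omega

/-! ### The Moser estimates in Sobolev norms -/

theorem scaledSq_one (hD : IsOpen D.cover) (e) (α) (u) :
    scaledSq e (fun _ => 1) D (α, 0) u = weakDerivNorm D 2 α u ^ 2 := by
  by_cases h : ∃ g, IsWeakDeriv D α u g
  · obtain ⟨g, hg⟩ := h
    rw [IsWeakDeriv.scaledSq_eq hD _ (by simpa using hg), hg.norm_eq hD,
      lpNorm_two_sq]
    simp
  · have h1 : weakDerivNorm D 2 α u = ⊤ := by
      by_contra hne
      exact h (exists_weakDeriv hne)
    have h2 : scaledSq e (fun _ => 1) D (α, 0) u = ⊤ := by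
      by_contra hne
      obtain ⟨g, hg⟩ := exists_of_scaledSq hne
      exact h ⟨g, by simpa using hg⟩
    rw [h1, h2]
    simp

theorem weakLev_one (hD : IsOpen D.cover) (e) (n) (u) :
    weakLev e (fun _ => 1) false D n u =
      ∑ p ∈ ords d false n, weakDerivNorm D 2 p.1 u ^ 2 := by
  unfold weakLev
  refine sum_congr rfl fun p hp => ?_
  obtain ⟨α, k⟩ := p
  have : k = 0 := (mem_ords.1 hp).2 rfl
  subst this
  exact scaledSq_one hD e α u

theorem moser_h1 [Fintype ι] [DecidableEq ι] (e) {K : Set ℝ} (hK : IsCompact K)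
    (n) (hΦ : Smooth Φ) (h0 : Φ 0 = 0) (R : NNReal) :
    ∃ C : NNReal, ∀ D I a b S, IsMoserBox e (fun _ => 1) 1 1 K D I a b S → ∀ γ, 1 ≤ γ →
    ∀ Y : ι → Fn d, (∀ k, AEPeriodic D (Y k)) →
    (∀ k, ∀ᵐ z ∂vol D, ‖Y k z‖ₑ ≤ R) →
      h1 D γ n (fun z => Φ fun k => Y k z) ≤ C * ∑ k, h1 D γ n (Y k) := by
  choose C hC using fun j => moser_weak e contDiff_const 1 one_pos 1 hK
    false j hΦ h0 R
  obtain ⟨C', hC'⟩ := lev1_le_of_lev (ι := ι) n 0 C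
  refine ⟨C', fun D I a b S hB γ hγ Y hY hR => hC' γ hγ _ _ fun j _ => ?_⟩
  simpa only [weakLev_one hB.box.isOpen, add_zero] using hC j D I a b S hB Y hY hR (by simp)

theorem moser_hs1 {σ : ℝ → ℝ} (hσ : IsConormalWeight σ) [Fintype ι] [DecidableEq ι]
    (n) (hΦ : Smooth Φ) (h0 : Φ 0 = 0) (R : NNReal) :
    ∃ C : NNReal, ∀ T, ∀ γ, 1 ≤ γ →
    ∀ Y : ι → Fn 4, (∀ k, AEPeriodic (Q⁺ T) (Y k)) →
    (∀ k, ∀ᵐ z ∂vol (Q⁺ T), ‖Y k z‖ₑ ≤ R) →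
    (∀ i k, ∃ h, IsWeakPartial (Q⁺ T) i (Y k) h ∧
      ∀ᵐ z ∂vol (Q⁺ T), ‖zCoef σ i z * h z‖ₑ ≤ R) →
      hs1 σ (Q⁺ T) γ n (fun z => Φ fun k => Y k z) ≤
        C * ∑ k, hs1 σ (Q⁺ T) γ n (Y k) := by
  obtain ⟨κ, hκ, Λ, hbox⟩ := exists_isMoserBox_plasma hσ
  choose C hC using fun j => moser_weak (d := 4) 1 (smooth_sigExt hσ) κ hκ Λ
    (isCompact_Icc) true j hΦ h0 R
  choose C₁ hC₁ using conLev_le_weakLev hσ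
  choose C₂ hC₂ using weakLev_le_conLev hσ
  obtain ⟨C', hC'⟩ := lev1_le_of_lev (ι := ι) n 0
    fun j => C₁ j * C j * C₂ j
  refine ⟨C', fun T γ hγ Y hY hR hZ => hC' γ hγ _ _ fun j _ => ?_⟩
  refine (hC₁ j T _).trans ?_
  rw [coe_mul, coe_mul, mul_assoc, mul_assoc]
  refine mul_le_mul_right ?_ _
  refine (hC j _ _ _ _ _ (hbox T) Y hY hR fun _ i k => ?_).trans ?_
  · obtain ⟨h, hh, hb⟩ := hZ i k
    refine ⟨h, hh, ?_⟩
    filter_upwards [hb, ae_restrict_mem (isOpen_plasma T).measurableSet] with z hz hzD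
    by_cases hi : i = 1
    · subst hi
      rw [zCoef_one_eq hzD] at hz
      simpa using hz
    · simpa [zCoef, hi] using hz
  · refine mul_le_mul_right ?_ _
    rw [mul_sum]
    exact sum_le_sum fun k _ => hC₂ j T _

end

section

/-! ### Products -/

variable {γ : ℝ} {n : ℕ}

theorem ae_le_lpNorm_top (hD : IsOpen D.cover) (hI : IsInvariant D)
    (hp : AEPeriodic D f) (hf : LocallyIntegrableOn f D.cover) :
    ∀ᵐ z ∂vol D, ‖f z‖ₑ ≤ lpNorm D ⊤ f := by
  refine hp.ae_le hD hI hf.aestronglyMeasurable.aemeasurable ?_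
  unfold lpNorm
  rw [eLpNorm_exponent_top]
  exact ae_le_eLpNormEssSup

theorem ae_eq_zero_of_cell (hD : IsOpen D.cover) (hI : IsInvariant D)
    (hp : AEPeriodic D f) (hf : LocallyIntegrableOn f D.cover)
    (h : f =ᵐ[volume.restrict D.cell] fun _ => 0) : f =ᵐ[vol D] fun _ => 0 := by
  have := hp.ae_le hD hI hf.aestronglyMeasurable.aemeasurable (R := 0) (by
    exact h.mono fun z hz => by simp [hz])
  exact this.mono fun z hz => by simpa using hz

theorem ae_zero_of_lpNorm (hD : IsOpen D.cover) (hI : IsInvariant D)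
    (hp : AEPeriodic D f) (hf : LocallyIntegrableOn f D.cover) (hp0 : p ≠ 0)
    (h : lpNorm D p f = 0) : f =ᵐ[vol D] fun _ => 0 :=
  ae_eq_zero_of_cell hD hI hp hf ((eLpNorm_eq_zero_iff (aesm_cell hf) hp0).1 h)

theorem weakDerivNorm_zero_order (hD : IsOpen D.cover)
    (hf : LocallyIntegrableOn f D.cover) (p) : weakDerivNorm D p 0 f = lpNorm D p f :=
  ((isWeakDeriv_zero_iff hD).2 ⟨hf, EventuallyEq.rfl⟩).norm_eq hD

theorem lpNorm_le_weakDerivNorm (hD : IsOpen D.cover) (f) (p) :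
    lpNorm D p f ≤ weakDerivNorm D p 0 f :=
  le_iInf₂ fun _ h => (lpNorm_congr ((isWeakDeriv_zero_iff hD).1 h).2).le

theorem ae_eq_zero_of_h1 (hD : IsOpen D.cover) (hI : IsInvariant D)
    (hp : AEPeriodic D f) (hf : LocallyIntegrableOn f D.cover) (hγ : 1 ≤ γ)
    (h : h1 D γ n f = 0) : f =ᵐ[vol D] fun _ => 0 := by
  refine ae_zero_of_lpNorm hD hI hp hf two_ne_zero (le_antisymm ?_ zero_le)
  rw [← weakDerivNorm_zero_order hD hf, ← h]
  exact weakDerivNorm_le_h1 hγ (by simp)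

theorem AEPeriodic.const_mul (h : AEPeriodic D f) (c) :
    AEPeriodic D fun z => c * f z := fun v hv => by
  filter_upwards [h v hv] with z hz
  rw [hz]

/-- The estimate of products, from the Moser estimate for `Φ(x, y) = x y` after division by the
`L^∞` norms. -/
theorem enorm_toReal (h : a ≠ ⊤) : ‖a.toReal‖ₑ = a := by
  rw [enorm_of_nonneg ENNReal.toReal_nonneg, ofReal_toReal h]

theorem enorm_toReal_inv (h0 : a ≠ 0) (h : a ≠ ⊤) : ‖a.toReal⁻¹‖ₑ = a⁻¹ := by
  rw [enorm_inv (ENNReal.toReal_ne_zero.2 ⟨h0, h⟩), enorm_toReal h]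

theorem enorm_inv_mul_le (h0 : a ≠ 0) (h : a ≠ ⊤) (hx : ‖x‖ₑ ≤ a) :
    ‖a.toReal⁻¹ * x‖ₑ ≤ 1 := by
  rw [enorm_mul, enorm_toReal_inv h0 h]
  exact (mul_le_mul_right hx _).trans (ENNReal.inv_mul_cancel h0 h).le

theorem h1_mul_le (e) (hK : IsCompact K) (n) : ∃ C : NNReal,
    ∀ D I a b S, IsMoserBox e (fun _ => 1) 1 1 K D I a b S → ∀ γ, 1 ≤ γ →
    ∀ f g : Fn d, AEPeriodic D f → AEPeriodic D g →
    LocallyIntegrableOn f D.cover → LocallyIntegrableOn g D.cover →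
      h1 D γ n (fun z => f z * g z) ≤
        C * (h1 D γ n f * lpNorm D ⊤ g + lpNorm D ⊤ f * h1 D γ n g) := by
  obtain ⟨C, hC⟩ := moser_h1 (ι := Fin 2) e hK n (Φ := fun x => x 0 * x 1) (by fun_prop) (by simp) 1
  refine ⟨max 1 C, fun D I a b S hB γ hγ f g hfp hgp hf hg => ?_⟩
  have hD := hB.box.isOpen
  have hI := hB.box.invariant
  have hC1 : ((max 1 C : NNReal) : ℝ≥0∞) ≠ 0 := by
    exact_mod_cast (zero_lt_one.trans_le (le_max_left _ _)).ne'
  have hz : (fun z => f z * g z) =ᵐ[vol D] (fun _ => 0) →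
      h1 D γ n (fun z => f z * g z) ≤
        (max 1 C) * (h1 D γ n f * lpNorm D ⊤ g + lpNorm D ⊤ f * h1 D γ n g) := by
    intro h
    rw [h1_congr h, h1_zero]
    exact zero_le
  set A := lpNorm D ⊤ f
  set B := lpNorm D ⊤ g
  by_cases hA0 : A = 0
  · exact hz ((ae_zero_of_lpNorm hD hI hfp hf ENNReal.top_ne_zero hA0).mono fun z h => by simp [h])
  by_cases hB0 : B = 0
  · exact hz ((ae_zero_of_lpNorm hD hI hgp hg ENNReal.top_ne_zero hB0).mono fun z h => by simp [h])
  have hf0 : h1 D γ n f ≠ 0 := fun h => hA0 (by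
    exact (lpNorm_congr (ae_eq_zero_of_h1 hD hI hfp hf hγ h)).trans eLpNorm_zero')
  have hg0 : h1 D γ n g ≠ 0 := fun h => hB0 (by
    exact (lpNorm_congr (ae_eq_zero_of_h1 hD hI hgp hg hγ h)).trans eLpNorm_zero')
  by_cases hA : A = ⊤
  · rw [hA, ENNReal.top_mul hg0, add_top, mul_top hC1]; exact le_top
  by_cases hB' : B = ⊤
  · rw [hB', mul_top hf0, top_add, mul_top hC1]; exact le_top
  have h := hC D I a b S hB γ hγ ![fun z => A.toReal⁻¹ * f z, fun z => B.toReal⁻¹ * g z] (by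
      simp only [Fin.forall_fin_two, Matrix.cons_val_zero, Matrix.cons_val_one]
      exact ⟨hfp.const_mul _, hgp.const_mul _⟩) (by
      simp only [Fin.forall_fin_two, Matrix.cons_val_zero, Matrix.cons_val_one]
      exact ⟨(ae_le_lpNorm_top hD hI hfp hf).mono fun z => enorm_inv_mul_le hA0 hA,
        (ae_le_lpNorm_top hD hI hgp hg).mono fun z => enorm_inv_mul_le hB0 hB'⟩)
  simp only [Fin.sum_univ_two, Matrix.cons_val_zero, Matrix.cons_val_one] at h
  have e1 : (fun z => f z * g z) = fun z => (A.toReal * B.toReal) *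
      (A.toReal⁻¹ * f z * (B.toReal⁻¹ * g z)) := by
    have := ENNReal.toReal_ne_zero.2 ⟨hA0, hA⟩
    have := ENNReal.toReal_ne_zero.2 ⟨hB0, hB'⟩
    funext z
    field_simp
  calc _ ≤ A * B * (C * (A⁻¹ * h1 D γ n f + B⁻¹ * h1 D γ n g)) := by
        rw [e1, ← enorm_toReal_inv hA0 hA, ← enorm_toReal_inv hB0 hB']
        refine (h1_const_mul_le hD _).trans ?_
        rw [enorm_mul, enorm_toReal hA, enorm_toReal hB']
        gcongr
        exact h.trans (by gcongr <;> exact h1_const_mul_le hD _)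
    _ = C * ((A * A⁻¹) * h1 D γ n f * B + A * ((B * B⁻¹) * h1 D γ n g)) := by ring
    _ ≤ _ := by
        rw [ENNReal.mul_inv_cancel hA0 hA, ENNReal.mul_inv_cancel hB0 hB', one_mul, one_mul]
        gcongr
        exact le_max_right _ _

/-! ### The vacuum operator -/

theorem mixedDeriv_quadratic (a b c e f g : Fin n → ℝ) :
    mixedDeriv (fun ε δ => a + ε • b + δ • c + (ε * δ) • e + ε ^ 2 • f + δ ^ 2 • g) = e := by
  have h1 ε : deriv (fun δ : ℝ => a + ε • b + δ • c + (ε * δ) • e + ε ^ 2 • f + δ ^ 2 • g) 0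
      = c + ε • e := by
    have h : HasDerivAt (fun δ => a + ε • b + δ • c + (ε * δ) • e + ε ^ 2 • f + δ ^ 2 • g)
        (0 + (1 : ℝ) • c + (ε * 1) • e + 0 + (2 * (0 : ℝ) ^ (2 - 1) * 1) • g) 0 := by
      refine ((((hasDerivAt_const 0 (a + ε • b)).add
        ((hasDerivAt_id' 0).smul_const c)).add
        (((hasDerivAt_id' 0).const_mul ε).smul_const e)).add
        (hasDerivAt_const 0 (ε ^ 2 • f))).add
        (((hasDerivAt_id' 0).pow 2).smul_const g)
    rw [h.deriv]
    simp
  unfold mixedDeriv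
  simp only [h1]
  have h : HasDerivAt (fun ε : ℝ => c + ε • e) (0 + (1 : ℝ) • e) 0 :=
    (hasDerivAt_const 0 c).add ((hasDerivAt_id' 0).smul_const e)
  rw [h.deriv]
  simp

theorem curlFlux_mixedDeriv (H K₁ K₂ : Fin 3 → ℝ) (P A B : Fin 4 → ℝ) :
    (mixedDeriv fun ε δ => curlFlux (H + ε • K₁ + δ • K₂) (P + ε • A + δ • B)) =
      ![K₁ 0 * B 1 + K₂ 0 * A 1, K₁ 0 * B 2 + K₂ 0 * A 2, K₁ 0 * B 3 + K₂ 0 * A 3] := by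
  rw [← mixedDeriv_quadratic (curlFlux H P)
    ![H 0 * A 1 + K₁ 0 * (1 + P 1), H 0 * A 2 + K₁ 0 * P 2 + K₁ 1, H 0 * A 3 + K₁ 0 * P 3 + K₁ 2]
    ![H 0 * B 1 + K₂ 0 * (1 + P 1), H 0 * B 2 + K₂ 0 * P 2 + K₂ 1, H 0 * B 3 + K₂ 0 * P 3 + K₂ 2]
    ![K₁ 0 * B 1 + K₂ 0 * A 1, K₁ 0 * B 2 + K₂ 0 * A 2, K₁ 0 * B 3 + K₂ 0 * A 3]
    ![K₁ 0 * A 1, K₁ 0 * A 2, K₁ 0 * A 3] ![K₂ 0 * B 1, K₂ 0 * B 2, K₂ 0 * B 3]]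
  congr 1
  funext ε δ j
  fin_cases j <;> simp [curlFlux] <;> ring

theorem divFlux_mixedDeriv (H K₁ K₂ : Fin 3 → ℝ) (P A B : Fin 4 → ℝ) :
    (mixedDeriv fun ε δ => divFlux (H + ε • K₁ + δ • K₂) (P + ε • A + δ • B)) =
      ![-(K₁ 1 * B 2 + K₂ 1 * A 2) - (K₁ 2 * B 3 + K₂ 2 * A 3), K₁ 1 * B 1 + K₂ 1 * A 1,
        K₁ 2 * B 1 + K₂ 2 * A 1] := by
  rw [← mixedDeriv_quadratic (divFlux H P)
    ![K₁ 0 - (K₁ 1 * P 2 + H 1 * A 2) - (K₁ 2 * P 3 + H 2 * A 3), H 1 * A 1 + K₁ 1 * (1 + P 1),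
      H 2 * A 1 + K₁ 2 * (1 + P 1)]
    ![K₂ 0 - (K₂ 1 * P 2 + H 1 * B 2) - (K₂ 2 * P 3 + H 2 * B 3), H 1 * B 1 + K₂ 1 * (1 + P 1),
      H 2 * B 1 + K₂ 2 * (1 + P 1)]
    ![-(K₁ 1 * B 2 + K₂ 1 * A 2) - (K₁ 2 * B 3 + K₂ 2 * A 3), K₁ 1 * B 1 + K₂ 1 * A 1,
        K₁ 2 * B 1 + K₂ 2 * A 1]
    ![-(K₁ 1 * A 2) - K₁ 2 * A 3, K₁ 1 * A 1, K₁ 2 * A 1]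
    ![-(K₂ 1 * B 2) - K₂ 2 * B 3, K₂ 1 * B 1, K₂ 2 * B 1]]
  congr 1
  funext ε δ j
  fin_cases j <;> simp [divFlux] <;> ring

theorem h1_sub_le (hD : IsOpen D.cover) :
    h1 D γ n (fun z => u z - v z) ≤ h1 D γ n u + h1 D γ n v := by
  have h : (fun z => u z - v z) = fun z => u z + (-1) * v z := by funext z; ring
  rw [h]
  refine (h1_add_le hD).trans (add_le_add le_rfl ((h1_const_mul_le hD _).trans ?_))
  simp

theorem h1_neg_le (hD : IsOpen D.cover) :
    h1 D γ n (fun z => -u z) ≤ h1 D γ n u := by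
  have h : (fun z => -u z) = fun z => (-1) * u z := by funext z; ring
  rw [h]
  refine (h1_const_mul_le hD _).trans ?_
  simp

theorem h1_weakPartial_le (hγ : 1 ≤ γ) (i) (u) :
    h1 D γ n (weakPartial D i u) ≤ h1 D γ (n + 1) u := by
  by_cases h : ∃ g, IsWeakPartial D i u g
  · obtain ⟨g, hg⟩ := h
    exact h1_partial_le (weakPartial_spec hg)
  · have htop : weakDerivNorm D 2 (single i 1) u = ⊤ := by
      by_contra hne
      obtain ⟨g, hg⟩ := exists_weakDeriv hne
      exact h ⟨g, weakDeriv_single.1 hg⟩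
    have := weakDerivNorm_le_h1 (D := D) (n := n + 1) (u := u) hγ (α := single i 1)
      (by simp)
    rw [htop] at this
    exact le_top.trans this

theorem le_gradNorm {D : PeriodicDomain 4} (hD : IsOpen D.cover)
   
    (hN : ∀ f g, f =ᵐ[vol D] g → N f = N g)
    (hi : i ≠ 0) (u : Fn 4) : N (weakPartial D i u) ≤ gradNorm D N u := by
  have hi' : i ∈ ({1, 2, 3} : Finset (Fin 4)) := by
    fin_cases i <;> simp_all
  exact (le_iInf₂ fun g hg => (hN _ _ (weakPartial_ae_eq hD hg)).le).trans (single_le_sum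
    (f := fun i => ⨅ (g : Fn 4) (_ : IsWeakPartial D i u g), N g)
    (fun _ _ => zero_le) hi')

theorem exists_of_gradNorm {D : PeriodicDomain 4}
    {u : Fn 4} (h : gradNorm D N u ≠ ⊤) (hi : i ≠ 0) :
    ∃ g, IsWeakPartial D i u g := by
  by_contra hne
  refine h ?_
  unfold gradNorm
  rw [ENNReal.sum_eq_top]
  have hi' : i ∈ ({1, 2, 3} : Finset (Fin 4)) := by
    fin_cases i <;> simp_all
  exact ⟨i, hi', iInf₂_eq_top.2 fun g hg => absurd ⟨g, hg⟩ hne⟩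

theorem wInfNorm_congr (h : u =ᵐ[vol D] v) :
    wInfNorm D k u = wInfNorm D k v := by
  simp only [wInfNorm, weakDerivNorm_congr h]

theorem hNorm_congr (h : u =ᵐ[vol D] v) :
    hNorm D γ n u = hNorm D γ n v := by
  simp only [hNorm, weakDerivNorm_congr h]

theorem lpNorm_top_le_wInfNorm (hD : IsOpen D.cover) (k) (u) :
    lpNorm D ⊤ u ≤ wInfNorm D k u :=
  (lpNorm_le_weakDerivNorm hD u ⊤).trans (single_le_sum
    (f := fun α => weakDerivNorm D ⊤ α u) (fun _ _ => zero_le) (mem_multiIndices.2 (by simp)))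

theorem le_vecNorm (N) (u : (Fin d → ℝ) → Fin n → ℝ)
    (j) : N (fun z => u z j) ≤ vecNorm N u :=
  single_le_sum (f := fun j => N fun z => u z j) (fun _ _ => zero_le) (mem_univ j)

theorem IsPeriodic.apply {u : (Fin d → ℝ) → Fin n → ℝ} (h : IsPeriodic D u) (j) :
    IsPeriodic D fun z => u z j := fun i hi z => by simp only [h i hi z]

theorem IsWeakPartial.aePeriodic (hD : IsOpen D.cover) (hI : IsInvariant D)
    (h : IsWeakPartial D i u g) (hu : AEPeriodic D u) :
    AEPeriodic D g := (weakDeriv_single.2 h).aePeriodic hD hI hu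

theorem locInt_of_hNorm (hγ : 1 ≤ γ) (h : hNorm D γ n u < ⊤) :
    LocallyIntegrableOn u D.cover := by
  obtain ⟨g, hg⟩ := exists_weakDeriv ((weakDerivNorm_le_h1 (α := 0) hγ (by simp)).trans_lt ((h1_le_hNorm D γ n u).trans_lt (mul_lt_top (by simp) h))).ne
  exact hg.1

/-- The estimate of the second derivative of the vacuum operator. -/
theorem vacuum_estimate (m : ℕ) : ∃ C : NNReal, ∀ T γ, 1 ≤ γ →
    ∀ Hh Ψh K₁ Ψ₁ K₂ Ψ₂,
    IsPeriodic (vacuumDomain T) K₁ → IsPeriodic (vacuumDomain T) Ψ₁ →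
    IsPeriodic (vacuumDomain T) K₂ → IsPeriodic (vacuumDomain T) Ψ₂ →
    vacuumHNorm T γ (m + 1) K₁ Ψ₁ < ⊤ → vacuumHNorm T γ (m + 1) K₂ Ψ₂ < ⊤ →
    vecNorm (hNorm (vacuumDomain T) γ m)
        (vacuumSecond (vacuumDomain T) Hh Ψh K₁ Ψ₁ K₂ Ψ₂) ≤
      C * (vacuumHNorm T γ (m + 1) K₁ Ψ₁ * vacuumWNorm T K₂ Ψ₂ +
        vacuumHNorm T γ (m + 1) K₂ Ψ₂ * vacuumWNorm T K₁ Ψ₁) := by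
  obtain ⟨C, hC⟩ := h1_mul_le (d := 4) 1 (isCompact_Icc) (m + 1)
  set c := ((multiIndices 4 (m + 1)).card : NNReal) with hc
  refine ⟨48 * (C * c), fun T γ hγ Hh Ψh K₁ Ψ₁ K₂ Ψ₂ pK₁ pΨ₁ pK₂ pΨ₂ f₁ f₂ => ?_⟩
  set D := vacuumDomain T
  have hD := (isBox_vacuum T).isOpen
  set X₁ := vacuumHNorm T γ (m + 1) K₁ Ψ₁
  set X₂ := vacuumHNorm T γ (m + 1) K₂ Ψ₂
  set W₁ := vacuumWNorm T K₁ Ψ₁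
  set W₂ := vacuumWNorm T K₂ Ψ₂
  -- the components of `K` and of `∇Ψ` are controlled by the norms of `(K, Ψ)`
  let Good K Ψ w : Prop := AEPeriodic D w ∧ LocallyIntegrableOn w D.cover ∧
    h1 D γ (m + 1) w ≤ c * vacuumHNorm T γ (m + 1) K Ψ ∧ lpNorm D ⊤ w ≤ vacuumWNorm T K Ψ
  have hcomp K Ψ (pK : IsPeriodic D K) (pΨ : IsPeriodic D Ψ)
      (hf : vacuumHNorm T γ (m + 1) K Ψ < ⊤) : (∀ j, Good K Ψ fun z => K z j) ∧
      ∀ i, i ≠ 0 → Good K Ψ (weakPartial D i Ψ) := by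
    have hh1 : ∀ w, hNorm D γ (m + 1) w ≤ vacuumHNorm T γ (m + 1) K Ψ →
        h1 D γ (m + 1) w ≤ c * vacuumHNorm T γ (m + 1) K Ψ := fun w hw =>
      (h1_le_hNorm D γ _ w).trans (by rw [hc]; simpa using mul_le_mul_right hw _)
    constructor
    · intro j
      have e1 : hNorm D γ (m + 1) (fun z => K z j) ≤ vacuumHNorm T γ (m + 1) K Ψ :=
        (le_vecNorm _ K j).trans le_self_add
      exact ⟨(pK.apply j).ae, locInt_of_hNorm hγ (e1.trans_lt hf), hh1 _ e1,
        (lpNorm_top_le_wInfNorm hD 1 _).trans ((le_vecNorm _ K j).trans le_self_add)⟩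
    · intro i hi
      have hg : gradNorm D (hNorm D γ (m + 1)) Ψ ≤ vacuumHNorm T γ (m + 1) K Ψ := le_add_self
      obtain ⟨g, hg'⟩ := exists_of_gradNorm (hg.trans_lt hf).ne hi
      have hs := weakPartial_spec hg'
      exact ⟨hs.aePeriodic hD ((isBox_vacuum T).invariant) pΨ.ae, hs.2.1,
        hh1 _ ((le_gradNorm hD (fun _ _ h => hNorm_congr h) hi Ψ).trans hg),
        (lpNorm_top_le_wInfNorm hD 1 _).trans
          ((le_gradNorm hD (fun _ _ h => wInfNorm_congr h) hi Ψ).trans le_add_self)⟩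
  have hmul {K Ψ w K' Ψ' w'} (h : Good K Ψ w) (h' : Good K' Ψ' w') :
      h1 D γ (m + 1) (fun z => w z * w' z) ≤ C * (c * vacuumHNorm T γ (m + 1) K Ψ *
        vacuumWNorm T K' Ψ' + vacuumWNorm T K Ψ * (c * vacuumHNorm T γ (m + 1) K' Ψ')) := by
    refine (hC D _ _ _ _ (isMoserBox_vacuum T) γ hγ _ _ h.1 h'.1 h.2.1 h'.2.1).trans ?_
    gcongr
    exacts [h.2.2.1, h'.2.2.2, h.2.2.2, h'.2.2.1]
  obtain ⟨k₁, g₁⟩ := hcomp K₁ Ψ₁ pK₁ pΨ₁ f₁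
  obtain ⟨k₂, g₂⟩ := hcomp K₂ Ψ₂ pK₂ pΨ₂ f₂
  set R := C * c * (X₁ * W₂ + X₂ * W₁) with hR
  set q := fun a i z =>
    K₁ z a * weakPartial D i Ψ₂ z + K₂ z a * weakPartial D i Ψ₁ z
  have hqR a i : i ≠ 0 → h1 D γ (m + 1) (q a i) ≤ 2 * R := by
    intro hi
    rw [two_mul]
    refine (h1_add_le hD).trans (add_le_add ?_ ?_)
    · exact (hmul (k₁ a) (g₂ i hi)).trans_eq (by rw [hR]; ring)
    · exact (hmul (k₂ a) (g₁ i hi)).trans_eq (by rw [hR]; ring)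
  have hv : vacuumSecond D Hh Ψh K₁ Ψ₁ K₂ Ψ₂ = curlDiv D
      (fun z => ![q 0 1 z, q 0 2 z, q 0 3 z])
      (fun z => ![-q 1 2 z - q 2 3 z, q 1 1 z, q 2 1 z]) := by
    unfold vacuumSecond
    congr 1
    exacts [funext fun z => curlFlux_mixedDeriv .., funext fun z => divFlux_mixedDeriv ..]
  have hpart : ∀ i w, h1 D γ (m + 1) w ≤ 4 * R →
      h1 D γ m (weakPartial D i w) ≤ 4 * R := fun i w hw => (h1_weakPartial_le hγ i w).trans hw
  have hq4 : ∀ a i, i ≠ 0 → h1 D γ (m + 1) (fun z => q a i z) ≤ 4 * R := fun a i hi =>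
    (hqR a i hi).trans (mul_le_mul_left (by norm_num) _)
  have hq5 : h1 D γ (m + 1) (fun z => -q 1 2 z - q 2 3 z) ≤ 4 * R := by
    refine (h1_sub_le hD).trans ?_
    calc _ ≤ 2 * R + 2 * R := add_le_add
          ((h1_neg_le hD).trans (hqR 1 2 (by decide))) (hqR 2 3 (by decide))
      _ = 4 * R := by ring
  have hall j : hNorm D γ m (fun z => vacuumSecond D Hh Ψh K₁ Ψ₁ K₂ Ψ₂ z j) ≤ 12 * R := by
    refine (hNorm_le_h1 _ _ _ _).trans ?_
    have h8 : 4 * R + 4 * R ≤ 12 * R := by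
      rw [← add_mul]; exact mul_le_mul_left (by norm_num) _
    rw [hv]
    fin_cases j
    · exact ((h1_sub_le hD).trans (add_le_add (hpart 2 _ (hq4 0 3 (by decide)))
        (hpart 3 _ (hq4 0 2 (by decide))))).trans h8
    · exact ((h1_sub_le hD).trans (add_le_add (hpart 3 _ (hq4 0 1 (by decide)))
        (hpart 1 _ (hq4 0 3 (by decide))))).trans h8
    · exact ((h1_sub_le hD).trans (add_le_add (hpart 1 _ (hq4 0 2 (by decide)))
        (hpart 2 _ (hq4 0 1 (by decide))))).trans h8
    · refine ((h1_add_le hD).trans (add_le_add ((h1_add_le hD).trans (add_le_add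
        (hpart 1 _ hq5) (hpart 2 _ (hq4 1 1 (by decide)))))
        (hpart 3 _ (hq4 2 1 (by decide))))).trans (le_of_eq ?_)
      ring
  calc _ ≤ ∑ _j, 12 * R := sum_le_sum fun j _ => hall j
    _ = _ := by
      rw [sum_const, Finset.card_univ, Fintype.card_fin, nsmul_eq_mul, hR]
      push_cast
      ring

end

section

/-! ### Properties of the anisotropic norms -/

variable {σ : ℝ → ℝ} {T γ : ℝ} {n : ℕ} {D : PeriodicDomain 4} {u v : Fn 4}

theorem IsConormalDeriv.congr {k : ℕ} {g : Fn 4}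
    (h : IsConormalDeriv σ D α k u g) (hu : u =ᵐ[vol D] v) :
    IsConormalDeriv σ D α k v g := by
  obtain ⟨h1, h2, h3⟩ := h
  refine ⟨?_, h2, fun φ hφ => ?_⟩
  · exact h1.congr hu
  · rw [← h3 φ hφ]; exact (integral_mul_congr hu).symm

theorem conormalDerivNorm_congr (h : u =ᵐ[vol D] v) :
    conormalDerivNorm σ D α k u = conormalDerivNorm σ D α k v := by
  unfold conormalDerivNorm
  refine iInf_congr fun g => ?_
  have : IsConormalDeriv σ D α k u g ↔ IsConormalDeriv σ D α k v g :=
    ⟨fun h' => h'.congr h, fun h' => h'.congr h.symm⟩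
  simp only [this]

theorem conormalDerivNorm_zero :
    conormalDerivNorm σ D α k (fun _ => 0) = 0 := by
  refine le_antisymm ((iInf₂_le _ ⟨locallyIntegrableOn_zero, locallyIntegrableOn_zero, fun φ _ => by simp⟩).trans ?_) zero_le
  simp [lpNorm]

theorem conormalDerivNorm_const_mul_le (hD : IsOpen D.cover) (c) :
    conormalDerivNorm σ D α k (fun z => c * u z) ≤ ‖c‖ₑ * conormalDerivNorm σ D α k u := by
  by_cases hc : c = 0
  · simp [hc, conormalDerivNorm_zero]
  by_cases hu : conormalDerivNorm σ D α k u = ⊤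
  · rw [hu, mul_top (by simpa using hc)]; exact le_top
  obtain ⟨g, hg⟩ := exists_conormalDeriv hu
  have hcg : IsConormalDeriv σ D α k (fun z => c * u z) (fun z => c * g z) := by
    refine ⟨locInt_mul hD continuousOn_const hg.1,
      locInt_mul hD continuousOn_const hg.2.1, fun φ hφ => ?_⟩
    simp only [mul_assoc]
    rw [integral_const_mul, integral_const_mul, hg.2.2 φ hφ]
  rw [hcg.norm_eq hD, hg.norm_eq hD]
  exact (eLpNorm_const_smul c g 2 _).le

theorem hs1_congr (h : u =ᵐ[vol D] v) : hs1 σ D γ n u = hs1 σ D γ n v := by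
  simp only [hs1, conormalDerivNorm_congr h]

theorem hs1_zero : hs1 σ D γ n (fun _ => 0) = 0 := by
  simp only [hs1, conormalDerivNorm_zero, lev1_zero]

theorem hs1_const_mul_le (hD : IsOpen D.cover) (c) :
    hs1 σ D γ n (fun z => c * u z) ≤ ‖c‖ₑ * hs1 σ D γ n u := by
  unfold hs1
  rw [← lev1_const_mul]
  exact lev1_le_of_le fun _ => conormalDerivNorm_const_mul_le hD c

theorem hs1_mono (hγ : 1 ≤ γ) (h : m ≤ n) : hs1 σ D γ m u ≤ hs1 σ D γ n u := by
  unfold hs1 lev1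
  refine (sum_le_sum fun q hq => ?_).trans
    (Finset.sum_le_sum_of_subset (ords_mono h))
  gcongr
  exact one_le_ofReal hγ

theorem isConormalDeriv_zero_iff {g : Fn 4} :
    IsConormalDeriv σ D 0 0 u g ↔ IsWeakDeriv D 0 u g := by
  unfold IsConormalDeriv IsWeakDeriv
  simp [conormalAdj, pdMulti_zero]

theorem exists_weak_of_hs1 (hσ : IsConormalWeight σ) (hγ : 1 ≤ γ)
    (h : hs1 σ (Q⁺ T) γ n u ≠ ⊤) (hp : p ∈ ords 4 true n) :
    ∃ g, IsWeakDeriv (Q⁺ T) (p.1 + single 1 p.2) u g := by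
  obtain ⟨C, hC⟩ := weakLev_le_conLev hσ n
  have hfin : conLev σ (Q⁺ T) n u ≠ ⊤ := by
    unfold conLev
    rw [Ne, ENNReal.sum_eq_top]
    rintro ⟨q, hq, htop⟩
    exact h (top_le_iff.1 (((ENNReal.pow_eq_top_iff.1 htop).1).symm.le.trans
        (le_lev1 hγ hq)))
  exact exists_of_scaledSq
    (((le_weakLev hp u).trans_lt (((hC T u).trans_lt (mul_lt_top ENNReal.coe_lt_top hfin.lt_top)).ne).lt_top).ne)

theorem exists_isWeakPartial_of_hs1 (hσ : IsConormalWeight σ) (hγ : 1 ≤ γ) (hn : 2 ≤ n)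
    (h : hs1 σ (Q⁺ T) γ n u ≠ ⊤) (i) :
    ∃ g, IsWeakPartial (Q⁺ T) i u g := by
  by_cases hi : i = 1
  · subst hi
    obtain ⟨g, hg⟩ := exists_weak_of_hs1 hσ hγ h (p := (0, 1))
      (mem_ords.2 ⟨by simpa [wt] using hn, by simp⟩)
    exact ⟨g, weakDeriv_single.1 (by simpa using hg)⟩
  · obtain ⟨g, hg⟩ := exists_weak_of_hs1 hσ hγ h (p := (single i 1, 0))
      (mem_ords.2 ⟨by simp [wt]; omega, by simp⟩)
    exact ⟨g, weakDeriv_single.1 (by simpa using hg)⟩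

theorem locInt_of_hs1 (hσ : IsConormalWeight σ) (hγ : 1 ≤ γ)
    (h : hs1 σ (Q⁺ T) γ n u ≠ ⊤) :
    LocallyIntegrableOn u (Q⁺ T).cover := by
  obtain ⟨g, hg⟩ := exists_weak_of_hs1 hσ hγ h (p := (0, 0))
    (mem_ords.2 ⟨by simp [wt], by simp⟩)
  exact hg.1

theorem scaledSq_partial_le {g : Fn 4}
    (h : IsWeakPartial D i u g) (p : (Fin 4 → ℕ) × ℕ) : scaledSq 1 s D p g ≤
      scaledSq 1 s D (if i = 1 then (p.1, p.2 + 1) else (p.1 + single i 1, p.2)) u := by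
  refine le_iInf₂ fun k hk => ?_
  by_cases hi : i = 1
  · subst hi
    simp only [if_true] at hk ⊢
    refine iInf₂_le _ ((weakDeriv_single.2 h).of_trans ?_)
    convert hk using 1
    rw [add_comm p.2 1, Pi.single_add]
    abel
  · simp only [hi, if_false] at hk ⊢
    have hi' : (p.1 + single i 1 : Fin 4 → ℕ) 1 = p.1 1 := by
      simp [Ne.symm hi]
    rw [hi']
    refine iInf₂_le _ ((weakDeriv_single.2 h).of_trans ?_)
    convert hk using 1
    abel

theorem hs1_weakPartial_le (hσ : IsConormalWeight σ) (n : ℕ) : ∃ C : NNReal, ∀ T γ, 1 ≤ γ →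
    ∀ (i : Fin 4) (u : Fn 4), hs1 σ (Q⁺ T) γ n
      (weakPartial (Q⁺ T) i u) ≤ C * hs1 σ (Q⁺ T) γ (n + 2) u := by
  choose C₁ hC₁ using conLev_le_weakLev hσ
  choose C₂ hC₂ using weakLev_le_conLev hσ
  obtain ⟨C', hC'⟩ := lev1_le_of_lev (ι := Unit) n 2
    fun j => C₁ j * ((ords 4 true j).card * C₂ (j + 2))
  refine ⟨max 1 C', fun T γ hγ i u => ?_⟩
  by_cases hfin : hs1 σ (Q⁺ T) γ (n + 2) u = ⊤
  · rw [hfin, mul_top]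
    · exact le_top
    · exact_mod_cast (zero_lt_one.trans_le (le_max_left 1 _)).ne'
  obtain ⟨g, hg⟩ := exists_isWeakPartial_of_hs1 hσ hγ (by omega) hfin i
  have hs := weakPartial_spec hg
  have h := hC' γ hγ (fun p => conormalDerivNorm σ (Q⁺ T) p.1 p.2
    (weakPartial (Q⁺ T) i u)) (fun _ p => conormalDerivNorm σ (Q⁺ T) p.1 p.2 u)
    fun j _ => ?_
  · simp only [Finset.univ_unique, Finset.sum_singleton] at h
    refine h.trans (mul_le_mul_left ?_ _)
    exact_mod_cast le_max_right _ _
  · simp only [Finset.univ_unique, Finset.sum_singleton]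
    refine (hC₁ j T _).trans ?_
    rw [coe_mul, coe_mul, mul_assoc, mul_assoc]
    refine mul_le_mul_right ?_ _
    calc weakLev 1 (sigExt σ) true (Q⁺ T) j (weakPartial (Q⁺ T) i u)
        ≤ (ords 4 true j).card • weakLev 1 (sigExt σ) true (Q⁺ T) (j + 2) u := by
          refine sum_le_card_nsmul _ _ _ fun p hp => (scaledSq_partial_le hs p).trans ?_
          refine le_weakLev (mem_ords.2 ⟨?_, by simp⟩) u
          have hw := (mem_ords.1 hp).1
          unfold wt at hw ⊢
          by_cases hi : i = 1
          · simp only [hi, if_true]; omega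
          · simp only [hi, if_false]
            rw [sum_add_single]
            omega
      _ ≤ _ := by
          rw [nsmul_eq_mul]
          push_cast
          exact mul_le_mul_right (hC₂ (j + 2) T u) _

theorem ae_eq_zero_of_hs1 (hσ : IsConormalWeight σ) (hγ : 1 ≤ γ)
    (hp : AEPeriodic (Q⁺ T) u) (h : hs1 σ (Q⁺ T) γ n u = 0) :
    u =ᵐ[vol (Q⁺ T)] fun _ => 0 := by
  have hD := isOpen_plasma T
  have hu :=
    locInt_of_hs1 hσ hγ (by rw [h]; exact ENNReal.zero_ne_top)
  refine ae_zero_of_lpNorm hD (isBox_plasma T).invariant hp hu two_ne_zero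
    (le_antisymm ?_ zero_le)
  rw [← h]
  refine le_trans (le_of_eq ?_) (le_lev1 hγ (p := (0, 0)) (mem_ords.2 ⟨by simp [wt], by simp⟩))
  exact ((isConormalDeriv_zero_iff.2
    ((isWeakDeriv_zero_iff hD).2 ⟨hu, EventuallyEq.rfl⟩)).norm_eq hD).symm

/-! ### Anisotropic Lipschitz norms -/

theorem IsWeakPartial.iInf_eq (hD : IsOpen D.cover) {g : Fn 4}
    (h : IsWeakPartial D i u g) {N : (Fn 4) → ℝ≥0∞}
    (hN : ∀ f g, f =ᵐ[vol D] g → N f = N g) :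
    ⨅ (g : Fn 4) (_ : IsWeakPartial D i u g), N g = N g :=
  le_antisymm (iInf₂_le g h) (le_iInf₂ fun _ h' => (hN _ _ (h.unique hD h')).le)

theorem exists_of_iInf_partial {N : (Fn 4) → ℝ≥0∞}
    (h : ⨅ (g : Fn 4) (_ : IsWeakPartial D i u g), N g ≠ ⊤) :
    ∃ g, IsWeakPartial D i u g := by
  by_contra hne
  exact h (iInf₂_eq_top.2 fun g hg => absurd ⟨g, hg⟩ hne)

theorem wStarOneNorm_congr (h : u =ᵐ[vol D] v) :
    wStarOneNorm σ D u = wStarOneNorm σ D v := by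
  unfold wStarOneNorm
  have : ∀ i g, IsWeakPartial D i u g ↔ IsWeakPartial D i v g := fun i g =>
    ⟨fun h' => h'.congr h EventuallyEq.rfl, fun h' => h'.congr h.symm EventuallyEq.rfl⟩
  simp only [this, lpNorm_congr h]

theorem wStarTwoNorm_congr (h : u =ᵐ[vol D] v) :
    wStarTwoNorm σ D u = wStarTwoNorm σ D v := by
  unfold wStarTwoNorm
  have : ∀ i g, IsWeakPartial D i u g ↔ IsWeakPartial D i v g := fun i g =>
    ⟨fun h' => h'.congr h EventuallyEq.rfl, fun h' => h'.congr h.symm EventuallyEq.rfl⟩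
  simp only [this, wStarOneNorm_congr h]

theorem wStarOneNorm_zero : wStarOneNorm σ D (fun _ => 0) = 0 := by
  have h : ∀ i, ⨅ (g : Fn 4) (_ : IsWeakPartial D i (fun _ => 0) g),
      lpNorm D ⊤ (fun z => zCoef σ i z * g z) = 0 := fun i =>
    le_antisymm ((iInf₂_le _ (isWeakPartial_zero i)).trans
      (by simp only [mul_zero]; exact eLpNorm_zero'.le)) zero_le
  have h0 : lpNorm D ⊤ (fun _ => 0) = 0 := eLpNorm_zero'
  simp only [wStarOneNorm, h, h0, Finset.sum_const_zero, add_zero]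

theorem wStarTwoNorm_zero : wStarTwoNorm σ D (fun _ => 0) = 0 := by
  have h : ∀ i, ⨅ (g : Fn 4) (_ : IsWeakPartial D i (fun _ => 0) g),
      wStarOneNorm σ D g = 0 := fun i =>
    le_antisymm ((iInf₂_le _ (isWeakPartial_zero i)).trans wStarOneNorm_zero.le) zero_le
  simp [wStarTwoNorm, h, wStarOneNorm_zero]

theorem wOne_weakPartial_le (hD : IsOpen D.cover) (i) :
    wStarOneNorm σ D (weakPartial D i u) ≤ wStarTwoNorm σ D u := by
  refine le_trans ?_ le_add_self
  refine le_trans ?_ (single_le_sum (fun _ _ => zero_le) (mem_univ i))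
  exact le_iInf₂ fun g hg => (wStarOneNorm_congr (weakPartial_ae_eq hD hg)).le

theorem lpNorm_le_wStarOneNorm : lpNorm D ⊤ u ≤ wStarOneNorm σ D u := le_self_add

theorem continuousOn_zCoef (hσ : IsConormalWeight σ) (i) :
    ContinuousOn (zCoef σ i) (Q⁺ T).cover := by
  by_cases hi : i = 1
  · subst hi
    exact (smooth_coord (smooth_sigExt hσ) 1).continuous.continuousOn.congr
      fun z hz => zCoef_one_eq hz
  · have : zCoef σ i = fun _ => 1 := by funext z; simp [zCoef, hi]
    rw [this]; exact continuousOn_const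

theorem exists_conormal_bound (hσ : IsConormalWeight σ) (hp : AEPeriodic (Q⁺ T) u)
    {R : ℝ≥0∞} (hR : wStarOneNorm σ (Q⁺ T) u ≤ R) (hRt : R ≠ ⊤) (i) :
    ∃ h, IsWeakPartial (Q⁺ T) i u h ∧
      ∀ᵐ z ∂vol (Q⁺ T), ‖zCoef σ i z * h z‖ₑ ≤ R := by
  have hD := isOpen_plasma T
  have hI := (isBox_plasma T).invariant
  have h1 : ⨅ (g : Fn 4) (_ : IsWeakPartial (Q⁺ T) i u g),
      lpNorm (Q⁺ T) ⊤ (fun z => zCoef σ i z * g z) ≤ R := by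
    refine le_trans ?_ hR
    refine le_trans ?_ le_add_self
    exact single_le_sum (f := fun i => ⨅ (g : Fn 4)
      (_ : IsWeakPartial (Q⁺ T) i u g), lpNorm (Q⁺ T) ⊤
      (fun z => zCoef σ i z * g z)) (fun _ _ => zero_le) (mem_univ i)
  obtain ⟨h, hh⟩ := exists_of_iInf_partial (h1.trans_lt hRt.lt_top).ne
  rw [hh.iInf_eq hD
    fun f g hfg => lpNorm_congr (hfg.mono fun z hz => by simp only [hz])] at h1
  refine ⟨h, hh, ?_⟩
  have hper : AEPeriodic (Q⁺ T) fun z => zCoef σ i z * h z := fun v hv =>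
      (hh.aePeriodic hD hI hp v hv).mono fun z hz => by simp only [hz, zCoef, Pi.add_apply, shiftVec,
        hv 1 (by simp [plasmaDomain]), Int.cast_zero, add_zero]
  filter_upwards [ae_le_lpNorm_top hD hI hper
    (locInt_mul hD (continuousOn_zCoef hσ i) hh.2.1)] with z hz
  exact hz.trans h1

theorem plasma_subset_full (T) : (Q⁺ T).cover ⊆ (fullDomain T).cover :=
  fun z hz => ⟨hz.1, by linarith [hz.2.1], hz.2.2⟩

theorem IsTest.mono (h : IsTest A φ)
    (hAB : A ⊆ B) : IsTest B φ := ⟨h.1, h.2.1, h.2.2.trans hAB⟩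

theorem setIntegral_mul_test (hAB : A ⊆ B)
    (hφ : ∀ z, z ∉ A → φ z = 0) :
    ∫ z in B, f z * φ z = ∫ z in A, f z * φ z := by
  rw [setIntegral_eq_integral_of_forall_compl_eq_zero fun z hz => by rw [hφ z fun h => hz (hAB h),
    mul_zero], setIntegral_eq_integral_of_forall_compl_eq_zero fun z hz => by
    rw [hφ z hz, mul_zero]]

theorem IsWeakPartial.restrict {g : Fn 4}
    (h : IsWeakPartial (fullDomain T) i u g) : IsWeakPartial (Q⁺ T) i u g := by
  refine ⟨h.1.mono_set (plasma_subset_full T), h.2.1.mono_set (plasma_subset_full T),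
    fun φ hφ => ?_⟩
  rw [← setIntegral_mul_test (plasma_subset_full T) fun z hz => (hφ.pd i).eq_zero hz,
    ← setIntegral_mul_test (plasma_subset_full T) fun z hz => hφ.eq_zero hz]
  exact h.2.2 φ (hφ.mono (plasma_subset_full T))

theorem lpNorm_restrict (f) (p) :
    lpNorm (Q⁺ T) p f ≤ lpNorm (fullDomain T) p f :=
  eLpNorm_mono_measure _ (Measure.restrict_mono
    (Set.inter_subset_inter_left _ (plasma_subset_full T)) le_rfl)

theorem wStarOneNorm_restrict :
    wStarOneNorm σ (Q⁺ T) u ≤ wStarOneNorm σ (fullDomain T) u := by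
  refine add_le_add (lpNorm_restrict _ _) (sum_le_sum fun i _ => ?_)
  refine le_iInf₂ fun g hg => ?_
  refine le_trans (iInf₂_le g hg.restrict) ?_
  exact lpNorm_restrict _ _

theorem wStarTwoNorm_restrict :
    wStarTwoNorm σ (Q⁺ T) u ≤ wStarTwoNorm σ (fullDomain T) u := by
  refine add_le_add wStarOneNorm_restrict (sum_le_sum fun i _ => ?_)
  refine le_iInf₂ fun g hg => ?_
  refine le_trans (iInf₂_le g hg.restrict) ?_
  exact wStarOneNorm_restrict

end

section

/-! ### The second derivative of the plasma symbol -/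

/-- Near an interior point of smoothness, the second derivative of a nonlinear map is bilinear in
the increments with coefficients that extend to smooth functions on the whole space. -/
theorem exists_second_coeff [Fintype J] [DecidableEq J]
    {G : (J → ℝ) → Fin n → ℝ} {V : Set (J → ℝ)} (hV : IsOpen V) (h0 : 0 ∈ V)
    (hG : ContDiffOn ℝ ∞ G V) :
    ∃ r > 0, ∃ F : J → J → (J → ℝ) → Fin n → ℝ, (∀ k l, Smooth (F k l)) ∧
      ∀ X, ‖X‖ < r → ∀ X₁ X₂,
        mixedDeriv (fun ε δ => G (X + ε • X₁ + δ • X₂)) =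
          ∑ k, ∑ l, (X₁ k * X₂ l) • F k l X := by
  obtain ⟨R, hR, hRV⟩ := Metric.isOpen_iff.1 hV 0 h0
  let χ : ContDiffBump (0 : J → ℝ) := ⟨R / 3, R / 2, by positivity, by linarith⟩
  let E := fun X => χ X • G X
  have hE : Smooth E := by
    rw [contDiff_iff_contDiffAt]
    intro X
    by_cases hX : X ∈ V
    · exact χ.contDiff.contDiffAt.smul (hG.contDiffAt (hV.mem_nhds hX))
    · have : X ∈ (tsupport χ)ᶜ := fun h => hX (hRV (by
        rw [χ.tsupport_eq] at h
        exact Metric.closedBall_subset_ball (by show R / 2 < R; linarith) h))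
      refine contDiffAt_const (c := 0) |>.congr_of_eventuallyEq ?_
      filter_upwards [(isClosed_tsupport χ).isOpen_compl.mem_nhds this] with Y hY
      simp [E, image_eq_zero_of_notMem_tsupport hY]
  have hF : ∀ v, Smooth fun Y => fderiv ℝ E Y v := fun v =>
    (hE.fderiv_right le_rfl).clm_apply contDiff_const
  have hd := fun v =>
    (hF v).differentiable (by simp)
  refine ⟨R / 3, by positivity, fun k l X => fderiv ℝ (fun Y => fderiv ℝ E Y (single l 1)) X
    (single k 1), fun k l => ((hF _).fderiv_right le_rfl).clm_apply contDiff_const,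
    fun X hX X₁ X₂ => ?_⟩
  have hEG : ∀ Y, ‖Y‖ < R / 3 → E Y = G Y := fun Y hY => by
    simp only [E]
    rw [χ.one_of_mem_closedBall (by simpa using hY.le), one_smul]
  have hb : ∀ (L : (J → ℝ) →L[ℝ] Fin n → ℝ) v, L v = ∑ l, v l • L (single l 1) := fun L v => by
    conv_lhs => rw [← Finset.univ_sum_single v]
    simp only [map_sum, ← map_smul, ← Pi.single_smul, smul_eq_mul, mul_one]
  have hline : ∀ Y v : J → ℝ, HasDerivAt (fun δ : ℝ => Y + δ • v) v 0 := fun Y v => by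
    simpa using ((hasDerivAt_id (0 : ℝ)).smul_const v).const_add Y
  have hin : ∀ Y, ‖Y‖ < R / 3 →
      deriv (fun δ : ℝ => G (Y + δ • X₂)) 0 = fderiv ℝ E Y X₂ := fun Y hY => by
    have h1 : (fun δ : ℝ => E (Y + δ • X₂)) =ᶠ[𝓝 0] fun δ => G (Y + δ • X₂) := by
      have : ContinuousAt (fun δ : ℝ => ‖Y + δ • X₂‖) 0 := by fun_prop
      filter_upwards [this.eventually_lt_const (by simpa using hY)] with δ hδ using hEG _ hδ
    rw [← h1.deriv_eq]
    exact ((hE.differentiable (by simp) Y).hasFDerivAt.comp_hasDerivAt_of_eq 0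
      (hline Y X₂) (by simp)).deriv
  have hout : (fun ε : ℝ => deriv (fun δ : ℝ => G (X + ε • X₁ + δ • X₂)) 0) =ᶠ[𝓝 0]
      fun ε => fderiv ℝ E (X + ε • X₁) X₂ := by
    have : ContinuousAt (fun ε : ℝ => ‖X + ε • X₁‖) 0 := by fun_prop
    filter_upwards [this.eventually_lt_const (by simpa using hX)] with ε hε using hin _ hε
  unfold mixedDeriv
  rw [hout.deriv_eq]
  have h2 : deriv (fun ε : ℝ => fderiv ℝ E (X + ε • X₁) X₂) 0 =
      fderiv ℝ (fun Y => fderiv ℝ E Y X₂) X X₁ :=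
    ((hd X₂ X).hasFDerivAt.comp_hasDerivAt_of_eq 0 (hline X X₁) (by simp)).deriv
  rw [h2, funext fun Y => hb _ _, fderiv_fun_sum
    fun l _ => (hd _ X).fun_const_smul _, _root_.sum_apply, Finset.sum_comm]
  refine sum_congr rfl fun l _ => ?_
  rw [fderiv_fun_const_smul (hd _ X), _root_.smul_apply,
    hb _ X₁, Finset.smul_sum]
  exact sum_congr rfl fun k _ => by rw [smul_smul, mul_comm]

section

variable {E : Type} [NormedAddCommGroup E] [NormedSpace ℝ E] {V : Set E}

theorem contDiffOn_vecCons [NormedAddCommGroup F] [NormedSpace ℝ F] {f : E → F}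
    {g : E → Fin n → F} (hf : ContDiffOn ℝ ∞ f V) (hg : ContDiffOn ℝ ∞ g V) :
    ContDiffOn ℝ ∞ (fun x => Matrix.vecCons (f x) (g x)) V :=
  contDiffOn_pi.2 fun i => by
    refine Fin.cases ?_ (fun j => ?_) i
    · simpa using hf
    · simpa using contDiffOn_pi.1 hg j

theorem contDiffOn_mulVec {M : E → Matrix (Fin 8) (Fin 8) ℝ} {w : E → Fin 8 → ℝ}
    (hM : ∀ i j, ContDiffOn ℝ ∞ (fun x => M x i j) V) (hw : ∀ j, ContDiffOn ℝ ∞ (fun x => w x j) V) :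
    ContDiffOn ℝ ∞ (fun x => M x *ᵥ w x) V :=
  contDiffOn_pi.2 fun i => by
    simp only [Matrix.mulVec, dotProduct]
    exact ContDiffOn.sum fun j _ => (hM i j).mul (hw j)

theorem contDiffOn_matrices {ρ : ℝ → ℝ → ℝ} {U : E → Fin 8 → ℝ}
    (hU : ∀ j, ContDiffOn ℝ ∞ (fun x => U x j) V)
    (hr : ContDiffOn ℝ ∞ (fun x => rhoRatio ρ (U x)) V)
    (hd : ContDiffOn ℝ ∞ (fun x => density ρ (U x)) V) :
    (∀ i j, ContDiffOn ℝ ∞ (fun x => matA0 ρ (U x) i j) V) ∧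
      ∀ k i j, ContDiffOn ℝ ∞ (fun x => matA ρ (U x) k i j) V := by
  have hv : ∀ k, ContDiffOn ℝ ∞ (fun x => ![U x 1, U x 2, U x 3] k) V := fun k =>
    contDiffOn_pi.1 (contDiffOn_vecCons (hU 1) (contDiffOn_vecCons (hU 2)
      (contDiffOn_vecCons (hU 3) contDiffOn_const))) k
  have h4 := hU 4
  have h5 := hU 5
  have h6 := hU 6
  refine ⟨fun i j => contDiffOn_pi.1 (contDiffOn_pi.1 (show ContDiffOn ℝ ∞
    (fun x => Matrix.of.symm (matA0 ρ (U x))) V from ?_) i) j, fun k i j => contDiffOn_pi.1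
    (contDiffOn_pi.1 (show ContDiffOn ℝ ∞ (fun x => Matrix.of.symm (matA ρ (U x) k)) V from ?_) i) j⟩
  all_goals
    simp only [matA0, matA, Equiv.symm_apply_apply]
    repeat' refine contDiffOn_vecCons ?_ ?_
  all_goals first
    | exact contDiffOn_const
    | exact hd
    | exact hr
    | exact hr.neg.mul ‹_›
    | exact (hr.mul ‹_›).mul ‹_›
    | exact contDiffOn_const.add ((hr.mul ‹_›).mul ‹_›)
    | exact ((fun k => contDiffOn_pi.1 (contDiffOn_vecCons (hU 4) (contDiffOn_vecCons (hU 5) (contDiffOn_vecCons (hU 6) contDiffOn_const))) k) k).neg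
    | exact hv k
    | exact hd.mul (hv k)
    | exact hr.mul (hv k)
    | exact (hr.neg.mul ‹_›).mul (hv k)
    | exact ((hr.mul ‹_›).mul ‹_›).mul (hv k)
    | exact (contDiffOn_const.add ((hr.mul ‹_›).mul ‹_›)).mul (hv k)

end

/-- The positions of the entries of the 1-jet of `(U, Ψ)` without the value of `Ψ`. -/
abbrev JetIndex : Type := Fin 8 ⊕ (Fin 4 × Fin 8) ⊕ Fin 4

/-- The plasma symbol as a function of the jet. -/
def jetSymbol (ρ : ℝ → ℝ → ℝ) (X : JetIndex → ℝ) : Fin 8 → ℝ :=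
  plasmaSymbol ρ (fun j => X (.inl j)) (fun i j => X (.inr (.inl (i, j))))
    fun i => X (.inr (.inr i))

/-- The jets with admissible density and with `|∂₁Ψ| < 1`. -/
def jetDomain (O : Set (ℝ × ℝ)) : Set (JetIndex → ℝ) :=
  {X | (pressure fun j => X (.inl j), X (.inl 7)) ∈ O ∧ |X (.inr (.inr 1))| < 1}

theorem isOpen_jetDomain {O : Set (ℝ × ℝ)} (hO : IsOpen O) : IsOpen (jetDomain O) := by
  refine (hO.preimage
    ?_).inter (isOpen_lt (f := fun X : JetIndex → ℝ => |X (.inr (.inr 1))|) (by fun_prop)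
    continuous_const)
  unfold pressure; fun_prop

theorem contDiffOn_jetSymbol {ρ : ℝ → ℝ → ℝ} {O : Set (ℝ × ℝ)} (hρ : IsEquationOfState ρ O) :
    ContDiffOn ℝ ∞ (jetSymbol ρ) (jetDomain O) := by
  obtain ⟨hO, -, hs, hpos⟩ := hρ
  have hX : ∀ k, ContDiffOn ℝ ∞ (fun X => X k) (jetDomain O) := fun k =>
    (contDiff_apply ℝ ℝ k).contDiffOn
  have hps : ContDiffOn ℝ ∞ (fun X => (pressure fun j => X (.inl j), X (.inl 7)))
      (jetDomain O) := by
    unfold pressure; fun_prop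
  have hm : Set.MapsTo (fun X => (pressure fun j => X (.inl j), X (.inl 7)))
      (jetDomain O) O := fun X hX => hX.1
  have hd := hs.comp hps hm
  have hr : ContDiffOn ℝ ∞ (fun X => rhoRatio ρ fun j => X (.inl j))
      (jetDomain O) := by
    refine ((((hs.fderiv_of_isOpen hO (by simp)).clm_apply (contDiffOn_const (c := (1, 0)))).comp hps hm).div hd fun X hX => (hpos _ (hm hX)).1.ne').congr fun X hX => ?_
    unfold rhoRatio density
    congr 1
    exact (HasFDerivAt.comp_hasDerivAt
      (f := fun p => (p, X (.inl 7))) _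
          (((hs.contDiffAt (hO.mem_nhds (hm hX))).differentiableAt (by simp)).hasFDerivAt)
          ((hasDerivAt_id _).prodMk (hasDerivAt_const _ _))).deriv
  obtain ⟨hA0, hA⟩ := contDiffOn_matrices
    (fun j => hX _) hr hd
  unfold jetSymbol plasmaSymbol
  refine (((contDiffOn_mulVec hA0 fun j => hX _).add (contDiffOn_mulVec (fun i j => ?_)
    fun j => hX _)).add (contDiffOn_mulVec (hA 1) fun j => hX _)).add
    (contDiffOn_mulVec (hA 2) fun j => hX _)
  simp only [Matrix.smul_apply, Matrix.sub_apply, smul_eq_mul]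
  exact ((contDiffOn_const.add (hX _)).inv fun X h => by have := (abs_lt.1 h.2).1; linarith).mul ((((hA 0 i j).sub ((hX _).mul (hA0 i j))).sub ((hX _).mul (hA 1 i j))).sub
    ((hX _).mul (hA 2 i j)))

end

section

/-! ### The estimate of the second derivative of the plasma operator -/

variable {σ : ℝ → ℝ} {T γ : ℝ}

/-- The entries of the jet of `(V, Ψ)`. -/
def jet (T : ℝ) (V : (Fin 4 → ℝ) → Fin 8 → ℝ) (Ψ : Fn 4) : JetIndex → Fn 4
  | .inl j => fun z => V z j
  | .inr (.inl (i, j)) => weakPartial (Q⁺ T) i fun w => V w j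
  | .inr (.inr i) => weakPartial (Q⁺ T) i Ψ

variable {V : (Fin 4 → ℝ) → Fin 8 → ℝ} {Ψ : Fn 4}

theorem aePeriodic_weakPartial {u : Fn 4} (h : AEPeriodic (Q⁺ T) u) (i) :
    AEPeriodic (Q⁺ T) (weakPartial (Q⁺ T) i u) := by
  by_cases he : ∃ g, IsWeakPartial (Q⁺ T) i u g
  · exact (weakPartial_spec he.choose_spec).aePeriodic (isOpen_plasma T)
      (isBox_plasma T).invariant h
  · rw [weakPartial, dif_neg he]
    exact fun _ _ => of_forall fun _ => rfl

theorem aePeriodic_jet (hV : IsPeriodic (Q⁺ T) V) (hΨ : IsPeriodic (Q⁺ T) Ψ) :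
    ∀ k, AEPeriodic (Q⁺ T) (jet T V Ψ k)
  | .inl j => (hV.apply j).ae
  | .inr (.inl (i, j)) => aePeriodic_weakPartial (hV.apply j).ae i
  | .inr (.inr i) => aePeriodic_weakPartial hΨ.ae i

theorem hs1_jet_le (hσ : IsConormalWeight σ) (m : ℕ) : ∃ C : NNReal, ∀ T γ : ℝ, 1 ≤ γ →
    ∀ V Ψ k,
      hs1 σ (Q⁺ T) γ m (jet T V Ψ k) ≤ C * plasmaHNorm σ T γ (m + 2) V Ψ := by
  obtain ⟨C, hC⟩ := hs1_weakPartial_le hσ m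
  refine ⟨(1 + C) * (ords 4 true (m + 2)).card, fun T γ hγ V Ψ k => ?_⟩
  have key (u : Fn 4) : hStarNorm σ (Q⁺ T) γ (m + 2) u ≤
      plasmaHNorm σ T γ (m + 2) V Ψ → (1 + C) * hs1 σ (Q⁺ T) γ (m + 2) u ≤
        ((1 + C) * (ords 4 true (m + 2)).card : NNReal) * plasmaHNorm σ T γ (m + 2) V Ψ := by
    intro hu
    push_cast
    rw [mul_assoc]
    exact mul_le_mul_right ((hs1_le_hStarNorm _ _ _ _ _).trans (mul_le_mul_right hu _)) _
  have hp : ∀ i u, hs1 σ (Q⁺ T) γ m (weakPartial (Q⁺ T) i u) ≤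
      (1 + C) * hs1 σ (Q⁺ T) γ (m + 2) u := fun i u =>
    (hC T γ hγ i u).trans (mul_le_mul_left le_add_self _)
  have hv : ∀ j, hStarNorm σ (Q⁺ T) γ (m + 2) (fun z => V z j) ≤
      plasmaHNorm σ T γ (m + 2) V Ψ := fun j => (le_vecNorm _ V j).trans le_self_add
  match k with
  | .inl j => exact ((hs1_mono hγ (by omega)).trans
      (le_mul_of_one_le_left zero_le le_self_add)).trans (key _ (hv j))
  | .inr (.inl (i, j)) => exact (hp i _).trans (key _ (hv j))
  | .inr (.inr i) => exact (hp i _).trans (key _ le_add_self)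

theorem wOne_jet_le : ∀ k, wStarOneNorm σ (Q⁺ T) (jet T V Ψ k) ≤
    plasmaWNorm σ T V Ψ
  | .inl j => le_self_add.trans ((le_vecNorm (wStarTwoNorm σ (Q⁺ T)) V j).trans le_self_add)
  | .inr (.inl (i, j)) => (wOne_weakPartial_le (isOpen_plasma T) i).trans
      ((le_vecNorm (wStarTwoNorm σ (Q⁺ T)) V j).trans le_self_add)
  | .inr (.inr i) => (wOne_weakPartial_le (isOpen_plasma T) i).trans le_add_self

theorem enorm_jet_le (hσ : IsConormalWeight σ) (hV : IsPeriodic (Q⁺ T) V)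
    (hΨ : IsPeriodic (Q⁺ T) Ψ) (h : plasmaWNorm σ T V Ψ ≠ ⊤) (k : JetIndex) :
    ∀ᵐ z ∂vol (Q⁺ T), ‖jet T V Ψ k z‖ₑ ≤ plasmaWNorm σ T V Ψ := by
  have hp := aePeriodic_jet hV hΨ k
  obtain ⟨g, hg, -⟩ := exists_conormal_bound hσ hp (wOne_jet_le k) h 0
  exact (ae_le_lpNorm_top (isOpen_plasma T) (isBox_plasma T).invariant hp hg.1).mono fun z hz =>
    hz.trans (lpNorm_le_wStarOneNorm.trans (wOne_jet_le k))

theorem plasmaWNorm_eq_zero (hσ : IsConormalWeight σ) (hγ : 1 ≤ γ)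
    (hV : IsPeriodic (Q⁺ T) V) (hΨ : IsPeriodic (Q⁺ T) Ψ)
    (h : plasmaHNorm σ T γ s V Ψ = 0) : plasmaWNorm σ T V Ψ = 0 := by
  have key : ∀ u : Fn 4, IsPeriodic (Q⁺ T) u → hStarNorm σ (Q⁺ T) γ s u = 0 →
      wStarTwoNorm σ (Q⁺ T) u = 0 := fun u hu h0 => by
    rw [wStarTwoNorm_congr (ae_eq_zero_of_hs1 hσ hγ hu.ae (n := s) (le_antisymm
      ((hs1_le_hStarNorm _ _ _ _ _).trans (by rw [h0, mul_zero])) zero_le)), wStarTwoNorm_zero]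
  unfold plasmaHNorm vecNorm at h
  rw [add_eq_zero, Finset.sum_eq_zero_iff] at h
  unfold plasmaWNorm vecNorm
  rw [key _ hΨ h.2, Finset.sum_eq_zero fun j hj => key _ (hV.apply j) (h.1 j hj), add_zero]

theorem plasma_estimate {O : Set (ℝ × ℝ)} (hρ : IsEquationOfState ρ O)
    (hσ : IsConormalWeight σ) : ∃ K : ℝ, 0 < K ∧ ∀ m : ℕ, ∃ C : NNReal, ∀ T γ : ℝ, 1 ≤ γ →
    ∀ U Ψ V₁ Ψ₁ V₂ Ψ₂,
    IsPeriodic (Q⁺ T) U → IsPeriodic (Q⁺ T) Ψ →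
    IsPeriodic (Q⁺ T) V₁ → IsPeriodic (Q⁺ T) Ψ₁ →
    IsPeriodic (Q⁺ T) V₂ → IsPeriodic (Q⁺ T) Ψ₂ →
    plasmaWNorm σ T U Ψ ≤ ofReal K →
    vecNorm (hStarNorm σ (Q⁺ T) γ m)
        (plasmaSecond ρ (Q⁺ T) U Ψ V₁ Ψ₁ V₂ Ψ₂) ≤
      C * (plasmaHNorm σ T γ (m + 2) U Ψ * plasmaWNorm σ T V₁ Ψ₁ * plasmaWNorm σ T V₂ Ψ₂ +
        plasmaHNorm σ T γ (m + 2) V₁ Ψ₁ * plasmaWNorm σ T V₂ Ψ₂ +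
        plasmaHNorm σ T γ (m + 2) V₂ Ψ₂ * plasmaWNorm σ T V₁ Ψ₁) := by
  have h00 : (0 : JetIndex → ℝ) ∈ jetDomain O := by
    refine ⟨?_, by simp⟩
    simpa [pressure] using hρ.2.1
  obtain ⟨r, hr, F, hF, hmix⟩ := exists_second_coeff (isOpen_jetDomain hρ.1) h00
    (contDiffOn_jetSymbol hρ)
  let Φ : Fin 8 → (JetIndex ⊕ JetIndex ⊕ JetIndex → ℝ) → ℝ := fun c y =>
    ∑ k, ∑ l, y (.inr (.inl k)) * y (.inr (.inr l)) * F k l (fun p => y (.inl p)) c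
  have hΦ : ∀ c, Smooth (Φ c) := fun c => by
    refine ContDiff.sum fun k _ => ContDiff.sum fun l _ => ContDiff.mul (by fun_prop) ?_
    exact (contDiff_pi.1 (hF k l) c).comp (by fun_prop)
  refine ⟨r / 2, by positivity, fun m => ?_⟩
  let R : NNReal := max 1 (r / 2).toNNReal
  choose C hC using fun c => moser_hs1 hσ m (hΦ c) ((fun c => by simp [Φ]) c) R
  obtain ⟨C', hC'⟩ := hs1_jet_le hσ m
  let N : NNReal := card JetIndex
  refine ⟨1 + (∑ c, C c) * (N * C'), fun T γ hγ U Ψ V₁ Ψ₁ V₂ Ψ₂ pU pΨ pV₁ pΨ₁ pV₂ pΨ₂ hK => ?_⟩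
  have hD := isOpen_plasma T
  set H := plasmaHNorm σ T γ (m + 2) U Ψ
  set H₁ := plasmaHNorm σ T γ (m + 2) V₁ Ψ₁
  set H₂ := plasmaHNorm σ T γ (m + 2) V₂ Ψ₂
  set w₁ := plasmaWNorm σ T V₁ Ψ₁
  set w₂ := plasmaWNorm σ T V₂ Ψ₂
  have hbase : ∀ᵐ z ∂vol (Q⁺ T), ‖fun k => jet T U Ψ k z‖ < r := by
    filter_upwards [ae_all_iff.2 fun k =>
      enorm_jet_le hσ pU pΨ (hK.trans_lt ENNReal.ofReal_lt_top).ne k] with z hz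
    refine (pi_norm_lt_iff hr).2 fun k => ?_
    have := (hz k).trans hK
    rw [← ofReal_norm, ENNReal.ofReal_le_ofReal_iff (by positivity)] at this
    linarith
  have hsec : ∀ c, (fun z => plasmaSecond ρ (Q⁺ T) U Ψ V₁ Ψ₁ V₂ Ψ₂ z c)
      =ᵐ[vol (Q⁺ T)] fun z => ∑ k, ∑ l,
        jet T V₁ Ψ₁ k z * jet T V₂ Ψ₂ l z * F k l (fun p => jet T U Ψ p z) c := fun c => by
    exact hbase.mono fun z hz =>
      (congrFun (hmix _ hz (fun k => jet T V₁ Ψ₁ k z) fun k => jet T V₂ Ψ₂ k z) c).trans (by simp)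
  have hzero : (∀ᵐ z ∂vol (Q⁺ T),
      ∀ k l, jet T V₁ Ψ₁ k z * jet T V₂ Ψ₂ l z = 0) →
      vecNorm (hStarNorm σ (Q⁺ T) γ m)
        (plasmaSecond ρ (Q⁺ T) U Ψ V₁ Ψ₁ V₂ Ψ₂) = 0 := fun h => by
    refine Finset.sum_eq_zero fun c _ => le_antisymm ((hStarNorm_le_hs1 _ _ _ _ _).trans ?_) zero_le
    rw [hs1_congr ((hsec c).trans (h.mono fun z hz => ?_)), hs1_zero]
    simp [hz]
  have hz0 {V Ψ} (pV : IsPeriodic (Q⁺ T) V) (pΨ : IsPeriodic (Q⁺ T) Ψ)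
      (h : plasmaWNorm σ T V Ψ = 0) : ∀ᵐ z ∂vol (Q⁺ T), ∀ k, jet T V Ψ k z = 0 :=
    ae_all_iff.2 fun k => (enorm_jet_le hσ pV pΨ (by simp [h]) k).mono fun z hz => by
      simpa [h] using hz
  by_cases h1 : w₁ = 0
  · rw [hzero ((hz0 pV₁ pΨ₁ h1).mono fun z hz k l => by rw [hz, zero_mul])]
    exact zero_le
  by_cases h2 : w₂ = 0
  · rw [hzero ((hz0 pV₂ pΨ₂ h2).mono fun z hz k l => by rw [hz l, mul_zero])]
    exact zero_le
  have hC0 : ((1 + (∑ c, C c) * (N * C') : NNReal) : ℝ≥0∞) ≠ 0 := by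
    exact_mod_cast (add_pos_of_pos_of_nonneg one_pos zero_le).ne'
  by_cases t1 : w₁ = ⊤
  · rw [t1, mul_top (fun h => h2 (plasmaWNorm_eq_zero hσ hγ pV₂ pΨ₂ h)), add_top, mul_top hC0]
    exact le_top
  by_cases t2 : w₂ = ⊤
  · rw [t2, mul_top (fun h => h1 (plasmaWNorm_eq_zero hσ hγ pV₁ pΨ₁ h)), add_top, top_add, mul_top hC0]
    exact le_top
  -- the increments, normalised so that their Lipschitz norms are at most one
  let Y : JetIndex ⊕ JetIndex ⊕ JetIndex → Fn 4
    | .inl k => jet T U Ψ k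
    | .inr (.inl k) => fun z => w₁.toReal⁻¹ * jet T V₁ Ψ₁ k z
    | .inr (.inr k) => fun z => w₂.toReal⁻¹ * jet T V₂ Ψ₂ k z
  have hRK : ofReal (r / 2) ≤ R := coe_le_coe.2 (le_max_right _ _)
  have hYp : ∀ k, AEPeriodic (Q⁺ T) (Y k)
    | .inl k => aePeriodic_jet pU pΨ k
    | .inr (.inl k) => (aePeriodic_jet pV₁ pΨ₁ k).const_mul _
    | .inr (.inr k) => (aePeriodic_jet pV₂ pΨ₂ k).const_mul _
  have hscale : ∀ (w : ℝ≥0∞) (x : ℝ), w ≠ 0 → w ≠ ⊤ → ‖x‖ₑ ≤ w → ‖w.toReal⁻¹ * x‖ₑ ≤ R :=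
    fun w x h h' hx => (enorm_inv_mul_le h h' hx).trans (by exact_mod_cast le_max_left _ _)
  have hYb : ∀ k, ∀ᵐ z ∂vol (Q⁺ T), ‖Y k z‖ₑ ≤ R
    | .inl k => (enorm_jet_le hσ pU pΨ (hK.trans_lt ENNReal.ofReal_lt_top).ne k).mono
        fun z hz => (hz.trans hK).trans hRK
    | .inr (.inl k) => (enorm_jet_le hσ pV₁ pΨ₁ t1 k).mono fun z hz => hscale _ _ h1 t1 hz
    | .inr (.inr k) => (enorm_jet_le hσ pV₂ pΨ₂ t2 k).mono fun z hz => hscale _ _ h2 t2 hz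
  have hd {V Ψ} (pV : IsPeriodic (Q⁺ T) V) (pΨ : IsPeriodic (Q⁺ T) Ψ)
      (h : plasmaWNorm σ T V Ψ ≠ 0) (t : plasmaWNorm σ T V Ψ ≠ ⊤) i k :
      ∃ h, IsWeakPartial (Q⁺ T) i (fun z => (plasmaWNorm σ T V Ψ).toReal⁻¹ * jet T V Ψ k z) h ∧
        ∀ᵐ z ∂vol (Q⁺ T), ‖zCoef σ i z * h z‖ₑ ≤ R := by
    obtain ⟨g, hg, hb⟩ := exists_conormal_bound hσ (aePeriodic_jet pV pΨ k) (wOne_jet_le k) t i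
    exact ⟨_, hg.const_mul _, hb.mono fun z hz => by rw [mul_left_comm]; exact hscale _ _ h t hz⟩
  have hYd : ∀ i k, ∃ h, IsWeakPartial (Q⁺ T) i (Y k) h ∧
      ∀ᵐ z ∂vol (Q⁺ T), ‖zCoef σ i z * h z‖ₑ ≤ R
    | i, .inl k => exists_conormal_bound hσ (aePeriodic_jet pU pΨ k)
        ((wOne_jet_le k).trans (hK.trans hRK)) ENNReal.coe_ne_top i
    | i, .inr (.inl k) => hd pV₁ pΨ₁ h1 t1 i k
    | i, .inr (.inr k) => hd pV₂ pΨ₂ h2 t2 i k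
  have hYs : ∑ k, hs1 σ (Q⁺ T) γ m (Y k) ≤
      N * C' * (H + w₁⁻¹ * H₁ + w₂⁻¹ * H₂) := by
    rw [Fintype.sum_sum_type, Fintype.sum_sum_type
      fun a : JetIndex ⊕ JetIndex => hs1 σ (Q⁺ T) γ m (Y (.inr a))]
    have hs : ∀ (f : JetIndex → ℝ≥0∞) (B : ℝ≥0∞), (∀ k, f k ≤ B) → ∑ k, f k ≤ N * B :=
      fun f B h => (sum_le_card_nsmul _ _ _ fun k _ => h k).trans (by
        rw [nsmul_eq_mul, Finset.card_univ]; simp [N])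
    have hq : ∀ (w : ℝ≥0∞) V Ψ k, w ≠ 0 → w ≠ ⊤ →
        hs1 σ (Q⁺ T) γ m (fun z => w.toReal⁻¹ * jet T V Ψ k z) ≤
          w⁻¹ * (C' * plasmaHNorm σ T γ (m + 2) V Ψ) := fun w V Ψ k h h' => by
      rw [← enorm_toReal_inv h h']
      exact (hs1_const_mul_le hD _).trans (mul_le_mul_right (hC' T γ hγ _ _ _) _)
    calc _ ≤ (N : ℝ≥0∞) * (C' * H) + (N * (w₁⁻¹ * (C' * H₁)) + N * (w₂⁻¹ * (C' * H₂))) :=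
          add_le_add (hs _ _ fun k => hC' T γ hγ U Ψ k) (add_le_add
            (hs _ _ fun k => hq w₁ V₁ Ψ₁ k h1 t1) (hs _ _ fun k => hq w₂ V₂ Ψ₂ k h2 t2))
      _ = _ := by ring
  have hcomp : ∀ c, hStarNorm σ (Q⁺ T) γ m
      (fun z => plasmaSecond ρ (Q⁺ T) U Ψ V₁ Ψ₁ V₂ Ψ₂ z c) ≤
      C c * (N * C') * (H * w₁ * w₂ + H₁ * w₂ + H₂ * w₁) := fun c => by
    have he : (fun z => plasmaSecond ρ (Q⁺ T) U Ψ V₁ Ψ₁ V₂ Ψ₂ z c)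
        =ᵐ[vol (Q⁺ T)]
          fun z => (w₁.toReal * w₂.toReal) * Φ c fun k => Y k z := by
      filter_upwards [hsec c] with z hz
      rw [hz, mul_sum]
      refine sum_congr rfl fun k _ => ?_
      rw [mul_sum]
      refine sum_congr rfl fun l _ => ?_
      have e1 : w₁.toReal ≠ 0 := ENNReal.toReal_ne_zero.2 ⟨h1, t1⟩
      have e2 : w₂.toReal ≠ 0 := ENNReal.toReal_ne_zero.2 ⟨h2, t2⟩
      simp only [Y]
      field_simp
    refine (hStarNorm_le_hs1 _ _ _ _ _).trans ?_
    rw [hs1_congr he]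
    refine (hs1_const_mul_le hD _).trans ?_
    rw [enorm_mul, enorm_toReal t1, enorm_toReal t2]
    calc w₁ * w₂ * _ ≤ w₁ * w₂ * (C c * (N * C' * (H + w₁⁻¹ * H₁ + w₂⁻¹ * H₂))) :=
          mul_le_mul_right ((hC c T γ hγ Y hYp hYb hYd).trans (mul_le_mul_right hYs _)) _
      _ = C c * (N * C') * (H * w₁ * w₂ + (w₁ * w₁⁻¹) * H₁ * w₂ + (w₂ * w₂⁻¹) * H₂ * w₁) := by ring
      _ = _ := by rw [ENNReal.mul_inv_cancel h1 t1, ENNReal.mul_inv_cancel h2 t2, one_mul, one_mul]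
  refine (sum_le_sum fun c _ => hcomp c).trans ?_
  rw [← sum_mul, ← sum_mul]
  refine mul_le_mul_left ?_ _
  push_cast
  exact le_add_self

end

section

/-! ### The trace inequality on a rectangle -/

theorem ivlIntegrable {f : ℝ → ℝ} (h : Continuous f := by fun_prop) :
    IntervalIntegrable f volume a b := h.intervalIntegrable a b

/-- An energy estimate for a function with anisotropic derivatives. If `v = ∂ₜf` and `p = ∂ₐf`, then
`∂ₜf` at `a = 0` is controlled by `∂ₜf`, `∂ₜ²f` and `∂ₐf`, without any mixed derivative. In the
derivative of `∫ |∂ₜf|²` with respect to `a` the mixed derivative is integrated by parts in `t`;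
the boundary term at `t = 0` is cancelled by the corresponding term of the extension
`-t ↦ 4 f(t / 2) - 3 f(t)`, and the one at `t = -1` is removed by the weight `(t + 1)²`. -/
theorem trace_rectangle {v v' p r : ℝ × ℝ → ℝ}
    (h1 : ∀ a t, HasDerivAt (fun t => v (a, t)) (v' (a, t)) t)
    (h2 : ∀ a t, HasDerivAt (fun t => p (a, t)) (r (a, t)) t)
    (h3 : ∀ a t, HasDerivAt (fun a => v (a, t)) (r (a, t)) a)
    (hv : Continuous v := by fun_prop) (hv' : Continuous v' := by fun_prop)
    (hp : Continuous p := by fun_prop) (hr : Continuous r := by fun_prop) :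
    ∫ t in (-1 / 2 : ℝ)..0, v (0, t) ^ 2 ≤ 1200 * ∫ a in (0 : ℝ)..(1 / 2),
      ∫ t in (-1 : ℝ)..0, (v (a, t) ^ 2 + v' (a, t) ^ 2 + p (a, t) ^ 2) := by
  set e := fun x => v x ^ 2 + v' x ^ 2 + p x ^ 2 with he
  have hec : Continuous e := by fun_prop
  have he0 : ∀ x, 0 ≤ e x := fun x => by positivity
  -- the extension of `v` and `p` and their derivatives
  let B := fun x => 2 * v (x.1, x.2 / 2) - 3 * v x
  let B' := fun x => v' (x.1, x.2 / 2) - 3 * v' x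
  let P := fun x => 4 * p (x.1, x.2 / 2) - 3 * p x
  let Q := fun x => 2 * r (x.1, x.2 / 2) - 3 * r x
  have hhalf : ∀ t, HasDerivAt (fun t : ℝ => t / 2) (1 / 2) t := fun t =>
    (hasDerivAt_id t).div_const 2
  have hB : ∀ a t, HasDerivAt (fun t => B (a, t)) (B' (a, t)) t := fun a t => by
    refine ((((h1 a (t / 2)).comp t (hhalf t)).const_mul 2).sub ((h1 a t).const_mul 3)).congr_deriv ?_
    simp only [B']; ring
  have hP : ∀ a t, HasDerivAt (fun t => P (a, t)) (Q (a, t)) t := fun a t => by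
    refine ((((h2 a (t / 2)).comp t (hhalf t)).const_mul 4).sub ((h2 a t).const_mul 3)).congr_deriv ?_
    simp only [Q]; ring
  have hBa : ∀ a t, HasDerivAt (fun a => B (a, t)) (Q (a, t)) a := fun a t =>
    ((h3 a (t / 2)).const_mul 2).sub ((h3 a t).const_mul 3)
  let X' := fun a t => (t + 1) ^ 2 * (-2 * (v (a, t) ^ 2 + B (a, t) ^ 2) +
    (1 - 2 * a) * (2 * (v (a, t) * r (a, t) + B (a, t) * Q (a, t))))
  let Y' := fun a t => 2 * (t + 1) * (v (a, t) * p (a, t) + B (a, t) * P (a, t)) +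
    (t + 1) ^ 2 * (v' (a, t) * p (a, t) + v (a, t) * r (a, t) +
      (B' (a, t) * P (a, t) + B (a, t) * Q (a, t)))
  have hcB : Continuous B := by fun_prop
  have hcB' : Continuous B' := by fun_prop
  have hcP : Continuous P := by fun_prop
  have hcQ : Continuous Q := by fun_prop
  have hX : ∀ t, ∫ a in 0..(1 / 2), X' a t =
      -((t + 1) ^ 2 * (v (0, t) ^ 2 + B (0, t) ^ 2)) := fun t => by
    rw [integral_eq_sub_of_hasDerivAt (f := fun a =>
      (t + 1) ^ 2 * ((1 - 2 * a) * (v (a, t) ^ 2 + B (a, t) ^ 2))) (fun a _ => ?_)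
      ivlIntegrable]
    · norm_num
    · refine (((((hasDerivAt_id a).const_mul 2).const_sub 1).mul
        (((h3 a t).pow 2).add ((hBa a t).pow 2))).const_mul ((t + 1) ^ 2)).congr_deriv ?_
      simp only [X', id, Pi.add_apply, Pi.pow_apply]; push_cast; ring
  have hY : ∀ a, ∫ t in (-1)..0, Y' a t = 0 := fun a => by
    rw [integral_eq_sub_of_hasDerivAt (f := fun t =>
      (t + 1) ^ 2 * (v (a, t) * p (a, t) + B (a, t) * P (a, t))) (fun t _ => ?_)
      ivlIntegrable]
    · simp only [B, P, zero_div]; ring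
    · refine ((((hasDerivAt_id t).add_const 1).pow 2).mul
        (((h1 a t).mul (h2 a t)).add ((hB a t).mul (hP a t)))).congr_deriv ?_
      simp only [Y', id, Pi.add_apply, Pi.mul_apply, Pi.pow_apply]; push_cast; ring
  have hpt : ∀ a ∈ Icc 0 (1 / 2), ∀ t ∈ Icc (-1) 0,
      2 * (1 - 2 * a) * Y' a t - X' a t ≤ 100 * (e (a, t) + e (a, t / 2)) := fun a ha t ht => by
    have hk : ∀ k x y : ℝ, 0 ≤ k → k ≤ 1 → k * (x * y) ≤ (x ^ 2 + y ^ 2) / 2 := fun k x y h h' => by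
      nlinarith [mul_nonneg h (sq_nonneg (x - y)), mul_nonneg (sub_nonneg.2 h')
        (add_nonneg (sq_nonneg x) (sq_nonneg y))]
    have hk' : ∀ k x : ℝ, k ≤ 1 → k * x ^ 2 ≤ x ^ 2 := fun k x h =>
      mul_le_of_le_one_left (sq_nonneg x) h
    obtain ⟨c0, c1⟩ : 0 ≤ 1 - 2 * a ∧ 1 - 2 * a ≤ 1 := ⟨by linarith [ha.2], by linarith [ha.1]⟩
    obtain ⟨m0, m1⟩ : 0 ≤ t + 1 ∧ t + 1 ≤ 1 := ⟨by linarith [ht.1], by linarith [ht.2]⟩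
    have w1 : (t + 1) ^ 2 ≤ 1 := pow_le_one₀ m0 m1
    have d0 := mul_nonneg c0 m0
    have d1 := mul_le_one₀ c1 m0 m1
    have f0 := mul_nonneg c0 (sq_nonneg (t + 1))
    have f1 := mul_le_one₀ c1 (sq_nonneg (t + 1)) w1
    have hB2 : B (a, t) ^ 2 ≤ 8 * v (a, t / 2) ^ 2 + 18 * v (a, t) ^ 2 := by
      simp only [B]; nlinarith [sq_nonneg (2 * v (a, t / 2) + 3 * v (a, t))]
    have hB2' : B' (a, t) ^ 2 ≤ 2 * v' (a, t / 2) ^ 2 + 18 * v' (a, t) ^ 2 := by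
      simp only [B']; nlinarith [sq_nonneg (v' (a, t / 2) + 3 * v' (a, t))]
    have hP2 : P (a, t) ^ 2 ≤ 32 * p (a, t / 2) ^ 2 + 18 * p (a, t) ^ 2 := by
      simp only [P]; nlinarith [sq_nonneg (4 * p (a, t / 2) + 3 * p (a, t))]
    have e1 := hk _ (v (a, t)) (p (a, t)) d0 d1
    have e2 := hk _ (B (a, t)) (P (a, t)) d0 d1
    have e3 := hk _ (v' (a, t)) (p (a, t)) f0 f1
    have e4 := hk _ (B' (a, t)) (P (a, t)) f0 f1
    have e5 := hk' _ (v (a, t)) w1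
    have e6 := hk' _ (B (a, t)) w1
    simp only [X', Y', he]
    linarith [sq_nonneg (v (a, t)), sq_nonneg (v' (a, t)), sq_nonneg (p (a, t)),
      sq_nonneg (v (a, t / 2)), sq_nonneg (v' (a, t / 2)), sq_nonneg (p (a, t / 2))]
  have hsl : ∀ a, ∫ t in (-1)..0, (e (a, t) + e (a, t / 2)) ≤
      3 * ∫ t in (-1)..0, e (a, t) := fun a => by
    have hi : ∀ x y, IntervalIntegrable (fun t => e (a, t)) volume x y := fun _ _ => ivlIntegrable
    rw [intervalIntegral.integral_add (hi _ _)
      ivlIntegrable,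
      intervalIntegral.integral_comp_div (fun t => e (a, t)) two_ne_zero, zero_div,
      ← intervalIntegral.integral_add_adjacent_intervals (hi (-1) (-1 / 2)) (hi _ 0), smul_eq_mul]
    linarith [intervalIntegral.integral_nonneg (μ := volume) (f := fun t => e (a, t))
      (by norm_num : (-1 : ℝ) ≤ -1 / 2) fun t _ => he0 _]
  have hcX : Continuous fun q : ℝ × ℝ => X' q.1 q.2 := by fun_prop
  have hcY : Continuous fun q : ℝ × ℝ => 2 * (1 - 2 * q.1) * Y' q.1 q.2 := by fun_prop
  have hswap : ∫ a in 0..(1 / 2), ∫ t in (-1)..0, X' a t =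
      ∫ t in (-1)..0, -((t + 1) ^ 2 * (v (0, t) ^ 2 + B (0, t) ^ 2)) := by
    rw [intervalIntegral_intervalIntegral_swap]
    · simp only [hX]
    · exact (hcX.continuousOn.integrableOn_compact (isCompact_uIcc.prod isCompact_uIcc)).mono_set
        (Set.prod_mono Set.uIoc_subset_uIcc Set.uIoc_subset_uIcc)
  have hmain : ∫ t in (-1)..0, (t + 1) ^ 2 * (v (0, t) ^ 2 + B (0, t) ^ 2) ≤
      300 * ∫ a in 0..(1 / 2), ∫ t in (-1)..0, e (a, t) := by
    calc _ = ∫ a in 0..(1 / 2), -∫ t in (-1)..0, X' a t := by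
          rw [intervalIntegral.integral_neg, hswap, intervalIntegral.integral_neg, neg_neg]
      _ ≤ ∫ a in 0..(1 / 2), 300 * ∫ t in (-1)..0, e (a, t) := by
          refine integral_mono_on (by norm_num)
            ivlIntegrable
            ivlIntegrable fun a ha => ?_
          have hi : -∫ t in (-1)..0, X' a t =
              ∫ t in (-1)..0, (2 * (1 - 2 * a) * Y' a t - X' a t) := by
            rw [intervalIntegral.integral_sub, intervalIntegral.integral_const_mul, hY]
            · ring
            all_goals exact ivlIntegrable
          rw [hi]
          refine (integral_mono_on
            (by norm_num) ivlIntegrable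
            ivlIntegrable fun t ht => hpt a ha t ht).trans ?_
          rw [intervalIntegral.integral_const_mul]
          linarith [hsl a]
      _ = _ := intervalIntegral.integral_const_mul _ _
  have hi : ∀ x y, IntervalIntegrable (fun t => (t + 1) ^ 2 * (v (0, t) ^ 2 + B (0, t) ^ 2))
      volume x y := fun _ _ => ivlIntegrable
  have hlow : ∫ t in (-1 / 2)..0, v (0, t) ^ 2 ≤
      4 * ∫ t in (-1 / 2)..0, (t + 1) ^ 2 * (v (0, t) ^ 2 + B (0, t) ^ 2) := by
    rw [← intervalIntegral.integral_const_mul]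
    refine integral_mono_on (by norm_num)
      ivlIntegrable
      ivlIntegrable fun t ht => ?_
    have : 1 ≤ 4 * (t + 1) ^ 2 := by nlinarith [ht.1]
    nlinarith [sq_nonneg (v (0, t)), mul_nonneg (sq_nonneg (t + 1)) (sq_nonneg (B (0, t)))]
  have hsplit := intervalIntegral.integral_add_adjacent_intervals (hi (-1) (-1 / 2)) (hi _ 0)
  have hn := intervalIntegral.integral_nonneg (μ := volume)
    (f := fun t => (t + 1) ^ 2 * (v (0, t) ^ 2 + B (0, t) ^ 2))
    (by norm_num : (-1 : ℝ) ≤ -1 / 2) fun t _ => by positivity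
  linarith

end

section

/-! ### Square integrals over slices -/

theorem enorm_sq_eq (x) : ‖x‖ₑ ^ 2 = ofReal (x ^ 2) := by
  rw [Real.enorm_eq_ofReal_abs, ← ofReal_pow (abs_nonneg x), sq_abs]

theorem lintegral_Ico_ofReal {g : ℝ → ℝ} (hg : Continuous g) (h0 : ∀ t, 0 ≤ g t)
    (h : l ≤ r) : ∫⁻ t in Ico l r, ofReal (g t) = ofReal (∫ t in l..r, g t) := by
  rw [integral_of_le h, ← integral_Ico_eq_integral_Ioc,
    ofReal_integral_eq_lintegral_ofReal
      ((hg.integrableOn_Icc).mono_set Set.Ico_subset_Icc_self)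
      (ae_of_all _ h0)]

/-- The trace inequality on unit intervals: `trace_rectangle` and its reflection cover the two
halves of the interval. -/
theorem trace_line
    (h1 : ∀ a t, HasDerivAt (fun t => v (a, t)) (v' (a, t)) t)
    (h2 : ∀ a t, HasDerivAt (fun t => p (a, t)) (r (a, t)) t)
    (h3 : ∀ a t, HasDerivAt (fun a => v (a, t)) (r (a, t)) a) (c : ℝ)
    (hv : Continuous v := by fun_prop) (hv' : Continuous v' := by fun_prop)
    (hp : Continuous p := by fun_prop) (hr : Continuous r := by fun_prop) :
    ∫⁻ t in Ico c (c + 1), ofReal (v (0, t) ^ 2) ≤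
      ∫⁻ t in Ico c (c + 1), 2400 * ∫⁻ a in Ico (0 : ℝ) (1 / 2),
        ofReal (v (a, t) ^ 2 + v' (a, t) ^ 2 + p (a, t) ^ 2) := by
  set e := fun x => v x ^ 2 + v' x ^ 2 + p x ^ 2
  have hec : Continuous e := by fun_prop
  have he0 : ∀ x, 0 ≤ e x := fun x => by positivity
  have up := trace_rectangle (v := fun x => v (x.1, c + 1 + x.2))
    (v' := fun x => v' (x.1, c + 1 + x.2)) (p := fun x => p (x.1, c + 1 + x.2))
    (r := fun x => r (x.1, c + 1 + x.2))
    (fun a t => (h1 a _).comp_const_add _ _) (fun a t => (h2 a _).comp_const_add _ _)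
    fun a t => h3 a (c + 1 + t)
  have lo := trace_rectangle (v := fun x => -v (x.1, c - x.2))
    (v' := fun x => v' (x.1, c - x.2)) (p := fun x => p (x.1, c - x.2))
    (r := fun x => -r (x.1, c - x.2))
    (fun a t => ((h1 a _).comp_const_sub c t).fun_neg.congr_deriv (neg_neg _))
    (fun a t => (h2 a _).comp_const_sub c t) fun a t => (h3 a (c - t)).fun_neg
  simp only [neg_sq] at lo
  have eu : ∀ a, ∫ t in (-1)..0, e (a, c + 1 + t) = ∫ t in c..(c + 1), e (a, t) := fun a => by
    rw [intervalIntegral.integral_comp_add_left fun t => e (a, t)]; congr 1 <;> ring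
  have el : ∀ a, ∫ t in (-1)..0, e (a, c - t) = ∫ t in c..(c + 1), e (a, t) := fun a => by
    rw [intervalIntegral.integral_comp_sub_left fun t => e (a, t)]; congr 1 <;> ring
  change _ ≤ 1200 * ∫ a in 0..(1 / 2), ∫ t in (-1)..0, e (a, c + 1 + t) at up
  change _ ≤ 1200 * ∫ a in 0..(1 / 2), ∫ t in (-1)..0, e (a, c - t) at lo
  simp only [eu] at up
  simp only [el] at lo
  rw [intervalIntegral.integral_comp_add_left fun t => v (0, t) ^ 2] at up
  rw [intervalIntegral.integral_comp_sub_left fun t => v (0, t) ^ 2] at lo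
  have hi : ∀ x y, IntervalIntegrable (fun t => v (0, t) ^ 2) volume x y := fun _ _ => ivlIntegrable
  have hs := intervalIntegral.integral_add_adjacent_intervals (hi c (c + 1 / 2)) (hi _ (c + 1))
  rw [show c - 0 = c by ring, show c - -1 / 2 = c + 1 / 2 by ring] at lo
  rw [show c + 1 + -1 / 2 = c + 1 / 2 by ring, add_zero] at up
  rw [lintegral_const_mul' _ _ (by norm_num), lintegral_lintegral_swap (by fun_prop)]
  change _ ≤ 2400 * ∫⁻ a in Ico 0 (1 / 2), ∫⁻ t in Ico c (c + 1),
    ofReal (e (a, t))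
  rw [lintegral_Ico_ofReal (by fun_prop) (fun _ => sq_nonneg _) (by linarith)]
  have hin : ∀ a, ∫⁻ t in Ico c (c + 1), ofReal (e (a, t)) =
      ofReal (∫ t in c..(c + 1), e (a, t)) := fun a =>
    lintegral_Ico_ofReal (by fun_prop) (fun _ => he0 _) (by linarith)
  simp only [hin]
  rw [lintegral_Ico_ofReal (by fun_prop)
    (fun a => intervalIntegral.integral_nonneg (by linarith) fun _ _ => he0 _) (by norm_num),
    show 2400 = ofReal 2400 by norm_num, ← ofReal_mul (by norm_num)]
  exact ofReal_le_ofReal (by linarith)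

theorem lintegral_side_le (T) {f h : ℝ → ℝ≥0∞}
    (H : ∀ c, ∫⁻ t in Ico c (c + 1), f t ≤ ∫⁻ t in Ico c (c + 1), h t) (i : Fin 3) :
    ∫⁻ t in interfaceSides T i, f t ≤ ∫⁻ t in interfaceSides T i, h t := by
  have h0 : ∫⁻ t in Iio T, f t ≤ ∫⁻ t in Iio T, h t := by
    have hU : Iio T = ⋃ n : {n : ℤ // n < 0}, Ico (T + n) (T + n + 1) := by
      ext x
      have h1 : x ∈ ⋃ n : ℤ, Ico (T + n) (T + n + 1) := by
        rw [iUnion_Ico_add_intCast]; trivial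
      simp only [Set.mem_iUnion, Set.mem_Ico, Set.mem_Iio, Subtype.exists, exists_prop] at h1 ⊢
      obtain ⟨n, hn⟩ := h1
      refine ⟨fun hx => ⟨n, ?_, hn⟩, fun ⟨k, hk, hx⟩ => ?_⟩
      · exact_mod_cast (by linarith [hn.1] : (n : ℝ) < 0)
      · have : (k : ℝ) + 1 ≤ 0 := by exact_mod_cast hk
        linarith [hx.2]
    have hd : Pairwise (Function.onFun Disjoint fun n : {n : ℤ // n < 0} =>
        Ico (T + n) (T + n + 1)) := fun a b hab =>
      Set.pairwise_disjoint_Ico_add_intCast T (Subtype.coe_injective.ne hab)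
    rw [hU, lintegral_iUnion (fun _ => measurableSet_Ico) hd,
      lintegral_iUnion (fun _ => measurableSet_Ico) hd]
    exact ENNReal.tsum_le_tsum fun n => H _
  have h1 : ∫⁻ t in Ico 0 1, f t ≤ ∫⁻ t in Ico 0 1, h t := by simpa using H 0
  fin_cases i
  exacts [h0, h1, h1]

/-- The point of `ℝ⁴` over the point `y` of the boundary, at height `x₁ = a`. -/
def emb (a : X) (y : Fin 3 → X) : Fin 4 → X := ![y 0, a, y 1, y 2]

/-- The index in `(t, x₁, x₂, x₃)` of a coordinate of `(t, x₂, x₃)`. -/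
def tang : Fin 3 → Fin 4 := ![0, 2, 3]

theorem emb_eq (a) (y : Fin 3 → X) :
    emb a y = Fin.insertNth 1 a y := by
  funext j; fin_cases j <;> rfl

theorem emb_update (a) (y) (i) (t : ℝ) :
    emb a (update y i t) = update (emb a y) (tang i) t := by
  funext j; fin_cases i <;> fin_cases j <;> rfl

theorem emb_update_one (a b) (y : Fin 3 → ℝ) :
    emb a y = update (emb b y) 1 a := by
  funext j; fin_cases j <;> rfl

theorem smooth_emb : Smooth fun q : ℝ × (Fin 3 → ℝ) => emb q.1 q.2 := by
  refine contDiff_pi.2 fun j => ?_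
  have h : ∀ i, Smooth fun q : ℝ × (Fin 3 → ℝ) => q.2 i := fun i => by fun_prop
  fin_cases j
  exacts [h 0, contDiff_fst, h 1, h 2]

theorem tang_ne (i) : tang i ≠ 1 := by fin_cases i <;> decide

/-- The interval of `x₁` and the sign of `x₁` on the two sides of the interface. -/
inductive IsSide (T : ℝ) : ℝ → PeriodicDomain 4 → Prop
  | plasma : IsSide T 1 (Q⁺ T)
  | vacuum : IsSide T (-1) (vacuumDomain T)

variable {T s : ℝ} {D : PeriodicDomain 4}

theorem IsSide.sq (h : IsSide T s D) : s ^ 2 = 1 := by cases h <;> norm_num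

theorem lintegral_slices_le (h : IsSide T s D) (hb : b ∈ Icc (0 : ℝ) (1 / 2))
    {F : (Fin 4 → ℝ) → ℝ≥0∞} (hF : Measurable F) :
    ∫⁻ y in (Γ T).cell, ∫⁻ a in Ico (0 : ℝ) (1 / 2), F (emb (s * (b + a)) y)
      ≤ ∫⁻ z in D.cell, F z := by
  have hm :=
    smooth_emb.continuous.measurable
  have hcell J : MeasurableSet J → D.cell = {z | z 1 ∈ J ∧ (fun j => z (tang j)) ∈
      (Γ T).cell} → ∫⁻ z in D.cell, F z =
        ∫⁻ a in J, ∫⁻ y in (Γ T).cell, F (emb a y) := by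
    intro hJ hD
    have hDm : MeasurableSet D.cell := by
      rw [hD]; exact (measurable_pi_apply 1 hJ).inter (
          (measurableSet_cell (isBox_interface T).isOpen).preimage (by fun_prop))
    have := ((volume_preserving_piFinSuccAbove (fun _ => ℝ) 1).symm
      _).setLIntegral_comp_preimage hDm hF
    rw [← this, show (MeasurableEquiv.piFinSuccAbove (fun _ => ℝ) 1).symm ⁻¹' D.cell =
      J ×ˢ (Γ T).cell by
        ext ⟨a, y⟩
        rw [hD]
        have : ((MeasurableEquiv.piFinSuccAbove (fun _ => ℝ) 1).symm (a, y)) =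
          emb a y := (emb_eq a y).symm
        simp only [Set.mem_preimage, this, Set.mem_ofPred_eq, Set.mem_prod]
        exact and_congr Iff.rfl (by
          rw [show (fun j => emb a y (tang j)) = y by funext j; fin_cases j <;> rfl]),
      Measure.volume_eq_prod, ← Measure.prod_restrict, lintegral_prod _ (by
        exact (hF.comp (MeasurableEquiv.measurable _)).aemeasurable)]
    refine lintegral_congr fun a => lintegral_congr fun y => ?_
    rw [emb_eq]; rfl
  rw [lintegral_lintegral_swap (f := fun y a => F (emb (s * (b + a)) y))
    (hF.comp (hm.comp (by fun_prop : Measurable fun q : (Fin 3 → ℝ) × ℝ =>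
      (s * (b + q.2), q.1)))).aemeasurable]
  set G := fun a => ∫⁻ y in (Γ T).cell, F (emb a y)
  have key l r : (∀ a ∈ Ico 0 (1 / 2), 0 < a → s * (b + a) ∈ Ioo l r) →
      MeasurePreserving (fun a => s * (b + a)) →
      ∫⁻ a in Ico 0 (1 / 2), G (s * (b + a)) ≤ ∫⁻ a in Ioo l r, G a := by
    intro hsub hmp
    have hGm : Measurable G := (hF.comp hm).lintegral_prod_right'
    rw [← hmp.setLIntegral_comp_preimage measurableSet_Ioo hGm]
    refine lintegral_mono' (Measure.restrict_mono' ?_ le_rfl) le_rfl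
    filter_upwards [compl_mem_ae_iff.2 (measure_singleton 0)] with a ha h'
    exact hsub a h' (lt_of_le_of_ne h'.1 (Ne.symm ha))
  obtain ⟨b0, b1⟩ := hb
  cases h with
  | plasma =>
    refine (key 0 1 (fun a ha h0 => ?_) ?_).trans_eq (hcell _ measurableSet_Ioo ?_).symm
    · constructor <;> linarith [ha.2]
    · simpa using measurePreserving_add_left volume b
    · ext z
      simp [PeriodicDomain.cell, interfaceDomain, plasmaDomain, tang]
      tauto
  | vacuum =>
    refine (key (-1) 0 (fun a ha h0 => ?_) ?_).trans_eq (hcell _ measurableSet_Ioo ?_).symm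
    · constructor <;> linarith [ha.2]
    · simpa [Function.comp_def, add_comm] using (Measure.measurePreserving_neg
        volume).comp (measurePreserving_add_left volume b)
    · ext z
      simp [PeriodicDomain.cell, interfaceDomain, vacuumDomain, tang]
      tauto

variable {f : (Fin 4 → ℝ) → ℝ}

theorem hasDerivAt_emb (hf : Smooth f) (s b a) (y : Fin 3 → ℝ) :
    HasDerivAt (fun a => f (emb (s * (b + a)) y)) (s * pd 1 f (emb (s * (b + a)) y)) a := by
  have h := (hasDerivAt_line hf 1 (emb 0 y) (s * (b + a))).comp a
    (((hasDerivAt_id a).const_add b).const_mul s)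
  simp only [← emb_update_one, mul_one] at h
  rw [mul_comm]
  exact h

/-- The trace of a tangential derivative on a slice. -/
theorem lintegral_slice_pd_le (h : IsSide T s D) (hf : Smooth f) {b : ℝ}
    (hb : b ∈ Icc (0 : ℝ) (1 / 2)) (i) :
    ∫⁻ y in (Γ T).cell, ofReal (pd (tang i) f (emb (s * b) y) ^ 2) ≤
      2400 * ∫⁻ z in D.cell, ofReal (pd (tang i) f z ^ 2 +
        pd (tang i) (pd (tang i) f) z ^ 2 + pd 1 f z ^ 2) := by
  set g := pd (tang i) f with hg
  have hgs : Smooth g := smooth_pd hf _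
  have c1 := (smooth_pd hf 1).continuous
  have c2 := hgs.continuous
  have c3 := (smooth_pd hgs (tang i)).continuous
  have c4 := (smooth_pd hgs 1).continuous
  have hA := smooth_emb.continuous
  have hF : Measurable fun z => ofReal (g z ^ 2 + pd (tang i) g z ^ 2 + pd 1 f z ^ 2) := by
    fun_prop
  refine le_trans ?_ (mul_le_mul_right (lintegral_slices_le h hb hF) _)
  rw [← lintegral_const_mul' _ _ (by norm_num), (isMoserBox_interface T).cell_eq, volume_pi,
    Measure.restrict_pi_pi]
  have hcomp : ∀ {u : Fn 4}, Continuous u → Continuous fun q : (Fin 3 → ℝ) × ℝ =>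
    u (emb (s * (b + q.2)) q.1) := fun hu => hu.comp
      (hA.comp (by fun_prop : Continuous fun q : (Fin 3 → ℝ) × ℝ => (s * (b + q.2), q.1)))
  refine lintegral_le_of_lmarginal_le {i} ?_ ?_ fun x => ?_
  · exact ((c2.comp (hA.comp (continuous_const.prodMk continuous_id))).pow 2).measurable.ennreal_ofReal
  · refine Measurable.const_mul (Measurable.lintegral_prod_right' (f := fun q =>
      ofReal (g (emb (s * (b + q.2)) q.1) ^ 2 +
        pd (tang i) g (emb (s * (b + q.2)) q.1) ^ 2 +
        pd 1 f (emb (s * (b + q.2)) q.1) ^ 2)) ?_) _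
    have k1 := hcomp c1
    have k2 := hcomp c2
    have k3 := hcomp c3
    fun_prop
  rw [lmarginal_singleton, lmarginal_singleton]
  refine lintegral_side_le T (fun c => ?_) i
  let L : ℝ × ℝ → Fin 4 → ℝ := fun q => emb (s * (b + q.1)) (update x i q.2)
  have hL := hA.comp (by fun_prop : Continuous fun q : ℝ × ℝ =>
    (s * (b + q.1), update x i q.2))
  have hline : ∀ {u : Fn 4}, Smooth u → ∀ a t, HasDerivAt (fun t => u (L (a, t)))
      (pd (tang i) u (L (a, t))) t := fun hu a t => by
    simp only [L, emb_update]
    exact hasDerivAt_line hu _ _ _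
  have := trace_line (v := fun q => g (L q)) (v' := fun q => pd (tang i) g (L q))
    (p := fun q => s * pd 1 f (L q)) (r := fun q => s * pd 1 g (L q))
    (hline hgs)
    (fun a t => by
      rw [hg, pd_comm hf]
      exact (hline (smooth_pd hf 1) a t).const_mul s)
    (fun a t => hasDerivAt_emb hgs s b a (update x i t)) c
  simpa only [mul_pow, h.sq, one_mul, L, add_zero] using this

/-- The trace of the function itself on a slice. The parameter `γ` balances the two terms; it is
introduced by oscillating factors `cos (γ t)` and `sin (γ t)` in an auxiliary variable `t`. -/
theorem lintegral_slice_le (h : IsSide T s D) (hf : Smooth f) {b : ℝ}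
    (hb : b ∈ Icc (0 : ℝ) (1 / 2)) {γ : ℝ} (hγ : 1 ≤ γ) :
    ∫⁻ y in (Γ T).cell, ofReal ((γ * f (emb (s * b) y)) ^ 2) ≤
      2400 * ∫⁻ z in D.cell, ofReal (2 * (γ ^ 2 * f z) ^ 2 + pd 1 f z ^ 2) := by
  have c1 := (smooth_pd hf 1).continuous
  have c2 := hf.continuous
  refine le_trans ?_ (mul_le_mul_right (lintegral_slices_le h hb (by fun_prop)) _)
  rw [← lintegral_const_mul' _ _ (by norm_num)]
  refine lintegral_mono fun y => ?_
  set w := fun a => f (emb (s * (b + a)) y) with hw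
  set w' := fun a => s * pd 1 f (emb (s * (b + a)) y) with hw'
  have hL :=
    smooth_emb.continuous.comp (by fun_prop : Continuous fun a => (s * (b + a), y))
  have hwc := c2.comp hL
  have hwc' : Continuous w' := continuous_const.mul (c1.comp hL)
  have hd := fun a => hasDerivAt_emb hf s b a y
  have hcos : ∀ t, HasDerivAt (fun t => Real.cos (γ * t)) (-(γ * Real.sin (γ * t))) t := fun t =>
    ((hasDerivAt_id t).const_mul γ).cos.congr_deriv (by simp; ring)
  have hsin : ∀ t, HasDerivAt (fun t => Real.sin (γ * t)) (γ * Real.cos (γ * t)) t := fun t =>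
    ((hasDerivAt_id t).const_mul γ).sin.congr_deriv (by simp; ring)
  have e1 (c e) : c ^ 2 + e ^ 2 = 1 → ∀ x,
      ofReal ((c * x) ^ 2) + ofReal ((e * x) ^ 2) = ofReal (x ^ 2) := by
    intro hce x
    rw [← ofReal_add (sq_nonneg _) (sq_nonneg _)]
    congr 1
    linear_combination x ^ 2 * hce
  have := add_le_add (trace_line (v := fun q => Real.cos (γ * q.2) * (γ * w q.1)) (v' := fun q => -(γ * Real.sin (γ * q.2)) * (γ * w q.1)) (p := fun q => Real.sin (γ * q.2) * w' q.1) (r := fun q => γ * Real.cos (γ * q.2) * w' q.1) (fun a t => (hcos t).mul_const (γ * w a)) (fun a t => (hsin t).mul_const (w' a)) (fun a t => (((hd a).const_mul γ).const_mul (Real.cos (γ * t))).congr_deriv (by ring)) 0) (trace_line (v := fun q => Real.sin (γ * q.2) * (γ * w q.1)) (v' := fun q => γ * Real.cos (γ * q.2) * (γ * w q.1)) (p := fun q => -Real.cos (γ * q.2) * w' q.1) (r := fun q => γ * Real.sin (γ * q.2) * w' q.1) (fun a t => (hsin t).mul_const (γ * w a)) (fun a t => ((hcos t).fun_neg.mul_const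 (w' a)).congr_deriv (by ring)) (fun a t => (((hd a).const_mul γ).const_mul (Real.sin (γ * t))).congr_deriv (by ring)) 0)
  rw [← lintegral_add_left (by fun_prop), ← lintegral_add_left (by fun_prop)] at this
  simp only [e1 _ _ (Real.cos_sq_add_sin_sq _), ← mul_add] at this
  simp only [zero_add, lintegral_const, Measure.restrict_apply MeasurableSet.univ,
    Set.univ_inter, Real.volume_Ico, sub_zero, ofReal_one, mul_one, hw, add_zero] at this
  refine this.trans ((lintegral_mono fun t => mul_le_mul_right (?_ : _ ≤ ∫⁻ a in Ico 0
    (1 / 2), ofReal (2 * (γ ^ 2 * f (emb (s * (b + a)) y)) ^ 2 +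
      pd 1 f (emb (s * (b + a)) y) ^ 2)) _).trans_eq ?_)
  · rw [← lintegral_add_left (by fun_prop)]
    refine lintegral_mono fun a => ?_
    rw [← ofReal_add (by positivity) (by positivity)]
    refine ofReal_le_ofReal ?_
    set F := f (emb (s * (b + a)) y)
    set P := pd 1 f (emb (s * (b + a)) y)
    have h4 : γ ^ 2 * F ^ 2 ≤ γ ^ 4 * F ^ 2 := mul_le_mul_of_nonneg_right
        (pow_le_pow_right₀ hγ (by norm_num)) (sq_nonneg _)
    calc _ = (Real.cos (γ * t) ^ 2 + Real.sin (γ * t) ^ 2) *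
          (γ ^ 2 * F ^ 2 + γ ^ 4 * F ^ 2 + s ^ 2 * P ^ 2) := by simp only [hw']; ring
      _ ≤ _ := by rw [Real.cos_sq_add_sin_sq (γ * t), h.sq]; nlinarith
  · rw [setLIntegral_const, Real.volume_Ico, sub_zero, ofReal_one, mul_one]

end

section

/-! ### Slices of smooth functions -/

variable {T s b γ : ℝ} {D : PeriodicDomain 4} {f : (Fin 4 → ℝ) → ℝ}

theorem smooth_slice (hf : Smooth f) (a) : Smooth fun y => f (emb a y) :=
  hf.comp (smooth_emb.comp (contDiff_const.prodMk contDiff_id))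

theorem pdMulti_slice (hf : Smooth f) (a) (β) :
    pdMulti β (fun y => f (emb a y)) = fun y => pdMulti (emb 0 β) f (emb a y) := by
  induction β using multiIndex_ind with
  | h0 =>
    have : emb 0 0 = 0 := by funext j; fin_cases j <;> rfl
    simp [this]
  | h1 β i ih =>
    have hβ : emb 0 (β + single i 1) = emb 0 β + single (tang i) 1 := by
      funext j; fin_cases i <;> fin_cases j <;> simp [emb, tang]
    rw [pdMulti_succ (smooth_slice hf a), ih, hβ, pdMulti_succ hf]
    funext y
    have hg := smooth_pdMulti hf (emb 0 β)
    have k1 := hasDerivAt_line (smooth_slice hg a) i y (y i)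
    have k2 := hasDerivAt_line hg (tang i) (emb a y) (y i)
    simp only [← emb_update, Function.update_eq_self] at k1 k2
    exact k1.unique k2

/-- The norms `N (∂^α ∂₁^k u)` with `α` tangential and `|α| + 2 k ≤ n`, with powers of `γ`, are
bounded by `Q`. These are the derivatives on which the trace of order `n - 1` depends. -/
def TraceBound (γ : ℝ) (n : ℕ) (N : (Fin 4 → ℕ) → ℝ≥0∞) (Q : ℝ≥0∞) : Prop :=
  ∀ (α : Fin 4 → ℕ) (k : ℕ), α 1 = 0 → ∑ i, α i + 2 * k ≤ n →
    ofReal γ ^ (n - (∑ i, α i + 2 * k)) * N (α + single 1 k) ≤ Q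

theorem sq_add_le {a x y z : ℝ≥0∞} (h : a ^ 2 ≤ 2400 * (x ^ 2 + y ^ 2 + z ^ 2)) :
    a ≤ 49 * (x + y + z) := by
  rw [← sq_le_sq_iff]
  have h1 : x ^ 2 + y ^ 2 + z ^ 2 ≤ (x + y + z) ^ 2 := by
    rw [show (x + y + z) ^ 2 = x ^ 2 + y ^ 2 + z ^ 2 + (2 * x * y + 2 * x * z + 2 * y * z) by ring]
    exact le_self_add
  calc _ ≤ _ := h
    _ ≤ 49 ^ 2 * (x + y + z) ^ 2 := mul_le_mul' (by norm_num) h1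
    _ = _ := by ring

theorem lpNorm_slice_le (h : IsSide T s D) (hf : Smooth f) (hb : b ∈ Icc (0 : ℝ) (1 / 2))
    (hγ : 1 ≤ γ) (hm : 1 ≤ m) {Q : ℝ≥0∞}
    (H : TraceBound γ (m + 1) (fun α => lpNorm D 2 (pdMulti α f)) Q)
    (hβ : ∑ i, β i ≤ m) : ofReal γ ^ (m - ∑ i, β i) *
      lpNorm (Γ T) 2 (pdMulti β fun y => f (emb (s * b) y)) ≤ 147 * Q := by
  have hsum : ∀ δ, ∑ i, emb 0 δ i = ∑ i, δ i := fun δ => by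
    simp [Fin.sum_univ_four, Fin.sum_univ_three, emb]
  set g := ofReal γ with hg
  have key {N A B E} h {p} (a : p * A ≤ Q) (b : p * B ≤ Q)
      (e : p * E ≤ Q) : p * N ≤ 147 * Q :=
    calc _ ≤ p * (49 * (A + B + E)) := mul_le_mul_right h _
      _ = 49 * (p * A + p * B + p * E) := by ring
      _ ≤ 49 * (Q + Q + Q) := by gcongr
      _ = _ := by ring
  rw [pdMulti_slice hf]
  by_cases h0 : ∃ i, β i ≠ 0
  · obtain ⟨i, hi⟩ := h0
    set δ := β - single i 1
    have hβδ : β = δ + single i 1 := (sub_add_single hi).symm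
    have hlen : ∑ j, β j = ∑ j, δ j + 1 := by rw [hβδ, sum_add_single]
    have hα : emb 0 β = emb 0 δ + single (tang i) 1 := by
      rw [hβδ]; funext j; fin_cases i <;> fin_cases j <;> simp [emb, tang]
    have h1 := lintegral_slice_pd_le h (smooth_pdMulti hf (emb 0 δ)) hb i
    rw [← pdMulti_succ hf, ← hα, ← pdMulti_succ hf, ← pdMulti_succ hf] at h1
    have c := fun α => (smooth_pdMulti hf α).continuous
    have hofr : ∀ x y z, ofReal (x ^ 2 + y ^ 2 + z ^ 2) =
        ‖x‖ₑ ^ 2 + ‖y‖ₑ ^ 2 + ‖z‖ₑ ^ 2 := fun x y z => by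
      rw [ofReal_add, ofReal_add] <;> first | positivity | simp only [enorm_sq_eq]
    simp only [hofr, ← enorm_sq_eq] at h1
    rw [lintegral_add_left (by fun_prop),
      lintegral_add_left (by fun_prop), ← lpNorm_two_sq, ← lpNorm_two_sq,
      ← lpNorm_two_sq, ← lpNorm_two_sq] at h1
    have hβ0 : emb 0 β 1 = 0 := rfl
    have a1 := H (emb 0 β) 0 hβ0 (by rw [hsum]; omega)
    have a2 := H (emb 0 β + single (tang i) 1) 0 (by simp [hβ0, (tang_ne i).symm])
      (by rw [sum_add_single, hsum]; omega)
    have a3 := H (emb 0 δ) 1 rfl (by rw [hsum]; omega)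
    rw [sum_add_single, hsum] at a2
    rw [hsum] at a1 a3
    simp only [Pi.single_zero, add_zero, mul_zero] at a1 a2
    rw [show m + 1 - (∑ i, β i + 1) = m - ∑ i, β i by omega] at a2
    rw [show m + 1 - (∑ i, δ i + 2 * 1) = m - ∑ i, β i by omega] at a3
    exact key (sq_add_le h1) ((mul_le_mul_left (pow_le_pow_right₀
        (one_le_ofReal hγ) (by omega)) _).trans a1) a2 a3
  · push Not at h0
    have hβ0 : emb 0 β = 0 := by funext j; fin_cases j <;> simp [emb, h0]
    have hs0 : ∑ i, β i = 0 := by simp [h0]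
    have h1 := lintegral_slice_le h hf hb hγ
    have hofr : ∀ x z, ofReal (2 * (γ ^ 2 * x) ^ 2 + z ^ 2) =
        g ^ 4 * ‖x‖ₑ ^ 2 + g ^ 4 * ‖x‖ₑ ^ 2 + ‖z‖ₑ ^ 2 := fun x z => by
      simp only [enorm_sq_eq, hg, ← ofReal_pow (zero_le_one.trans hγ)]
      rw [← ofReal_mul, ← ofReal_add, ← ofReal_add] <;> first | positivity | (congr 1; ring)
    have hofr' : ∀ x, ofReal ((γ * x) ^ 2) = g ^ 2 * ‖x‖ₑ ^ 2 := fun x => by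
      rw [enorm_sq_eq, hg, ← ofReal_pow (by linarith), ← ofReal_mul (by positivity), mul_pow]
    have c := hf.continuous
    have gt : g ≠ ⊤ := ofReal_ne_top
    simp only [hofr, hofr'] at h1
    rw [lintegral_const_mul' _ _ (by finiteness), lintegral_add_left (by fun_prop), lintegral_add_left (by fun_prop),
      lintegral_const_mul' _ _ (by finiteness),
      ← lpNorm_two_sq, ← lpNorm_two_sq, ← lpNorm_two_sq, ← pdMulti_single hf] at h1
    have a1 := H 0 0 rfl (by simp)
    have a3 := H 0 1 rfl (by simp; omega)
    simp only [Pi.zero_apply, Finset.sum_const_zero, Pi.single_zero, add_zero, mul_zero, zero_add,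
      pdMulti_zero, Nat.sub_zero, mul_one] at a1 a3
    obtain ⟨l, rfl⟩ := Nat.exists_eq_add_of_le' hm
    rw [hβ0, hs0, pdMulti_zero, Nat.sub_zero, pow_succ, mul_assoc]
    rw [show l + 1 + 1 - 2 = l by omega] at a3
    have a2 : g ^ l * (g ^ 2 * lpNorm D 2 f) ≤ Q := by rwa [← mul_assoc, ← pow_add]
    exact key (sq_add_le (by simpa only [mul_pow, ← pow_mul] using h1)) a2 a2 a3

end

section

/-! ### A Sobolev inequality on the interface -/

/-- The derivative of `v` in the direction `e`. -/
def dirDeriv (e : Fin d → ℝ) (v : Fn d) : Fn d := fun z => ∑ i, e i * pd i v z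

theorem hasDerivAt_ray (hv : Smooth v) (y e : Fin d → ℝ) (r) :
    HasDerivAt (fun r : ℝ => v (y + r • e)) (dirDeriv e v (y + r • e)) r := by
  have h2 : HasDerivAt (fun r => y + r • e) e r := by
    simpa using ((hasDerivAt_id r).smul_const e).const_add y
  refine (((hv.differentiable (by simp) (y + r • e)).hasFDerivAt).comp_hasDerivAt r h2).congr_deriv ?_
  have h3 := (fderiv ℝ v (y + r • e)).toLinearMap.pi_apply_eq_sum_univ e
  rw [ContinuousLinearMap.coe_coe] at h3
  rw [h3]
  refine sum_congr rfl fun i _ => ?_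
  rw [smul_eq_mul, pd]
  congr 2
  funext j
  simp [Pi.single_apply, eq_comm]

theorem dirDeriv_sq_le {e : Fin 3 → ℝ} (he : ∀ i, e i ^ 2 ≤ 1) (x : Fin 3 → ℝ) :
    (∑ i, e i * x i) ^ 2 ≤ 3 * ∑ i, x i ^ 2 := by
  refine (Finset.sum_mul_sq_le_sq_mul_sq _ _ _).trans ?_
  refine mul_le_mul_of_nonneg_right ?_ (sum_nonneg fun _ _ => sq_nonneg _)
  calc _ ≤ ∑ _i, 1 := sum_le_sum fun i _ => he i
    _ = 3 := by simp

theorem sq_integral_le {f : ℝ → ℝ} (hf : Continuous f) :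
    (∫ t in (0 : ℝ)..1, f t) ^ 2 ≤ ∫ t in (0 : ℝ)..1, f t ^ 2 := by
  set c := ∫ t in 0..1, f t with hc
  have h0 : 0 ≤ ∫ t in 0..1, (f t - c) ^ 2 :=
    intervalIntegral.integral_nonneg (by norm_num) fun _ _ => sq_nonneg _
  have e1 : ∀ t, (f t - c) ^ 2 = f t ^ 2 - (2 * c) * f t + c ^ 2 := fun t => by ring
  simp only [e1] at h0
  rw [intervalIntegral.integral_add ivlIntegrable ivlIntegrable,
    intervalIntegral.integral_sub ivlIntegrable ivlIntegrable, intervalIntegral.integral_const_mul, ← hc, intervalIntegral.integral_const] at h0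
  simp only [sub_zero, one_smul] at h0
  linarith

/-- The sum of the squares of the derivatives of order at most two. -/
def jetSq (v : Fn 3) (z : Fin 3 → ℝ) : ℝ :=
  v z ^ 2 + ∑ i, pd i v z ^ 2 + ∑ i, ∑ j, pd j (pd i v) z ^ 2

theorem jetSq_nonneg {v : (Fin 3 → ℝ) → ℝ} z : 0 ≤ jetSq v z := by unfold jetSq; positivity

theorem continuous_jetSq {v : (Fin 3 → ℝ) → ℝ} (hv : Smooth v) : Continuous (jetSq v) := by
  have hc := hv.continuous
  have hc1 i := (smooth_pd hv i).continuous
  have hc2 i j := (smooth_pd (smooth_pd hv i) j).continuous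
  unfold jetSq; fun_prop

/-- Taylor's formula along the ray from `y` in the direction `e`, parametrized by `ρ ↦ y + ρ² e`. -/
theorem sq_le_ray {v : (Fin 3 → ℝ) → ℝ} (hv : Smooth v) (y)
    (he : ∀ i, e i ^ 2 ≤ 1) : v y ^ 2 ≤ 12 * jetSq v (y + e) +
      ∫ ρ in (0 : ℝ)..1, 108 * ρ ^ 6 * jetSq v (y + ρ ^ 2 • e) := by
  have hp := fun i => smooth_pd hv i
  set φ₁ := dirDeriv e v with h₁
  set φ₂ := fun z => ∑ i, e i * dirDeriv e (pd i v) z with h₂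
  have d2 : ∀ r, HasDerivAt (fun r => φ₁ (y + r • e)) (φ₂ (y + r • e)) r := fun r =>
    HasDerivAt.fun_sum fun i _ => (hasDerivAt_ray (hp i) y e r).const_mul (e i)
  have hc := hv.continuous
  have hc1 := fun i => (hp i).continuous
  have hc2 := fun i j => (smooth_pd (hp i) j).continuous
  have c2 : Continuous φ₂ := by simp only [h₂, dirDeriv]; fun_prop
  have cS := continuous_jetSq hv
  have hk : ∀ ρ, HasDerivAt (fun ρ => v (y + ρ ^ 2 • e) - ρ ^ 2 * φ₁ (y + ρ ^ 2 • e))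
      (-(2 * ρ ^ 3 * φ₂ (y + ρ ^ 2 • e))) ρ := fun ρ => by
    have hs : HasDerivAt (fun ρ => ρ ^ 2) (2 * ρ) ρ := by simpa using hasDerivAt_pow 2 ρ
    have k1 := (hasDerivAt_ray hv y e (ρ ^ 2)).comp ρ hs
    have k2 := (d2 (ρ ^ 2)).comp ρ hs
    exact (k1.sub (hs.mul k2)).congr_deriv (by simp only [Function.comp_apply, ← h₁]; ring)
  have hI := integral_eq_sub_of_hasDerivAt (a := 0) (b := 1)
    (fun ρ _ => hk ρ) ivlIntegrable
  rw [intervalIntegral.integral_neg] at hI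
  simp only [one_pow, one_smul, one_mul, ne_eq, OfNat.ofNat_ne_zero, not_false_eq_true, zero_pow, zero_smul, add_zero,
    zero_mul, sub_zero] at hI
  have hsq := sq_integral_le (by fun_prop : Continuous fun ρ => 2 * ρ ^ 3 * φ₂ (y + ρ ^ 2 • e))
  have b0 : ∀ z, v z ^ 2 ≤ jetSq v z ∧ φ₁ z ^ 2 ≤ 3 * jetSq v z ∧
      φ₂ z ^ 2 ≤ 9 * jetSq v z := fun z => by
    have n1 : 0 ≤ ∑ i, pd i v z ^ 2 := sum_nonneg fun _ _ => sq_nonneg _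
    have n2 : 0 ≤ ∑ i, ∑ j, pd j (pd i v) z ^ 2 :=
      sum_nonneg fun _ _ => sum_nonneg fun _ _ => sq_nonneg _
    have n3 := sq_nonneg (v z)
    have k3 : ∑ i, dirDeriv e (pd i v) z ^ 2 ≤ ∑ i, 3 * ∑ j, pd j (pd i v) z ^ 2 :=
      sum_le_sum fun i _ => dirDeriv_sq_le he fun j => pd j (pd i v) z
    rw [← mul_sum] at k3
    refine ⟨?_, (dirDeriv_sq_le he fun i => pd i v z).trans ?_,
        (dirDeriv_sq_le he fun i => dirDeriv e (pd i v) z).trans ?_⟩ <;> unfold jetSq <;> linarith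
  have hint : ∫ ρ in 0..1, (2 * ρ ^ 3 * φ₂ (y + ρ ^ 2 • e)) ^ 2 ≤
      ∫ ρ in 0..1, 36 * ρ ^ 6 * jetSq v (y + ρ ^ 2 • e) := by
    refine integral_mono_on (by norm_num) ivlIntegrable ivlIntegrable fun ρ _ => ?_
    nlinarith [mul_le_mul_of_nonneg_left (b0 (y + ρ ^ 2 • e)).2.2
      (by positivity : (0 : ℝ) ≤ 4 * ρ ^ 6)]
  rw [show (108 : ℝ) = 3 * 36 by norm_num]
  simp only [mul_assoc (3 : ℝ) 36, mul_assoc (3 : ℝ) (36 * _), intervalIntegral.integral_const_mul]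
  obtain ⟨b1, b2, -⟩ := b0 (y + e)
  set J := ∫ ρ in 0..1, 2 * ρ ^ 3 * φ₂ (y + ρ ^ 2 • e)
  have hv' : v y = v (y + e) - φ₁ (y + e) + J := by linarith
  rw [hv']
  nlinarith [sq_nonneg (v (y + e) + φ₁ (y + e)), sq_nonneg (v (y + e) - J), sq_nonneg (φ₁ (y + e) + J)]

/-- The Sobolev embedding of `H²` into `L^∞` on the three-dimensional interface: Taylor's formula is
averaged over the rays into the cube `[-1, 0]³`. The Jacobian `ρ⁻⁶` of `e ↦ ρ² e` is compensated by
the weight in Taylor's formula. -/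
theorem sq_le_lintegral_cell (hv : Smooth v)
    (hper : IsPeriodic (Γ T) v) (hy : y ∈ (Γ T).cover) :
    ofReal (v y ^ 2) ≤
      3240 * ∫⁻ z in (Γ T).cell, ofReal (jetSq v z) := by
  have hB := isBox_interface T
  have hO := hB.isOpen
  have cS := continuous_jetSq hv
  have S0 := jetSq_nonneg (v := v)
  set F := fun z => ofReal (jetSq v z) with hF
  have hFm : Measurable F := by fun_prop
  have hFper : ∀ k, IsShift (Γ T) k → ∀ z, F (z + shiftVec k) = F z := fun k hk z => by
    have h0 := funext fun z => hper.shift hk z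
    have h1 : ∀ i, (fun z => pd i v (z + shiftVec k)) = pd i v := fun i => by
      rw [← pd_comp_add, h0]
    have h2 : ∀ i j, (fun z => pd j (pd i v) (z + shiftVec k)) = pd j (pd i v) := fun i j => by
      rw [← pd_comp_add, h1]
    simp only [hF, jetSq]
    rw [congrFun h0 z]
    simp only [fun i => congrFun (h1 i) z, fun i j => congrFun (h2 i j) z]
  -- the point is moved into the unit cell
  suffices H : ∀ y ∈ (Γ T).cell,
      ofReal (v y ^ 2) ≤ 3240 * ∫⁻ z in (Γ T).cell, F z by
    have hk : IsShift (Γ T) (-perIdx (Γ T) y) :=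
      isShift_neg (isShift_perIdx _ y)
    rw [← hper.shift hk]
    refine H _ ?_
    rw [cell_eq]
    exact ⟨(hB.invariant _ hk y).2 hy, by simp [perIdx_add hk]⟩
  intro y hy
  set E : Set (Fin 3 → ℝ) := univ.pi fun _ => Icc (-1) 0 with hE
  have hEm : MeasurableSet E := MeasurableSet.univ_pi fun _ => measurableSet_Icc
  have hE1 : volume E = 1 := by rw [hE, volume_pi_pi]; simp
  set I := ∫⁻ e in E, F (y + e) with hI
  have hIle : I ≤ 27 * ∫⁻ z in (Γ T).cell, F z := by
    have := lintegral_big_le hO hB.invariant (F := F) fun k hk => of_forall (hFper k hk)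
    refine le_trans ?_ (this.trans_eq (by norm_num))
    rw [← lintegral_indicator hO.measurableSet, ← lintegral_add_left_eq_self _ y, hI,
      ← lintegral_indicator hEm]
    refine lintegral_mono fun e => Set.indicator_apply_le' (fun he => ?_) fun _ => zero_le
    have he' := fun i => he i (Set.mem_univ i)
    rw [indicator_of_mem, indicator_of_mem]
    · intro i hi
      have := hy.2 i hi
      constructor <;> simp only [Pi.add_apply] <;> linarith [this.1, this.2, (he' i).1, (he' i).2]
    · exact (add_le_of_nonpos_right (he' 0).2).trans_lt hy.1
  have hscale : ∀ ρ ∈ Ioo 0 1, ofReal (ρ ^ 6) * ∫⁻ e in E, F (y + ρ ^ 2 • e) ≤ I := by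
    intro ρ hρ
    have h1 : ∫⁻ e in E, F (y + ρ ^ 2 • e) ≤ ∫⁻ e, E.indicator (fun e => F (y + e)) (ρ ^ 2 • e) := by
      rw [← lintegral_indicator hEm]
      refine lintegral_mono fun e => Set.indicator_apply_le' (fun he => ?_) fun _ => zero_le
      rw [indicator_of_mem]
      intro i _
      have h2 := he i (Set.mem_univ i)
      have h3 : ρ ^ 2 ≤ 1 := pow_le_one₀ hρ.1.le hρ.2.le
      simp only [Pi.smul_apply, smul_eq_mul]
      constructor <;> nlinarith [h2.1, h2.2, sq_nonneg ρ]
    rw [← lintegral_map (by measurability) (measurable_const_smul (ρ ^ 2)), Measure.map_addHaar_smul volume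
        ((pow_pos hρ.1 2).ne'),
      lintegral_smul_measure, lintegral_indicator hEm] at h1
    refine (mul_le_mul_right h1 _).trans_eq ?_
    rw [smul_eq_mul, ← mul_assoc, ← ofReal_mul (by have := hρ.1; positivity)]
    have : ρ ^ 6 * |((ρ ^ 2) ^ Module.finrank ℝ (Fin 3 → ℝ))⁻¹| = 1 := by
      have := hρ.1
      rw [Module.finrank_fin_fun, abs_of_pos (by positivity)]
      field_simp
    rw [this, ofReal_one, one_mul]
  have hmain : ∀ e ∈ E, ofReal (v y ^ 2) ≤ 12 * F (y + e) +
      ∫⁻ ρ in Ico 0 1, 108 * (ofReal (ρ ^ 6) * F (y + ρ ^ 2 • e)) := by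
    intro e he
    have := sq_le_ray hv y fun i => by
      have := he i (Set.mem_univ i); nlinarith [this.1, this.2]
    refine (ofReal_le_ofReal this).trans ?_
    rw [ofReal_add (by have := S0 (y + e); positivity) (intervalIntegral.integral_nonneg (by norm_num)
      fun ρ _ => by have := S0 (y + ρ ^ 2 • e); positivity), ofReal_mul (by norm_num),
      ← lintegral_Ico_ofReal (by fun_prop) (fun ρ => by have := S0 (y + ρ ^ 2 • e); positivity) (by norm_num)]
    refine add_le_add (by norm_num [hF]) (le_of_eq (lintegral_congr fun ρ => ?_))
    rw [mul_assoc, ofReal_mul (by norm_num), ofReal_mul (by positivity)]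
    norm_num [hF]
  calc ofReal (v y ^ 2) = ∫⁻ e in E, ofReal (v y ^ 2) := by
        rw [setLIntegral_const, hE1, mul_one]
    _ ≤ ∫⁻ e in E, (12 * F (y + e) +
        ∫⁻ ρ in Ico 0 1, 108 * (ofReal (ρ ^ 6) * F (y + ρ ^ 2 • e))) :=
        setLIntegral_mono' hEm hmain
    _ = 12 * I + ∫⁻ ρ in Ico 0 1, 108 * (ofReal (ρ ^ 6) * ∫⁻ e in E, F (y + ρ ^ 2 • e)) := by
        rw [lintegral_add_left (by fun_prop), lintegral_const_mul' _ _ (by norm_num),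
          lintegral_lintegral_swap
            (by fun_prop)]
        congr 1
        refine lintegral_congr fun ρ => ?_
        rw [lintegral_const_mul' _ _ (by norm_num), lintegral_const_mul' _ _ ofReal_ne_top]
    _ ≤ 12 * I + ∫⁻ ρ in Ico (0 : ℝ) 1, 108 * I := by
        rw [← restrict_Ioo_eq_restrict_Ico]
        gcongr 12 * I + ?_
        exact setLIntegral_mono' measurableSet_Ioo fun ρ hρ => mul_le_mul_right (hscale ρ hρ) _
    _ = 120 * I := by
        rw [setLIntegral_const, Real.volume_Ico]; norm_num; ring
    _ ≤ _ := (mul_le_mul_right hIle _).trans_eq (by ring)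

theorem enorm_le_of_lpNorm_le (hv : Smooth v)
    (hper : IsPeriodic (Γ T) v)
    (H : ∀ β, ∑ i, β i ≤ 2 → lpNorm (Γ T) 2 (pdMulti β v) ≤ Q)
    (hy : y ∈ (Γ T).cover) : ‖v y‖ₑ ≤ 206 * Q := by
  rw [← sq_le_sq_iff, enorm_sq_eq]
  refine (sq_le_lintegral_cell hv hper hy).trans ?_
  have hc := fun β => (smooth_pdMulti hv β).continuous
  have hQ : ∀ β, ∑ i, β i ≤ 2 →
      ∫⁻ z in (Γ T).cell, ofReal (pdMulti β v z ^ 2) ≤ Q ^ 2 := fun β hβ => by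
    simp only [← enorm_sq_eq]
    rw [← lpNorm_two_sq]
    exact sq_le_sq_iff.2 (H β hβ)
  have hS : ∀ z, ofReal (jetSq v z) = ofReal (pdMulti 0 v z ^ 2) +
      ∑ i, ofReal (pdMulti (single i 1) v z ^ 2) +
      ∑ i, ∑ j, ofReal (pdMulti (single i 1 + single j 1) v z ^ 2) := fun z => by
    simp only [pdMulti_succ hv, pdMulti_single hv, pdMulti_zero, jetSq]
    repeat rw [ofReal_add (by positivity) (by positivity)]
    simp only [ENNReal.ofReal_sum_of_nonneg, sq_nonneg, sum_nonneg, implies_true]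
  simp only [hS]
  rw [lintegral_add_left (by fun_prop), lintegral_add_left (by fun_prop)]
  simp (discharger := fun_prop) only [lintegral_finsetSum]
  calc _ ≤ 3240 * (Q ^ 2 + ∑ _i, Q ^ 2 + ∑ _i, ∑ _j, Q ^ 2) := by
        gcongr with i _ i _ j _
        · exact hQ _ (by simp)
        · exact hQ _ (by simp)
        · exact hQ _ (by rw [sum_add_single]; simp)
    _ = 42120 * Q ^ 2 := by simp; ring
    _ ≤ 206 ^ 2 * Q ^ 2 := mul_le_mul_left (by norm_num) _
    _ = _ := by ring

end

section

/-! ### Traces -/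

theorem locInt_indicator_of_lpNorm (hD : IsOpen D.cover)
    (hI : IsInvariant D) (hp : AEPeriodic D f)
    (hf : LocallyIntegrableOn f D.cover) (h : lpNorm D 2 f ≠ ⊤) :
    LocallyIntegrable (D.cover.indicator f) := by
  refine locallyIntegrable_iff.2 fun K hK => ⟨
      ((aestronglyMeasurable_indicator_iff hD.measurableSet).2 hf.aestronglyMeasurable).restrict, ?_⟩
  have hfin := finite_image_perIdx D hK
  have hL : ∫⁻ z in D.cell, ‖f z‖ₑ ^ 2 ≠ ⊤ := by
    rw [← lpNorm_two_sq]; exact ENNReal.pow_ne_top h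
  have hsq : ∀ x : ℝ≥0∞, x ≤ 1 + x ^ 2 := fun x => by
    rcases le_total x 1 with hx | hx
    · exact hx.trans le_self_add
    · exact (le_self_pow₀ hx two_ne_zero).trans le_add_self
  calc ∫⁻ z in K, ‖D.cover.indicator f z‖ₑ
      ≤ ∫⁻ z in K, (1 + ∑ v ∈ hfin.toFinset,
          (D.cover ∩ perIdx D ⁻¹' {v}).indicator (fun z => ‖f z‖ₑ ^ 2) z) := by
        refine setLIntegral_mono_ae' hK.measurableSet (ae_of_all _ fun z hz => ?_)
        by_cases hc : z ∈ D.cover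
        · rw [indicator_of_mem hc]
          refine (hsq _).trans (add_le_add le_rfl ?_)
          refine le_trans (le_of_eq ?_) (single_le_sum (fun _ _ => zero_le)
            (hfin.mem_toFinset.2 (Set.mem_image_of_mem _ hz)))
          have : z ∈ D.cover ∩ perIdx D ⁻¹' {perIdx D z} := ⟨hc, rfl⟩
          rw [indicator_of_mem this]
        · simp [Set.indicator_of_notMem hc]
    _ ≤ volume K + ∑ v ∈ hfin.toFinset, ∫⁻ z in D.cell, ‖f z‖ₑ ^ 2 := by
        rw [lintegral_add_left measurable_const, setLIntegral_const, one_mul]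
        refine add_le_add le_rfl ((lintegral_mono' Measure.restrict_le_self le_rfl).trans ?_)
        have hfm := fun v =>
          hD.measurableSet.inter (measurable_perIdx D (measurableSet_singleton v))
        rw [lintegral_finsetSum' _ fun v _ => (aemeasurable_indicator_iff (hfm v)).2
          ((hf.aestronglyMeasurable.enorm.pow_const 2).mono_measure
            (Measure.restrict_mono Set.inter_subset_left le_rfl))]
        refine sum_le_sum fun v _ => ?_
        rw [lintegral_indicator (hfm v)]
        exact lintegral_period_le hD hI v fun k hk => by
          filter_upwards [hp k hk] with z hz
          rw [hz]
    _ < ⊤ := by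
        rw [sum_const, nsmul_eq_mul]
        exact (ENNReal.add_ne_top.2 ⟨hK.measure_lt_top.ne, mul_ne_top (by simp) hL⟩).lt_top

variable {T s γ : ℝ} {D : PeriodicDomain 4} {Q : ℝ≥0∞}

theorem IsSide.exists_isBox (h : IsSide T s D) : ∃ I a b, IsBox D I a b := by
  cases h
  exacts [⟨_, _, _, isBox_plasma T⟩, ⟨_, _, _, isBox_vacuum T⟩]

theorem IsSide.emb_mem (h : IsSide T s D) (hy : y ∈ (Γ T).cover)
    (ha : a ∈ Ioo (0 : ℝ) 1) : emb (s * a) y ∈ D.cover := by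
  have hy := hy
  have := ha.1
  have := ha.2
  cases h
  · exact ⟨hy, by change 0 < 1 * a; linarith, by change 1 * a < 1; linarith⟩
  · exact ⟨hy, by change -1 < -1 * a; linarith, by change -1 * a < 0; linarith⟩

theorem IsSide.ae_slices (h : IsSide T s D) {P : (Fin 4 → ℝ) → Prop}
    (hP : ∀ᵐ z ∂vol D, P z) :
    ∀ᵐ y ∂vol (Γ T), ∀ᵐ a : ℝ, a ∈ Ioo (0 : ℝ) 1 →
      P (emb (s * a) y) := by
  obtain ⟨I, a, b, hB⟩ := h.exists_isBox
  rw [ae_restrict_iff' hB.isOpen.measurableSet] at hP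
  rw [ae_restrict_iff' (isBox_interface T).isOpen.measurableSet]
  have h1 := ((volume_preserving_piFinSuccAbove (fun _ => ℝ) 1).symm
    _).quasiMeasurePreserving.ae hP
  rw [Measure.volume_eq_prod] at h1
  have hs : Measure.QuasiMeasurePreserving (fun a => s * a) := by
    cases h
    · simpa using! Measure.QuasiMeasurePreserving.id volume
    · simpa using (Measure.measurePreserving_neg volume).quasiMeasurePreserving
  filter_upwards [Measure.ae_ae_of_ae_prod ((Measure.measurePreserving_swap).quasiMeasurePreserving.ae h1)] with y hy hyc
  filter_upwards [hs.ae hy] with a ha hI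
  have := h.emb_mem hyc hI
  rw [emb_eq] at this ⊢
  exact ha this

theorem IsPeriodic.slice (h : IsSide T s D) {f : Fn 4} (hf : IsPeriodic D f) (a) :
    IsPeriodic (Γ T) fun y => f (emb a y) := by
  have ht : D.torus = {2, 3} := by cases h <;> rfl
  intro i hi z
  have : emb a (z + single i 1) = emb a z + single (tang i) 1 := by
    have h1 : i ≠ 0 := by rintro rfl; simp [interfaceDomain] at hi
    funext j; fin_cases i <;> fin_cases j <;> simp_all [emb, tang]
  simp only [this]
  refine hf _ ?_ _
  rw [ht]
  simp only [interfaceDomain, Finset.mem_insert, Finset.mem_singleton] at hi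
  rcases hi with rfl | rfl <;> simp [tang]

theorem IsPeriodic.trace (h : IsSide T s D) {f : Fn 4} (hf : IsPeriodic D f) :
    IsPeriodic (Γ T) (trace s f) := fun i hi y => by
  have := fun a => (hf.slice h (s * a)) i hi y
  simp only [emb] at this
  simp only [PlasmaVacuum.trace, this]

/-- If smooth functions with bounded derivative in `x₁` converge on almost all of a line segment
orthogonal to the interface, then their boundary values converge to the trace of the limit. -/
theorem tendsto_trace (hs : s ^ 2 = 1) {v : ℕ → (Fin 4 → ℝ) → ℝ} (hv : ∀ n, Smooth (v n))
    (hR : ∀ n, ∀ b ∈ Icc (0 : ℝ) (1 / 2), |pd 1 (v n) (emb (s * b) y)| ≤ R)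
    {u : Fn 4} (hu : ∀ᵐ a : ℝ, a ∈ Ioo (0 : ℝ) 1 →
      Tendsto (fun n => v n (emb (s * a) y)) atTop (𝓝 (u (emb (s * a) y)))) :
    Tendsto (fun n => v n (emb 0 y)) atTop (𝓝 (trace s u y)) := by
  set w := fun n a => v n (emb (s * a) y) with hw
  set U := fun a => u (emb (s * a) y)
  have hs1 : |s| = 1 := by
    rw [← sq_eq_sq₀ (abs_nonneg s) zero_le_one, sq_abs, hs, one_pow]
  have hR0 := (abs_nonneg _).trans (hR 0 0 (by norm_num))
  have hd := fun n a => by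
    simpa only [zero_add] using hasDerivAt_emb (hv n) s 0 a y
  have hlip : ∀ n, ∀ a ∈ Icc 0 (1 / 2), |w n a - w n 0| ≤ R * a := fun n a ha => by
    have := (convex_Icc 0 (1 / 2)).norm_image_sub_le_of_norm_hasDerivWithin_le (f := w n)
      (fun x _ => (hd n x).hasDerivWithinAt) (fun x hx => by
        rw [norm_mul, norm_eq_abs, norm_eq_abs, hs1, one_mul]; exact hR n x hx)
      (by norm_num : (0 : ℝ) ∈ Icc (0 : ℝ) (1 / 2)) ha
    simpa [abs_of_nonneg ha.1] using this
  have hgood : ∀ r, 0 < r → ∃ a ∈ Ioo 0 r, a ∈ Icc 0 (1 / 2) ∧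
      Tendsto (fun n => w n a) atTop (𝓝 (U a)) := fun r hr => by
    obtain ⟨a, ha, hI⟩ := (Measure.dense_of_ae hu).exists_mem_open
      (isOpen_Ioo (b := min r (1 / 2))) (Set.nonempty_Ioo.2 (by positivity))
    have h2 := hI.2.trans_le (min_le_right _ _)
    exact ⟨a, ⟨hI.1, hI.2.trans_le (min_le_left _ _)⟩, ⟨hI.1.le, h2.le⟩, ha ⟨hI.1, by linarith⟩⟩
  have hC : CauchySeq fun n => w n 0 := by
    refine Metric.cauchySeq_iff.2 fun ε hε => ?_
    obtain ⟨a, ha, haI, hlim⟩ := hgood (ε / (4 * (R + 1))) (by positivity)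
    obtain ⟨N, hN⟩ := Metric.cauchySeq_iff.1 hlim.cauchySeq (ε / 2) (by positivity)
    refine ⟨N, fun m hm n hn => ?_⟩
    have h1 := hN m hm n hn
    have h2 : R * a ≤ ε / 4 := by
      have := ha.2
      rw [lt_div_iff₀ (by positivity)] at this
      nlinarith [ha.1]
    rw [Real.dist_eq] at h1 ⊢
    have h3 := abs_le.1 (hlip m a haI)
    have h4 := abs_le.1 (hlip n a haI)
    have h5 := abs_lt.1 h1
    rw [abs_lt]
    constructor <;> linarith [h3.1, h3.2, h4.1, h4.2, h5.1, h5.2]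
  obtain ⟨L, hL⟩ := cauchySeq_tendsto_of_complete hC
  have hUL : ∀ᵐ a : ℝ, a ∈ Set.Ioc 0 (1 / 2) → |U a - L| ≤ R * a := by
    filter_upwards [hu] with a ha hI
    exact le_of_tendsto ((ha ⟨hI.1, by linarith [hI.2]⟩).sub hL).abs
      (of_forall fun n => hlip n a ⟨hI.1.le, hI.2⟩)
  suffices hT : trace s u y = L by
    have h0 : (fun n => v n (emb 0 y)) = fun n => w n 0 := by simp [hw]
    rw [hT, h0]; exact hL
  refine Tendsto.limUnder_eq (tendsto_iff_norm_sub_tendsto_zero.2 ?_)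
  have hlin : Tendsto (fun r => R * r) (𝓝[>] 0) (𝓝 0) := by
    have := (continuous_const_mul R).tendsto 0
    rw [mul_zero] at this
    exact this.mono_left nhdsWithin_le_nhds
  refine squeeze_zero' (of_forall fun _ => norm_nonneg _) ?_ hlin
  filter_upwards [Ioo_mem_nhdsGT (by norm_num : (0 : ℝ) < 1 / 2)] with r hr
  change ‖r⁻¹ * (∫ a in 0..r, U a) - L‖ ≤ R * r
  have hae : ∀ᵐ a ∂volume.restrict (Set.Ioc 0 r), |U a - L| ≤ R * r ∧
      Tendsto (fun n => w n a) atTop (𝓝 (U a)) := by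
    rw [ae_restrict_iff' measurableSet_Ioc]
    filter_upwards [hu, hUL] with a h1 h2 ha
    exact ⟨(h2 ⟨ha.1, by linarith [ha.2, hr.2]⟩).trans (mul_le_mul_of_nonneg_left ha.2 hR0),
      h1 ⟨ha.1, by linarith [ha.2, hr.2]⟩⟩
  have hint : IntervalIntegrable U volume 0 r := by
    rw [intervalIntegrable_iff_integrableOn_Ioc_of_le hr.1.le]
    refine (integrable_const (R * r + |L|)).mono'
        (aestronglyMeasurable_of_tendsto_ae atTop (fun n => (continuous_iff_continuousAt.2 fun a => (hd n a).continuousAt).aestronglyMeasurable) (hae.mono fun a ha => ha.2)) (hae.mono fun a ha => ?_)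
    have := abs_sub_abs_le_abs_sub (U a) L
    rw [norm_eq_abs]; linarith [ha.1]
  have hsub : r⁻¹ * (∫ a in 0..r, U a) - L = r⁻¹ * ∫ a in 0..r, (U a - L) := by
    rw [intervalIntegral.integral_sub hint intervalIntegrable_const, intervalIntegral.integral_const]
    have := hr.1.ne'
    simp only [smul_eq_mul]
    field_simp
    ring
  rw [hsub, norm_mul, norm_inv, Real.norm_of_nonneg hr.1.le]
  have := intervalIntegral.norm_integral_le_of_norm_le_const_ae (f := fun a => U a - L)
    (by
      rw [Set.uIoc_of_le hr.1.le, ← ae_restrict_iff' measurableSet_Ioc]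
      exact hae.mono fun a ha => ha.1)
  rw [sub_zero, abs_of_pos hr.1] at this
  refine (mul_le_mul_of_nonneg_left this (inv_nonneg.2 hr.1.le)).trans_eq ?_
  have := hr.1.ne'
  field_simp

end

section

/-! ### The trace theorem -/

variable {T s γ : ℝ} {D : PeriodicDomain 4} {Q : ℝ≥0∞} {n : ℕ} {N : (Fin 4 → ℕ) → ℝ≥0∞}

theorem TraceBound.mono (hγ : 1 ≤ γ) (h : TraceBound γ n N Q) (hk : k ≤ n) :
    TraceBound γ k N Q := fun α j h0 hj =>
  (mul_le_mul_left (pow_le_pow_right₀ (one_le_ofReal hγ) (by omega)) _).trans (h α j h0 (hj.trans hk))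

theorem TraceBound.le (hγ : 1 ≤ γ) (h : TraceBound γ n N Q) (h0 : α 1 = 0)
    (hk : ∑ i, α i + 2 * k ≤ n) : N (α + single 1 k) ≤ Q :=
  (le_mul_of_one_le_left zero_le (one_le_pow₀ (one_le_ofReal hγ))).trans (h α k h0 hk)

theorem traceBound_moll (hB : IsBox D I a b) {u : Fn 4}
    (hp : AEPeriodic D u) (hl : LocallyIntegrable (D.cover.indicator u)) (hγ : 1 ≤ γ) (hQ : Q ≠ ⊤)
    (H : TraceBound γ n (fun α => weakDerivNorm D 2 α u) Q) (j) :
    TraceBound γ n (fun α => lpNorm D 2 (pdMulti α (moll D a b j u))) (36 * Q) := by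
  intro α k h0 hk
  have hD := hB.isOpen
  obtain ⟨g, hg⟩ := exists_weakDeriv (((H.le hγ h0 hk).trans_lt hQ.lt_top).ne)
  have h1 := lintegral_moll_sq_le hB (mollWeight_one D a b) hl hg
    (hg.aePeriodic hD hB.invariant hp) j
  simp only [one_mul] at h1
  rw [← lpNorm_two_sq, ← lpNorm_two_sq, ← hg.norm_eq hD] at h1
  have h2 : lpNorm D 2 (pdMulti (α + single 1 k) (moll D a b j u)) ≤
      36 * weakDerivNorm D 2 (α + single 1 k) u := by
    rw [← sq_le_sq_iff, mul_pow]
    exact h1.trans_eq (by norm_num)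
  calc _ ≤ _ := mul_le_mul_right h2 _
    _ ≤ 36 * Q := by rw [mul_left_comm]; exact mul_le_mul_right (H α k h0 hk) _

/-- Smooth functions are bounded on the slices by three derivatives. -/
theorem enorm_slice_le (h : IsSide T s D) {f : (Fin 4 → ℝ) → ℝ} (hf : Smooth f)
    (hp : IsPeriodic D f) (hγ : 1 ≤ γ) (H : TraceBound γ 3 (fun α => lpNorm D 2 (pdMulti α f)) Q)
    (hb : b ∈ Icc (0 : ℝ) (1 / 2)) (hy : y ∈ (Γ T).cover) :
    ‖f (emb (s * b) y)‖ₑ ≤ 206 * (147 * Q) :=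
  enorm_le_of_lpNorm_le (smooth_slice hf _) (hp.slice h _) (fun _ hβ =>
    (le_mul_of_one_le_left zero_le (one_le_pow₀ (one_le_ofReal hγ))).trans
      (lpNorm_slice_le h hf hb hγ (by norm_num) H hβ)) hy

/-- The trace of a function with derivatives of weight at most `m + 1` has derivatives of order at
most `m`. It is bounded by the derivatives of weight at most three, and by the function. -/
theorem trace_estimate {m : ℕ} (hm : 4 ≤ m) : ∃ C : NNReal, ∀ T s D, IsSide T s D → ∀ γ,
    1 ≤ γ → ∀ (u : Fn 4) (Q : ℝ≥0∞), IsPeriodic D u → Q ≠ ⊤ →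
    TraceBound γ (m + 1) (fun α => weakDerivNorm D 2 α u) Q →
    h1 (Γ T) γ m (trace s u) ≤ C * Q ∧
    (∀ Q₃, TraceBound γ 3 (fun α => weakDerivNorm D 2 α u) Q₃ →
      lpNorm (Γ T) ⊤ (trace s u) ≤ C * Q₃) ∧
    lpNorm (Γ T) ⊤ (trace s u) ≤ lpNorm D ⊤ u := by
  obtain ⟨C₂, hC₂⟩ := exists_weak_of_tendsto 3
  refine ⟨(multiIndices 3 m).card * ((1 + C₂) * 5292) + 1090152, fun T s D h γ hγ u Q hu hQ H => ?_⟩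
  obtain ⟨I, a, b, hB⟩ := h.exists_isBox
  have hD := hB.isOpen
  have hW := isBox_interface T
  have hN0 := H.le hγ (α := 0) (k := 0) rfl (by simp)
  simp only [Pi.single_zero, add_zero] at hN0
  obtain ⟨g, hg⟩ := exists_weakDeriv (hN0.trans_lt hQ.lt_top).ne
  have hul := hg.1
  have hu0 := (isWeakDeriv_zero_iff hD).2 ⟨hul, EventuallyEq.rfl⟩
  have hl := locInt_indicator_of_lpNorm hD hB.invariant hu.ae hul
    (by rw [← hu0.norm_eq hD]; exact (hN0.trans_lt hQ.lt_top).ne)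
  set v := fun j => moll D a b j u
  have hvs : ∀ j, Smooth (v j) := smooth_moll hl
  have hvp := moll_periodic hB hu.ae
  have hvB : ∀ j k Q', Q' ≠ ⊤ → TraceBound γ k (fun α => weakDerivNorm D 2 α u) Q' →
      TraceBound γ k (fun α => lpNorm D 2 (pdMulti α (v j))) (36 * Q') := fun j k Q' hQ' H' =>
    traceBound_moll hB hu.ae hl hγ hQ' H' j
  have hsup Q' : Q' ≠ ⊤ → TraceBound γ 3 (fun α => weakDerivNorm D 2 α u) Q' →
      ∀ j, ∀ y ∈ (Γ T).cover, ‖v j (emb 0 y)‖ₑ ≤ 1090152 * Q' := by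
    intro hQ' H' j y hy
    have := enorm_slice_le h (hvs j) (hvp j) hγ (hvB j 3 Q' hQ' H') (b := 0) (by norm_num) hy
    rw [mul_zero] at this
    exact this.trans_eq (by ring)
  -- the derivative in `x₁` costs two units of weight
  have hsup1 j : ∀ y ∈ (Γ T).cover, ∀ b ∈ Icc 0 (1 / 2),
      ‖pd 1 (v j) (emb (s * b) y)‖ₑ ≤ 1090152 * Q := by
    intro y hy b hb
    refine (enorm_slice_le h (smooth_pd (hvs j) 1) (fun i hi z => ?_) hγ (Q := 36 * Q)
      (fun α k h0 hk => ?_) hb hy).trans_eq (by ring)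
    · rw [← congrFun (pd_comp_add (single i 1) 1) z]
      exact congrArg (pd 1 · z) (funext (hvp j i hi))
    · have := hvB j 5 Q hQ (H.mono hγ (by omega)) α (k + 1) h0 (by omega)
      dsimp only at this ⊢
      rwa [Pi.single_add, ← add_assoc, pdMulti_succ' (hvs j), show
        5 - (∑ i, α i + 2 * (k + 1)) = 3 - (∑ i, α i + 2 * k) by omega] at this
  have htr : ∀ᵐ y ∂vol (Γ T),
      Tendsto (fun j => v j (emb 0 y)) atTop (𝓝 (trace s u y)) := by
    filter_upwards [h.ae_slices (ae_tendsto_moll hB hl),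
      ae_restrict_mem hW.isOpen.measurableSet] with y hy hyc
    refine tendsto_trace h.sq hvs (R := (1090152 * Q).toReal) (fun j b hb => ?_) hy
    have := ENNReal.toReal_mono (mul_ne_top (by norm_num) hQ) (hsup1 j y hyc b hb)
    rwa [toReal_enorm] at this
  have hinf M : (∀ j, ∀ y ∈ (Γ T).cover, ‖v j (emb 0 y)‖ₑ ≤ M) →
      lpNorm (Γ T) ⊤ (trace s u) ≤ M := by
    intro hM
    unfold lpNorm
    rw [eLpNorm_exponent_top]
    refine essSup_le_of_ae_le M (ae_restrict_of_ae_restrict_of_subset (cell_subset _) ?_)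
    filter_upwards [htr, ae_restrict_mem hW.isOpen.measurableSet] with y hy hyc
    exact le_of_tendsto hy.enorm (of_forall fun j => hM j y hyc)
  refine ⟨?_, fun Q₃ H₃ => ?_, hinf _ fun j y hy => ?_⟩
  · have key : ∀ β ∈ multiIndices 3 m, ofReal γ ^ (m - ∑ i, β i) *
        weakDerivNorm (Γ T) 2 β (trace s u) ≤ (1 + C₂) * 5292 * Q := by
      intro β hβ
      rw [mem_multiIndices] at hβ
      set G := ofReal γ ^ (m - ∑ i, β i)
      have hG0 : G ≠ 0 := (zero_lt_one.trans_le (one_le_pow₀ (one_le_ofReal hγ))).ne'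
      have hGt : G ≠ ⊤ := ENNReal.pow_ne_top ofReal_ne_top
      set q := 5292 * Q / G with hq
      have hqt : q ^ 2 ≠ ⊤ :=
        ENNReal.pow_ne_top (ENNReal.div_ne_top (mul_ne_top (by norm_num) hQ) hG0)
      have hb j : lpNorm (Γ T) 2 (pdMulti β fun y => v j (emb 0 y)) ≤ q := by
        have := lpNorm_slice_le h (hvs j) (b := 0) (by norm_num) hγ (by omega)
          (hvB j (m + 1) Q hQ H) hβ
        rw [mul_zero] at this
        rw [hq, ENNReal.le_div_iff_mul_le (Or.inl hG0) (Or.inl hGt), mul_comm]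
        exact this.trans_eq (by ring)
      obtain ⟨w, hw, hle⟩ := hC₂ (Γ T) hW.isOpen hW.invariant β (fun _ => 1)
        contDiff_const (fun _ _ => one_ne_zero) (fun _ _ _ => rfl) (fun j y => v j (emb 0 y))
        (trace s u) (1090152 * Q).toReal (q ^ 2).toNNReal (fun j => smooth_slice (hvs j) 0)
        (fun j => (hvp j).slice h 0) (fun j y hy => by
          have := ENNReal.toReal_mono (mul_ne_top (by norm_num) hQ)
            (hsup Q hQ (H.mono hγ (by omega)) j y hy)
          rwa [toReal_enorm] at this) htr (fun j => by
          simp only [one_mul]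
          rw [← lpNorm_two_sq, coe_toNNReal hqt]
          exact sq_le_sq_iff.2 (hb j))
      simp only [one_mul] at hle
      rw [← lpNorm_two_sq, coe_toNNReal hqt] at hle
      have hle' : lpNorm (Γ T) 2 w ≤ (1 + C₂) * q := by
        rw [← sq_le_sq_iff, mul_pow]
        refine hle.trans (mul_le_mul_left ?_ _)
        exact_mod_cast (by nlinarith [sq_nonneg C₂])
      rw [hw.norm_eq hW.isOpen]
      refine (mul_le_mul_right hle' _).trans_eq ?_
      rw [mul_left_comm, hq, ENNReal.mul_div_cancel hG0 hGt, mul_assoc]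
    rw [h1_eq]
    refine (sum_le_card_nsmul _ _ _ key).trans ?_
    rw [nsmul_eq_mul, ← mul_assoc]
    refine mul_le_mul_left ?_ _
    push_cast
    exact le_self_add
  · by_cases hQ3 : Q₃ = ⊤
    · simp [hQ3]
    · refine (hinf _ (hsup Q₃ hQ3 H₃)).trans (mul_le_mul_left ?_ _)
      push_cast
      exact le_add_self
  · have hM : ∀ z ∈ D.cover, ‖v j z‖ₑ ≤ lpNorm D ⊤ u := fun z hz => by
      simpa [pdMulti_zero] using enorm_moll_le hB (mollWeight_one D a b) hl hu0 (by simpa using ae_le_lpNorm_top hD hB.invariant hu.ae hul) j hz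
    have hc : Continuous fun r => v j (emb (s * r) y) :=
      (hvs j).continuous.comp (smooth_emb.continuous.comp
        (by fun_prop : Continuous fun r => (s * r, y)))
    have hc0 := (hc.tendsto 0).mono_left (nhdsWithin_le_nhds (s := Set.Ioi 0))
    simp only [mul_zero] at hc0
    refine le_of_tendsto hc0.enorm ?_
    filter_upwards [Ioo_mem_nhdsGT (by norm_num : (0 : ℝ) < 1)] with r hr
    exact hM _ (h.emb_mem hy hr)

theorem traceBound_h1 (hγ : 1 ≤ γ) (n) (u) :
    TraceBound γ n (fun α => weakDerivNorm D 2 α u) (h1 D γ n u) := by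
  intro α k _ hk
  have hsum : ∑ i, (α + single 1 k : Fin 4 → ℕ) i = ∑ i, α i + k := by simp [sum_add_distrib]
  rw [h1_eq]
  refine le_trans ?_ (single_le_sum (fun _ _ => zero_le)
    (mem_multiIndices.2 (by rw [hsum]; omega)))
  exact mul_le_mul_left (pow_le_pow_right₀ (one_le_ofReal hγ) (by rw [hsum]; omega)) _

theorem traceBound_hs1 (hσ : IsConormalWeight σ) (n) : ∃ C : NNReal, ∀ T γ,
    1 ≤ γ → ∀ u, TraceBound γ n (fun α => weakDerivNorm (Q⁺ T) 2 α u)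
      (C * hs1 σ (Q⁺ T) γ n u) := by
  choose C hC using weakLev_le_conLev hσ
  obtain ⟨C', hC'⟩ := lev1_le_of_lev (ι := Unit) n 0 C
  refine ⟨C', fun T γ hγ u α k h0 hk => ?_⟩
  have h := hC' γ hγ (fun p => scaledSq 1 (sigExt σ) (Q⁺ T) p u ^ (1 / 2 : ℝ))
    (fun _ p => conormalDerivNorm σ (Q⁺ T) p.1 p.2 u) fun j _ => by
      simpa only [sqrt_sq, Finset.univ_unique, Finset.sum_singleton] using! hC j T u
  simp only [Finset.univ_unique, Finset.sum_singleton] at h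
  have hmem : (α, k) ∈ ords 4 true n := mem_ords.2 ⟨hk, by simp⟩
  refine le_trans ?_ ((single_le_sum (fun _ _ => zero_le) hmem).trans h)
  refine mul_le_mul_right ?_ _
  rw [← sq_le_sq_iff, sqrt_sq]
  refine le_iInf₂ fun g hg => ?_
  simp only [h0, pow_zero, one_mul]
  rw [← lpNorm_two_sq]
  exact sq_le_sq_iff.2 (iInf₂_le g hg)

end

section

/-! ### The boundary operator -/

theorem interfaceSymbol_mixedDeriv (U V₁ V₂) (H K₁ K₂ P A B) :
    mixedDeriv (fun ε δ => interfaceSymbol (U + ε • V₁ + δ • V₂) (H + ε • K₁ + δ • K₂)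
        (P + ε • A + δ • B)) =
      ![(V₁ 2 * B 1 + V₁ 3 * B 2) + (V₂ 2 * A 1 + V₂ 3 * A 2),
        -(K₁ 0 * K₂ 0 + K₁ 1 * K₂ 1 + K₁ 2 * K₂ 2),
        -((K₁ 1 * B 1 + K₁ 2 * B 2) + (K₂ 1 * A 1 + K₂ 2 * A 2))] := by
  refine Eq.trans ?_ (mixedDeriv_quadratic (interfaceSymbol U H P)
    ![A 0 - V₁ 1 + U 2 * A 1 + V₁ 2 * P 1 + U 3 * A 2 + V₁ 3 * P 2,
      V₁ 0 - (H 0 * K₁ 0 + H 1 * K₁ 1 + H 2 * K₁ 2),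
      K₁ 0 - H 1 * A 1 - K₁ 1 * P 1 - H 2 * A 2 - K₁ 2 * P 2]
    ![B 0 - V₂ 1 + U 2 * B 1 + V₂ 2 * P 1 + U 3 * B 2 + V₂ 3 * P 2,
      V₂ 0 - (H 0 * K₂ 0 + H 1 * K₂ 1 + H 2 * K₂ 2),
      K₂ 0 - H 1 * B 1 - K₂ 1 * P 1 - H 2 * B 2 - K₂ 2 * P 2]
    _ ![V₁ 2 * A 1 + V₁ 3 * A 2, -(K₁ 0 ^ 2 + K₁ 1 ^ 2 + K₁ 2 ^ 2) / 2, -(K₁ 1 * A 1 + K₁ 2 * A 2)]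
    ![V₂ 2 * B 1 + V₂ 3 * B 2, -(K₂ 0 ^ 2 + K₂ 1 ^ 2 + K₂ 2 ^ 2) / 2, -(K₂ 1 * B 1 + K₂ 2 * B 2)])
  congr 1
  funext ε δ j
  fin_cases j <;> simp [interfaceSymbol] <;> ring

variable {T γ : ℝ}

theorem interface_gradient (hγ : 1 ≤ γ) (hp : IsPeriodic (Γ T) ψ)
    (hf : hNorm (Γ T) γ (m + 1) ψ < ⊤) (i) :
    AEPeriodic (Γ T) (weakPartial (Γ T) i ψ) ∧
    LocallyIntegrableOn (weakPartial (Γ T) i ψ) (Γ T).cover ∧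
    h1 (Γ T) γ m (weakPartial (Γ T) i ψ) ≤
      (multiIndices 3 (m + 1)).card * hNorm (Γ T) γ (m + 1) ψ ∧
    lpNorm (Γ T) ⊤ (weakPartial (Γ T) i ψ) ≤
      wInfNorm (Γ T) 1 ψ := by
  have hW := isBox_interface T
  have h1f := h1_le_hNorm (Γ T) γ (m + 1) ψ
  obtain ⟨g, hg⟩ := exists_weakDeriv ((weakDerivNorm_le_h1 (α := single i 1) hγ (by simp)).trans_lt (h1f.trans_lt (mul_lt_top (by simp) hf))).ne
  have hs := weakPartial_spec (weakDeriv_single.1 hg)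
  refine ⟨hs.aePeriodic hW.isOpen hW.invariant hp.ae, hs.2.1,
    (h1_weakPartial_le hγ i ψ).trans h1f, ?_⟩
  rw [← (weakDeriv_single.2 hs).norm_eq hW.isOpen]
  exact single_le_sum (f := fun α => weakDerivNorm (Γ T) ⊤ α ψ)
    (fun _ _ => zero_le) (mem_multiIndices.2 (by simp))

/-- A function on the interface with the bound `a` for its norm in `H^m` and `l` for its supremum. -/
def Controlled (T γ : ℝ) (m : ℕ) (f : Fn 3) (a l : ℝ≥0∞) : Prop :=
  AEPeriodic (Γ T) f ∧ LocallyIntegrableOn f (Γ T).cover ∧ h1 (Γ T) γ m f ≤ a ∧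
    lpNorm (Γ T) ⊤ f ≤ l

/-- The estimate of the second derivative of the boundary operator. -/
theorem interface_estimate (hσ : IsConormalWeight σ) (hm : 4 ≤ m) :
    ∃ C : NNReal, ∀ T γ, 1 ≤ γ →
    ∀ (U : (Fin 4 → ℝ) → Fin 8 → ℝ) (H : (Fin 4 → ℝ) → Fin 3 → ℝ) (φ : Fn 3)
      (V : Fin 2 → (Fin 4 → ℝ) → Fin 8 → ℝ) (K : Fin 2 → (Fin 4 → ℝ) → Fin 3 → ℝ) (ψ : Fin 2 → Fn 3),
    (∀ l, IsPeriodic (Q⁺ T) (V l)) → (∀ l, IsPeriodic (vacuumDomain T) (K l)) →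
    (∀ l, IsPeriodic (Γ T) (ψ l)) →
    ∀ (A L B W K' K₃ : Fin 2 → ℝ≥0∞),
    (∀ l, vecNorm (hStarNorm σ (Q⁺ T) γ (m + 1)) (V l) = A l) → (∀ l, A l < ⊤) →
    (∀ l, vecNorm (lpNorm (Q⁺ T) ⊤) (V l) = L l) →
    (∀ l, hNorm (Γ T) γ (m + 1) (ψ l) = B l) → (∀ l, B l < ⊤) →
    (∀ l, wInfNorm (Γ T) 1 (ψ l) = W l) →
    (∀ l, vecNorm (hNorm (vacuumDomain T) γ (m + 1)) (K l) = K' l) → (∀ l, K' l < ⊤) →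
    (∀ l, vecNorm (hNorm (vacuumDomain T) γ 3) (K l) = K₃ l) →
    vecNorm (hNorm (Γ T) γ m)
        (interfaceSecond (Γ T) U H φ (V 0) (K 0) (ψ 0) (V 1) (K 1) (ψ 1)) ≤
      C * (A 0 * W 1 + L 0 * B 1 + A 1 * W 0 + L 1 * B 0 + K₃ 0 * K' 1 + K' 0 * K₃ 1 +
        K₃ 0 * B 1 + K' 0 * W 1 + K₃ 1 * B 0 + K' 1 * W 0) := by
  obtain ⟨C₁, hC₁⟩ := trace_estimate hm
  obtain ⟨C₂, hC₂⟩ := traceBound_hs1 hσ (m + 1)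
  obtain ⟨C, hC⟩ := h1_mul_le (d := 3) 1 (isCompact_Icc) m
  set c₁ := C₁ * (C₂ * (ords 4 true (m + 1)).card) with hc₁
  set c₂ := C₁ * (multiIndices 4 (m + 1)).card with hc₂
  set c₃ := C₁ * (multiIndices 4 3).card with hc₃
  set c₄ := ((multiIndices 3 (m + 1)).card : NNReal) with hc₄
  set c := 1 + c₁ + c₂ + c₃ + c₄ with hc
  refine ⟨12 * (C * (c * c)), fun T γ hγ U H φ V K ψ pV pK pψ A L B W K' K₃ hA fA hL hB fB hW hK' fK'
    hK₃ => ?_⟩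
  set D := Γ T
  have hD := (isBox_interface T).isOpen
  have le1 : (c₁ : ℝ≥0∞) ≤ c ∧ (c₂ : ℝ≥0∞) ≤ c ∧ (c₃ : ℝ≥0∞) ≤ c ∧ c₄ ≤ c ∧ (1 : ℝ≥0∞) ≤ c := by
    refine ⟨?_, ?_, ?_, ?_, ?_⟩ <;> norm_cast <;> rw [← NNReal.coe_le_coe, hc] <;> push_cast <;>
      linarith [c₁.coe_nonneg, c₂.coe_nonneg, c₃.coe_nonneg, c₄.coe_nonneg]
  obtain ⟨l₁, l₂, l₃, l₄, l₅⟩ := le1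
  have up : ∀ {y x : ℝ≥0∞}, y ≤ x → y ≤ c * x := fun h => h.trans (le_mul_of_one_le_left zero_le l₅)
  -- the traces and the gradients as functions on the interface, with their bounds
  have hloc : ∀ {u : Fn 3}, h1 D γ m u < ⊤ → LocallyIntegrableOn u D.cover := fun hu => by
    obtain ⟨g, hg⟩ := exists_weakDeriv
      ((weakDerivNorm_le_h1 (α := 0) hγ (by simp)).trans_lt hu).ne
    exact hg.1
  have hv : ∀ l j, Controlled T γ m (fun y => vecTrace 1 (V l) y j) (c * A l) (c * L l) := fun l j => by
    have hp := (pV l).apply j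
    have h0 := (hs1_le_hStarNorm _ _ _ _ _).trans
      (mul_le_mul_right ((le_vecNorm _ (V l) j).trans_eq (hA l)) _)
    obtain ⟨e1, -, e3⟩ := hC₁ T 1 _ .plasma γ hγ _ _ hp
        (mul_ne_top (by simp) (h0.trans_lt (mul_lt_top (by simp) (fA l))).ne) (hC₂ T γ hγ _)
    have e4 : h1 D γ m (trace 1 fun z => V l z j) ≤ c * A l := by
      refine e1.trans (le_trans ?_ (mul_le_mul_left l₁ _))
      rw [hc₁, coe_mul, coe_mul, mul_assoc, mul_assoc]
      exact mul_le_mul_right (mul_le_mul_right h0 _) _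
    exact ⟨(hp.trace .plasma).ae, hloc (e4.trans_lt (mul_lt_top (by simp) (fA l))), e4,
      up (e3.trans ((le_vecNorm _ (V l) j).trans_eq (hL l)))⟩
  have hk : ∀ l j, Controlled T γ m (fun y => vecTrace (-1) (K l) y j) (c * K' l) (c * K₃ l) := fun l j => by
    have hp := (pK l).apply j
    have h0 : ∀ n, h1 (vacuumDomain T) γ n (fun z => K l z j) ≤ (multiIndices 4 n).card *
        vecNorm (hNorm (vacuumDomain T) γ n) (K l) := fun n => (h1_le_hNorm _ _ _ _).trans
      (mul_le_mul_right (le_vecNorm _ (K l) j) _)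
    have h2 := h0 (m + 1)
    rw [hK'] at h2
    have h3 := h0 3
    rw [hK₃] at h3
    obtain ⟨e1, e2, -⟩ := hC₁ T (-1) _ .vacuum γ hγ _ _ hp
      (h2.trans_lt (mul_lt_top (by simp) (fK' l))).ne (traceBound_h1 hγ (m + 1) _)
    have e4 : h1 D γ m (trace (-1) fun z => K l z j) ≤ c * K' l := by
      refine e1.trans (le_trans ?_ (mul_le_mul_left l₂ _))
      rw [hc₂, coe_mul, mul_assoc]
      exact mul_le_mul_right h2 _
    refine ⟨(hp.trace .vacuum).ae, hloc (e4.trans_lt (mul_lt_top (by simp) (fK' l))), e4,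
      (e2 _ (traceBound_h1 hγ 3 _)).trans (le_trans ?_ (mul_le_mul_left l₃ _))⟩
    rw [hc₃, coe_mul, mul_assoc]
    exact mul_le_mul_right h3 _
  have hd : ∀ l i, Controlled T γ m (fun y => weakGrad D (ψ l) y i) (c * B l) (c * W l) := fun l i => by
    obtain ⟨e1, e2, e3, e4⟩ := interface_gradient hγ (pψ l) (by rw [hB l]; exact fB l) i
    rw [hB l] at e3
    exact ⟨e1, e2, e3.trans (mul_le_mul_left (by rw [hc₄] at l₄; exact_mod_cast l₄) _),
      up (e4.trans_eq (hW l))⟩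
  set x := ![A 0 * W 1 + L 0 * B 1, A 1 * W 0 + L 1 * B 0, K' 0 * K₃ 1 + K₃ 0 * K' 1,
    K' 0 * W 1 + K₃ 0 * B 1, K' 1 * W 0 + K₃ 1 * B 0] with hx
  set M := C * (c * c) * ∑ i, x i with hM
  have hprod : ∀ {f g : Fn 3} {a l b w : ℝ≥0∞}, Controlled T γ m f (c * a) (c * l) →
      Controlled T γ m g (c * b) (c * w) → ∀ i, x i = a * w + l * b →
      h1 D γ m (fun y => f y * g y) ≤ M := by
    rintro f g a l b w ⟨f1, f2, f3, f4⟩ ⟨g1, g2, g3, g4⟩ i hi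
    refine (hC _ _ _ _ _ (isMoserBox_interface T) γ hγ f g f1 g1 f2 g2).trans ?_
    calc _ ≤ C * ((c * a) * (c * w) + (c * l) * (c * b)) := by gcongr
      _ = C * (c * c) * x i := by rw [hi]; ring
      _ ≤ M := mul_le_mul_right (single_le_sum (fun _ _ => zero_le) (mem_univ i)) _
  have add4 : ∀ {f₁ f₂ f₃ f₄ : Fn 3}, h1 D γ m f₁ ≤ M → h1 D γ m f₂ ≤ M → h1 D γ m f₃ ≤ M →
      h1 D γ m f₄ ≤ M → h1 D γ m (fun y => (f₁ y + f₂ y) + (f₃ y + f₄ y)) ≤ 4 * M :=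
    fun a₁ a₂ a₃ a₄ => (h1_add_le hD).trans ((add_le_add ((h1_add_le hD).trans (add_le_add a₁ a₂))
      ((h1_add_le hD).trans (add_le_add a₃ a₄))).trans_eq (by ring))
  have hall j : hNorm D γ m (fun y => interfaceSecond D U H φ (V 0) (K 0) (ψ 0) (V 1) (K 1) (ψ 1)
      y j) ≤ 4 * M := by
    refine (hNorm_le_h1 _ _ _ _).trans ?_
    simp only [interfaceSecond, interfaceSymbol_mixedDeriv]
    fin_cases j
    · exact add4 (hprod (hv 0 2) (hd 1 1) 0 rfl) (hprod (hv 0 3) (hd 1 2) 0 rfl)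
        (hprod (hv 1 2) (hd 0 1) 1 rfl) (hprod (hv 1 3) (hd 0 2) 1 rfl)
    · refine (h1_neg_le hD).trans ((h1_add_le hD).trans ((add_le_add ((h1_add_le hD).trans
        (add_le_add (hprod (hk 0 0) (hk 1 0) 2 rfl) (hprod (hk 0 1) (hk 1 1) 2 rfl)))
        (hprod (hk 0 2) (hk 1 2) 2 rfl)).trans ?_))
      calc M + M + M = 3 * M := by ring
        _ ≤ _ := mul_le_mul_left (by norm_num) _
    · exact (h1_neg_le hD).trans (add4 (hprod (hk 0 1) (hd 1 1) 3 rfl) (hprod (hk 0 2) (hd 1 2) 3 rfl)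
        (hprod (hk 1 1) (hd 0 1) 4 rfl) (hprod (hk 1 2) (hd 0 2) 4 rfl))
  calc _ ≤ ∑ _j, 4 * M := sum_le_sum fun j _ => hall j
    _ = _ := by
      simp [hM, hx, Fin.sum_univ_five]
      ring

end

end PlasmaVacuum

end

open PlasmaVacuum in
theorem proposition23
    (ρ : ℝ → ℝ → ℝ) (O : Set (ℝ × ℝ)) (hρ : IsEquationOfState ρ O)
    (σ : ℝ → ℝ) (hσ : IsConormalWeight σ) (αt : ℕ) :
    ∃ Kt₀ : ℝ, 0 < Kt₀ ∧ ∃ C : ℝ, 0 < C ∧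
      ∀ m : ℕ, 6 ≤ m → m + 2 ≤ αt → ∀ T : ℝ, 0 < T → ∀ γ : ℝ, 1 ≤ γ →
      ∀ (Uh : (Fin 4 → ℝ) → Fin 8 → ℝ) (Hh : (Fin 4 → ℝ) → Fin 3 → ℝ)
        (Ψh : (Fin 4 → ℝ) → ℝ) (φh : (Fin 3 → ℝ) → ℝ) (Kt : ℝ),
      IsPeriodic (plasmaDomain T) Uh → IsPeriodic (vacuumDomain T) Hh →
      IsPeriodic (fullDomain T) Ψh → IsPeriodic (interfaceDomain T) φh →
      wInfNorm (fullDomain T) 2 Ψh < ⊤ →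
      vecNorm (wStarTwoNorm σ (plasmaDomain T)) Uh + vecNorm (wInfNorm (vacuumDomain T) 1) Hh +
        wStarTwoNorm σ (fullDomain T) Ψh ≤ ENNReal.ofReal Kt →
      vecNorm (hStarNorm σ (plasmaDomain T) γ αt) Uh < ⊤ →
      vecNorm (hNorm (vacuumDomain T) γ αt) Hh < ⊤ →
      hNorm (fullDomain T) γ αt Ψh < ⊤ →
      Kt ≤ Kt₀ →
      -- the plasma operator
      (∀ (V₁ : (Fin 4 → ℝ) → Fin 8 → ℝ) (Ψ₁ : (Fin 4 → ℝ) → ℝ)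
          (V₂ : (Fin 4 → ℝ) → Fin 8 → ℝ) (Ψ₂ : (Fin 4 → ℝ) → ℝ),
        IsPeriodic (plasmaDomain T) V₁ → IsPeriodic (plasmaDomain T) Ψ₁ →
        IsPeriodic (plasmaDomain T) V₂ → IsPeriodic (plasmaDomain T) Ψ₂ →
        plasmaHNorm σ T γ (m + 2) V₁ Ψ₁ < ⊤ → plasmaHNorm σ T γ (m + 2) V₂ Ψ₂ < ⊤ →
        vecNorm (hStarNorm σ (plasmaDomain T) γ m)
            (plasmaSecond ρ (plasmaDomain T) Uh Ψh V₁ Ψ₁ V₂ Ψ₂) ≤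
          ENNReal.ofReal C *
            (plasmaHNorm σ T γ (m + 2) Uh Ψh * plasmaWNorm σ T V₁ Ψ₁ * plasmaWNorm σ T V₂ Ψ₂ +
              plasmaHNorm σ T γ (m + 2) V₁ Ψ₁ * plasmaWNorm σ T V₂ Ψ₂ +
              plasmaHNorm σ T γ (m + 2) V₂ Ψ₂ * plasmaWNorm σ T V₁ Ψ₁)) ∧
      -- the vacuum operator
      (∀ (K₁ : (Fin 4 → ℝ) → Fin 3 → ℝ) (Ψ₁ : (Fin 4 → ℝ) → ℝ)
          (K₂ : (Fin 4 → ℝ) → Fin 3 → ℝ) (Ψ₂ : (Fin 4 → ℝ) → ℝ),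
        IsPeriodic (vacuumDomain T) K₁ → IsPeriodic (vacuumDomain T) Ψ₁ →
        IsPeriodic (vacuumDomain T) K₂ → IsPeriodic (vacuumDomain T) Ψ₂ →
        vacuumHNorm T γ (m + 1) K₁ Ψ₁ < ⊤ → vacuumHNorm T γ (m + 1) K₂ Ψ₂ < ⊤ →
        vecNorm (hNorm (vacuumDomain T) γ m)
            (vacuumSecond (vacuumDomain T) Hh Ψh K₁ Ψ₁ K₂ Ψ₂) ≤
          ENNReal.ofReal C *
            (vacuumHNorm T γ (m + 1) Hh Ψh * vacuumWNorm T K₁ Ψ₁ * vacuumWNorm T K₂ Ψ₂ +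
              vacuumHNorm T γ (m + 1) K₁ Ψ₁ * vacuumWNorm T K₂ Ψ₂ +
              vacuumHNorm T γ (m + 1) K₂ Ψ₂ * vacuumWNorm T K₁ Ψ₁)) ∧
      -- the boundary operator
      (∀ (V₁ : (Fin 4 → ℝ) → Fin 8 → ℝ) (K₁ : (Fin 4 → ℝ) → Fin 3 → ℝ) (ψ₁ : (Fin 3 → ℝ) → ℝ)
          (V₂ : (Fin 4 → ℝ) → Fin 8 → ℝ) (K₂ : (Fin 4 → ℝ) → Fin 3 → ℝ) (ψ₂ : (Fin 3 → ℝ) → ℝ),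
        IsPeriodic (plasmaDomain T) V₁ → IsPeriodic (vacuumDomain T) K₁ →
        IsPeriodic (interfaceDomain T) ψ₁ →
        IsPeriodic (plasmaDomain T) V₂ → IsPeriodic (vacuumDomain T) K₂ →
        IsPeriodic (interfaceDomain T) ψ₂ →
        vecNorm (hStarNorm σ (plasmaDomain T) γ (m + 1)) V₁ < ⊤ →
        vecNorm (hNorm (vacuumDomain T) γ (m + 1)) K₁ < ⊤ →
        hNorm (interfaceDomain T) γ (m + 1) ψ₁ < ⊤ →
        vecNorm (hStarNorm σ (plasmaDomain T) γ (m + 1)) V₂ < ⊤ →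
        vecNorm (hNorm (vacuumDomain T) γ (m + 1)) K₂ < ⊤ →
        hNorm (interfaceDomain T) γ (m + 1) ψ₂ < ⊤ →
        vecNorm (hNorm (interfaceDomain T) γ m)
            (interfaceSecond (interfaceDomain T) Uh Hh φh V₁ K₁ ψ₁ V₂ K₂ ψ₂) ≤
          ENNReal.ofReal C *
            (vecNorm (hStarNorm σ (plasmaDomain T) γ (m + 1)) V₁ *
                wInfNorm (interfaceDomain T) 1 ψ₂ +
              vecNorm (lpNorm (plasmaDomain T) ⊤) V₁ * hNorm (interfaceDomain T) γ (m + 1) ψ₂ +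
              vecNorm (hStarNorm σ (plasmaDomain T) γ (m + 1)) V₂ *
                wInfNorm (interfaceDomain T) 1 ψ₁ +
              vecNorm (lpNorm (plasmaDomain T) ⊤) V₂ * hNorm (interfaceDomain T) γ (m + 1) ψ₁ +
              vecNorm (hNorm (vacuumDomain T) γ 3) K₁ *
                vecNorm (hNorm (vacuumDomain T) γ (m + 1)) K₂ +
              vecNorm (hNorm (vacuumDomain T) γ (m + 1)) K₁ *
                vecNorm (hNorm (vacuumDomain T) γ 3) K₂ +
              vecNorm (hNorm (vacuumDomain T) γ 3) K₁ * hNorm (interfaceDomain T) γ (m + 1) ψ₂ +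
              vecNorm (hNorm (vacuumDomain T) γ (m + 1)) K₁ * wInfNorm (interfaceDomain T) 1 ψ₂ +
              vecNorm (hNorm (vacuumDomain T) γ 3) K₂ * hNorm (interfaceDomain T) γ (m + 1) ψ₁ +
              vecNorm (hNorm (vacuumDomain T) γ (m + 1)) K₂ *
                wInfNorm (interfaceDomain T) 1 ψ₁)) := by
  obtain ⟨K, hK, hP⟩ := plasma_estimate hρ hσ
  choose C₁ hC₁ using hP
  choose C₂ hC₂ using vacuum_estimate
  choose C₃ hC₃ using fun (m : ℕ) (hm : 4 ≤ m) => interface_estimate hσ hm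
  set E : ℕ → NNReal := fun m => C₁ m + C₂ m + if hm : 4 ≤ m then C₃ m hm else 0 with hE
  set S : NNReal := 1 + ∑ m ∈ Finset.range (αt + 1), E m with hS
  have hSE : ∀ m, m + 2 ≤ αt → ∀ c : NNReal, c ≤ E m → (c : ℝ≥0∞) ≤ ENNReal.ofReal S :=
    fun m hm c hc => by
      rw [ENNReal.ofReal_coe_nnreal]
      refine ENNReal.coe_le_coe.2 (hc.trans (le_trans ?_ le_add_self))
      exact Finset.single_le_sum (f := E) (fun _ _ => zero_le) (Finset.mem_range.2 (by omega))
  refine ⟨K, hK, S, by rw [hS]; positivity, ?_⟩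
  intro m hm6 hmα T _ γ hγ Uh Hh Ψh φh Kt pU _ pΨ _ _ hsmall _ _ _ hKt
  refine ⟨?_, ?_, ?_⟩
  · intro V₁ Ψ₁ V₂ Ψ₂ pV₁ pΨ₁ pV₂ pΨ₂ _ _
    have hΨ : IsPeriodic (plasmaDomain T) Ψh := pΨ
    refine (hC₁ m T γ hγ Uh Ψh V₁ Ψ₁ V₂ Ψ₂ pU hΨ pV₁ pΨ₁ pV₂ pΨ₂ ?_).trans
      (mul_le_mul_left (hSE m hmα _ ?_) _)
    · refine le_trans ?_ (hsmall.trans (ENNReal.ofReal_le_ofReal hKt))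
      exact add_le_add le_self_add wStarTwoNorm_restrict
    · exact (le_self_add.trans le_self_add : C₁ m ≤ E m)
  · intro K₁ Ψ₁ K₂ Ψ₂ pK₁ pΨ₁ pK₂ pΨ₂ f₁ f₂
    refine (hC₂ m T γ hγ Hh Ψh K₁ Ψ₁ K₂ Ψ₂ pK₁ pΨ₁ pK₂ pΨ₂ f₁ f₂).trans
      (mul_le_mul' (hSE m hmα _ (le_add_self.trans le_self_add : C₂ m ≤ E m)) ?_)
    rw [add_assoc]
    exact le_add_self
  · intro V₁ K₁ ψ₁ V₂ K₂ ψ₂ pV₁ pK₁ pψ₁ pV₂ pK₂ pψ₂ fV₁ fK₁ fψ₁ fV₂ fK₂ fψ₂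
    have hm4 : 4 ≤ m := by omega
    refine (hC₃ m hm4 T γ hγ Uh Hh φh ![V₁, V₂] ![K₁, K₂] ![ψ₁, ψ₂] (Fin.forall_fin_two.2 ⟨pV₁, pV₂⟩)
      (Fin.forall_fin_two.2 ⟨pK₁, pK₂⟩) (Fin.forall_fin_two.2 ⟨pψ₁, pψ₂⟩) _ _ _ _ _ _ (fun _ => rfl)
      (Fin.forall_fin_two.2 ⟨fV₁, fV₂⟩) (fun _ => rfl) (fun _ => rfl)
      (Fin.forall_fin_two.2 ⟨fψ₁, fψ₂⟩) (fun _ => rfl) (fun _ => rfl)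
      (Fin.forall_fin_two.2 ⟨fK₁, fK₂⟩) fun _ => rfl).trans (mul_le_mul_left (hSE m hmα _ ?_) _)
    have : E m = C₁ m + C₂ m + C₃ m hm4 := by simp only [hE, hm4, dif_pos]
    rw [this]
    exact le_add_self
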